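/- Let $q$ be an odd prime power, and let $x\mapsto \bar x=x^q$ be the nontrivial automorphism of $\mathbb F_{q^2}/\mathbb F_q$. For a nondegenerate hermitian space $V$ over $\mathbb F_{q^2}$ let $\mathrm U(V)$ be its (finite) unitary group. All representations are finite-dimensional and complex. **Weil representation.** Fix a nontrivial additive character $\psi$ of the $\mathbb F_q$-line $\{z\in\mathbb F_{q^2}: z+\bar z=0\}$. For a nondegenerate hermitian space $W$ of dimension $N$ with form $\langle\cdot,\cdot\rangle$ (linear in the first variable), let $\mathcal H(W)=\{(w,z)\in W\times\mathbb F_{q^2}: z+\bar z=\langle w,w\rangle\}$ be its Heisenberg group, with $(w,z)(w',z')=(w+w',z+z'+\langle w,w'\rangle)$ and with $\mathrm U(W)$ acting by $g\cdot(w,z)=(gw,z)$, and let $\eta_\psi$ be its irreducible representation with central character $\psi$. The Weil representation $\omega_W$ of $\mathrm U(W)$ on the space of $\eta_\psi$ is $$\omega_W(g)=(-q)^{\operatorname{rank}(g-1)}\,\frac1{|\mathcal H(W)|}\sum_{h\in \mathcal H(W)}\eta_\psi\big((g\cdot h)\,h^{-1}\big);$$ it satisfies $\omega_W(g)\eta_\psi(h)\omega_W(g)^{-1}=\eta_\psi(g\cdot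 h)$ and has character $g\mapsto(-1)^N(-q)^{\dim\ker(g-1)}$. **Theta lifting.** For hermitian spaces $V,V'$ let $\omega_{V,V'}$ be the pull-back of $\omega_{V\otimes V'}$ under $\mathrm U(V)\times \mathrm U(V')\to \mathrm U(V\otimes V')$, $(g,g')\mapsto g\otimes g'$. For a representation $\pi$ of $\mathrm U(V)$ let $\Theta_{V,V'}(\pi)=\mathrm{Hom}_{\mathrm U(V)}(\pi,\omega_{V,V'})$, a representation of $\mathrm U(V')$; thus $\omega_{V,V'}\cong\bigoplus_{\pi}\pi\otimes\Theta_{V,V'}(\pi)$, the sum being over the irreducible representations $\pi$ of $\mathrm U(V)$. **Parabolic induction.** Let $V_n$ be a nondegenerate hermitian space of dimension $n$ and $V_{n+2\ell}=(X\oplus X^\vee)\oplus V_n$, an orthogonal sum of $V_n$ and a split space with $X$ and $X^\vee$ isotropic of dimension $\ell$ in duality. For a representation $\tau$ of $\mathrm{GL}_\ell(\mathbb F_{q^2})=\mathrm{GL}(X)$ and a representation $\pi$ of $\mathrm U(V_n)$ let $R(\tau\otimes\pi)$ be the representation of $\mathrm U(V_{n+2\ell})$ induced from the inflation of $\tau\otimes\pi$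 to the stabilizer of $X$, whose Levi factor is $\mathrm{GL}_\ell(\mathbb F_{q^2})\times\mathrm U(V_n)$. For another space $V'_{n'}$ define $V'_{n'+2\ell}$ and $R$ in the same way. Write $\Theta_{n,n'}$ for $\Theta_{V_n,V'_{n'}}$, and $\Theta_{n+2\ell,n'+2\ell}$ for $\Theta_{V_{n+2\ell},V'_{n'+2\ell}}$ (with the same $\psi$). **Proposition.** Let $\tau$ be an irreducible cuspidal representation of $\mathrm{GL}_\ell(\mathbb F_{q^2})$ which is nontrivial if $\ell=1$, let $\pi$ be an irreducible representation of $\mathrm U(V_n)$, and put $\pi'=\Theta_{n,n'}(\pi)$. 1. If $\rho$ is an irreducible representation of $\mathrm U(V_{n+2\ell})$ that occurs in $R(\tau\otimes\pi)$, and $\rho'$ is an irreducible representation of $\mathrm U(V'_{n'+2\ell})$ that occurs in $\Theta_{n+2\ell,n'+2\ell}(\rho)$, then $\rho'$ occurs in $R(\tau\otimes\pi')$. 2. If $R(\tau\otimes\pi)$ is irreducible, then $\Theta_{n+2\ell,n'+2\ell}(R(\tau\otimes\pi))\cong R(\tau\otimes\pi')$. -/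

import Mathlib

open scoped Matrix Kronecker

namespace FiniteUnitary

/-- `K` is a finite field with `q ^ 2` elements, and its star operation is the nontrivial
automorphism `x ↦ x ^ q` of `K` over the subfield with `q` elements. -/
class QuadraticStar (q : ℕ) (K : Type*) [Field K] [Fintype K] [StarRing K] : Prop where
  card_eq : Fintype.card K = q ^ 2
  star_eq : ∀ x : K, star x = x ^ q

section Field

variable {K : Type*} [Field K] [Fintype K] [StarRing K] 

theorem one_lt_q (q : ℕ) (K : Type*) [Field K] [Fintype K] [StarRing K] [hK : QuadraticStar q K] :
    1 < q := by
  have h1 : 1 < Fintype.card K := Fintype.one_lt_card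
  rw [hK.card_eq] at h1
  by_contra h
  interval_cases q <;> simp at h1

theorem exists_star_ne (q : ℕ) (K : Type*) [Field K] [Fintype K] [StarRing K]
    [hK : QuadraticStar q K] : ∃ x : K, star x ≠ x := by
  classical
  by_contra! h
  have hq := one_lt_q q K
  have hp : (Polynomial.X ^ q - Polynomial.X : Polynomial K) ≠ 0 :=
    FiniteField.X_pow_card_sub_X_ne_zero K hq
  have h2 : Fintype.card K ≤ q := by
    have h3 : (Finset.univ : Finset K) ⊆
        (Polynomial.X ^ q - Polynomial.X : Polynomial K).roots.toFinset := by
      intro x _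
      simp [hp, ← hK.star_eq, h x]
    have h4 := Finset.card_le_card h3
    refine (h4.trans (Multiset.toFinset_card_le _)).trans ((Polynomial.card_roots' _).trans ?_)
    exact (FiniteField.X_pow_card_sub_X_natDegree_eq K hq).le
  rw [hK.card_eq] at h2
  nlinarith

theorem exists_sub_star_eq (q : ℕ) {K : Type*} [Field K] [Fintype K] [StarRing K]
    [hK : QuadraticStar q K] {z : K} (hz : star z = -z) : ∃ a : K, a - star a = z := by
  obtain ⟨t, ht⟩ := exists_star_ne q K
  have hd : t - star t ≠ 0 := sub_ne_zero.2 (Ne.symm ht)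
  have hd' : star t - t ≠ 0 := sub_ne_zero.2 ht
  refine ⟨z / (t - star t) * t, ?_⟩
  have : star (z / (t - star t)) = z / (t - star t) := by
    rw [star_div₀, star_sub, star_star, hz, div_eq_div_iff hd' hd]; ring
  rw [star_mul', this, ← mul_sub, div_mul_cancel₀ _ hd]

theorem exists_add_star_eq (q : ℕ) {K : Type*} [Field K] [Fintype K] [StarRing K]
    [hK : QuadraticStar q K] {c : K} (hc : star c = c) : ∃ a : K, a + star a = c := by
  have : ∃ t : K, t + star t ≠ 0 := by
    by_contra! h
    have h1 := h 1
    rw [star_one] at h1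
    obtain ⟨t, ht⟩ := exists_star_ne q K
    apply ht
    have := h t
    linear_combination this - t * h1
  obtain ⟨t, ht⟩ := this
  refine ⟨c / (t + star t) * t, ?_⟩
  have : star (c / (t + star t)) = c / (t + star t) := by
    rw [star_div₀, star_add, star_star, hc, add_comm]
  rw [star_mul', this, ← mul_add, div_mul_cancel₀ _ ht]

theorem card_skewAdjoint (q : ℕ) (K : Type*) [Field K] [Fintype K] [StarRing K]
    [hK : QuadraticStar q K] : Nat.card (skewAdjoint K) = q := by
  classical
  let f : K →+ K := AddMonoidHom.mk' (fun a => a - star a) (by intro a b; simp only [star_add]; ring)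
  have hr : f.range = skewAdjoint K := by
    ext z
    constructor
    · rintro ⟨a, rfl⟩
      simp [f, skewAdjoint.mem_iff]
    · intro hz
      exact exists_sub_star_eq q (skewAdjoint.mem_iff.1 hz)
  obtain ⟨t, ht⟩ := exists_star_ne q K
  have hd : t - star t ≠ 0 := sub_ne_zero.2 (Ne.symm ht)
  have hd' : star t - t ≠ 0 := sub_ne_zero.2 ht
  have hk : Nat.card f.ker = Nat.card (skewAdjoint K) := by
    refine Nat.card_congr
      { toFun := fun a => ⟨a.1 * (t - star t), ?_⟩
        invFun := fun z => ⟨z.1 / (t - star t), ?_⟩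
        left_inv := ?_
        right_inv := ?_ }
    · have h1 : a.1 - star a.1 = 0 := a.2
      rw [skewAdjoint.mem_iff, star_mul', star_sub, star_star, ← sub_eq_zero.1 h1]; ring
    · change z.1 / (t - star t) - star (z.1 / (t - star t)) = 0
      have hz := skewAdjoint.mem_iff.1 z.2
      rw [star_div₀, star_sub, star_star, hz, sub_eq_zero, div_eq_div_iff hd hd']; ring
    · intro a; ext; simp [hd]
    · intro z; ext; simp [hd]
  have h1 : Nat.card f.ker * Nat.card f.range = Nat.card K := by
    rw [← AddSubgroup.index_ker, AddSubgroup.card_mul_index]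
  rw [hk, hr, Nat.card_eq_fintype_card (α := K), hK.card_eq, ← sq] at h1
  exact Nat.pow_left_injective (n := 2) (by norm_num) h1

theorem exists_norm_eq (q : ℕ) {K : Type*} [Field K] [Fintype K] [StarRing K]
    [hK : QuadraticStar q K] {c : K} (hc : star c = c) : ∃ a : K, star a * a = c := by
  classical
  by_cases h0 : c = 0
  · exact ⟨0, by simp [h0]⟩
  have hq := one_lt_q q K
  obtain ⟨g, hg⟩ := IsCyclic.exists_generator (α := Kˣ)
  obtain ⟨k, hk⟩ := (Submonoid.mem_powers_iff _ _).1 (mem_powers_iff_mem_zpowers.2 (hg (Units.mk0 c h0)))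
  have ho : orderOf g = (q + 1) * (q - 1) := by
    rw [orderOf_eq_card_of_forall_mem_zpowers hg, Nat.card_eq_fintype_card, Fintype.card_units,
      hK.card_eq]
    exact Nat.sq_sub_sq q 1
  have h1 : (Units.mk0 c h0) ^ (q - 1) = 1 := by
    ext
    have h2 : c ^ q = c := by rw [← hK.star_eq, hc]
    obtain ⟨m, rfl⟩ : ∃ m, q = m + 1 := ⟨q - 1, by omega⟩
    have : c ^ m * c = 1 * c := by rw [← pow_succ, h2, one_mul]
    simpa using mul_right_cancel₀ h0 this
  rw [← hk, ← pow_mul, ← orderOf_dvd_iff_pow_eq_one, ho] at h1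
  obtain ⟨m, rfl⟩ := Nat.dvd_of_mul_dvd_mul_right (by omega) h1
  refine ⟨(g : K) ^ m, ?_⟩
  have := congrArg Units.val hk
  simp only [Units.val_pow_eq_pow_val, Units.val_mk0] at this
  rw [hK.star_eq, ← this, ← pow_mul, ← pow_add]
  congr 1; ring

theorem skew_mul_norm {K : Type*} [Field K] [StarRing K] (z : skewAdjoint K) (a : K) :
    star a * a * z.1 ∈ skewAdjoint K := by
  rw [skewAdjoint.mem_iff, star_mul', star_mul', star_star, skewAdjoint.mem_iff.1 z.2]; ring

/-- The Gauss sum attached to the norm form of a quadratic extension of finite fields. -/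
theorem sum_norm (q : ℕ) {K : Type*} [Field K] [Fintype K] [StarRing K]
    [hK : QuadraticStar q K] (ψ : AddChar (skewAdjoint K) ℂ) (hψ : ψ ≠ 1)
    (z : skewAdjoint K) (hz : z ≠ 0) :
    ∑ a : K, ψ ⟨star a * a * z.1, skew_mul_norm z a⟩ = -(q : ℂ) := by
  classical
  let G : skewAdjoint K → ℂ := fun z => ∑ a : K, ψ ⟨star a * a * z.1, skew_mul_norm z a⟩
  have hGG : ∀ w : skewAdjoint K, w ≠ 0 → G w = G z := by
    intro w hw
    have hz' : z.1 ≠ 0 := fun h => hz (Subtype.ext h)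
    have hw' : w.1 ≠ 0 := fun h => hw (Subtype.ext h)
    obtain ⟨b, hb⟩ := exists_norm_eq q (c := z.1 / w.1) (by
      rw [star_div₀, skewAdjoint.mem_iff.1 z.2, skewAdjoint.mem_iff.1 w.2, neg_div_neg_eq])
    have hb0 : b ≠ 0 := by
      rintro rfl
      simp [eq_comm, hz', hw'] at hb
    symm
    refine Fintype.sum_bijective (fun a => a * b) (mulRight_bijective₀ b hb0) _ _ ?_
    intro a
    congr 1
    ext
    simp only [star_mul']
    have : z.1 = star b * b * w.1 := by rw [hb, div_mul_cancel₀ _ hw']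
    rw [this]; ring
  have hG0 : G 0 = (q : ℂ) ^ 2 := by
    have : ∀ a : K, (⟨star a * a * (0 : skewAdjoint K).1, skew_mul_norm 0 a⟩ : skewAdjoint K) = 0 :=
      fun a => by ext; simp
    simp only [G, this, AddChar.map_zero_eq_one]
    simp [hK.card_eq]
  have hsum : ∑ w, G w = q := by
    simp only [G]
    rw [Finset.sum_comm, Finset.sum_eq_single 0]
    · have : ∀ w : skewAdjoint K, (⟨star (0 : K) * 0 * w.1, skew_mul_norm w 0⟩ : skewAdjoint K) = 0 :=
        fun a => by ext; simp
      simp only [this, AddChar.map_zero_eq_one]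
      simp [← card_skewAdjoint q K, Nat.card_eq_fintype_card]
    · intro a _ ha
      have hna : star a * a ≠ 0 := mul_ne_zero (by simpa using ha) ha
      rw [← AddChar.sum_eq_zero_iff_ne_zero.2 (show ψ ≠ 0 from hψ)]
      refine Fintype.sum_bijective
        (fun w : skewAdjoint K => (⟨star a * a * w.1, skew_mul_norm w a⟩ : skewAdjoint K)) ?_ _ _
        (fun _ => rfl)
      rw [← Finite.injective_iff_bijective]
      intro w w' h
      ext
      exact mul_left_cancel₀ hna (congrArg Subtype.val h)
    · simp
  have hsplit : ∑ w, G w = G 0 + (q - 1) * G z := by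
    rw [← Finset.add_sum_erase _ _ (Finset.mem_univ (0 : skewAdjoint K)),
      Finset.sum_congr rfl (fun w hw => hGG w (Finset.ne_of_mem_erase hw)), Finset.sum_const,
      Finset.card_erase_of_mem (Finset.mem_univ _), Finset.card_univ, ← Nat.card_eq_fintype_card,
      card_skewAdjoint q K, nsmul_eq_mul, Nat.cast_sub (one_lt_q q K).le, Nat.cast_one]
  have hq1 : (q : ℂ) - 1 ≠ 0 := by
    rw [sub_ne_zero]; exact_mod_cast (one_lt_q q K).ne'
  change G z = _
  apply mul_left_cancel₀ hq1
  rw [hsum, hG0] at hsplit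
  linear_combination -hsplit


/-- The Gauss sum of a skew-hermitian form `Q` over a subspace `P`: its value is governed by the
dimension of `P` and the dimension of the radical of `Q` on `P`. -/
theorem sum_skew (q : ℕ) {K : Type*} [Field K] [Fintype K] [StarRing K]
    [hK : QuadraticStar q K] (ψ : AddChar (skewAdjoint K) ℂ) (hψ : ψ ≠ 1)
    {M : Type*} [AddCommGroup M] [Module K M] [Finite M]
    (Q : M → M → K) (hadd : ∀ x y z, Q (x + y) z = Q x z + Q y z)
    (hsmul : ∀ (a : K) x z, Q (a • x) z = a * Q x z)
    (hskew : ∀ x y, star (Q x y) = -Q y x) (n : ℕ) :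
    ∀ (P R : Submodule K M), Module.finrank K P = n →
      (∀ x, x ∈ R ↔ x ∈ P ∧ ∀ y ∈ P, Q x y = 0) →
      ∑ᶠ x : P, ψ ⟨Q x x, skewAdjoint.mem_iff.2 (hskew x x)⟩ =
        (-(q : ℂ)) ^ (n + Module.finrank K R) := by
  classical
  have haddr : ∀ x y z, Q x (y + z) = Q x y + Q x z := by
    intro x y z
    have h1 := hskew (y + z) x
    rw [hadd, star_add, hskew, hskew] at h1
    linear_combination h1
  have hsmulr : ∀ (a : K) x z, Q x (a • z) = star a * Q x z := by
    intro a x z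
    have h1 := hskew (a • z) x
    rw [hsmul, star_mul', hskew] at h1
    linear_combination h1
  have : Module.Finite K M := Module.Finite.of_finite
  have hzero : ∀ (n : ℕ) (P R : Submodule K M), Module.finrank K P = n →
      (∀ x, x ∈ R ↔ x ∈ P ∧ ∀ y ∈ P, Q x y = 0) → (∀ x ∈ P, Q x x = 0) →
      ∑ᶠ x : P, ψ ⟨Q x x, skewAdjoint.mem_iff.2 (hskew x x)⟩ =
        (-(q : ℂ)) ^ (n + Module.finrank K R) := by
    intro n P R hP hR hz
    have hQ : ∀ x ∈ P, ∀ y ∈ P, Q x y = 0 := by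
      intro x hx y hy
      obtain ⟨a, ha⟩ := exists_star_ne q K
      have h1 : ∀ b : K, b * Q x y = star b * star (Q x y) := by
        intro b
        have h2 := hz (b • x + y) (P.add_mem (P.smul_mem b hx) hy)
        rw [hadd, haddr, haddr, hz y hy, hsmul, hsmul, hsmulr, hsmulr, hz x hx] at h2
        rw [hskew]
        linear_combination h2
      have h3 := h1 1
      rw [star_one, one_mul, one_mul] at h3
      have h4 := h1 a
      rw [← h3] at h4
      by_contra h
      exact ha (mul_right_cancel₀ h h4).symm
    have hRP : R = P := by
      ext x
      rw [hR]
      exact ⟨fun h => h.1, fun h => ⟨h, hQ x h⟩⟩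
    subst hRP
    have h1 : ∀ x : R, ψ ⟨Q x x, skewAdjoint.mem_iff.2 (hskew x x)⟩ = 1 := by
      intro x
      have : (⟨Q x x, skewAdjoint.mem_iff.2 (hskew x x)⟩ : skewAdjoint K) = 0 :=
        Subtype.ext (hz x x.2)
      rw [this, AddChar.map_zero_eq_one]
    have : Fintype R := Fintype.ofFinite R
    simp only [h1]
    rw [finsum_eq_sum_of_fintype, hP, Finset.sum_const, Finset.card_univ,
      Module.card_eq_pow_finrank (K := K) (V := R), hP, hK.card_eq, ← two_mul, pow_mul]
    simp
  induction n with
  | zero =>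
    intro P R hP hR
    apply hzero 0 P R hP hR
    obtain rfl := Submodule.finrank_eq_zero.1 hP
    intro x hx
    rw [(Submodule.mem_bot K).1 hx]
    simpa using hsmul 0 0 0
  | succ n ih =>
    intro P R hP hR
    by_cases hz : ∀ x ∈ P, Q x x = 0
    · exact hzero _ P R hP hR hz
    push Not at hz
    obtain ⟨x, hx, hc⟩ := hz
    have hQ0 : ∀ y, Q 0 y = 0 := fun y => by simpa using hsmul 0 0 y
    let P' : Submodule K M :=
      { carrier := {y | y ∈ P ∧ Q y x = 0}
        add_mem' := fun {a b} ha hb => ⟨P.add_mem ha.1 hb.1, by rw [hadd, ha.2, hb.2, add_zero]⟩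
        zero_mem' := ⟨P.zero_mem, hQ0 x⟩
        smul_mem' := fun c y hy => ⟨P.smul_mem c hy.1, by rw [hsmul, hy.2, mul_zero]⟩ }
    have hP' : ∀ y : P', Q x y = 0 := by
      intro y
      have := hskew x y
      rw [y.2.2, neg_zero, star_eq_zero] at this
      exact this
    let e : (K × P') →ₗ[K] P :=
      { toFun := fun a => ⟨a.1 • x + a.2.1, P.add_mem (P.smul_mem _ hx) a.2.2.1⟩
        map_add' := fun a b => by
          ext
          simp only [Prod.fst_add, Prod.snd_add, Submodule.coe_add, add_smul]
          abel
        map_smul' := fun c a => by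
          ext
          simp [mul_smul] }
    have he : Function.Bijective e := by
      constructor
      · rw [← LinearMap.ker_eq_bot, LinearMap.ker_eq_bot']
        rintro ⟨a, y⟩ h
        have h1 : a • x + y.1 = 0 := congrArg Subtype.val h
        have h2 : a * Q x x = 0 := by
          have := hadd (a • x) y.1 x
          rw [h1, hsmul, y.2.2, hQ0] at this
          simpa using this.symm
        have ha : a = 0 := (mul_eq_zero.1 h2).resolve_right hc
        subst ha
        ext
        · rfl
        · simpa using h1
      · rintro ⟨p, hp⟩
        refine ⟨(Q p x / Q x x, ⟨p + (-(Q p x / Q x x)) • x,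
          P.add_mem hp (P.smul_mem _ hx), ?_⟩), ?_⟩
        · rw [hadd, hsmul]
          field_simp
          ring
        · ext
          simp [e]
    have hfin : Module.finrank K P' = n := by
      have h1 := (LinearEquiv.ofBijective e he).finrank_eq
      rw [Module.finrank_prod, Module.finrank_self, hP] at h1
      omega
    have hR' : ∀ r, r ∈ R ↔ r ∈ P' ∧ ∀ y ∈ P', Q r y = 0 := by
      intro r
      rw [hR]
      constructor
      · exact fun h => ⟨⟨h.1, h.2 x hx⟩, fun y hy => h.2 y hy.1⟩
      · rintro ⟨h1, h2⟩
        refine ⟨h1.1, fun y hy => ?_⟩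
        obtain ⟨⟨a, y'⟩, h3⟩ := he.2 ⟨y, hy⟩
        have h4 : a • x + y'.1 = y := congrArg Subtype.val h3
        rw [← h4, haddr, hsmulr, h1.2, h2 y' y'.2, mul_zero, add_zero]
    have key := ih P' R hfin hR'
    have hF : Fintype P' := Fintype.ofFinite P'
    have hF2 : Fintype P := Fintype.ofFinite P
    rw [finsum_eq_sum_of_fintype] at key ⊢
    have hx0 : (⟨Q x x, skewAdjoint.mem_iff.2 (hskew x x)⟩ : skewAdjoint K) ≠ 0 :=
      fun h => hc (congrArg Subtype.val h)
    have hgauss := sum_norm q ψ hψ _ hx0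
    rw [show n + 1 + Module.finrank K R = (n + Module.finrank K R) + 1 by ring, pow_succ', ← key,
      ← hgauss, Finset.sum_mul_sum, ← Fintype.sum_prod_type']
    symm
    refine Fintype.sum_bijective e he _ _ ?_
    rintro ⟨a, y⟩
    rw [← AddChar.map_add_eq_mul]
    congr 1
    ext
    change star a * a * Q x x + Q y.1 y.1 = Q (a • x + y.1) (a • x + y.1)
    rw [hadd, haddr, haddr, hsmul, hsmul, hsmulr, hsmulr, hP' y, y.2.2]
    ring

end Field

/-- A nondegenerate hermitian form on the column space `ι → K`, given by its Gram matrix. -/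
structure HermForm (K ι : Type*) [Field K] [StarRing K] [Fintype ι] [DecidableEq ι] where
  gram : Matrix ι ι K
  isHermitian : gram.IsHermitian
  isUnit_det : IsUnit gram.det

section Heisenberg

variable {K ι : Type*} [Field K] [StarRing K] [Fintype ι] [DecidableEq ι]

namespace HermForm

/-- The hermitian form, linear in `v` and conjugate-linear in `w`. -/
def form (J : HermForm K ι) (v w : ι → K) : K := star w ⬝ᵥ (J.gram *ᵥ v)

theorem form_add_left (J : HermForm K ι) (u v w : ι → K) :
    J.form (u + v) w = J.form u w + J.form v w := by
  simp [form, Matrix.mulVec_add]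

theorem form_add_right (J : HermForm K ι) (u v w : ι → K) :
    J.form u (v + w) = J.form u v + J.form u w := by
  simp [form, add_dotProduct]

theorem form_neg_left (J : HermForm K ι) (v w : ι → K) : J.form (-v) w = -J.form v w := by
  simp [form, Matrix.mulVec_neg]

theorem form_neg_right (J : HermForm K ι) (v w : ι → K) : J.form v (-w) = -J.form v w := by
  simp [form]

theorem form_sub_left (J : HermForm K ι) (u v w : ι → K) :
    J.form (u - v) w = J.form u w - J.form v w := by
  simp [form, Matrix.mulVec_sub]

theorem form_sub_right (J : HermForm K ι) (u v w : ι → K) :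
    J.form u (v - w) = J.form u v - J.form u w := by
  simp [form, sub_dotProduct]

theorem form_smul_left (J : HermForm K ι) (a : K) (v w : ι → K) :
    J.form (a • v) w = a * J.form v w := by
  simp [form, Matrix.mulVec_smul]

theorem star_form (J : HermForm K ι) (v w : ι → K) : star (J.form v w) = J.form w v := by
  rw [form, form, Matrix.star_dotProduct, Matrix.star_mulVec, J.isHermitian.eq,
    Matrix.dotProduct_mulVec, star_star]

/-- Every linear functional is represented by the form. -/
theorem exists_form_eq (J : HermForm K ι) (φ : Module.Dual K (ι → K)) :
    ∃ w, ∀ v, J.form v w = φ v := by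
  let c : ι → K := fun i => φ (Pi.single i 1)
  have hc : ∀ v, φ v = c ⬝ᵥ v := by
    intro v
    conv_lhs => rw [pi_eq_sum_univ' v]
    simp [dotProduct, c, mul_comm]
  refine ⟨star (c ᵥ* J.gram⁻¹), fun v => ?_⟩
  rw [form, star_star, hc, Matrix.dotProduct_mulVec, Matrix.vecMul_vecMul,
    Matrix.nonsing_inv_mul _ J.isUnit_det, Matrix.vecMul_one]

theorem eq_zero_of_form (J : HermForm K ι) {w : ι → K} (h : ∀ v, J.form v w = 0) : w = 0 := by
  have h1 : ∀ v, star w ᵥ* J.gram ⬝ᵥ v = 0 := by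
    intro v; rw [← Matrix.dotProduct_mulVec]; exact h v
  have h2 := dotProduct_eq_zero _ h1
  have h3 : star w = 0 := by
    have := congrArg (fun u => u ᵥ* J.gram⁻¹) h2
    simpa [Matrix.vecMul_vecMul, Matrix.mul_nonsing_inv _ J.isUnit_det] using this
  simpa using h3

/-- The unitary group of a hermitian form. -/
def U (J : HermForm K ι) : Subgroup (GL ι K) where
  carrier := {g | (g : Matrix ι ι K)ᴴ * J.gram * (g : Matrix ι ι K) = J.gram}
  one_mem' := by simp
  mul_mem' := by
    intro a b ha hb
    simp only [Set.mem_ofPred_eq] at ha hb ⊢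
    calc _ = (b : Matrix ι ι K)ᴴ * ((a : Matrix ι ι K)ᴴ * J.gram * (a : Matrix ι ι K)) *
          (b : Matrix ι ι K) := by simp [Matrix.mul_assoc]
      _ = J.gram := by rw [ha, hb]
  inv_mem' := by
    intro a ha
    simp only [Set.mem_ofPred_eq] at ha ⊢
    have h1 : (a : Matrix ι ι K) * ((a⁻¹ : GL ι K) : Matrix ι ι K) = 1 := by
      rw [← Units.val_mul, mul_inv_cancel, Units.val_one]
    have h2 : ((a⁻¹ : GL ι K) : Matrix ι ι K)ᴴ * (a : Matrix ι ι K)ᴴ = 1 := by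
      rw [← Matrix.conjTranspose_mul, h1, Matrix.conjTranspose_one]
    calc _ = ((a⁻¹ : GL ι K) : Matrix ι ι K)ᴴ * ((a : Matrix ι ι K)ᴴ * J.gram * (a : Matrix ι ι K)) *
          ((a⁻¹ : GL ι K) : Matrix ι ι K) := by rw [ha]
      _ = (((a⁻¹ : GL ι K) : Matrix ι ι K)ᴴ * (a : Matrix ι ι K)ᴴ) * J.gram *
          ((a : Matrix ι ι K) * ((a⁻¹ : GL ι K) : Matrix ι ι K)) := by
            simp only [Matrix.mul_assoc]
      _ = J.gram := by rw [h1, h2, Matrix.one_mul, Matrix.mul_one]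

/-- The linear map of the column space given by an element of the unitary group. -/
def act {J : HermForm K ι} (g : J.U) : (ι → K) →ₗ[K] (ι → K) :=
  Matrix.mulVecLin ((g : GL ι K) : Matrix ι ι K)

theorem act_one {J : HermForm K ι} (v : ι → K) : act (1 : J.U) v = v := by
  simp [act]

theorem act_mul {J : HermForm K ι} (g k : J.U) (v : ι → K) : act (g * k) v = act g (act k v) := by
  simp [act, Matrix.mulVec_mulVec]

theorem form_act {J : HermForm K ι} (g : J.U) (v w : ι → K) :
    J.form (act g v) (act g w) = J.form v w := by
  have hg : ((g : GL ι K) : Matrix ι ι K)ᴴ * J.gram * ((g : GL ι K) : Matrix ι ι K) = J.gram := g.2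
  simp only [form, act, Matrix.mulVecLin_apply]
  rw [Matrix.star_mulVec, ← Matrix.dotProduct_mulVec, Matrix.mulVec_mulVec, Matrix.mulVec_mulVec,
    hg]

end HermForm

/-- The Heisenberg group of a hermitian space: pairs `(v, z)` with `z + star z = ⟨v, v⟩` and
`(v, z) * (w, t) = (v + w, z + t + ⟨v, w⟩)`. -/
@[ext]
structure Heisenberg (J : HermForm K ι) where
  vec : ι → K
  ctr : K
  rel : ctr + star ctr = J.form vec vec

namespace Heisenberg

instance (J : HermForm K ι) : Mul (Heisenberg J) where
  mul x y := ⟨x.vec + y.vec, x.ctr + y.ctr + J.form x.vec y.vec, by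
    rw [J.form_add_left, J.form_add_right, J.form_add_right, ← x.rel, ← y.rel, star_add, star_add,
      J.star_form]
    ring⟩

instance (J : HermForm K ι) : One (Heisenberg J) where
  one := ⟨0, 0, by simp [HermForm.form]⟩

instance (J : HermForm K ι) : Inv (Heisenberg J) where
  inv x := ⟨-x.vec, star x.ctr, by
    rw [J.form_neg_left, J.form_neg_right, neg_neg, ← x.rel, star_star, add_comm]⟩

theorem mul_vec {J : HermForm K ι} (x y : Heisenberg J) : (x * y).vec = x.vec + y.vec := rfl

theorem mul_ctr {J : HermForm K ι} (x y : Heisenberg J) :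
    (x * y).ctr = x.ctr + y.ctr + J.form x.vec y.vec := rfl

theorem one_vec {J : HermForm K ι} : (1 : Heisenberg J).vec = 0 := rfl

theorem one_ctr {J : HermForm K ι} : (1 : Heisenberg J).ctr = 0 := rfl

theorem inv_vec {J : HermForm K ι} (x : Heisenberg J) : x⁻¹.vec = -x.vec := rfl

theorem inv_ctr {J : HermForm K ι} (x : Heisenberg J) : x⁻¹.ctr = star x.ctr := rfl

instance (J : HermForm K ι) : Group (Heisenberg J) :=
  Group.ofLeftAxioms
    (fun x y z => by
      ext1
      · simp only [mul_vec, add_assoc]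
      · simp only [mul_vec, mul_ctr, J.form_add_left, J.form_add_right]; ring)
    (fun x => by
      ext1
      · simp only [mul_vec, one_vec, zero_add]
      · simp [mul_ctr, one_ctr, one_vec, HermForm.form])
    (fun x => by
      ext1
      · simp only [mul_vec, one_vec, inv_vec, neg_add_cancel]
      · simp only [mul_ctr, one_ctr, inv_ctr, inv_vec, J.form_neg_left, ← x.rel]; ring)

/-- The central elements `(0, z)` with `z + star z = 0`. -/
def center (J : HermForm K ι) (z : skewAdjoint K) : Heisenberg J :=
  ⟨0, z, by rw [skewAdjoint.mem_iff.1 z.2]; simp [HermForm.form]⟩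

/-- The unitary group acts on the Heisenberg group by `g • (v, z) = (g v, z)`. -/
instance (J : HermForm K ι) : MulDistribMulAction J.U (Heisenberg J) where
  smul g x := ⟨HermForm.act g x.vec, x.ctr, by rw [HermForm.form_act, x.rel]⟩
  one_smul x := by
    ext1
    · exact HermForm.act_one _
    · rfl
  mul_smul g k x := by
    ext1
    · exact HermForm.act_mul g k _
    · rfl
  smul_mul g x y := by
    ext1
    · exact map_add (HermForm.act g) x.vec y.vec
    · exact congrArg (x.ctr + y.ctr + ·) (HermForm.form_act g x.vec y.vec).symm
  smul_one g := by
    ext1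
    · exact map_zero (HermForm.act g)
    · rfl

theorem smul_vec {J : HermForm K ι} (g : J.U) (x : Heisenberg J) :
    (g • x).vec = HermForm.act g x.vec := rfl

theorem smul_ctr {J : HermForm K ι} (g : J.U) (x : Heisenberg J) : (g • x).ctr = x.ctr := rfl

/-- The element `(g • x) * x⁻¹` of the Heisenberg group; it depends only on the vector `u`
of `x`. -/
def comm {J : HermForm K ι} (g : J.U) (u : ι → K) : Heisenberg J :=
  ⟨HermForm.act g u - u, J.form u u - J.form (HermForm.act g u) u, by
    rw [star_sub, J.star_form, J.star_form, J.form_sub_left, J.form_sub_right, J.form_sub_right,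
      HermForm.form_act]
    ring⟩

theorem smul_mul_inv {J : HermForm K ι} (g : J.U) (x : Heisenberg J) :
    (g • x) * x⁻¹ = comm g x.vec := by
  ext1
  · simp [mul_vec, smul_vec, inv_vec, comm, sub_eq_add_neg]
  · simp only [mul_ctr, smul_ctr, smul_vec, inv_vec, inv_ctr, comm, J.form_neg_right, ← x.rel]
    ring

theorem smul_mul_comm {J : HermForm K ι} (g : J.U) (x : Heisenberg J) (u : ι → K) :
    (g • x) * comm g u = comm g (x.vec + u) * x := by
  ext1
  · simp only [mul_vec, smul_vec, comm, map_add]; abel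
  · simp only [mul_ctr, smul_ctr, smul_vec, comm, map_add, J.form_add_left, J.form_add_right,
      J.form_sub_left, J.form_sub_right, HermForm.form_act]
    ring

end Heisenberg

end Heisenberg

section Weil

set_option linter.unusedSectionVars false

variable {K ι : Type*} [Field K] [Fintype K] [StarRing K] [Fintype ι] [DecidableEq ι]
  {S : Type*} [AddCommGroup S] [Module ℂ S]

/-- `ρ` is the irreducible representation of the Heisenberg group with central character `ψ`
(unique up to isomorphism when `ψ` is nontrivial). -/
structure IsHeisenbergRep {J : HermForm K ι} (ψ : AddChar (skewAdjoint K) ℂ)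
    (ρ : Representation ℂ (Heisenberg J) S) : Prop where
  irreducible : ρ.IsIrreducible
  central : ∀ (z : skewAdjoint K) (s : S), ρ (Heisenberg.center J z) s = ψ z • s

/-- The average of the operators `ρ ((g • x) * x⁻¹)`. -/
noncomputable def avgOp {J : HermForm K ι} (ρ : Representation ℂ (Heisenberg J) S) (g : J.U) :
    Module.End ℂ S :=
  (Fintype.card (ι → K) : ℂ)⁻¹ • ∑ u : ι → K, ρ (Heisenberg.comm g u)

/-- The operator by which `g` acts in the Weil representation. -/
noncomputable def weilOp (q : ℕ) {J : HermForm K ι} (ρ : Representation ℂ (Heisenberg J) S)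
    (g : J.U) : Module.End ℂ S :=
  (-(q : ℂ)) ^ Module.finrank K (LinearMap.range (HermForm.act g - LinearMap.id)) • avgOp ρ g

theorem avgOp_mul_apply {J : HermForm K ι} (ρ : Representation ℂ (Heisenberg J) S) (g : J.U)
    (x : Heisenberg J) : avgOp ρ g * ρ x = ρ (g • x) * avgOp ρ g := by
  rw [avgOp, smul_mul_assoc, mul_smul_comm, Finset.sum_mul, Finset.mul_sum]
  congr 1
  symm
  refine Fintype.sum_bijective (fun u => x.vec + u) (AddGroup.addLeft_bijective x.vec) _ _ ?_
  intro u
  rw [← map_mul, ← map_mul, Heisenberg.smul_mul_comm]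

theorem avgOp_one {J : HermForm K ι} (ρ : Representation ℂ (Heisenberg J) S) :
    avgOp ρ (1 : J.U) = 1 := by
  have h : ∀ u, Heisenberg.comm (1 : J.U) u = 1 := by
    intro u
    ext1
    · simp [Heisenberg.comm, HermForm.act_one, Heisenberg.one_vec]
    · simp [Heisenberg.comm, HermForm.act_one, Heisenberg.one_ctr]
  simp only [avgOp, h, map_one, Finset.sum_const, Finset.card_univ]
  rw [← Nat.cast_smul_eq_nsmul ℂ, smul_smul, inv_mul_cancel₀, one_smul]
  exact_mod_cast Fintype.card_ne_zero

theorem trace_eq_zero (q : ℕ) [QuadraticStar q K] {J : HermForm K ι}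
    {ψ : AddChar (skewAdjoint K) ℂ} (hψ : ψ ≠ 1)
    {ρ : Representation ℂ (Heisenberg J) S} (hρ : IsHeisenbergRep ψ ρ) (x : Heisenberg J)
    (hx : x.vec ≠ 0) : LinearMap.trace ℂ S (ρ x) = 0 := by
  obtain ⟨z, hz⟩ := AddChar.ne_one_iff.1 hψ
  obtain ⟨a, ha⟩ := exists_sub_star_eq q (skewAdjoint.mem_iff.1 z.2)
  obtain ⟨v, hv⟩ : ∃ v, J.form v x.vec ≠ 0 := by
    by_contra! h
    exact hx (J.eq_zero_of_form h)
  let w := (a / J.form v x.vec) • v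
  have hw : J.form w x.vec = a := by
    rw [J.form_smul_left, div_mul_cancel₀ _ hv]
  obtain ⟨t, ht⟩ := exists_add_star_eq q (J.star_form w w)
  let y : Heisenberg J := ⟨w, t, ht⟩
  have h1 : y * x = Heisenberg.center J z * (x * y) := by
    ext1
    · simp [Heisenberg.mul_vec, Heisenberg.center, add_comm]
    · simp only [Heisenberg.mul_ctr, Heisenberg.mul_vec, Heisenberg.center]
      have h2 : J.form y.vec x.vec = a := hw
      have h3 : J.form x.vec y.vec = star a := by rw [← h2, J.star_form]
      rw [h2, h3, ← ha]
      simp only [HermForm.form, Matrix.mulVec_zero, dotProduct_zero]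
      ring
  have h2 : ρ y * ρ x = ψ z • (ρ x * ρ y) := by
    rw [← map_mul, h1, map_mul, map_mul]
    ext s
    exact hρ.central z _
  have h3 := congrArg (LinearMap.trace ℂ S) h2
  rw [map_smul, ← map_mul, ← map_mul] at h3
  have h4 : LinearMap.trace ℂ S (ρ x) = ψ z • LinearMap.trace ℂ S (ρ x) := by
    have h5 : ρ x = ρ y⁻¹ * (ρ y * ρ x) := by
      rw [← mul_assoc, ← map_mul, inv_mul_cancel, map_one, one_mul]
    conv_lhs => rw [h5, h2, mul_smul_comm, map_smul, LinearMap.trace_mul_comm, mul_assoc, ← map_mul ρ y,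
      mul_inv_cancel, map_one, mul_one]
  rw [smul_eq_mul] at h4
  by_contra h
  exact hz (mul_right_cancel₀ h (h4.symm.trans (one_mul _).symm))

theorem trace_center [FiniteDimensional ℂ S] {J : HermForm K ι}
    {ψ : AddChar (skewAdjoint K) ℂ}
    {ρ : Representation ℂ (Heisenberg J) S} (hρ : IsHeisenbergRep ψ ρ) (x : Heisenberg J)
    (hx : x.vec = 0) (hx' : x.ctr ∈ skewAdjoint K) :
    LinearMap.trace ℂ S (ρ x) = ψ ⟨x.ctr, hx'⟩ * Module.finrank ℂ S := by
  have h1 : x = Heisenberg.center J ⟨x.ctr, hx'⟩ := by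
    ext1
    · exact hx
    · rfl
  have h2 : ρ x = ψ ⟨x.ctr, hx'⟩ • (1 : Module.End ℂ S) := by
    ext s
    conv_lhs => rw [h1]
    exact hρ.central _ s
  rw [h2, map_smul, LinearMap.trace_one, smul_eq_mul]

/-- The space of fixed vectors of `g`. -/
def fixed {J : HermForm K ι} (g : J.U) : Submodule K (ι → K) :=
  LinearMap.ker (HermForm.act g - LinearMap.id)

theorem mem_fixed {J : HermForm K ι} (g : J.U) (v : ι → K) :
    v ∈ fixed g ↔ HermForm.act g v = v := by
  rw [fixed, LinearMap.mem_ker, LinearMap.sub_apply, LinearMap.id_apply, sub_eq_zero]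

theorem mem_fixed_iff_form {J : HermForm K ι} (g : J.U) (a : ι → K) :
    a ∈ fixed g ↔ ∀ v, J.form (HermForm.act g v - v) a = 0 := by
  rw [mem_fixed]
  constructor
  · intro h v
    rw [J.form_sub_left, sub_eq_zero]
    conv_lhs => rw [← h]
    exact HermForm.form_act g v a
  · intro h
    have h1 : ∀ v, J.form v (a - HermForm.act g a) = 0 := by
      intro v
      have h2 := h (HermForm.act g⁻¹ v)
      have h3 : HermForm.act g (HermForm.act g⁻¹ v) = v := by
        rw [← HermForm.act_mul, mul_inv_cancel, HermForm.act_one]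
      rw [J.form_sub_left, h3, ← HermForm.form_act g (HermForm.act g⁻¹ v) a, h3,
        ← J.form_sub_right] at h2
      exact h2
    exact (sub_eq_zero.1 (J.eq_zero_of_form h1)).symm

theorem finrank_fixed_add {J : HermForm K ι} (g : J.U) :
    Module.finrank K (LinearMap.range (HermForm.act g - LinearMap.id)) +
      Module.finrank K (fixed g) = Fintype.card ι := by
  rw [fixed, LinearMap.finrank_range_add_finrank_ker, Module.finrank_fintype_fun_eq_card]

theorem trace_avgOp [FiniteDimensional ℂ S] (q : ℕ) [hK : QuadraticStar q K] {J : HermForm K ι}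
    {ψ : AddChar (skewAdjoint K) ℂ} (hψ : ψ ≠ 1)
    {ρ : Representation ℂ (Heisenberg J) S} (hρ : IsHeisenbergRep ψ ρ) (g : J.U) :
    LinearMap.trace ℂ S (avgOp ρ g) = (Fintype.card (ι → K) : ℂ)⁻¹ *
      (((q : ℂ) ^ 2) ^ Module.finrank K (fixed g) * Module.finrank ℂ S) := by
  classical
  rw [avgOp, map_smul, map_sum, smul_eq_mul]
  congr 1
  have h1 : ∀ u : ι → K, LinearMap.trace ℂ S (ρ (Heisenberg.comm g u)) =
      if u ∈ fixed g then (Module.finrank ℂ S : ℂ) else 0 := by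
    intro u
    split_ifs with h
    · rw [mem_fixed] at h
      have : Heisenberg.comm g u = 1 := by
        ext1
        · simp [Heisenberg.comm, h, Heisenberg.one_vec]
        · simp [Heisenberg.comm, h, Heisenberg.one_ctr]
      rw [this, map_one, LinearMap.trace_one]
    · apply trace_eq_zero q hψ hρ
      rw [mem_fixed] at h
      exact sub_ne_zero.2 h
  simp only [h1]
  rw [Finset.sum_ite, Finset.sum_const_zero, add_zero, Finset.sum_const, nsmul_eq_mul]
  congr 1
  have : (Finset.univ.filter (fun u => u ∈ fixed g)).card = Fintype.card (fixed g) := by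
    rw [Fintype.card_subtype]
  rw [this, Module.card_eq_pow_finrank (K := K) (V := fixed g), hK.card_eq]
  push_cast
  rfl

/-- The pairs `(u, v)` with `(g u - u) + (k v - v) = 0`. -/
def pairs {J : HermForm K ι} (g k : J.U) : Submodule K ((ι → K) × (ι → K)) :=
  LinearMap.ker ((HermForm.act g - LinearMap.id).coprod (HermForm.act k - LinearMap.id))

theorem mem_pairs {J : HermForm K ι} (g k : J.U) (p : (ι → K) × (ι → K)) :
    p ∈ pairs g k ↔ HermForm.act g p.1 - p.1 + (HermForm.act k p.2 - p.2) = 0 := by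
  simp [pairs]

/-- The skew-hermitian form on `pairs g k` that describes the phase of a product of two
averages. -/
def phase {J : HermForm K ι} (g k : J.U) (x y : pairs g k) : K :=
  -J.form (HermForm.act g x.1.1 - x.1.1) (HermForm.act g y.1.1 - y.1.2)

theorem star_phase {J : HermForm K ι} (g k : J.U) (x y : pairs g k) :
    star (phase g k x y) = -phase g k y x := by
  obtain ⟨⟨u, v⟩, h⟩ := x
  obtain ⟨⟨u', v'⟩, h'⟩ := y
  rw [mem_pairs] at h h'
  dsimp only at h h'
  simp only [phase, star_neg, J.star_form, neg_neg]
  have e : HermForm.act g u = u + v - HermForm.act k v := by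
    rw [← sub_eq_zero, ← h]; abel
  have e' : HermForm.act g u' = u' + v' - HermForm.act k v' := by
    rw [← sub_eq_zero, ← h']; abel
  have i1 := HermForm.form_act g u' u
  have i2 := HermForm.form_act k v' v
  rw [e, e'] at i1 ⊢
  simp only [J.form_sub_left, J.form_sub_right, J.form_add_left, J.form_add_right] at i1 ⊢
  first | linear_combination i1 - i2 | linear_combination i2 - i1 | linear_combination i1 + i2 | linear_combination -i1 - i2

theorem comm_mul_comm_ctr {J : HermForm K ι} (g k : J.U) (x : pairs g k) :
    (Heisenberg.comm g x.1.1 * Heisenberg.comm k x.1.2).ctr = phase g k x x := by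
  obtain ⟨⟨u, v⟩, h⟩ := x
  rw [mem_pairs] at h
  dsimp only at h
  have e : HermForm.act k v = u + v - HermForm.act g u := by
    rw [← sub_eq_zero, ← h]; abel
  simp only [Heisenberg.mul_ctr, Heisenberg.comm, phase, e, J.form_sub_left, J.form_sub_right,
    J.form_add_left, J.form_add_right]
  ring

theorem finrank_pairs {J : HermForm K ι} (g k : J.U) (R : Submodule K (pairs g k))
    (hR : ∀ x, x ∈ R ↔ ∀ y, phase g k x y = 0) :
    Module.finrank K (pairs g k) + Module.finrank K R = Fintype.card ι + Module.finrank K (fixed g)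
      + Module.finrank K (fixed k) + Module.finrank K (fixed (k * g)) := by
  classical
  let L := (HermForm.act g - LinearMap.id).coprod (HermForm.act k - LinearMap.id)
  have hL : Module.finrank K (LinearMap.range L) + Module.finrank K (pairs g k) =
      Fintype.card ι + Fintype.card ι := by
    rw [pairs, LinearMap.finrank_range_add_finrank_ker, Module.finrank_prod,
      Module.finrank_fintype_fun_eq_card]
  -- the common fixed vectors are the orthogonal complement of the range of `L`
  let D : (ι → K) → Module.Dual K (ι → K) := fun w =>
    { toFun := fun v => J.form v w
      map_add' := fun a b => J.form_add_left a b w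
      map_smul' := fun c a => J.form_smul_left c a w }
  have hDmem : ∀ w, w ∈ fixed g ⊓ fixed k ↔ D w ∈ (LinearMap.range L).dualAnnihilator := by
    intro w
    rw [Submodule.mem_inf, mem_fixed_iff_form, mem_fixed_iff_form,
      Submodule.mem_dualAnnihilator]
    constructor
    · rintro ⟨h1, h2⟩ _ ⟨⟨u, v⟩, rfl⟩
      change J.form (L (u, v)) w = 0
      simp only [L, LinearMap.coprod_apply, LinearMap.sub_apply, LinearMap.id_apply]
      rw [J.form_add_left, h1, h2, add_zero]
    · intro h
      constructor
      · intro v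
        have : J.form (L (v, 0)) w = 0 := h _ ⟨(v, 0), rfl⟩
        simpa [L] using this
      · intro v
        have : J.form (L (0, v)) w = 0 := h _ ⟨(0, v), rfl⟩
        simpa [L] using this
  have hDbij : Function.Bijective D := by
    constructor
    · intro a b hab
      rw [← sub_eq_zero]
      apply J.eq_zero_of_form
      intro v
      rw [J.form_sub_right, sub_eq_zero]
      exact congrArg (fun φ : Module.Dual K (ι → K) => φ v) hab
    · intro φ
      obtain ⟨w, hw⟩ := J.exists_form_eq φ
      exact ⟨w, LinearMap.ext hw⟩
  have hfix : Module.finrank K (fixed g ⊓ fixed k : Submodule K (ι → K)) +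
      Module.finrank K (LinearMap.range L) = Fintype.card ι := by
    have h1 : Nat.card (fixed g ⊓ fixed k : Submodule K (ι → K)) =
        Nat.card (LinearMap.range L).dualAnnihilator := by
      refine Nat.card_congr (Equiv.ofBijective (fun w => ⟨D w, (hDmem w).1 w.2⟩) ⟨?_, ?_⟩)
      · intro a b hab
        exact Subtype.ext (hDbij.1 (congrArg Subtype.val hab))
      · rintro ⟨φ, hφ⟩
        obtain ⟨w, rfl⟩ := hDbij.2 φ
        exact ⟨⟨w, (hDmem w).2 hφ⟩, rfl⟩
    rw [Module.natCard_eq_pow_finrank (K := K) (V := (fixed g ⊓ fixed k : Submodule K (ι → K))),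
      Module.natCard_eq_pow_finrank (K := K) (V := (LinearMap.range L).dualAnnihilator)] at h1
    have h2 : 1 < Nat.card K := Finite.one_lt_card
    rw [Nat.pow_right_injective h2 h1, add_comm, Subspace.finrank_add_finrank_dualAnnihilator_eq,
      Module.finrank_fintype_fun_eq_card]
  -- a parametrization of the radical
  let Φ : (fixed (k * g) × (fixed g × fixed k)) →ₗ[K] ((ι → K) × (ι → K)) :=
    { toFun := fun p => (p.1.1 + p.2.1.1, HermForm.act g p.1.1 + p.2.2.1)
      map_add' := fun a b => by
        ext1 <;> simp only [Prod.fst_add, Prod.snd_add, Submodule.coe_add, map_add] <;> abel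
      map_smul' := fun c a => by
        ext1 <;> simp [Prod.smul_fst, Prod.smul_snd, map_smul, smul_add] }
  have hrange : LinearMap.range Φ = R.map (pairs g k).subtype := by
    ext p
    constructor
    · rintro ⟨⟨⟨y, hy⟩, ⟨a, ha⟩, ⟨b, hb⟩⟩, rfl⟩
      have hy' := (mem_fixed _ _).1 hy
      rw [HermForm.act_mul] at hy'
      have ha' := (mem_fixed _ _).1 ha
      have hb' := (mem_fixed _ _).1 hb
      have hmem : (y + a, HermForm.act g y + b) ∈ pairs g k := by
        rw [mem_pairs]
        simp only [map_add, hy', ha', hb']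
        abel
      refine ⟨⟨_, hmem⟩, (hR _).2 ?_, rfl⟩
      intro z
      have hz := (mem_pairs _ _ _).1 z.2
      have h1 : star (phase g k z ⟨_, hmem⟩) = 0 := by
        have h2 : HermForm.act g (y + a) - (HermForm.act g y + b) = a - b := by
          rw [map_add, ha']; abel
        rw [phase, h2, J.form_sub_right, (mem_fixed_iff_form g a).1 ha,
          eq_neg_of_add_eq_zero_left hz, J.form_neg_left, (mem_fixed_iff_form k b).1 hb]
        simp
      rw [star_phase, neg_eq_zero] at h1
      exact h1
    · rintro ⟨⟨⟨u, v⟩, hx⟩, hxR, rfl⟩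
      have h1 := (hR _).1 hxR
      have hx' := (mem_pairs _ _ _).1 hx
      dsimp only at hx'
      let A := LinearMap.range (HermForm.act g - LinearMap.id)
      let B := LinearMap.range (HermForm.act k - LinearMap.id)
      have h2 : D (HermForm.act g u - v) ∈ (A ⊓ B).dualAnnihilator := by
        rw [Submodule.mem_dualAnnihilator]
        rintro w ⟨⟨s, rfl⟩, ⟨t, ht⟩⟩
        have hst : (s, -t) ∈ pairs g k := by
          rw [mem_pairs]
          simp only [LinearMap.sub_apply, LinearMap.id_apply] at ht
          simp only [map_neg]
          linear_combination -ht
        have h3 := star_phase g k ⟨(u, v), hx⟩ ⟨(s, -t), hst⟩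
        rw [h1, star_zero, eq_comm, neg_eq_zero, phase, neg_eq_zero] at h3
        exact h3
      rw [Subspace.dualAnnihilator_inf_eq, Submodule.mem_sup] at h2
      obtain ⟨φ, hφ, χ, hχ, hsum⟩ := h2
      obtain ⟨a, rfl⟩ := hDbij.2 φ
      obtain ⟨b, rfl⟩ := hDbij.2 χ
      have ha : a ∈ fixed g := (mem_fixed_iff_form g a).2 fun v =>
        (Submodule.mem_dualAnnihilator _).1 hφ _ ⟨v, rfl⟩
      have hb : b ∈ fixed k := (mem_fixed_iff_form k b).2 fun v =>
        (Submodule.mem_dualAnnihilator _).1 hχ _ ⟨v, rfl⟩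
      have hab : a + b = HermForm.act g u - v := by
        apply hDbij.1
        rw [← hsum]
        ext v
        exact J.form_add_right _ _ _
      have ha' := (mem_fixed _ _).1 ha
      have hb' := (mem_fixed _ _).1 hb
      have hgy : HermForm.act g (u - a) = v + b := by
        rw [map_sub, ha']; linear_combination -hab
      have hy : u - a ∈ fixed (k * g) := by
        rw [mem_fixed, HermForm.act_mul, hgy, map_add, hb']
        linear_combination hx' + hab
      refine ⟨(⟨u - a, hy⟩, ⟨a, ha⟩, ⟨-b, (fixed k).neg_mem hb⟩), ?_⟩
      change (u - a + a, HermForm.act g (u - a) + -b) = (u, v)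
      rw [hgy]
      simp
  have hker : Module.finrank K (LinearMap.ker Φ) =
      Module.finrank K (fixed g ⊓ fixed k : Submodule K (ι → K)) := by
    refine LinearEquiv.finrank_eq (LinearEquiv.ofBijective
      ({ toFun := fun p => ⟨p.1.2.1.1, ?_⟩
         map_add' := fun _ _ => rfl
         map_smul' := fun _ _ => rfl } :
        LinearMap.ker Φ →ₗ[K] (fixed g ⊓ fixed k : Submodule K (ι → K))) ⟨?_, ?_⟩)
    · obtain ⟨⟨⟨y, hy⟩, ⟨a, ha⟩, ⟨b, hb⟩⟩, hp⟩ := p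
      have h1 : y + a = 0 := congrArg Prod.fst (LinearMap.mem_ker.1 hp)
      have h2 : HermForm.act g y + b = 0 := congrArg Prod.snd (LinearMap.mem_ker.1 hp)
      have h3 : b = a := by
        rw [eq_neg_of_add_eq_zero_left h1, map_neg, (mem_fixed _ _).1 ha] at h2
        exact (neg_add_eq_zero.1 h2).symm
      exact ⟨ha, h3 ▸ hb⟩
    · rintro ⟨⟨⟨y, hy⟩, ⟨a, ha⟩, ⟨b, hb⟩⟩, hp⟩ ⟨⟨⟨y', hy'⟩, ⟨a', ha'⟩, ⟨b', hb'⟩⟩, hp'⟩ h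
      have h0 : a = a' := congrArg Subtype.val h
      subst h0
      have h1 : y + a = 0 := congrArg Prod.fst (LinearMap.mem_ker.1 hp)
      have h2 : HermForm.act g y + b = 0 := congrArg Prod.snd (LinearMap.mem_ker.1 hp)
      have h1' : y' + a = 0 := congrArg Prod.fst (LinearMap.mem_ker.1 hp')
      have h2' : HermForm.act g y' + b' = 0 := congrArg Prod.snd (LinearMap.mem_ker.1 hp')
      have e1 : y = y' := add_right_cancel (h1.trans h1'.symm)
      subst e1
      have e2 : b = b' := add_left_cancel (h2.trans h2'.symm)
      subst e2
      rfl
    · rintro ⟨a, ha, hb⟩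
      have ha' := (mem_fixed _ _).1 ha
      have hb' := (mem_fixed _ _).1 hb
      have hy : -a ∈ fixed (k * g) := by
        rw [mem_fixed, HermForm.act_mul, map_neg, ha', map_neg, hb']
      refine ⟨⟨(⟨-a, hy⟩, ⟨a, ha⟩, ⟨a, hb⟩), ?_⟩, rfl⟩
      rw [LinearMap.mem_ker]
      change (-a + a, HermForm.act g (-a) + a) = (0, 0)
      rw [map_neg, ha', neg_add_cancel]
  have hΦ := LinearMap.finrank_range_add_finrank_ker Φ
  rw [hrange, hker, Module.finrank_prod, Module.finrank_prod,
    ← LinearEquiv.finrank_eq (Submodule.equivMapOfInjective (pairs g k).subtype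
      (Submodule.subtype_injective _) R)] at hΦ
  omega

theorem trace_avgOp_mul [FiniteDimensional ℂ S] (q : ℕ) [hK : QuadraticStar q K] {J : HermForm K ι}
    {ψ : AddChar (skewAdjoint K) ℂ} (hψ : ψ ≠ 1)
    {ρ : Representation ℂ (Heisenberg J) S} (hρ : IsHeisenbergRep ψ ρ) (g k : J.U) :
    LinearMap.trace ℂ S (avgOp ρ g * avgOp ρ k) = (Fintype.card (ι → K) : ℂ)⁻¹ ^ 2 *
      ((-(q : ℂ)) ^ (Fintype.card ι + Module.finrank K (fixed g) + Module.finrank K (fixed k) +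
        Module.finrank K (fixed (k * g))) * Module.finrank ℂ S) := by
  classical
  rw [avgOp, avgOp, smul_mul_assoc, mul_smul_comm, smul_smul, map_smul, smul_eq_mul, ← sq,
    Finset.sum_mul_sum, ← Fintype.sum_prod_type', map_sum]
  congr 1
  have hadd : ∀ x y z, phase g k (x + y) z = phase g k x z + phase g k y z := by
    intro x y z
    simp only [phase, Submodule.coe_add, Prod.fst_add, map_add, J.form_sub_left, J.form_add_left]
    ring
  have hsmul : ∀ (a : K) x z, phase g k (a • x) z = a * phase g k x z := by
    intro a x z
    simp only [phase, Submodule.coe_smul, Prod.smul_fst, map_smul, J.form_sub_left,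
      J.form_smul_left]
    ring
  let R : Submodule K (pairs g k) :=
    { carrier := {x | ∀ y, phase g k x y = 0}
      add_mem' := fun {a b} ha hb y => by rw [hadd, ha y, hb y, add_zero]
      zero_mem' := fun y => by simpa using hsmul 0 0 y
      smul_mem' := fun c x hx y => by rw [hsmul, hx y, mul_zero] }
  have hgauss := sum_skew q ψ hψ (phase g k) hadd hsmul (star_phase g k) _ ⊤ R rfl
    (fun x => ⟨fun h => ⟨trivial, fun y _ => h y⟩, fun h y => h.2 y trivial⟩)
  rw [finrank_top, finrank_pairs g k R (fun x => Iff.rfl)] at hgauss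
  rw [← hgauss, finsum_eq_sum_of_fintype, Finset.sum_mul]
  have h1 : ∀ p : (ι → K) × (ι → K),
      LinearMap.trace ℂ S (ρ (Heisenberg.comm g p.1) * ρ (Heisenberg.comm k p.2)) =
      if h : p ∈ pairs g k then
        ψ ⟨phase g k ⟨p, h⟩ ⟨p, h⟩, skewAdjoint.mem_iff.2 (star_phase g k _ _)⟩ *
          Module.finrank ℂ S
      else 0 := by
    intro p
    rw [← map_mul]
    split_ifs with h
    · have h2 := comm_mul_comm_ctr g k ⟨p, h⟩
      rw [trace_center hρ _ ((mem_pairs g k p).1 h)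
        (by rw [h2]; exact skewAdjoint.mem_iff.2 (star_phase g k _ _))]
      congr 3
    · apply trace_eq_zero q hψ hρ
      intro h2
      exact h ((mem_pairs g k p).2 h2)
  simp only [h1]
  rw [Finset.sum_dite, Finset.sum_const_zero, add_zero]
  symm
  refine Finset.sum_bij (fun x _ => ⟨x.1.1, by simp⟩) ?_ ?_ ?_ ?_
  · intro x _; simp
  · intro x _ y _ h
    have h' : x.1.1 = y.1.1 := congrArg (fun z => z.1) h
    exact Subtype.ext (Subtype.ext h')
  · rintro ⟨p, hp⟩ _
    simp only [Finset.mem_filter, Finset.mem_univ, true_and] at hp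
    exact ⟨⟨⟨p, hp⟩, trivial⟩, Finset.mem_univ _, rfl⟩
  · intro x _
    rfl

/-- Schur's lemma for the Heisenberg representation. -/
theorem exists_eq_smul_one [FiniteDimensional ℂ S] {J : HermForm K ι}
    {ψ : AddChar (skewAdjoint K) ℂ} {ρ : Representation ℂ (Heisenberg J) S}
    (hρ : IsHeisenbergRep ψ ρ) (T : Module.End ℂ S) (hT : ∀ x, T * ρ x = ρ x * T) :
    ∃ c : ℂ, T = c • 1 := by
  have := hρ.irreducible
  let f : ρ.IntertwiningMap ρ := ⟨T, fun x => hT x⟩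
  obtain ⟨c, hc⟩ :=
    (Representation.IsIrreducible.algebraMap_intertwiningMap_bijective_of_isAlgClosed
      (ρ := ρ)).2 f
  refine ⟨c, ?_⟩
  have h1 := congrArg Representation.IntertwiningMap.toLinearMap hc
  rw [Algebra.algebraMap_eq_smul_one] at h1
  exact h1.symm

theorem finrank_fixed_comm {J : HermForm K ι} (g k : J.U) :
    Module.finrank K (fixed (k * g)) = Module.finrank K (fixed (g * k)) := by
  refine LinearEquiv.finrank_eq
    { toFun := fun v => ⟨HermForm.act g v.1, ?_⟩
      invFun := fun v => ⟨HermForm.act k v.1, ?_⟩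
      map_add' := fun a b => Subtype.ext (map_add _ _ _)
      map_smul' := fun a b => Subtype.ext (map_smul _ _ _)
      left_inv := ?_
      right_inv := ?_ }
  · have h := (mem_fixed _ _).1 v.2
    rw [HermForm.act_mul] at h
    rw [mem_fixed, HermForm.act_mul, h]
  · have h := (mem_fixed _ _).1 v.2
    rw [HermForm.act_mul] at h
    rw [mem_fixed, HermForm.act_mul, h]
  · intro v
    have h := (mem_fixed _ _).1 v.2
    rw [HermForm.act_mul] at h
    exact Subtype.ext h
  · intro v
    have h := (mem_fixed _ _).1 v.2
    rw [HermForm.act_mul] at h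
    exact Subtype.ext h

theorem weilOp_mul [FiniteDimensional ℂ S] (q : ℕ) [hK : QuadraticStar q K] {J : HermForm K ι}
    {ψ : AddChar (skewAdjoint K) ℂ} (hψ : ψ ≠ 1)
    {ρ : Representation ℂ (Heisenberg J) S} (hρ : IsHeisenbergRep ψ ρ) (g k : J.U) :
    weilOp q ρ (g * k) = weilOp q ρ g * weilOp q ρ k := by
  have hirr := hρ.irreducible
  have hq : (-(q : ℂ)) ≠ 0 := by
    rw [neg_ne_zero]; exact_mod_cast (zero_lt_one.trans (one_lt_q q K)).ne'
  have hW : (Fintype.card (ι → K) : ℂ) = (-(q : ℂ)) ^ (2 * Fintype.card ι) := by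
    rw [Fintype.card_fun, hK.card_eq, pow_mul, neg_sq]; push_cast; rfl
  have hW0 : (Fintype.card (ι → K) : ℂ) ≠ 0 := by rw [hW]; exact pow_ne_zero _ hq
  have hS : (Module.finrank ℂ S : ℂ) ≠ 0 := by
    have : Nontrivial S := by
      by_contra h
      rw [not_nontrivial_iff_subsingleton] at h
      apply bot_ne_top (α := Subrepresentation ρ)
      ext v
      obtain rfl : v = 0 := Subsingleton.elim _ _
      exact ⟨fun _ => trivial, fun _ => Submodule.zero_mem _⟩
    exact_mod_cast (Module.finrank_pos (R := ℂ) (M := S)).ne'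
  -- the averages are invertible up to a scalar
  have hinv : ∀ h : J.U, ∃ c : ℂ, c ≠ 0 ∧ avgOp ρ h⁻¹ * avgOp ρ h = c • 1 := by
    intro h
    obtain ⟨c, hc⟩ := exists_eq_smul_one hρ (avgOp ρ h⁻¹ * avgOp ρ h) (fun x => by
      rw [mul_assoc, avgOp_mul_apply, ← mul_assoc, avgOp_mul_apply, inv_smul_smul, mul_assoc])
    refine ⟨c, ?_, hc⟩
    rintro rfl
    have h1 := trace_avgOp_mul q hψ hρ h⁻¹ h
    rw [hc, zero_smul, map_zero] at h1
    exact mul_ne_zero (pow_ne_zero _ (inv_ne_zero hW0)) (mul_ne_zero (pow_ne_zero _ hq) hS) h1.symm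
  obtain ⟨μ, hμ⟩ : ∃ μ : ℂ, avgOp ρ g * avgOp ρ k = μ • avgOp ρ (g * k) := by
    obtain ⟨c, hc0, hc⟩ := hinv (g * k)
    obtain ⟨m, hm⟩ := exists_eq_smul_one hρ (avgOp ρ g * avgOp ρ k * avgOp ρ (g * k)⁻¹) (fun x => by
      rw [mul_assoc, avgOp_mul_apply, ← mul_assoc, mul_assoc (avgOp ρ g), avgOp_mul_apply,
        ← mul_assoc, avgOp_mul_apply, ← mul_smul, ← mul_smul, mul_inv_cancel, one_smul]
      simp only [mul_assoc])
    refine ⟨c⁻¹ * m, ?_⟩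
    have h1 := congrArg (· * avgOp ρ (g * k)) hm
    simp only [mul_assoc] at h1
    rw [hc, smul_mul_assoc, one_mul, mul_smul_comm, mul_smul_comm, mul_one] at h1
    rw [mul_smul, ← h1, smul_smul, inv_mul_cancel₀ hc0, one_smul]
  have htr := congrArg (LinearMap.trace ℂ S) hμ
  rw [trace_avgOp_mul q hψ hρ, map_smul, trace_avgOp q hψ hρ, smul_eq_mul, finrank_fixed_comm,
    hW, ← neg_sq (q : ℂ), ← pow_mul] at htr
  rw [weilOp, weilOp, weilOp, smul_mul_assoc, mul_smul_comm, smul_smul, hμ, smul_smul]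
  congr 1
  have e1 := finrank_fixed_add g
  have e2 := finrank_fixed_add k
  have e3 := finrank_fixed_add (g * k)
  set a := Module.finrank K (LinearMap.range (HermForm.act g - LinearMap.id))
  set b := Module.finrank K (LinearMap.range (HermForm.act k - LinearMap.id))
  set c := Module.finrank K (LinearMap.range (HermForm.act (g * k) - LinearMap.id))
  set a' := Module.finrank K (fixed g)
  set b' := Module.finrank K (fixed k)
  set c' := Module.finrank K (fixed (g * k))
  set N := Fintype.card ι
  generalize (-(q : ℂ)) = t at *
  have h2 : t ^ (N + a' + b' + c') = t ^ (2 * N) * (μ * t ^ (2 * c')) := by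
    have hp : t ^ (2 * N) ≠ 0 := pow_ne_zero _ hq
    field_simp at htr
    linear_combination htr
  have h3 : t ^ (2 * N + 2 * c' + a' + b') * (t ^ a * t ^ b * μ) =
      t ^ (2 * N + 2 * c' + a' + b') * t ^ c := by
    calc _ = t ^ (a + b + a' + b') * (t ^ (2 * N) * (μ * t ^ (2 * c'))) := by ring
      _ = t ^ ((a + a') + (b + b') + N + a' + b' + c') := by rw [← h2]; ring
      _ = t ^ (2 * N + c' + a' + b' + (c + c')) := by rw [e1, e2, e3]; ring
      _ = _ := by ring
  exact (mul_left_cancel₀ (pow_ne_zero _ hq) h3).symm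

/-- The Weil representation of the unitary group of the hermitian space of `J`. It acts on the
space of the Heisenberg representation `ρ`, by
`g ↦ (-q) ^ rank (g - 1) • average of ρ ((g • x) * x⁻¹) over the Heisenberg group`. -/
noncomputable def weilRep [FiniteDimensional ℂ S] (q : ℕ) [QuadraticStar q K] {J : HermForm K ι}
    {ψ : AddChar (skewAdjoint K) ℂ} (hψ : ψ ≠ 1)
    {ρ : Representation ℂ (Heisenberg J) S} (hρ : IsHeisenbergRep ψ ρ) :
    Representation ℂ J.U S where
  toFun := weilOp q ρ
  map_one' := by
    have : HermForm.act (1 : J.U) - LinearMap.id = 0 := by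
      ext1 v; simp [HermForm.act]
    rw [weilOp, avgOp_one, this, LinearMap.range_zero, finrank_bot, pow_zero, one_smul]
  map_mul' := weilOp_mul q hψ hρ

/-- The Weil representation intertwines the Heisenberg representation with its twist by `g`. -/
theorem weilRep_mul_apply [FiniteDimensional ℂ S] (q : ℕ) [QuadraticStar q K] {J : HermForm K ι}
    {ψ : AddChar (skewAdjoint K) ℂ} (hψ : ψ ≠ 1)
    {ρ : Representation ℂ (Heisenberg J) S} (hρ : IsHeisenbergRep ψ ρ) (g : J.U)
    (x : Heisenberg J) : weilRep q hψ hρ g * ρ x = ρ (g • x) * weilRep q hψ hρ g := by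
  change weilOp q ρ g * ρ x = ρ (g • x) * weilOp q ρ g
  rw [weilOp, smul_mul_assoc, mul_smul_comm, avgOp_mul_apply]

/-- Every central character `ψ` belongs to some irreducible representation of the Heisenberg
group, so that `IsHeisenbergRep` is inhabited. -/
theorem exists_isHeisenbergRep (J : HermForm K ι) (ψ : AddChar (skewAdjoint K) ℂ) :
    ∃ (M : Submodule ℂ (Heisenberg J → ℂ)) (ρ : Representation ℂ (Heisenberg J) M),
      IsHeisenbergRep ψ ρ := by
  classical
  have hfin : Finite (Heisenberg J) := Finite.of_injective
    (fun x : Heisenberg J => (x.vec, x.ctr)) (fun x y h => by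
      ext1
      · exact congrArg Prod.fst h
      · exact congrArg Prod.snd h)
  let R : Representation ℂ (Heisenberg J) (Heisenberg J → ℂ) :=
    { toFun := fun x => LinearMap.funLeft ℂ ℂ (· * x)
      map_one' := by ext f y; simp [LinearMap.funLeft_apply]
      map_mul' := fun x y => by ext f z; simp [LinearMap.funLeft_apply, mul_assoc] }
  have hR : ∀ x f y, R x f y = f (y * x) := fun _ _ _ => rfl
  have hcentral : ∀ z (y : Heisenberg J), y * Heisenberg.center J z = Heisenberg.center J z * y := by
    intro z y
    ext1
    · simp [Heisenberg.mul_vec, Heisenberg.center]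
    · simp [Heisenberg.mul_ctr, Heisenberg.center, HermForm.form, add_comm]
  let good : Submodule ℂ (Heisenberg J → ℂ) → Prop := fun M =>
    M ≠ ⊥ ∧ (∀ x, ∀ f ∈ M, R x f ∈ M) ∧
      ∀ f ∈ M, ∀ z y, f (Heisenberg.center J z * y) = ψ z * f y
  have hex : ∃ M, good M := by
    let M : Submodule ℂ (Heisenberg J → ℂ) :=
      { carrier := {f | ∀ z y, f (Heisenberg.center J z * y) = ψ z * f y}
        add_mem' := fun {a b} ha hb z y => by
          rw [Pi.add_apply, Pi.add_apply, ha, hb, mul_add]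
        zero_mem' := fun z y => by simp
        smul_mem' := fun c f hf z y => by
          rw [Pi.smul_apply, Pi.smul_apply, hf, smul_eq_mul, smul_eq_mul]; ring }
    have hsk : ∀ y : Heisenberg J, y.vec = 0 → y.ctr ∈ skewAdjoint K := by
      intro y hy
      have h := y.rel
      rw [hy] at h
      rw [skewAdjoint.mem_iff]
      have h0 : J.form 0 0 = 0 := by simp [HermForm.form]
      rw [h0] at h
      linear_combination h
    let f₀ : Heisenberg J → ℂ := fun y => if h : y.vec = 0 then ψ ⟨y.ctr, hsk y h⟩ else 0
    have hf₀ : f₀ ∈ M := by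
      intro z y
      by_cases h : y.vec = 0
      · have h' : (Heisenberg.center J z * y).vec = 0 := by
          rw [Heisenberg.mul_vec, h, add_zero]; rfl
        simp only [f₀, dif_pos h, dif_pos h']
        rw [← AddChar.map_add_eq_mul]
        congr 1
        ext
        simp [Heisenberg.mul_ctr, Heisenberg.center, h, HermForm.form]
      · have h' : ¬ (Heisenberg.center J z * y).vec = 0 := by
          rw [Heisenberg.mul_vec]
          change ¬ (0 + y.vec = 0)
          rwa [zero_add]
        simp only [f₀, dif_neg h, dif_neg h', mul_zero]
    refine ⟨M, ?_, fun x f hf z y => ?_, fun f hf => hf⟩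
    · intro hM
      rw [hM, Submodule.mem_bot] at hf₀
      have h1 := congrFun hf₀ 1
      have h2 : (⟨(1 : Heisenberg J).ctr, hsk 1 rfl⟩ : skewAdjoint K) = 0 := rfl
      simp only [f₀, dif_pos (Heisenberg.one_vec (J := J)), h2, AddChar.map_zero_eq_one] at h1
      exact one_ne_zero h1
    · rw [hR, hR, mul_assoc, hf]
  obtain ⟨M, hM, hmin⟩ := WellFounded.has_min
    (InvImage.wf (fun M : Submodule ℂ (Heisenberg J → ℂ) => Module.finrank ℂ M) Nat.lt_wfRel.wf)
    {M | good M} hex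
  obtain ⟨hM0, hMR, hMψ⟩ := hM
  let ρ : Representation ℂ (Heisenberg J) M :=
    { toFun := fun x => (R x).restrict (hMR x)
      map_one' := by ext f; simp
      map_mul' := fun x y => by ext f; simp }
  refine ⟨M, ρ, ?_, ?_⟩
  · have hne : Nontrivial M := Submodule.nontrivial_iff_ne_bot.2 hM0
    have hnt : Nontrivial (Subrepresentation ρ) := by
      refine ⟨⊥, ⊤, fun h => ?_⟩
      obtain ⟨m, hm⟩ := exists_ne (0 : M)
      have : m ∈ (⊤ : Subrepresentation ρ) := trivial
      rw [← h] at this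
      exact hm this
    refine ⟨fun N => ?_⟩
    by_contra! hN
    have hinj := Submodule.subtype_injective M
    have hgood : good (N.toSubmodule.map M.subtype) := by
      refine ⟨?_, ?_, ?_⟩
      · intro h
        apply hN.1
        apply Subrepresentation.toSubmodule_injective
        refine (Submodule.eq_bot_iff _).2 fun m hm => hinj ?_
        have h1 : M.subtype m ∈ N.toSubmodule.map M.subtype := ⟨m, hm, rfl⟩
        rw [h, Submodule.mem_bot] at h1
        rw [h1, map_zero]
      · rintro x _ ⟨f, hf, rfl⟩
        exact ⟨ρ x f, N.apply_mem_toSubmodule x hf, rfl⟩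
      · rintro _ ⟨f, hf, rfl⟩
        exact hMψ f f.2
    apply hmin _ hgood
    have h1 : N.toSubmodule < ⊤ := by
      rw [lt_top_iff_ne_top]
      intro h
      exact hN.2 (Subrepresentation.toSubmodule_injective h)
    change Module.finrank ℂ (N.toSubmodule.map M.subtype) < Module.finrank ℂ M
    rw [← LinearEquiv.finrank_eq (Submodule.equivMapOfInjective M.subtype hinj N.toSubmodule)]
    exact Submodule.finrank_lt h1.ne
  · intro z f
    ext y
    change f.1 (y * Heisenberg.center J z) = ψ z * f.1 y
    rw [hcentral, hMψ f.1 f.2]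

end Weil

section DualPair

variable {K ι κ : Type*} [Field K] [StarRing K] [Fintype ι] [DecidableEq ι] [Fintype κ]
  [DecidableEq κ]

open Matrix in
/-- The tensor product of two hermitian spaces. -/
def HermForm.tensor (J : HermForm K ι) (J' : HermForm K κ) : HermForm K (ι × κ) where
  gram := J.gram ⊗ₖ J'.gram
  isHermitian := by
    rw [Matrix.IsHermitian, Matrix.conjTranspose_kronecker, J.isHermitian.eq, J'.isHermitian.eq]
  isUnit_det := by
    rw [Matrix.det_kronecker]
    exact (J.isUnit_det.pow _).mul (J'.isUnit_det.pow _)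

open Matrix in
/-- The homomorphism `(g, g') ↦ g ⊗ g'` of the dual pair into the unitary group of the tensor
product. -/
def tensorHom (J : HermForm K ι) (J' : HermForm K κ) : J.U × J'.U →* (J.tensor J').U where
  toFun p :=
    ⟨{ val := (p.1 : GL ι K).val ⊗ₖ (p.2 : GL κ K).val
       inv := (p.1 : GL ι K).inv ⊗ₖ (p.2 : GL κ K).inv
       val_inv := by
        rw [← Matrix.mul_kronecker_mul, Units.val_inv, Units.val_inv, Matrix.one_kronecker_one]
       inv_val := by
        rw [← Matrix.mul_kronecker_mul, Units.inv_val, Units.inv_val, Matrix.one_kronecker_one] },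
      by
        have h1 : (p.1 : GL ι K).valᴴ * J.gram * (p.1 : GL ι K).val = J.gram := p.1.2
        have h2 : (p.2 : GL κ K).valᴴ * J'.gram * (p.2 : GL κ K).val = J'.gram := p.2.2
        change ((p.1 : GL ι K).val ⊗ₖ (p.2 : GL κ K).val)ᴴ * (J.gram ⊗ₖ J'.gram) *
          ((p.1 : GL ι K).val ⊗ₖ (p.2 : GL κ K).val) = J.gram ⊗ₖ J'.gram
        rw [Matrix.conjTranspose_kronecker, ← Matrix.mul_kronecker_mul, ← Matrix.mul_kronecker_mul,
          h1, h2]⟩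
  map_one' := by
    ext1
    ext1
    exact Matrix.one_kronecker_one
  map_mul' p r := by
    ext1
    ext1
    exact Matrix.mul_kronecker_mul _ _ _ _

/-- The restriction of the Weil representation to the dual pair of unitary groups. -/
noncomputable def dualPairRep [Fintype K] {S : Type*} [AddCommGroup S] [Module ℂ S]
    [FiniteDimensional ℂ S] (q : ℕ) [QuadraticStar q K] {J : HermForm K ι} {J' : HermForm K κ}
    {ψ : AddChar (skewAdjoint K) ℂ} (hψ : ψ ≠ 1)
    {η : Representation ℂ (Heisenberg (J.tensor J')) S} (hη : IsHeisenbergRep ψ η) :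
    Representation ℂ (J.U × J'.U) S :=
  (weilRep q hψ hη).comp (tensorHom J J')

end DualPair

section Theta

variable {G G' S V : Type*} [Group G] [Group G'] [AddCommGroup S] [Module ℂ S] [AddCommGroup V]
  [Module ℂ V]

/-- The big theta lift `Θ(π) = Hom_G(π, ω)` with the action of `G'` through `ω`. -/
def theta (ω : Representation ℂ (G × G') S) (π : Representation ℂ G V) :
    Representation ℂ G' (π.IntertwiningMap (ω.comp (MonoidHom.inl G G'))) where
  toFun g' :=
    { toFun := fun f => ⟨ω (1, g') ∘ₗ f.toLinearMap, fun g => by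
        ext v
        have h := Representation.IntertwiningMap.isIntertwining π (ω.comp (MonoidHom.inl G G')) f g v
        simp only [LinearMap.comp_apply]
        change ω (1, g') (f (π g v)) = ω (g, 1) (ω (1, g') (f v))
        rw [h]
        change (ω (1, g') * ω (g, 1)) (f v) = (ω (g, 1) * ω (1, g')) (f v)
        rw [← map_mul, ← map_mul]
        simp⟩
      map_add' := fun a b => by
        ext v
        exact map_add (ω (1, g')) (a v) (b v)
      map_smul' := fun c a => by
        ext v
        exact map_smul (ω (1, g')) c (a v) }
  map_one' := by
    ext f v
    change ω (1, 1) (f v) = f v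
    rw [← Prod.one_eq_mk, map_one]
    rfl
  map_mul' g k := by
    ext f v
    change ω (1, g * k) (f v) = (ω (1, g) * ω (1, k)) (f v)
    rw [← map_mul]
    simp

/-- `σ` is isomorphic to a subrepresentation of `ρ`. -/
def Occurs {W : Type*} [AddCommGroup W] [Module ℂ W] (σ : Representation ℂ G V)
    (ρ : Representation ℂ G W) : Prop :=
  ∃ f : σ.IntertwiningMap ρ, Function.Injective f

end Theta

section Parabolic

variable {K ι : Type*} [Field K] [StarRing K] [Fintype ι] [DecidableEq ι]

/-- The orthogonal sum `(X + X^∨) ⊕ V` of the split space `X + X^∨` with `dim X = ℓ` and the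
hermitian space `V` of `J`. -/
def HermForm.addHyperbolic (ℓ : ℕ) (J : HermForm K ι) : HermForm K ((Fin ℓ ⊕ Fin ℓ) ⊕ ι) where
  gram := Matrix.fromBlocks (Matrix.fromBlocks 0 1 1 0) 0 0 J.gram
  isHermitian := by
    simp [Matrix.IsHermitian, Matrix.fromBlocks_conjTranspose, J.isHermitian.eq]
  isUnit_det := by
    rw [Matrix.det_fromBlocks_zero₂₁]
    refine IsUnit.mul ?_ J.isUnit_det
    have h : (Matrix.fromBlocks 0 1 1 0 : Matrix (Fin ℓ ⊕ Fin ℓ) (Fin ℓ ⊕ Fin ℓ) K) *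
        Matrix.fromBlocks 0 1 1 0 = 1 := by
      simp [Matrix.fromBlocks_multiply]
    exact IsUnit.of_mul_eq_one _ (by rw [← Matrix.det_mul, h, Matrix.det_one])

/-- The inclusion of `X` into `(X + X^∨) ⊕ V`. -/
def inclX (K ι : Type*) [Field K] (ℓ : ℕ) : Matrix ((Fin ℓ ⊕ Fin ℓ) ⊕ ι) (Fin ℓ) K :=
  Matrix.fromRows (Matrix.fromRows 1 0) 0

/-- The inclusion of `V` into `(X + X^∨) ⊕ V`. -/
def inclV (K ι : Type*) [Field K] [DecidableEq ι] (ℓ : ℕ) :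
    Matrix ((Fin ℓ ⊕ Fin ℓ) ⊕ ι) ι K :=
  Matrix.fromRows 0 1

/-- The maximal parabolic subgroup of the unitary group of `(X + X^∨) ⊕ V` that stabilizes `X`.
An element is recorded as a triple `(p, a, b)`, where `a` is the action of `p` on `X` and `b` is
its action on `V = X^⊥ / X`; these are determined by `p`. -/
def parabolic (ℓ : ℕ) (J : HermForm K ι) :
    Subgroup ((J.addHyperbolic ℓ).U × (GL (Fin ℓ) K × J.U)) where
  carrier := {p |
    (p.1 : GL ((Fin ℓ ⊕ Fin ℓ) ⊕ ι) K).val * inclX K ι ℓ = inclX K ι ℓ * p.2.1.val ∧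
    ∃ y : Matrix (Fin ℓ) ι K, (p.1 : GL ((Fin ℓ ⊕ Fin ℓ) ⊕ ι) K).val * inclV K ι ℓ =
      inclV K ι ℓ * (p.2.2 : GL ι K).val + inclX K ι ℓ * y}
  one_mem' := ⟨by simp, 0, by simp⟩
  mul_mem' := by
    rintro ⟨p, a, b⟩ ⟨p', a', b'⟩ ⟨h1, y, h2⟩ ⟨h1', y', h2'⟩
    dsimp only at h1 h2 h1' h2'
    refine ⟨?_, y * (b' : GL ι K).val + a.val * y', ?_⟩
    · simp only [Prod.mk_mul_mk, Subgroup.coe_mul, Units.val_mul]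
      rw [Matrix.mul_assoc, h1', ← Matrix.mul_assoc, h1, Matrix.mul_assoc]
    · simp only [Prod.mk_mul_mk, Subgroup.coe_mul, Units.val_mul]
      rw [Matrix.mul_assoc, h2', Matrix.mul_add, ← Matrix.mul_assoc, ← Matrix.mul_assoc, h1, h2]
      simp only [Matrix.add_mul, Matrix.mul_add, Matrix.mul_assoc]
      abel
  inv_mem' := by
    rintro ⟨p, a, b⟩ ⟨h1, y, h2⟩
    dsimp only at h1 h2
    have hp : ((p : GL ((Fin ℓ ⊕ Fin ℓ) ⊕ ι) K)⁻¹).val * (p : GL ((Fin ℓ ⊕ Fin ℓ) ⊕ ι) K).val = 1 :=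
      Units.inv_mul _
    have ha : a.val * (a⁻¹).val = 1 := Units.mul_inv _
    have hb : (b : GL ι K).val * ((b : GL ι K)⁻¹).val = 1 := Units.mul_inv _
    have e1 : ((p : GL ((Fin ℓ ⊕ Fin ℓ) ⊕ ι) K)⁻¹).val * inclX K ι ℓ =
        inclX K ι ℓ * (a⁻¹).val := by
      calc _ = ((p : GL ((Fin ℓ ⊕ Fin ℓ) ⊕ ι) K)⁻¹).val * (inclX K ι ℓ * a.val) * (a⁻¹).val := by
            rw [Matrix.mul_assoc, Matrix.mul_assoc, ha, Matrix.mul_one]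
        _ = _ := by rw [← h1, ← Matrix.mul_assoc, hp, Matrix.one_mul]
    refine ⟨e1, -((a⁻¹).val * y * ((b : GL ι K)⁻¹).val), ?_⟩
    have e2 : inclV K ι ℓ = ((p : GL ((Fin ℓ ⊕ Fin ℓ) ⊕ ι) K)⁻¹).val *
        (inclV K ι ℓ * (b : GL ι K).val) + inclX K ι ℓ * ((a⁻¹).val * y) := by
      rw [← Matrix.mul_assoc _ _ y, ← e1, Matrix.mul_assoc, ← Matrix.mul_add, ← h2,
        ← Matrix.mul_assoc, hp, Matrix.one_mul]
    have e3 := congrArg (· * ((b : GL ι K)⁻¹).val) e2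
    simp only [Matrix.add_mul] at e3
    rw [Matrix.mul_assoc _ _ ((b : GL ι K)⁻¹).val, Matrix.mul_assoc _ _ ((b : GL ι K)⁻¹).val, hb,
      Matrix.mul_one] at e3
    change ((p : GL ((Fin ℓ ⊕ Fin ℓ) ⊕ ι) K)⁻¹).val * inclV K ι ℓ =
      inclV K ι ℓ * ((b : GL ι K)⁻¹).val + _
    rw [e3, Matrix.mul_neg]
    simp only [Matrix.mul_assoc]
    abel

/-- The parabolic induction of `τ ⊗ π` from the parabolic subgroup with Levi factor
`GL_ℓ × U(J)` to the unitary group of `(X + X^∨) ⊕ V`. -/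
noncomputable def parabolicInd {ℓ : ℕ} {J : HermForm K ι} {T V : Type*} [AddCommGroup T]
    [Module ℂ T] [AddCommGroup V] [Module ℂ V] (τ : Representation ℂ (GL (Fin ℓ) K) T)
    (π : Representation ℂ J.U V) :
    Representation ℂ (J.addHyperbolic ℓ).U
      (Representation.coindV ((MonoidHom.fst _ _).comp (parabolic ℓ J).subtype)
        (Representation.tprod
          (τ.comp ((MonoidHom.fst _ _).comp ((MonoidHom.snd _ _).comp (parabolic ℓ J).subtype)))
          (π.comp ((MonoidHom.snd _ _).comp ((MonoidHom.snd _ _).comp (parabolic ℓ J).subtype))))) :=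
  Representation.coind _ _

/-- An irreducible representation of `GL_ℓ` is cuspidal if it has no nonzero vector fixed by the
unipotent radical of a proper (standard maximal) parabolic subgroup. -/
structure IsCuspidal {ℓ : ℕ} {T : Type*} [AddCommGroup T] [Module ℂ T]
    (τ : Representation ℂ (GL (Fin ℓ) K) T) : Prop where
  irreducible : τ.IsIrreducible
  cuspidal : ∀ k : ℕ, 0 < k → k < ℓ → ∀ t : T,
    (∀ u : GL (Fin ℓ) K,
      (∀ i j : Fin ℓ, ¬ (i.val < k ∧ k ≤ j.val) → u.val i j = (1 : Matrix (Fin ℓ) (Fin ℓ) K) i j) →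
        τ u t = t) → t = 0

end Parabolic
end FiniteUnitary

/-! Both assertions rest on one isomorphism Θ(R(τ ⊗ π)) ≅ R(τ ⊗ Θ(π)), which is
`nonempty_theta_parabolicInd_equiv_parabolicInd`. The second assertion is this isomorphism. For the
first, ρ is a direct summand of R(τ ⊗ π), so Θ(ρ) embeds into Θ(R(τ ⊗ π)) (`Occurs.theta`).

Write V₁ = (X + X^∨) ⊕ V and V₁' = (X' + X'^∨) ⊕ V', let P and P' be the stabilizers of X and X',
and let ω₁ be the Weil representation of the large dual pair. Frobenius reciprocity identifies Θ(R(τ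
⊗ π)) with Hom_P(τ ⊗ π, ω₁). A vector of ω₁ is determined by its "values" at the points B of X^∨ ⊗
V₁': translate by the inverse of B in the Heisenberg group, then average over the totally isotropic
subspace X ⊗ V₁' (`eq_zero_of_isotropicAvg`). Consider the vectors in the image of a P-equivariant
map. If the rows of B are dependent, the value vanishes because τ is cuspidal and is not the trivial
character of GL_1 (`IsCuspidal.eq_zero_of_invariant`). If the rows are independent and the value is
nonzero, invariance under the unipotent radical forces the rows to span an isotropic subspace, and
forces the value to be fixed by V tensored with that subspace. By Witt's theorem
(`exists_unitary_mul_eq_inclX`) U(V₁') moves such a B to the standard frame of X'. So everything is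
read off at one point t₀ of X^∨ ⊗ X', where the values lie in the vectors fixed by Y = X ⊗ V₁' + V ⊗
X'. As Y^⊥ / Y is V ⊗ V', these vectors carry the Weil representation of the small pair.

That no extra character appears in this last step is `weilRep_comp_fixed`: Schur's lemma gives the
equality up to a scalar, and the scalar is found from traces, which are Gauss sums
(`trace_avgOp_mul_isotropicAvg`). Evaluation at t₀ is a projection λ with a section μ, both
equivariant under pairs in P × P' whose GL-components correspond under star
(`exists_dualPairRep_projection`). The map f ↦ (g' ↦ λ ω₁(1, g') f) then identifies Hom_P(τ ⊗ π, ω₁)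
with the representation induced from P' of Hom(τ^σ, Θ(π)), where τ^σ is τ composed with entrywise
star. It is injective by the support argument above. It is surjective because translates of μ can be
summed, λ ω₁(1, g') μ being zero unless g' fixes X' pointwise (`projection_section_eq_zero`).

Finally the dual of τ^σ is replaced by τ under the induction (`nonempty_coind_conjHomRep_equiv`). A
conjugate-linear isometry gives an automorphism δ of the unitary group such that δ(g)⁻¹ is always
conjugate to g (`exists_conj_eq_conjHom_inv`); the substitution x ↦ δ(x)⁻¹ in character sums over P'
shows that both induced representations have the same multiplicities. The conjugacy holds because a
matrix is similar to its transpose and because elements of a finite unitary group that are similar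
are conjugate in it. The latter extracts a root cᴴ c = H inside a commutative ring of matrices
(`exists_conjTranspose_mul_self`), where q odd is used. -/

namespace FiniteUnitary

/-! ### Semisimplicity and comparison of representations by multiplicities. -/

section RepresentationTheory

open Representation

variable {G : Type*} [Group G]

/-- An injective intertwining map of complex representations of a finite group has an equivariant
retraction. -/
theorem exists_retraction [Finite G] {V W : Type*} [AddCommGroup V] [Module ℂ V] [AddCommGroup W]
    [Module ℂ W] {ρ : Representation ℂ G V} {σ : Representation ℂ G W} (f : ρ.IntertwiningMap σ)
    (hf : Function.Injective f) : ∃ r : σ.IntertwiningMap ρ, ∀ v, r (f v) = v := by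
  have := Fintype.ofFinite G
  obtain ⟨r₀, hr₀⟩ := LinearMap.exists_leftInverse_of_injective f.toLinearMap
    (LinearMap.ker_eq_bot.2 hf)
  have hr : ∀ v, r₀ (f v) = v := fun v => LinearMap.congr_fun hr₀ v
  have hc : (Fintype.card G : ℂ) ≠ 0 := by exact_mod_cast Fintype.card_ne_zero
  -- Maschke's averaging of a linear retraction.
  refine ⟨⟨(Fintype.card G : ℂ)⁻¹ • ∑ g : G, ρ g⁻¹ ∘ₗ r₀ ∘ₗ σ g, fun k => ?_⟩, fun v => ?_⟩
  · ext w
    simp only [LinearMap.comp_apply, LinearMap.smul_apply, LinearMap.sum_apply, map_smul, map_sum]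
    congr 1
    refine Fintype.sum_bijective (fun g => g * k) (Group.mulRight_bijective k) _ _ fun g => ?_
    rw [mul_inv_rev, map_mul, map_mul, Module.End.mul_apply, Module.End.mul_apply,
      ← Module.End.mul_apply (ρ k), ← map_mul, mul_inv_cancel, map_one]
    rfl
  · change ((Fintype.card G : ℂ)⁻¹ • ∑ g : G, ρ g⁻¹ ∘ₗ r₀ ∘ₗ σ g) (f v) = v
    have h1 : ∀ g : G, (ρ g⁻¹ ∘ₗ r₀ ∘ₗ σ g) (f v) = v := by
      intro g
      rw [LinearMap.comp_apply, LinearMap.comp_apply, ← f.isIntertwining, hr, inv_self_apply]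
    rw [LinearMap.smul_apply, LinearMap.sum_apply, Finset.sum_congr rfl fun g _ => h1 g,
      Finset.sum_const, Finset.card_univ, ← Nat.cast_smul_eq_nsmul ℂ, smul_smul,
      inv_mul_cancel₀ hc, one_smul]

/-- A representation with a retract splits as a product. -/
theorem nonempty_equiv_prod_ker {U V : Type*} [AddCommGroup U] [Module ℂ U] [AddCommGroup V]
    [Module ℂ V] {κ : Representation ℂ G U} {ρ : Representation ℂ G V} (i : κ.IntertwiningMap ρ)
    (r : ρ.IntertwiningMap κ) (h : ∀ u, r (i u) = u) :
    Nonempty (ρ.Equiv (κ.prod r.ker.toRepresentation)) := by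
  refine ⟨Representation.Equiv.symm (Representation.Equiv.mk (LinearEquiv.ofBijective
    (i.toLinearMap.coprod (Submodule.subtype r.ker.toSubmodule)) ⟨?_, ?_⟩) ?_)⟩
  · rw [← LinearMap.ker_eq_bot, LinearMap.ker_eq_bot']
    rintro ⟨u, ⟨k, hk⟩⟩ h0
    have h0' : i u + k = 0 := h0
    have hk' : r k = 0 := hk
    have h1 := congrArg r h0'
    rw [map_add, h, hk', map_zero, add_zero] at h1
    subst h1
    rw [map_zero, zero_add] at h0'
    subst h0'
    rfl
  · intro v
    refine ⟨(r v, ⟨v - i (r v), ?_⟩), ?_⟩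
    · change r (v - i (r v)) = 0
      rw [map_sub, h, sub_self]
    · change i (r v) + (v - i (r v)) = v
      abel
  · intro g
    refine LinearMap.ext fun x => ?_
    obtain ⟨u, k⟩ := x
    change i (κ g u) + ρ g k = ρ g (i u + k)
    rw [map_add, i.isIntertwining]

/-- Postcomposition with an isomorphism. -/
def homCongrRight {U V W : Type*} [AddCommGroup U] [Module ℂ U] [AddCommGroup V] [Module ℂ V]
    [AddCommGroup W] [Module ℂ W] {κ : Representation ℂ G U} {ρ : Representation ℂ G V}
    {σ : Representation ℂ G W} (e : ρ.Equiv σ) :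
    κ.IntertwiningMap ρ ≃ₗ[ℂ] κ.IntertwiningMap σ where
  toFun f := e.toIntertwiningMap.comp f
  invFun f := e.symm.toIntertwiningMap.comp f
  map_add' f f' := by ext; simp
  map_smul' c f := by ext; simp
  left_inv f := by ext; simp
  right_inv f := by ext; simp

/-- Precomposition with an isomorphism. -/
def homCongrLeft {U V W : Type*} [AddCommGroup U] [Module ℂ U] [AddCommGroup V] [Module ℂ V]
    [AddCommGroup W] [Module ℂ W] {κ : Representation ℂ G U} {ρ : Representation ℂ G V}
    {σ : Representation ℂ G W} (e : ρ.Equiv σ) :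
    σ.IntertwiningMap κ ≃ₗ[ℂ] ρ.IntertwiningMap κ where
  toFun f := f.comp e.toIntertwiningMap
  invFun f := f.comp e.symm.toIntertwiningMap
  map_add' f f' := by ext; simp
  map_smul' c f := by ext; simp
  left_inv f := by ext; simp
  right_inv f := by ext; simp

/-- Intertwining maps into a product are pairs of intertwining maps. -/
noncomputable def homProdEquiv {U V W : Type*} [AddCommGroup U] [Module ℂ U] [AddCommGroup V]
    [Module ℂ V]
    [AddCommGroup W] [Module ℂ W] (κ : Representation ℂ G U) (ρ : Representation ℂ G V)
    (σ : Representation ℂ G W) :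
    κ.IntertwiningMap (ρ.prod σ) ≃ₗ[ℂ] κ.IntertwiningMap ρ × κ.IntertwiningMap σ where
  toFun f := ((IntertwiningMap.fst ℂ ρ σ).comp f, (IntertwiningMap.snd ℂ ρ σ).comp f)
  invFun f := f.1.prod f.2
  map_add' f f' := by ext <;> simp
  map_smul' c f := by ext <;> simp
  left_inv f := rfl
  right_inv f := rfl

/-- The product of two isomorphisms of representations. -/
noncomputable def prodCongr {V V' W W' : Type*} [AddCommGroup V] [Module ℂ V] [AddCommGroup W]
    [Module ℂ W]
    [AddCommGroup V'] [Module ℂ V'] [AddCommGroup W'] [Module ℂ W']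
    {ρ : Representation ℂ G V} {σ : Representation ℂ G W} {ρ' : Representation ℂ G V'}
    {σ' : Representation ℂ G W'} (e : ρ.Equiv ρ') (e' : σ.Equiv σ') :
    (ρ.prod σ).Equiv (ρ'.prod σ') :=
  Representation.Equiv.mk (e.toLinearEquiv.prodCongr e'.toLinearEquiv) fun g => by
    refine LinearMap.ext fun x => Prod.ext ?_ ?_
    · exact IntertwiningMap.isIntertwining _ _ e.toIntertwiningMap g x.1
    · exact IntertwiningMap.isIntertwining _ _ e'.toIntertwiningMap g x.2

/-- Transport along a basis. It allows the criterion below to test only against representations on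
`Fin m → ℂ`, which live in one fixed universe. -/
theorem exists_equiv_fin {U : Type*} [AddCommGroup U] [Module ℂ U] [FiniteDimensional ℂ U]
    (κ : Representation ℂ G U) :
    ∃ κ' : Representation ℂ G (Fin (Module.finrank ℂ U) → ℂ), Nonempty (κ.Equiv κ') := by
  let e := (Module.finBasis ℂ U).equivFun
  refine ⟨{ toFun := fun g => e.toLinearMap ∘ₗ κ g ∘ₗ e.symm.toLinearMap
            map_one' := ?_
            map_mul' := fun g h => ?_ }, ⟨Representation.Equiv.mk e fun g => ?_⟩⟩
  · refine LinearMap.ext fun v => ?_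
    simp
  · refine LinearMap.ext fun v => ?_
    simp
  · refine LinearMap.ext fun v => ?_
    change e (κ g v) = e (κ g (e.symm (e v)))
    rw [e.symm_apply_apply]

/-- Two representations of a finite group that receive equally many intertwining maps from every
representation are isomorphic. -/
theorem nonempty_equiv_of_finrank_eq [Finite G] {V W : Type*} [AddCommGroup V] [Module ℂ V]
    [FiniteDimensional ℂ V] [AddCommGroup W] [Module ℂ W] [FiniteDimensional ℂ W]
    (ρ : Representation ℂ G V) (σ : Representation ℂ G W)
    (h : ∀ (m : ℕ) (κ : Representation ℂ G (Fin m → ℂ)),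
      Module.finrank ℂ (κ.IntertwiningMap ρ) = Module.finrank ℂ (κ.IntertwiningMap σ)) :
    Nonempty (ρ.Equiv σ) := by
  induction hn : Module.finrank ℂ V using Nat.strong_induction_on generalizing V W with
  | _ n ih =>
  have h' : ∀ {U : Type _} [AddCommGroup U] [Module ℂ U] [FiniteDimensional ℂ U]
      (κ : Representation ℂ G U),
      Module.finrank ℂ (κ.IntertwiningMap ρ) = Module.finrank ℂ (κ.IntertwiningMap σ) := by
    intro U _ _ _ κ
    obtain ⟨κ', ⟨e⟩⟩ := exists_equiv_fin κ
    rw [← (homCongrLeft e).finrank_eq, ← (homCongrLeft e).finrank_eq, h]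
  by_cases hV : Subsingleton V
  · have hW : Subsingleton W := by
      obtain ⟨σ', ⟨e⟩⟩ := exists_equiv_fin σ
      -- Testing against `σ` itself: if `ρ` is zero, the identity of `σ` must vanish.
      have h1 := h _ σ'
      have h2 : Subsingleton (σ'.IntertwiningMap ρ) :=
        ⟨fun a b => by ext; exact Subsingleton.elim _ _⟩
      rw [Module.finrank_zero_of_subsingleton, eq_comm, (homCongrLeft e).finrank_eq,
        Module.finrank_zero_iff] at h1
      have h3 : IntertwiningMap.id σ = 0 := Subsingleton.elim _ _
      refine ⟨fun a b => ?_⟩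
      have := fun w => congrArg (fun f : σ.IntertwiningMap σ => f w) h3
      exact (this a).trans (this b).symm
    exact ⟨Representation.Equiv.mk (LinearEquiv.ofSubsingleton V W) fun g => by
      ext; exact Subsingleton.elim _ _⟩
  · rw [not_subsingleton_iff_nontrivial] at hV
    -- A nonzero subrepresentation of least dimension. It maps nontrivially to `ρ`, hence to `σ`,
    -- and minimality makes that map injective. Splitting it off from both sides reduces the
    -- dimension, and the hypothesis on multiplicities passes to the complements.
    obtain ⟨U, hU, hmin⟩ := WellFounded.has_min
      (InvImage.wf (fun M : Subrepresentation ρ => Module.finrank ℂ M.toSubmodule) Nat.lt_wfRel.wf)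
      {M | M.toSubmodule ≠ ⊥} ⟨⊤, fun h0 => by
        obtain ⟨v, hv⟩ := exists_ne (0 : V)
        exact hv ((Submodule.mem_bot ℂ).1 (h0 ▸ (trivial : v ∈ (⊤ : Subrepresentation ρ))))⟩
    let i : U.toRepresentation.IntertwiningMap ρ := ⟨U.toSubmodule.subtype, fun g => rfl⟩
    have hi : Function.Injective i := Subtype.val_injective
    have hnt : Nontrivial (U.toRepresentation.IntertwiningMap ρ) := by
      refine ⟨i, 0, fun h0 => hU ?_⟩
      rw [Submodule.eq_bot_iff]
      intro u hu
      exact congrArg (fun f : U.toRepresentation.IntertwiningMap ρ => f ⟨u, hu⟩) h0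
    have hpos := Module.finrank_pos_iff (R := ℂ).2 hnt
    rw [h' U.toRepresentation, Module.finrank_pos_iff] at hpos
    obtain ⟨f, hf0⟩ := exists_ne (0 : U.toRepresentation.IntertwiningMap σ)
    have hf : Function.Injective f := by
      by_contra hinj
      let M : Subrepresentation ρ :=
        ⟨f.ker.toSubmodule.map U.toSubmodule.subtype, by
          rintro g _ ⟨u, hu, rfl⟩
          exact ⟨U.toRepresentation g u, f.ker.apply_mem_toSubmodule g hu, rfl⟩⟩
      have hker : f.ker.toSubmodule ≠ ⊥ := fun h0 =>
        hinj (LinearMap.ker_eq_bot.1 h0)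
      apply hmin M
      · intro h0
        refine hker ((Submodule.eq_bot_iff _).2 fun u hu => Subtype.ext ?_)
        exact (Submodule.mem_bot ℂ).1 (h0 ▸ ⟨u, hu, rfl⟩ : U.toSubmodule.subtype u ∈ (⊥ :
          Submodule ℂ V))
      · change Module.finrank ℂ (f.ker.toSubmodule.map U.toSubmodule.subtype) <
          Module.finrank ℂ U.toSubmodule
        rw [← LinearEquiv.finrank_eq (Submodule.equivMapOfInjective U.toSubmodule.subtype
          Subtype.val_injective f.ker.toSubmodule)]
        refine Submodule.finrank_lt fun h0 => hf0 ?_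
        ext u
        have : u ∈ f.ker.toSubmodule := h0 ▸ trivial
        exact this
    obtain ⟨r, hr⟩ := exists_retraction i hi
    obtain ⟨s, hs⟩ := exists_retraction f hf
    obtain ⟨e₁⟩ := nonempty_equiv_prod_ker i r hr
    obtain ⟨e₂⟩ := nonempty_equiv_prod_ker f s hs
    have hlt : Module.finrank ℂ r.ker.toSubmodule < n := by
      have h1 := e₁.toLinearEquiv.finrank_eq
      rw [Module.finrank_prod, hn] at h1
      have h2 : Module.finrank ℂ U.toSubmodule ≠ 0 := fun h0 =>
        hU (Submodule.finrank_eq_zero.1 h0)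
      omega
    obtain ⟨e₃⟩ := ih _ hlt r.ker.toRepresentation s.ker.toRepresentation (fun m κ => by
      have h1 := h m κ
      rw [(homCongrRight e₁).finrank_eq, (homCongrRight e₂).finrank_eq,
        (homProdEquiv _ _ _).finrank_eq, (homProdEquiv _ _ _).finrank_eq, Module.finrank_prod,
        Module.finrank_prod] at h1
      omega) rfl
    exact ⟨e₁.trans ((prodCongr (Representation.Equiv.refl _) e₃).trans e₂.symm)⟩

/-! ### The two Frobenius reciprocities for coinduction along a homomorphism. -/

section Coinduction

variable {H : Type*} [Group H] (φ : H →* G) {A : Type*} [AddCommGroup A] [Module ℂ A]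
  (α : Representation ℂ H A)

/-- Frobenius reciprocity for maps into a coinduced representation. -/
def homCoindEquiv {V : Type*} [AddCommGroup V] [Module ℂ V] (ρ : Representation ℂ G V) :
    ρ.IntertwiningMap (coind φ α) ≃ₗ[ℂ] (IntertwiningMap (ρ.comp φ : Representation ℂ H V) α) where
  toFun f :=
    { toFun := fun v => (f v).1 1
      map_add' := fun v w => by rw [map_add]; rfl
      map_smul' := fun c v => by rw [map_smul]; rfl
      isIntertwining' := fun h => by
        ext v
        change (f (ρ (φ h) v)).1 1 = α h ((f v).1 1)
        rw [f.isIntertwining, ← (f v).2 h 1]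
        change (f v).1 (1 * φ h) = _
        rw [one_mul, mul_one] }
  invFun f :=
    { toFun := fun v => ⟨fun g => f (ρ g v), fun h g => by
        change f (ρ (φ h * g) v) = _
        rw [map_mul, Module.End.mul_apply]
        exact IntertwiningMap.isIntertwining (ρ.comp φ : Representation ℂ H V) α f h _⟩
      map_add' := fun v w => by ext; simp
      map_smul' := fun c v => by ext; simp
      isIntertwining' := fun g => by
        ext v x
        change f (ρ x (ρ g v)) = f (ρ (x * g) v)
        rw [map_mul, Module.End.mul_apply] }
  map_add' f f' := rfl
  map_smul' c f := rfl
  left_inv f := by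
    ext v g
    change (f (ρ g v)).1 1 = (f v).1 g
    rw [f.isIntertwining]
    change (f v).1 (1 * g) = _
    rw [one_mul]
  right_inv f := by
    ext v
    change f (ρ 1 v) = f v
    rw [map_one, Module.End.one_apply]

theorem coindV_apply_mul (F : coindV φ α) (h : H) (g : G) :
    F.1 (φ h * g) = α h (F.1 g) := F.2 h g

open Classical in
/-- The function supported on the image of `φ` with value `a` at `1`. -/
noncomputable def indVec [Fintype H] : A →ₗ[ℂ] coindV φ α where
  toFun a := ⟨fun g => ∑ h : H, if φ h = g then α h a else 0, fun k g => by
    rw [map_sum]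
    refine (Fintype.sum_bijective (fun h => k * h) (Group.mulLeft_bijective k) _ _ fun h => ?_).symm
    rw [map_mul, mul_right_inj, apply_ite (α k), map_zero, map_mul, Module.End.mul_apply]⟩
  map_add' a b := by
    ext g
    simp only [map_add, Submodule.coe_add, Pi.add_apply, ← Finset.sum_add_distrib]
    refine Finset.sum_congr rfl fun h _ => ?_
    split_ifs <;> simp
  map_smul' c a := by
    ext g
    simp [Finset.smul_sum]

/-- Equivariance makes `indVec` the unit of the adjunction, so that restriction along it turns maps
out of the coinduced representation into maps of `H`-representations. -/
theorem indVec_apply [Fintype H] (k : H) (a : A) :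
    indVec φ α (α k a) = coind φ α (φ k) (indVec φ α a) := by
  classical
  ext g
  change (∑ h : H, if φ h = g then α h (α k a) else 0) =
    ∑ h : H, if φ h = g * φ k then α h a else 0
  refine Fintype.sum_bijective (fun h => h * k) (Group.mulRight_bijective k) _ _ fun h => ?_
  rw [map_mul, mul_left_inj, map_mul, Module.End.mul_apply]

/-- An element of the coinduced representation is a sum of translates of vectors `indVec`; this
inverts Frobenius reciprocity. The factor `card H` appears because the sum runs over all of `G`, and
each `h` contributes exactly one nonzero term at a given point. -/
theorem sum_coind_indVec [Fintype H] [Fintype G] (F : coindV φ α) :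
    ∑ g : G, coind φ α g⁻¹ (indVec φ α (F.1 g)) = (Fintype.card H : ℂ) • F := by
  classical
  ext x
  have h1 : (∑ g : G, coind φ α g⁻¹ (indVec φ α (F.1 g))).1 x =
      ∑ g : G, ∑ h : H, if φ h = x * g⁻¹ then α h (F.1 g) else 0 := by
    rw [← Submodule.subtype_apply, map_sum, Finset.sum_apply]
    rfl
  rw [h1, Finset.sum_comm]
  have h2 : ∀ h : H, (∑ g : G, if φ h = x * g⁻¹ then α h (F.1 g) else 0) = F.1 x := by
    intro h
    have h3 : ∀ g : G, (φ h = x * g⁻¹) ↔ g = φ h⁻¹ * x := by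
      intro g
      rw [map_inv, eq_mul_inv_iff_mul_eq, eq_inv_mul_iff_mul_eq]
    simp only [h3, Finset.sum_ite_eq', Finset.mem_univ, if_true, coindV_apply_mul]
    rw [self_inv_apply]
  simp only [h2, Finset.sum_const, Finset.card_univ]
  rw [← Nat.cast_smul_eq_nsmul ℂ]
  rfl

/-- Frobenius reciprocity for maps out of a coinduced representation. -/
noncomputable def coindHomEquiv [Fintype H] [Fintype G] {V : Type*} [AddCommGroup V] [Module ℂ V]
    (ρ : Representation ℂ G V) :
    (coind φ α).IntertwiningMap ρ ≃ₗ[ℂ] α.IntertwiningMap (ρ.comp φ : Representation ℂ H V) where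
  toFun f :=
    { toLinearMap := f.toLinearMap ∘ₗ indVec φ α
      isIntertwining' := fun h => by
        ext a
        change f (indVec φ α (α h a)) = ρ (φ h) (f (indVec φ α a))
        rw [indVec_apply, f.isIntertwining] }
  invFun k :=
    { toFun := fun F => (Fintype.card H : ℂ)⁻¹ • ∑ g : G, ρ g⁻¹ (k (F.1 g))
      map_add' := fun F F' => by
        simp [Finset.sum_add_distrib]
      map_smul' := fun c F => by
        simp only [Submodule.coe_smul, Pi.smul_apply, map_smul, ← Finset.smul_sum,
          RingHom.id_apply]
        rw [smul_comm]
      isIntertwining' := fun x => by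
        ext F
        change (Fintype.card H : ℂ)⁻¹ • ∑ g : G, ρ g⁻¹ (k (F.1 (g * x))) =
          ρ x ((Fintype.card H : ℂ)⁻¹ • ∑ g : G, ρ g⁻¹ (k (F.1 g)))
        rw [map_smul, map_sum]
        congr 1
        refine Fintype.sum_bijective (fun g => g * x) (Group.mulRight_bijective x) _ _ fun g => ?_
        rw [mul_inv_rev, map_mul, Module.End.mul_apply, self_inv_apply] }
  map_add' f f' := rfl
  map_smul' c f := rfl
  left_inv f := by
    ext F
    have hc : (Fintype.card H : ℂ) ≠ 0 := by exact_mod_cast Fintype.card_ne_zero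
    change (Fintype.card H : ℂ)⁻¹ • ∑ g : G, ρ g⁻¹ (f (indVec φ α (F.1 g))) = f F
    simp only [← f.isIntertwining]
    rw [← map_sum, sum_coind_indVec, map_smul, smul_smul, inv_mul_cancel₀ hc, one_smul]
  right_inv k := by
    classical
    ext a
    have hc : (Fintype.card H : ℂ) ≠ 0 := by exact_mod_cast Fintype.card_ne_zero
    change (Fintype.card H : ℂ)⁻¹ • ∑ g : G, ρ g⁻¹
      (k (∑ h : H, if φ h = g then α h a else 0)) = k a
    have h1 : ∀ g : G, ρ g⁻¹ (k (∑ h : H, if φ h = g then α h a else 0)) =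
        ∑ h : H, if φ h = g then k a else 0 := by
      intro g
      rw [map_sum, map_sum]
      refine Finset.sum_congr rfl fun h _ => ?_
      split_ifs with hg
      · rw [k.isIntertwining, ← hg]
        exact inv_self_apply ρ _ _
      · rw [map_zero, map_zero]
    simp only [h1]
    rw [Finset.sum_comm]
    simp only [Finset.sum_ite_eq, Finset.mem_univ, if_true, Finset.sum_const, Finset.card_univ]
    rw [← Nat.cast_smul_eq_nsmul ℂ, smul_smul, inv_mul_cancel₀ hc, one_smul]

/-- The dimension of the space of intertwining maps into a coinduced representation. -/
theorem finrank_hom_coind [Fintype H] [FiniteDimensional ℂ A] {V : Type*} [AddCommGroup V]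
    [Module ℂ V] [FiniteDimensional ℂ V] (ρ : Representation ℂ G V) :
    (Module.finrank ℂ (ρ.IntertwiningMap (coind φ α)) : ℂ) =
      (Nat.card H : ℂ)⁻¹ * ∑ h : H, α.character h * ρ.character (φ h)⁻¹ := by
  have hc : (Nat.card H : ℂ) ≠ 0 := by exact_mod_cast Nat.card_pos.ne'
  have := invertibleOfNonzero hc
  rw [(homCoindEquiv φ α ρ).finrank_eq, ← card_inv_mul_sum_char_mul_char_eq_finrank]
  simp only [← map_inv]
  rfl

end Coinduction

end RepresentationTheory

/-! ### Norm equations in finite commutative rings and roots cᴴ c = H of hermitian matrices. -/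

section NormForm

/-- Pigeonhole: in odd characteristic each of x² − b and d y² takes more than half of the values of
the field, so they meet. -/
theorem exists_sq_sub_mul_sq_eq_of_field {k : Type*} [Field k] [Finite k] {p : ℕ}
    (hp : p.Prime) (hp2 : p ≠ 2) (hch : (p : k) = 0) (b : k) {d : k} (hd : d ≠ 0) :
    ∃ x y : k, x ^ 2 - d * y ^ 2 = b := by
  let _ := Fintype.ofFinite k
  have := (CharP.charP_iff_prime_eq_zero hp).2 hch
  have hcard : Fintype.card k % 2 = 1 := by
    obtain ⟨n, -, hn⟩ := FiniteField.card k p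
    rw [hn, ← Nat.odd_iff]
    exact (hp.odd_of_ne_two hp2).pow
  obtain ⟨x, y, hxy⟩ := FiniteField.exists_root_sum_quadratic
    (f := Polynomial.X ^ 2 - Polynomial.C b)
    (g := Polynomial.C (-d) * Polynomial.X ^ 2)
    (Polynomial.degree_X_pow_sub_C (by norm_num) _)
    (Polynomial.degree_C_mul_X_pow 2 (neg_ne_zero.2 hd)) hcard
  refine ⟨x, y, ?_⟩
  simp only [Polynomial.eval_sub, Polynomial.eval_pow, Polynomial.eval_X,
    Polynomial.eval_C, Polynomial.eval_mul] at hxy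
  linear_combination hxy

/-- The Chinese remainder theorem, phrased so that only the value of the isomorphism on classes is
visible in later use. -/
theorem exists_quotNilradicalEquivPi (B : Type*) [CommRing B] [IsArtinianRing B] :
    ∃ e : (B ⧸ nilradical B) ≃+* (∀ I : MaximalSpectrum B, B ⧸ I.asIdeal),
      ∀ z I, e (Ideal.Quotient.mk _ z) I = Ideal.Quotient.mk I.asIdeal z :=
  ⟨(IsArtinianRing.quotNilradicalEquivPi B).toRingEquiv, fun _ _ => rfl⟩

/-- The equation is solved in every residue field and the solutions are glued by the Chinese
remainder theorem. -/
theorem exists_sq_sub_mul_sq_eq_mod_nilradical {B : Type*} [CommRing B] [Finite B] {p : ℕ}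
    (hp : p.Prime) (hch : (p : B) = 0) (hp2 : p ≠ 2) (b : B) {d : B} (hd : IsUnit d) :
    ∃ x y : B, IsNilpotent (x ^ 2 - d * y ^ 2 - b) := by
  have hloc : ∀ I : MaximalSpectrum B, ∃ x y : B ⧸ I.asIdeal,
      x ^ 2 - Ideal.Quotient.mk _ d * y ^ 2 = Ideal.Quotient.mk I.asIdeal b := by
    intro I
    have hI := I.isMaximal
    have hf : IsField (B ⧸ I.asIdeal) := Ideal.Quotient.maximal_ideal_iff_isField_quotient _ |>.1 hI
    have : Finite (B ⧸ I.asIdeal) := Finite.of_surjective _ Ideal.Quotient.mk_surjective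
    have hc : ((p : ℕ) : B ⧸ I.asIdeal) = 0 := by
      rw [← map_natCast (Ideal.Quotient.mk I.asIdeal), hch, map_zero]
    have hd' := hd.map (Ideal.Quotient.mk I.asIdeal)
    generalize Ideal.Quotient.mk I.asIdeal d = d' at hd'
    generalize Ideal.Quotient.mk I.asIdeal b = b'
    have : Nontrivial (B ⧸ I.asIdeal) := hf.nontrivial
    exact @exists_sq_sub_mul_sq_eq_of_field _ hf.toField _ p hp hp2 hc b' d' hd'.ne_zero
  choose x y hxy using hloc
  obtain ⟨e, he⟩ := exists_quotNilradicalEquivPi B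
  obtain ⟨x', hx'⟩ := Ideal.Quotient.mk_surjective (e.symm x)
  obtain ⟨y', hy'⟩ := Ideal.Quotient.mk_surjective (e.symm y)
  refine ⟨x', y', ?_⟩
  rw [← mem_nilradical, ← Ideal.Quotient.eq_zero_iff_mem]
  apply e.injective
  rw [map_zero]
  funext I
  have hx : Ideal.Quotient.mk I.asIdeal x' = x I := by
    rw [← he x' I, hx', e.apply_symm_apply]
  have hy : Ideal.Quotient.mk I.asIdeal y' = y I := by
    rw [← he y' I, hy', e.apply_symm_apply]
  rw [he, map_sub, map_sub, map_mul, map_pow, map_pow, hx, hy, hxy, sub_self, Pi.zero_apply]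

/-- Over a finite commutative ring of odd prime characteristic, a binary quadratic form
`x ^ 2 - d * y ^ 2` with `d` a unit represents all units. -/
theorem exists_sq_sub_mul_sq_eq {B : Type*} [CommRing B] [Finite B] {p : ℕ} [hp : Fact p.Prime]
    [CharP B p] (hp2 : p ≠ 2) {b d : B} (hb : IsUnit b) (hd : IsUnit d) :
    ∃ x y : B, x ^ 2 - d * y ^ 2 = b := by
  obtain ⟨x, y, hnil⟩ := exists_sq_sub_mul_sq_eq_mod_nilradical hp.1 (CharP.cast_eq_zero B p) hp2
    b hd
  obtain ⟨b', hb'⟩ := hb.exists_right_inv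
  obtain ⟨ν, hν⟩ : ∃ ν, ν = b' * (x ^ 2 - d * y ^ 2 - b) := ⟨_, rfl⟩
  obtain ⟨N, hN⟩ : IsNilpotent ν := hν ▸ (Commute.all b' _).isNilpotent_mul_left hnil
  have h1 : (1 + ν) ^ p ^ N = 1 := by
    rw [add_pow_char_pow, one_pow, pow_eq_zero_of_le (Nat.lt_pow_self hp.1.one_lt).le hN, add_zero]
  -- The approximate solution represents b (1 + ν) with ν nilpotent, and (1 + ν)^(p^N) = 1. As p^N =
  -- 2k + 1 is odd, scaling x and y by (1 + ν)^k turns the factor 1 + ν into 1.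
  obtain ⟨k, hk⟩ := (hp.1.odd_of_ne_two hp2).pow (n := N)
  refine ⟨x * (1 + ν) ^ k, y * (1 + ν) ^ k, ?_⟩
  have h2 : x ^ 2 - d * y ^ 2 = b * (1 + ν) := by
    rw [hν]; linear_combination (-(x ^ 2 - d * y ^ 2 - b)) * hb'
  rw [hk] at h1
  calc _ = (x ^ 2 - d * y ^ 2) * (1 + ν) ^ (2 * k) := by ring
    _ = b * (1 + ν) ^ (2 * k + 1) := by rw [h2]; ring
    _ = b := by rw [h1, mul_one]

variable {K ι : Type*} [Field K] [Fintype K] [StarRing K] [Fintype ι] [DecidableEq ι]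

theorem exists_prime_charP (q : ℕ) (K : Type*) [Field K] [Fintype K] [StarRing K]
    [hK : QuadraticStar q K] (hq : Odd q) : ∃ p : ℕ, p.Prime ∧ CharP K p ∧ p ≠ 2 := by
  obtain ⟨p, hp⟩ := CharP.exists K
  have hpr : p.Prime := (CharP.char_is_prime_or_zero K p).resolve_right
    (CharP.char_ne_zero_of_finite K p)
  refine ⟨p, hpr, hp, ?_⟩
  rintro rfl
  have : Fact (Nat.Prime 2) := ⟨hpr⟩
  obtain ⟨n, -, hn⟩ := FiniteField.card K 2
  rw [hK.card_eq] at hn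
  have h1 : Odd (q ^ 2) := hq.pow
  rw [hn, Nat.odd_pow_iff n.ne_zero] at h1
  exact absurd h1 (by decide)

theorem two_ne_zero_of_odd (q : ℕ) {K : Type*} [Field K] [Fintype K] [StarRing K]
    [hK : QuadraticStar q K] (hq : Odd q) : (2 : K) ≠ 0 := by
  obtain ⟨p, hp, hch, hp2⟩ := exists_prime_charP q K hq
  intro h
  have h1 : ((2 : ℕ) : K) = 0 := by exact_mod_cast h
  rw [CharP.cast_eq_zero_iff K p] at h1
  exact hp2 ((Nat.prime_dvd_prime_iff_eq hp Nat.prime_two).1 h1)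

/-- The hermitian matrices that commute with everything that commutes with `H`. -/
def hermitianBicommutant (H : Matrix ι ι K) (_ : H.IsHermitian) : Subring (Matrix ι ι K) where
  carrier := {z | z.IsHermitian ∧ ∀ g, Commute g H → Commute g z}
  mul_mem' := fun {a b} ha hb => by
    -- `a` commutes with `H`, hence with everything in the bicommutant; this makes the ring
    -- commutative and its products hermitian.
    have hab : Commute a b := (hb.2 a (ha.2 H (Commute.refl H)).symm)
    refine ⟨?_, fun g hg => (ha.2 g hg).mul_right (hb.2 g hg)⟩
    change (a * b)ᴴ = a * b
    rw [Matrix.conjTranspose_mul, ha.1.eq, hb.1.eq, hab.eq]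
  one_mem' := ⟨Matrix.isHermitian_one, fun g _ => Commute.one_right g⟩
  add_mem' := fun {a b} ha hb => ⟨ha.1.add hb.1, fun g hg => (ha.2 g hg).add_right (hb.2 g hg)⟩
  zero_mem' := ⟨Matrix.isHermitian_zero, fun g _ => Commute.zero_right g⟩
  neg_mem' := fun {a} ha => ⟨ha.1.neg, fun g hg => (ha.2 g hg).neg_right⟩

/-- An invertible hermitian matrix over `K` has the form `cᴴ * c`, where `c` commutes with
everything that commutes with it. -/
theorem exists_conjTranspose_mul_self (q : ℕ) [hK : QuadraticStar q K] (hq : Odd q)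
    {H : Matrix ι ι K} (hH : H.IsHermitian) (hu : IsUnit H.det) :
    ∃ c : Matrix ι ι K, cᴴ * c = H ∧ IsUnit c.det ∧ ∀ g, Commute g H → Commute g c := by
  obtain ⟨p, hp, hch, hp2⟩ := exists_prime_charP q K hq
  have : Fact p.Prime := ⟨hp⟩
  obtain ⟨t, ht⟩ := exists_star_ne q K
  set ε := t - star t with hε
  have hε0 : ε ≠ 0 := sub_ne_zero.2 (Ne.symm ht)
  have hεs : star ε = -ε := by rw [hε, star_sub, star_star]; ring
  -- The matrix ring of an empty index type is trivial and has no prime characteristic.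
  rcases isEmpty_or_nonempty ι with hι | hι
  · exact ⟨1, Subsingleton.elim _ _, by simp, fun g _ => Commute.one_right g⟩
  let B := hermitianBicommutant H hH
  let _ : CommRing B :=
    { (inferInstance : Ring B) with
      mul_comm := fun a b => Subtype.ext (b.2.2 a (a.2.2 H (Commute.refl H)).symm) }
  have hchB : CharP B p := by
    have : CharP (Matrix ι ι K) p := Matrix.charP p
    exact (CharP.charP_iff_prime_eq_zero hp).2 (Subtype.ext (by
      change (((p : ℕ) : B) : Matrix ι ι K) = 0
      rw [Subring.coe_natCast, CharP.cast_eq_zero]))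
  have hinv : H⁻¹ ∈ B := by
    refine ⟨hH.inv, fun g hg => ?_⟩
    have h1 := hg.eq
    change g * H⁻¹ = H⁻¹ * g
    calc g * H⁻¹ = H⁻¹ * (H * g) * H⁻¹ := by
          rw [← Matrix.mul_assoc, Matrix.nonsing_inv_mul _ hu, Matrix.one_mul]
      _ = H⁻¹ * g := by
          rw [← h1, Matrix.mul_assoc, Matrix.mul_assoc, Matrix.mul_nonsing_inv _ hu,
            Matrix.mul_one]
  have hHB : H ∈ B := ⟨hH, fun g hg => hg⟩
  have hsc : ∀ c : K, star c = c → c • (1 : Matrix ι ι K) ∈ B := fun c hc =>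
    ⟨by rw [Matrix.IsHermitian, Matrix.conjTranspose_smul, hc, Matrix.conjTranspose_one],
      fun g _ => (Commute.one_right g).smul_right c⟩
  have hd : star (ε ^ 2) = ε ^ 2 := by rw [star_pow, hεs]; ring
  have hd' : star (ε ^ 2)⁻¹ = (ε ^ 2)⁻¹ := by rw [star_inv₀, hd]
  -- Since `star ε = -ε`, commuting hermitian x and y give (x + ε y)ᴴ (x + ε y) = x² − ε² y².
  -- Solving this norm equation inside the bicommutant makes c = x + ε y commute with everything
  -- that commutes with `H`.
  obtain ⟨x, y, hxy⟩ := exists_sq_sub_mul_sq_eq (B := B) hp2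
    (b := ⟨H, hHB⟩) (d := ⟨_, hsc _ hd⟩)
    (IsUnit.of_mul_eq_one ⟨H⁻¹, hinv⟩ (Subtype.ext (Matrix.mul_nonsing_inv _ hu)))
    (IsUnit.of_mul_eq_one ⟨_, hsc _ hd'⟩ (Subtype.ext (by
      change (ε ^ 2 • (1 : Matrix ι ι K)) * ((ε ^ 2)⁻¹ • 1) = 1
      rw [smul_mul_smul_comm, mul_inv_cancel₀ (pow_ne_zero 2 hε0), one_smul, Matrix.one_mul])))
  have hxy' : x.1 ^ 2 - (ε ^ 2 • (1 : Matrix ι ι K)) * y.1 ^ 2 = H := congrArg Subtype.val hxy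
  have hcomm : x.1 * y.1 = y.1 * x.1 := congrArg Subtype.val (mul_comm x y)
  have key : (x.1 + ε • y.1)ᴴ * (x.1 + ε • y.1) = H := by
    rw [Matrix.conjTranspose_add, Matrix.conjTranspose_smul, x.2.1.eq, y.2.1.eq, hεs, ← hxy']
    simp only [mul_add, add_mul, smul_mul_assoc, mul_smul_comm, neg_smul, neg_mul, one_mul, hcomm,
      pow_two, smul_add, smul_neg, mul_smul]
    abel
  refine ⟨x.1 + ε • y.1, key, ?_, fun g hg => (x.2.2 g hg).add_right ((y.2.2 g hg).smul_right ε)⟩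
  rw [← key, Matrix.det_mul] at hu
  exact isUnit_of_mul_isUnit_right hu

end NormForm

/-! ### Frobenius forms on torsion `F[X]`-modules and similarity of a matrix to its transpose. -/

section Transpose

open Polynomial DirectSum

variable {F : Type*} [Field F]

/-- A functional on polynomials that vanishes on the multiples of `a`, but on no larger ideal. -/
theorem exists_functional (a : F[X]) (ha : a ≠ 0) :
    ∃ l : F[X] →ₗ[F] F, (∀ r, l (a * r) = 0) ∧ ∀ x, (∀ y, l (x * y) = 0) → a ∣ x := by
  set m := a * C a.leadingCoeff⁻¹ with hm
  have hmon : m.Monic := monic_mul_leadingCoeff_inv ha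
  have hlc : a.leadingCoeff⁻¹ ≠ 0 := inv_ne_zero (leadingCoeff_ne_zero.2 ha)
  -- The functional is the top coefficient of the remainder modulo the monic multiple `m` of `a`. A
  -- nonzero remainder is detected after multiplication by the power of X that lifts its leading
  -- term to degree deg m − 1.
  refine ⟨lcoeff F (m.natDegree - 1) ∘ₗ modByMonicHom m, fun r => ?_, fun x hx => ?_⟩
  · have h1 : a * r = m * (C a.leadingCoeff * r) := by
      rw [hm, mul_assoc, ← mul_assoc (C _), ← C_mul,
        inv_mul_cancel₀ (leadingCoeff_ne_zero.2 ha), C_1, one_mul]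
    have h2 : (a * r) %ₘ m = 0 := by
      rw [modByMonic_eq_zero_iff_dvd hmon, h1]
      exact dvd_mul_right _ _
    change coeff ((a * r) %ₘ m) _ = 0
    rw [h2, coeff_zero]
  · have hdvd : a ∣ m := dvd_mul_right _ _
    refine hdvd.trans ((modByMonic_eq_zero_iff_dvd hmon).1 ?_)
    by_contra h0
    set r := x %ₘ m with hr
    have hdeg : r.natDegree < m.natDegree := by
      apply natDegree_lt_natDegree h0
      exact degree_modByMonic_lt x hmon
    have h1 := hx (X ^ (m.natDegree - 1 - r.natDegree))
    change coeff ((x * _) %ₘ m) _ = 0 at h1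
    have h2 : (x * X ^ (m.natDegree - 1 - r.natDegree)) %ₘ m =
        r * X ^ (m.natDegree - 1 - r.natDegree) := by
      refine (div_modByMonic_unique (X ^ (m.natDegree - 1 - r.natDegree) * (x /ₘ m)) _ hmon
        ⟨?_, ?_⟩).2
      · conv_rhs => rw [← modByMonic_add_div x m, ← hr]
        ring
      · rw [degree_mul, degree_X_pow, degree_eq_natDegree h0, degree_eq_natDegree hmon.ne_zero]
        norm_cast
        omega
    rw [h2, show m.natDegree - 1 = r.natDegree + (m.natDegree - 1 - r.natDegree) by omega,
      show r.natDegree + (m.natDegree - 1 - r.natDegree) - r.natDegree =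
        m.natDegree - 1 - r.natDegree by omega, coeff_mul_X_pow] at h1
    exact h0 (leadingCoeff_eq_zero.1 h1)

end Transpose

section Transpose

open Polynomial DirectSum

variable {F : Type*} [Field F]

/-- A nondegenerate `F`-valued form on a module over `F[X]` for which the scalars are
self-adjoint. -/
structure IsFrobeniusForm {M : Type*} [AddCommGroup M] [Module F[X] M] (β : M → M → F) :
    Prop where
  add_left : ∀ x y z, β (x + y) z = β x z + β y z
  add_right : ∀ x y z, β x (y + z) = β x y + β x z
  smul_left : ∀ (r : F[X]) x y, β (r • x) y = β x (r • y)
  C_smul_left : ∀ (c : F) x y, β (C c • x) y = c * β x y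
  eq_zero : ∀ x, (∀ y, β x y = 0) → x = 0

/-- The form is (u, v) ↦ l(u v) for the functional `l` of `exists_functional`. Scalars are
self-adjoint because the product is commutative, and the form is nondegenerate because `l` vanishes
on no ideal larger than (a). -/
theorem exists_isFrobeniusForm_cyclic (a : F[X]) (ha : a ≠ 0) :
    ∃ β : (F[X] ⧸ Submodule.span F[X] {a}) → (F[X] ⧸ Submodule.span F[X] {a}) → F,
      IsFrobeniusForm β := by
  obtain ⟨l, hl, hl'⟩ := exists_functional a ha
  obtain ⟨β, hβ⟩ : ∃ β : (F[X] ⧸ Submodule.span F[X] {a}) → (F[X] ⧸ Submodule.span F[X] {a}) → F,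
      ∀ u v, β (Submodule.Quotient.mk u) (Submodule.Quotient.mk v) = l (u * v) := by
    refine ⟨fun x y => l (x.out * y.out), fun u v => ?_⟩
    have h : ∀ u : F[X], ∃ r, (Submodule.Quotient.mk u :
        F[X] ⧸ Submodule.span F[X] {a}).out = u + a * r := by
      intro u
      have h1 : (Submodule.Quotient.mk (Submodule.Quotient.mk u :
          F[X] ⧸ Submodule.span F[X] {a}).out : F[X] ⧸ Submodule.span F[X] {a}) =
          Submodule.Quotient.mk u := Quotient.out_eq _
      rw [Submodule.Quotient.eq, Submodule.mem_span_singleton] at h1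
      obtain ⟨r, hr⟩ := h1
      exact ⟨r, by rw [smul_eq_mul] at hr; linear_combination -hr⟩
    obtain ⟨r, hr⟩ := h u
    obtain ⟨s, hs⟩ := h v
    dsimp only
    rw [hr, hs, show (u + a * r) * (v + a * s) = u * v + a * (r * v + u * s + a * (r * s)) by ring,
      map_add, hl, add_zero]
  have hsurj := Submodule.Quotient.mk_surjective (Submodule.span F[X] {a})
  refine ⟨β, ⟨?_, ?_, ?_, ?_, ?_⟩⟩
  · intro x y z
    obtain ⟨x, rfl⟩ := hsurj x
    obtain ⟨y, rfl⟩ := hsurj y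
    obtain ⟨z, rfl⟩ := hsurj z
    rw [← Submodule.Quotient.mk_add, hβ, hβ, hβ, add_mul, map_add]
  · intro x y z
    obtain ⟨x, rfl⟩ := hsurj x
    obtain ⟨y, rfl⟩ := hsurj y
    obtain ⟨z, rfl⟩ := hsurj z
    rw [← Submodule.Quotient.mk_add, hβ, hβ, hβ, mul_add, map_add]
  · intro r x y
    obtain ⟨x, rfl⟩ := hsurj x
    obtain ⟨y, rfl⟩ := hsurj y
    rw [← Submodule.Quotient.mk_smul, ← Submodule.Quotient.mk_smul, hβ, hβ, smul_eq_mul,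
      smul_eq_mul]
    congr 1
    ring
  · intro c x y
    obtain ⟨x, rfl⟩ := hsurj x
    obtain ⟨y, rfl⟩ := hsurj y
    rw [← Submodule.Quotient.mk_smul, hβ, hβ, smul_eq_mul, mul_assoc, ← smul_eq_C_mul, map_smul,
      smul_eq_mul]
  · intro x hx
    obtain ⟨x, rfl⟩ := hsurj x
    rw [Submodule.Quotient.mk_eq_zero, Submodule.mem_span_singleton]
    obtain ⟨r, hr⟩ := hl' x fun y => by rw [← hβ, hx]
    exact ⟨r, by rw [hr, smul_eq_mul, mul_comm]⟩

/-- By the structure theorem the module is a direct sum of cyclic ones; the orthogonal sum of their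
forms works. -/
theorem exists_isFrobeniusForm {M : Type*} [AddCommGroup M] [Module F[X] M] [Module.Finite F[X] M]
    (hM : Module.IsTorsion F[X] M) : ∃ β : M → M → F, IsFrobeniusForm β := by
  classical
  obtain ⟨ι, _, p, hp, e, ⟨E⟩⟩ := Module.equiv_directSum_of_isTorsion hM
  have h : ∀ i, ∃ β : (F[X] ⧸ Submodule.span F[X] {p i ^ e i}) →
      (F[X] ⧸ Submodule.span F[X] {p i ^ e i}) → F, IsFrobeniusForm β := fun i =>
    exists_isFrobeniusForm_cyclic _ (pow_ne_zero _ (hp i).ne_zero)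
  choose β hβ using h
  have h0 : ∀ i x, β i x 0 = 0 := fun i x => by
    have := (hβ i).add_right x 0 0
    rw [add_zero] at this
    exact left_eq_add.1 this
  refine ⟨fun x y => ∑ i, β i (E x i) (E y i), ⟨?_, ?_, ?_, ?_, ?_⟩⟩
  · intro x y z
    simp only [map_add, DirectSum.add_apply, (hβ _).add_left, Finset.sum_add_distrib]
  · intro x y z
    simp only [map_add, DirectSum.add_apply, (hβ _).add_right, Finset.sum_add_distrib]
  · intro r x y
    simp only [map_smul, DirectSum.smul_apply, (hβ _).smul_left]
  · intro c x y
    simp only [map_smul, DirectSum.smul_apply, (hβ _).C_smul_left, Finset.mul_sum]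
  · intro x hx
    apply E.injective
    rw [map_zero]
    refine DFinsupp.ext fun i => ?_
    refine (hβ i).eq_zero _ fun y => ?_
    have h1 := hx (E.symm (DirectSum.lof F[X] ι _ i y))
    rw [Finset.sum_eq_single i, E.apply_symm_apply, DirectSum.lof_apply] at h1
    · exact h1
    · intro j _ hj
      rw [E.apply_symm_apply, DirectSum.lof_eq_of, DirectSum.of_eq_of_ne _ _ _ hj, h0]
    · simp

/-- A square matrix over a field is similar to its transpose. -/
theorem exists_transpose_mul_eq {ι : Type*} [Fintype ι] [DecidableEq ι] (A : Matrix ι ι F) :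
    ∃ S : Matrix ι ι F, IsUnit S.det ∧ Aᵀ * S = S * A := by
  -- The column space is an `F[X]`-module through `A`. A nondegenerate form for which X is
  -- self-adjoint has a Gram matrix S with Aᵀ S = S A.
  let f := Matrix.toLin' A
  obtain ⟨β, hβ⟩ := exists_isFrobeniusForm (F := F) (M := Module.AEval' f)
    (Module.AEval.isTorsion_of_finiteDimensional F (ι → F) f)
  let o := Module.AEval'.of f
  have hX : ∀ v w, β (o (f v)) (o w) = β (o v) (o (f w)) := by
    intro v w
    rw [← Module.AEval'.X_smul_of, ← Module.AEval'.X_smul_of, hβ.smul_left]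
  have hC : ∀ (c : F) v, o (c • v) = C c • o v := by
    intro c v
    rw [map_smul, Module.AEval.C_smul]
  let b : (ι → F) →ₗ[F] (ι → F) →ₗ[F] F := LinearMap.mk₂ F (fun v w => β (o v) (o w))
    (fun v v' w => by rw [map_add, hβ.add_left])
    (fun c v w => by rw [hC, hβ.C_smul_left, smul_eq_mul])
    (fun v w w' => by rw [map_add, hβ.add_right])
    (fun c v w => by rw [hC, ← hβ.smul_left, hβ.C_smul_left, smul_eq_mul])
  have hb : ∀ v w, b v w = β (o v) (o w) := fun v w => rfl
  refine ⟨LinearMap.toMatrix₂' F b, ?_, ?_⟩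
  · rw [isUnit_iff_ne_zero, Ne, ← Matrix.exists_vecMul_eq_zero_iff]
    rintro ⟨v, hv0, hv⟩
    apply hv0
    apply o.injective
    rw [map_zero]
    apply hβ.eq_zero
    intro y
    obtain ⟨w, rfl⟩ := o.surjective y
    rw [← hb, ← Matrix.toLinearMap₂'_toMatrix' (R := F) b, Matrix.toLinearMap₂'_apply',
      Matrix.dotProduct_mulVec, hv,
      zero_dotProduct]
  · have h1 := LinearMap.toMatrix₂'_compl₁₂ (R := F) b f LinearMap.id
    have h2 := LinearMap.toMatrix₂'_compl₁₂ (R := F) b LinearMap.id f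
    have h3 : b.compl₁₂ f LinearMap.id = b.compl₁₂ LinearMap.id f :=
      LinearMap.ext₂ fun v w => hX v w
    rw [h3, h2] at h1
    simpa [f] using h1.symm

end Transpose

/-! ### Conjugacy in finite unitary groups and the automorphism of a conjugate-linear isometry. -/

section UnitaryConjugacy

variable {K ι : Type*} [Field K] [StarRing K] [Fintype ι] [DecidableEq ι]

/-- The element of the unitary group given by a matrix that preserves the form. -/
noncomputable def HermForm.ofMatrix (J : HermForm K ι) (k : Matrix ι ι K)
    (hk : kᴴ * J.gram * k = J.gram) : J.U :=
  ⟨Matrix.GeneralLinearGroup.mkOfDetNeZero k (by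
    have h := J.isUnit_det
    rw [← hk, Matrix.det_mul] at h
    exact (isUnit_of_mul_isUnit_right h).ne_zero), hk⟩

theorem HermForm.coe_ofMatrix (J : HermForm K ι) (k : Matrix ι ι K)
    (hk : kᴴ * J.gram * k = J.gram) : ((J.ofMatrix k hk : GL ι K) : Matrix ι ι K) = k := rfl

theorem HermForm.U_ext {J : HermForm K ι} {g g' : J.U}
    (h : ((g : GL ι K) : Matrix ι ι K) = ((g' : GL ι K) : Matrix ι ι K)) : g = g' :=
  Subtype.ext (Units.ext h)

theorem HermForm.U_conjTranspose_mul {J : HermForm K ι} (g : J.U) :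
    ((g : GL ι K) : Matrix ι ι K)ᴴ * J.gram * ((g : GL ι K) : Matrix ι ι K) = J.gram := g.2

/-- The automorphism of a unitary group given by a conjugate-linear isometry. -/
def HermForm.conjHom (J : HermForm K ι) (D : GL ι K)
    (hD : (D : Matrix ι ι K)ᴴ * J.gram * (D : Matrix ι ι K) = J.gram.map star) : J.U →* J.U :=
  (((MulAut.conj D).toMonoidHom.comp (Matrix.GeneralLinearGroup.map (starRingEnd K))).comp
    J.U.subtype).codRestrict J.U fun g => by
      set a : Matrix ι ι K := ((g : GL ι K) : Matrix ι ι K) with ha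
      have hg : aᴴ * J.gram * a = J.gram := HermForm.U_conjTranspose_mul g
      have hDi : (D : Matrix ι ι K) * ((D⁻¹ : GL ι K) : Matrix ι ι K) = 1 := by
        rw [← Units.val_mul, mul_inv_cancel, Units.val_one]
      have hm : ∀ x y : Matrix ι ι K, (x * y).map star = x.map star * y.map star := by
        intro x y; ext i j; simp [Matrix.mul_apply]
      have hc : ∀ x : Matrix ι ι K, (x.map star)ᴴ = xᴴ.map star := fun x => rfl
      change (D.val * a.map star * D⁻¹.val)ᴴ * J.gram * (D.val * a.map star * D⁻¹.val) = J.gram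
      calc _ = D⁻¹.valᴴ * ((a.map star)ᴴ * (D.valᴴ * J.gram * D.val) * a.map star) * D⁻¹.val := by
            simp only [Matrix.conjTranspose_mul, Matrix.mul_assoc]
        _ = D⁻¹.valᴴ * (D.valᴴ * J.gram * D.val) * D⁻¹.val := by
            rw [hD, hc, ← hm, ← hm, hg]
        _ = (D.val * D⁻¹.val)ᴴ * J.gram * (D.val * D⁻¹.val) := by
            simp only [Matrix.conjTranspose_mul, Matrix.mul_assoc]
        _ = J.gram := by rw [hDi]; simp

theorem HermForm.conjHom_injective (J : HermForm K ι) (D : GL ι K)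
    (hD : (D : Matrix ι ι K)ᴴ * J.gram * (D : Matrix ι ι K) = J.gram.map star) :
    Function.Injective (J.conjHom D hD) := by
  intro g g' h
  have h1 : D * Matrix.GeneralLinearGroup.map (starRingEnd K) g.1 * D⁻¹ =
    D * Matrix.GeneralLinearGroup.map (starRingEnd K) g'.1 * D⁻¹ := congrArg Subtype.val h
  rw [mul_left_inj, mul_right_inj] at h1
  apply HermForm.U_ext
  have h2 : ((g : GL ι K) : Matrix ι ι K).map star = ((g' : GL ι K) : Matrix ι ι K).map star :=
    congrArg Units.val h1
  exact Matrix.map_injective star_injective h2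

variable [Fintype K]

/-- The root of a hermitian matrix shows that all nondegenerate hermitian forms of a given dimension
are isometric to the standard one. -/
theorem HermForm.exists_gram_eq (q : ℕ) [QuadraticStar q K] (hq : Odd q) (J : HermForm K ι) :
    ∃ P : Matrix ι ι K, Pᴴ * P = J.gram ∧ IsUnit P.det := by
  obtain ⟨c, hc, hcu, -⟩ := exists_conjTranspose_mul_self q hq J.isHermitian J.isUnit_det
  exact ⟨c, hc, hcu⟩

/-- Elements of a unitary group that are similar as matrices are conjugate in the unitary group. -/
theorem exists_conj_eq_of_similar (q : ℕ) [QuadraticStar q K] (hq : Odd q) {J : HermForm K ι}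
    {g g' : J.U} (S : Matrix ι ι K) (hS : IsUnit S.det)
    (h : S * ((g : GL ι K) : Matrix ι ι K) = ((g' : GL ι K) : Matrix ι ι K) * S) :
    ∃ k : J.U, k * g * k⁻¹ = g' := by
  obtain ⟨P, hP, hPu⟩ := J.exists_gram_eq q hq
  have hPP : P * P⁻¹ = 1 := Matrix.mul_nonsing_inv _ hPu
  have hPP' : P⁻¹ * P = 1 := Matrix.nonsing_inv_mul _ hPu
  obtain ⟨a, ha⟩ : ∃ a, a = ((g : GL ι K) : Matrix ι ι K) := ⟨_, rfl⟩
  obtain ⟨a', ha'⟩ : ∃ a', a' = ((g' : GL ι K) : Matrix ι ι K) := ⟨_, rfl⟩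
  have hg : aᴴ * J.gram * a = J.gram := ha ▸ HermForm.U_conjTranspose_mul g
  have hg' : a'ᴴ * J.gram * a' = J.gram := ha' ▸ HermForm.U_conjTranspose_mul g'
  rw [← ha, ← ha'] at h
  obtain ⟨X, hX⟩ : ∃ X, X = S * P⁻¹ := ⟨_, rfl⟩
  -- In the coordinates given by `P` the form is standard, so `b` is unitary in the sense b bᴴ = 1.
  obtain ⟨b, hb⟩ : ∃ b, b = P * a * P⁻¹ := ⟨_, rfl⟩
  have hXb : X * b = a' * X := by
    rw [hX, hb, ← Matrix.mul_assoc a', ← h]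
    simp only [← Matrix.mul_assoc]
    rw [Matrix.mul_assoc S, hPP', Matrix.mul_one]
  have hXu : IsUnit X.det := by
    rw [hX, Matrix.det_mul]
    exact hS.mul ((Matrix.isUnit_nonsing_inv_det_iff).2 hPu)
  have hbb : b * bᴴ = 1 := by
    rw [mul_eq_one_comm]
    calc bᴴ * b = P⁻¹ᴴ * (aᴴ * (Pᴴ * P) * a) * P⁻¹ := by
          rw [hb]; simp only [Matrix.conjTranspose_mul, Matrix.mul_assoc]
      _ = (P * P⁻¹)ᴴ * (P * P⁻¹) := by
          rw [hP, hg, ← hP]; simp only [Matrix.conjTranspose_mul, Matrix.mul_assoc]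
      _ = 1 := by rw [hPP]; simp
  -- The pullback of the form along the similarity `X`. It is preserved by `b`, and `b` is unitary,
  -- so `H` commutes with `b`. A root c of `H` then commutes with `b`, and X c⁻¹ still intertwines
  -- `b` with `a'` but is now isometric.
  obtain ⟨H, hH⟩ : ∃ H, H = Xᴴ * J.gram * X := ⟨_, rfl⟩
  have hHh : H.IsHermitian := by
    rw [Matrix.IsHermitian, hH]
    simp only [Matrix.conjTranspose_mul, Matrix.conjTranspose_conjTranspose, J.isHermitian.eq,
      Matrix.mul_assoc]
  have hHu : IsUnit H.det := by
    rw [hH, Matrix.det_mul, Matrix.det_mul, Matrix.det_conjTranspose]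
    exact (hXu.star.mul J.isUnit_det).mul hXu
  obtain ⟨c, hc, hcu, hcomm⟩ := exists_conjTranspose_mul_self q hq hHh hHu
  have hcc : c * c⁻¹ = 1 := Matrix.mul_nonsing_inv _ hcu
  have hcc' : c⁻¹ * c = 1 := Matrix.nonsing_inv_mul _ hcu
  have hHb : bᴴ * H * b = H := by
    calc bᴴ * H * b = (X * b)ᴴ * J.gram * (X * b) := by
          rw [hH]; simp only [Matrix.conjTranspose_mul, Matrix.mul_assoc]
      _ = Xᴴ * (a'ᴴ * J.gram * a') * X := by
          rw [hXb]; simp only [Matrix.conjTranspose_mul, Matrix.mul_assoc]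
      _ = H := by rw [hg', hH]
  have hbc : b * c = c * b := by
    refine (hcomm b ?_).eq
    change b * H = H * b
    calc b * H = b * (bᴴ * H * b) := by rw [hHb]
      _ = (b * bᴴ) * (H * b) := by simp only [Matrix.mul_assoc]
      _ = H * b := by rw [hbb, Matrix.one_mul]
  have hbc' : b * c⁻¹ = c⁻¹ * b := by
    calc b * c⁻¹ = c⁻¹ * (c * b) * c⁻¹ := by
          rw [← Matrix.mul_assoc, hcc', Matrix.one_mul]
      _ = c⁻¹ * b * (c * c⁻¹) := by rw [← hbc]; simp only [Matrix.mul_assoc]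
      _ = c⁻¹ * b := by rw [hcc, Matrix.mul_one]
  have hPa : P * a = b * P := by
    rw [hb, Matrix.mul_assoc _ P⁻¹, hPP', Matrix.mul_one]
  let k : J.U := J.ofMatrix (X * c⁻¹ * P) (by
    calc (X * c⁻¹ * P)ᴴ * J.gram * (X * c⁻¹ * P)
        = Pᴴ * (c⁻¹ᴴ * (Xᴴ * J.gram * X) * c⁻¹) * P := by
          simp only [Matrix.conjTranspose_mul, Matrix.mul_assoc]
      _ = Pᴴ * ((c * c⁻¹)ᴴ * (c * c⁻¹)) * P := by
          rw [← hH, ← hc]; simp only [Matrix.conjTranspose_mul, Matrix.mul_assoc]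
      _ = J.gram := by rw [hcc]; simp [hP])
  refine ⟨k, ?_⟩
  rw [mul_inv_eq_iff_eq_mul]
  apply HermForm.U_ext
  change X * c⁻¹ * P * ((g : GL ι K) : Matrix ι ι K) =
    ((g' : GL ι K) : Matrix ι ι K) * (X * c⁻¹ * P)
  rw [← ha, ← ha', Matrix.mul_assoc, hPa, ← Matrix.mul_assoc, Matrix.mul_assoc X, ← hbc',
    ← Matrix.mul_assoc X, hXb]
  simp only [Matrix.mul_assoc]

/-- A conjugate-linear isometry exists for every hermitian form. -/
theorem HermForm.exists_conj_isometry (q : ℕ) [QuadraticStar q K] (hq : Odd q) (J : HermForm K ι) :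
    ∃ D : GL ι K, (D : Matrix ι ι K)ᴴ * J.gram * (D : Matrix ι ι K) = J.gram.map star := by
  obtain ⟨P, hP, hPu⟩ := J.exists_gram_eq q hq
  have hPP : P * P⁻¹ = 1 := Matrix.mul_nonsing_inv _ hPu
  -- In coordinates where the form is standard, entrywise star is a conjugate-linear isometry; the
  -- factor P⁻¹ (star P) is this map in the original coordinates.
  have hdet : (P⁻¹ * P.map star).det ≠ 0 := by
    rw [Matrix.det_mul]
    refine mul_ne_zero ((Matrix.isUnit_nonsing_inv_det_iff).2 hPu).ne_zero ?_
    rw [← Matrix.transpose_conjTranspose, Matrix.det_conjTranspose, Matrix.det_transpose]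
    exact hPu.star.ne_zero
  refine ⟨Matrix.GeneralLinearGroup.mkOfDetNeZero (P⁻¹ * P.map star) hdet, ?_⟩
  change (P⁻¹ * P.map star)ᴴ * J.gram * (P⁻¹ * P.map star) = _
  calc _ = (P.map star)ᴴ * ((P * P⁻¹)ᴴ * (P * P⁻¹)) * P.map star := by
        rw [← hP]; simp only [Matrix.conjTranspose_mul, Matrix.mul_assoc]
    _ = (Pᴴ * P).map star := by
        rw [hPP, Matrix.conjTranspose_one, Matrix.one_mul, Matrix.mul_one]
        ext i j
        simp [Matrix.mul_apply]
    _ = _ := by rw [hP]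

/-- Every element of a finite unitary group is conjugate to the inverse of its image under the
automorphism given by a conjugate-linear isometry. -/
theorem exists_conj_eq_conjHom_inv (q : ℕ) [QuadraticStar q K] (hq : Odd q) (J : HermForm K ι)
    (D : GL ι K) (hD : (D : Matrix ι ι K)ᴴ * J.gram * (D : Matrix ι ι K) = J.gram.map star)
    (g : J.U) : ∃ k : J.U, k * g * k⁻¹ = (J.conjHom D hD g)⁻¹ := by
  obtain ⟨S, hS, hSg⟩ := exists_transpose_mul_eq ((g : GL ι K) : Matrix ι ι K)
  obtain ⟨a, ha⟩ : ∃ a, a = ((g : GL ι K) : Matrix ι ι K) := ⟨_, rfl⟩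
  have hg : aᴴ * J.gram * a = J.gram := ha ▸ HermForm.U_conjTranspose_mul g
  rw [← ha] at hSg
  have hDi : ((D⁻¹ : GL ι K) : Matrix ι ι K) * (D : Matrix ι ι K) = 1 := by
    rw [← Units.val_mul, inv_mul_cancel, Units.val_one]
  have hm : ∀ x y : Matrix ι ι K, (x * y).map star = x.map star * y.map star := by
    intro x y; ext i j; simp [Matrix.mul_apply]
  have hJu : IsUnit (J.gram.map star).det := by
    have : J.gram.map star = J.gramᵀ := by
      conv_rhs => rw [← J.isHermitian.eq]
      rfl
    rw [this, Matrix.det_transpose]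
    exact J.isUnit_det
  have hJJ : J.gram.map star * (J.gram.map star)⁻¹ = 1 := Matrix.mul_nonsing_inv _ hJu
  have hJJ' : (J.gram.map star)⁻¹ * J.gram.map star = 1 := Matrix.nonsing_inv_mul _ hJu
  have hg' : aᵀ * J.gram.map star * a.map star = J.gram.map star := by
    have h1 : aᴴ.map star = aᵀ := by ext; simp
    rw [← h1, ← hm, ← hm, hg]
  -- Unitarity of g reads aᵀ J̄ ā = J̄, so D J̄⁻¹ conjugates aᵀ into the matrix of δ(g)⁻¹, while S
  -- conjugates a into aᵀ. It suffices to have similarity by a matrix, not by an isometry.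
  refine exists_conj_eq_of_similar q hq (D.val * ((J.gram.map star)⁻¹ * S)) ?_ ?_
  · rw [Matrix.det_mul, Matrix.det_mul]
    exact ((Matrix.isUnit_iff_isUnit_det _).1 D.isUnit).mul
      (((Matrix.isUnit_nonsing_inv_det_iff).2 hJu).mul hS)
  · have h1 : J.conjHom D hD g * (J.conjHom D hD g)⁻¹ = 1 := mul_inv_cancel _
    have h2 : (D.val * a.map star * D⁻¹.val) *
        (((J.conjHom D hD g)⁻¹ : J.U) : GL ι K).val = 1 := by
      have := congrArg (fun u : J.U => ((u : GL ι K) : Matrix ι ι K)) h1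
      rw [ha]
      exact this
    have h3 := mul_eq_one_comm.1 h2
    rw [← ha]
    have h4 : (D.val * a.map star * D⁻¹.val) * (D.val * ((J.gram.map star)⁻¹ * S) * a) =
        D.val * ((J.gram.map star)⁻¹ * S) := by
      calc _ = D.val * a.map star * (D⁻¹.val * D.val) * (J.gram.map star)⁻¹ * (S * a) := by
            simp only [Matrix.mul_assoc]
        _ = D.val * (((J.gram.map star)⁻¹ * J.gram.map star) * a.map star *
              (J.gram.map star)⁻¹ * aᵀ) * S := by
            rw [hDi, hJJ', ← hSg]; simp only [Matrix.mul_assoc, Matrix.one_mul]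
        _ = _ := by
            have h5 : (J.gram.map star * a.map star * (J.gram.map star)⁻¹) * aᵀ = 1 := by
              rw [mul_eq_one_comm, ← Matrix.mul_assoc, ← Matrix.mul_assoc, hg', hJJ]
            have h6 : (J.gram.map star)⁻¹ * J.gram.map star * a.map star *
                (J.gram.map star)⁻¹ * aᵀ = (J.gram.map star)⁻¹ *
                ((J.gram.map star * a.map star * (J.gram.map star)⁻¹) * aᵀ) := by
              simp only [Matrix.mul_assoc]
            rw [h6, h5, Matrix.mul_one, Matrix.mul_assoc]
    calc _ = ((((J.conjHom D hD g)⁻¹ : J.U) : GL ι K).val * (D.val * a.map star * D⁻¹.val)) *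
          (D.val * ((J.gram.map star)⁻¹ * S) * a) := by rw [h3, Matrix.one_mul]
      _ = _ := by rw [Matrix.mul_assoc, h4]

end UnitaryConjugacy

/-! ### Witt's theorem for isotropic frames. -/

section Witt

variable {K ι : Type*} [Field K] [StarRing K] [Fintype ι] [DecidableEq ι]

theorem HermForm.gram_addHyperbolic (ℓ : ℕ) (J : HermForm K ι) : (J.addHyperbolic ℓ).gram =
    Matrix.fromBlocks (Matrix.fromBlocks 0 1 1 0) 0 0 J.gram := rfl

variable [Fintype K]

/-- Witt's theorem for maximal totally isotropic subspaces of the hyperbolic summand: an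
isotropic `ℓ`-frame of `(X + X^∨) ⊕ V` can be moved to the standard frame of `X`. -/
theorem exists_unitary_mul_eq_inclX (q : ℕ) [QuadraticStar q K] (hq : Odd q) (J : HermForm K ι)
    {ℓ : ℕ} (T : Matrix ((Fin ℓ ⊕ Fin ℓ) ⊕ ι) (Fin ℓ) K)
    (hT : Tᴴ * (J.addHyperbolic ℓ).gram * T = 0) (L : Matrix (Fin ℓ) ((Fin ℓ ⊕ Fin ℓ) ⊕ ι) K)
    (hL : L * T = 1) : ∃ g : (J.addHyperbolic ℓ).U,
      (g : GL ((Fin ℓ ⊕ Fin ℓ) ⊕ ι) K).val * T = inclX K ι ℓ := by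
  have hJG := J.gram_addHyperbolic ℓ
  obtain ⟨G, hG⟩ : ∃ G, G = (J.addHyperbolic ℓ).gram := ⟨_, rfl⟩
  have hGu : IsUnit G.det := hG ▸ (J.addHyperbolic ℓ).isUnit_det
  have hGh : Gᴴ = G := hG ▸ (J.addHyperbolic ℓ).isHermitian.eq
  have hGG : G * G⁻¹ = 1 := Matrix.mul_nonsing_inv _ hGu
  rw [← hG] at hT hJG
  have h2 : (2 : K) ≠ 0 := two_ne_zero_of_odd q hq
  -- A frame dual to T under the form, not yet isotropic.
  obtain ⟨C, hC⟩ : ∃ C, C = G⁻¹ * Lᴴ := ⟨_, rfl⟩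
  have hTC : Tᴴ * G * C = 1 := by
    rw [hC, Matrix.mul_assoc, ← Matrix.mul_assoc G, hGG, Matrix.one_mul,
      ← Matrix.conjTranspose_mul, hL, Matrix.conjTranspose_one]
  have hCT : Cᴴ * G * T = 1 := by
    have := congrArg Matrix.conjTranspose hTC
    simpa [Matrix.conjTranspose_mul, hGh, Matrix.mul_assoc] using this
  -- Subtracting T Z changes the Gram matrix of C by −(Z + Zᴴ); half of that Gram matrix is
  -- therefore the correction that makes the dual frame isotropic.
  obtain ⟨Z, hZ⟩ : ∃ Z, Z = (2 : K)⁻¹ • (Cᴴ * G * C) := ⟨_, rfl⟩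
  have hZh : Zᴴ = Z := by
    rw [hZ]
    simp [Matrix.conjTranspose_smul, Matrix.conjTranspose_mul, hGh, Matrix.mul_assoc]
  have hZZ : Z + Z = Cᴴ * G * C := by
    rw [← two_smul K, hZ, smul_smul, mul_inv_cancel₀ h2, one_smul]
  obtain ⟨C', hC'⟩ : ∃ C', C' = C - T * Z := ⟨_, rfl⟩
  have hTC' : Tᴴ * G * C' = 1 := by
    rw [hC', Matrix.mul_sub, hTC, ← Matrix.mul_assoc, hT, Matrix.zero_mul, sub_zero]
  have hC'T : C'ᴴ * G * T = 1 := by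
    have := congrArg Matrix.conjTranspose hTC'
    simpa [Matrix.conjTranspose_mul, hGh, Matrix.mul_assoc] using this
  have hCC' : C'ᴴ * G * C' = 0 := by
    calc C'ᴴ * G * C' = C'ᴴ * G * C - C'ᴴ * G * T * Z := by
          rw [hC', Matrix.mul_sub, Matrix.mul_assoc _ T]
      _ = Cᴴ * G * C - Zᴴ * (Tᴴ * G * C) - Z := by
          rw [hC'T, hC', Matrix.conjTranspose_sub, Matrix.conjTranspose_mul]
          simp only [Matrix.sub_mul, Matrix.mul_assoc, Matrix.one_mul]
      _ = 0 := by rw [hTC, hZh, ← hZZ]; simp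
  obtain ⟨A, hA⟩ : ∃ A, A = Matrix.fromCols T C' := ⟨_, rfl⟩
  obtain ⟨H, hH⟩ : ∃ H : Matrix (Fin ℓ ⊕ Fin ℓ) (Fin ℓ ⊕ Fin ℓ) K,
    H = Matrix.fromBlocks 0 1 1 0 := ⟨_, rfl⟩
  rw [← hH] at hJG
  have hAA : Aᴴ * G * A = H := by
    rw [hA, Matrix.conjTranspose_fromCols_eq_fromRows_conjTranspose, Matrix.fromRows_mul,
      Matrix.fromRows_mul_fromCols, hT, hTC', hC'T, hCC', hH]
  have hHH : H * H = 1 := by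
    rw [hH, Matrix.fromBlocks_multiply]; simp
  -- a basis of the orthogonal complement
  let f := Matrix.mulVecLin (Aᴴ * G)
  have hsurj : Function.Surjective f := by
    intro v
    refine ⟨A *ᵥ (H *ᵥ v), ?_⟩
    rw [Matrix.mulVecLin_apply, Matrix.mulVec_mulVec, Matrix.mulVec_mulVec, hAA, hHH,
      Matrix.one_mulVec]
  have hfin : Module.finrank K (ι → K) = Module.finrank K (LinearMap.ker f) := by
    have h1 := LinearMap.finrank_range_add_finrank_ker f
    rw [LinearMap.range_eq_top.2 hsurj, finrank_top] at h1
    simp only [Module.finrank_fintype_fun_eq_card, Fintype.card_sum, Fintype.card_fin] at h1 ⊢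
    omega
  let e := LinearEquiv.ofFinrankEq _ _ hfin
  obtain ⟨E, hE⟩ : ∃ E, E = LinearMap.toMatrix' ((LinearMap.ker f).subtype ∘ₗ e.toLinearMap) :=
    ⟨_, rfl⟩
  have hEv : ∀ v, E *ᵥ v = (e v : _ → K) := by
    intro v
    rw [hE, LinearMap.toMatrix'_mulVec]
    rfl
  have hAE : Aᴴ * G * E = 0 := by
    apply Matrix.ext_of_mulVec_single
    intro i
    rw [← Matrix.mulVec_mulVec, hEv, Matrix.zero_mulVec]
    exact (e _).2
  have hEA : Eᴴ * G * A = 0 := by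
    have := congrArg Matrix.conjTranspose hAE
    simpa [Matrix.conjTranspose_mul, hGh, Matrix.mul_assoc] using this
  have hblock : ∀ X : Matrix ι ι K, (Matrix.fromCols A (E * X))ᴴ * G * Matrix.fromCols A (E * X) =
      Matrix.fromBlocks H 0 0 (Xᴴ * (Eᴴ * G * E) * X) := by
    intro X
    rw [Matrix.conjTranspose_fromCols_eq_fromRows_conjTranspose, Matrix.fromRows_mul,
      Matrix.fromRows_mul_fromCols, hAA, ← Matrix.mul_assoc _ E, hAE, Matrix.conjTranspose_mul,
      Matrix.mul_assoc _ Eᴴ, Matrix.mul_assoc Xᴴ, hEA]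
    simp only [Matrix.mul_zero, Matrix.zero_mul, Matrix.mul_assoc]
  have hinj : Function.Injective (Matrix.fromCols A (E * (1 : Matrix ι ι K))).mulVec := by
    change Function.Injective (Matrix.mulVecLin (Matrix.fromCols A (E * (1 : Matrix ι ι K))))
    rw [← LinearMap.ker_eq_bot, LinearMap.ker_eq_bot']
    intro v hv
    rw [Matrix.mulVecLin_apply, Matrix.mul_one, ← Sum.elim_comp_inl_inr v,
      Matrix.fromCols_mulVec_sumElim] at hv
    have h3 := congrArg (fun u => (Aᴴ * G) *ᵥ u) hv
    simp only [Matrix.mulVec_add, Matrix.mulVec_mulVec, hAA, hAE, Matrix.zero_mulVec, add_zero,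
      Matrix.mulVec_zero] at h3
    have h4 := congrArg (fun u => H *ᵥ u) h3
    simp only [Matrix.mulVec_mulVec, hHH, Matrix.one_mulVec, Matrix.mulVec_zero] at h4
    rw [h4, Matrix.mulVec_zero, zero_add, hEv] at hv
    have h5 : e (v ∘ Sum.inr) = 0 := Subtype.ext hv
    have h6 := (LinearEquiv.map_eq_zero_iff e).1 h5
    rw [← Sum.elim_comp_inl_inr v, h4, h6]
    ext i
    cases i <;> rfl
  have hdet : IsUnit (Eᴴ * G * E).det := by
    have h3 := congrArg Matrix.det (hblock 1)
    rw [Matrix.det_mul, Matrix.det_mul, Matrix.det_conjTranspose, Matrix.det_fromBlocks_zero₂₁,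
      Matrix.conjTranspose_one, Matrix.one_mul, Matrix.mul_one (Eᴴ * G * E)] at h3
    have h4 := (Matrix.isUnit_iff_isUnit_det _).1 (Matrix.mulVec_injective_iff_isUnit.1 hinj)
    have h5 : IsUnit (H.det * (Eᴴ * G * E).det) := by
      rw [← h3]; exact (h4.star.mul hGu).mul h4
    exact isUnit_of_mul_isUnit_right h5
  have hEh : (Eᴴ * G * E).IsHermitian := by
    rw [Matrix.IsHermitian]
    simp only [Matrix.conjTranspose_mul, Matrix.conjTranspose_conjTranspose, hGh, Matrix.mul_assoc]
  -- The complement of the new hyperbolic space and V have the same dimension, and both forms are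
  -- standard in suitable coordinates; c⁻¹ d is the resulting isometry.
  obtain ⟨c, hc, hcu, -⟩ := exists_conjTranspose_mul_self q hq hEh hdet
  obtain ⟨d, hd, hdu⟩ := J.exists_gram_eq q hq
  have hcc : c * c⁻¹ = 1 := Matrix.mul_nonsing_inv _ hcu
  have hg : (Matrix.fromCols A (E * (c⁻¹ * d)))ᴴ * (J.addHyperbolic ℓ).gram *
      Matrix.fromCols A (E * (c⁻¹ * d)) = (J.addHyperbolic ℓ).gram := by
    rw [← hG, hblock]
    refine Eq.trans ?_ hJG.symm
    congr 1
    calc _ = dᴴ * ((c * c⁻¹)ᴴ * (c * c⁻¹)) * d := by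
          rw [← hc]; simp only [Matrix.conjTranspose_mul, Matrix.mul_assoc]
      _ = _ := by rw [hcc]; simp [hd]
  -- The matrix just built sends the standard frame to T, so its inverse is the element wanted.
  refine ⟨((J.addHyperbolic ℓ).ofMatrix _ hg)⁻¹, ?_⟩
  have h7 : Matrix.fromCols A (E * (c⁻¹ * d)) * inclX K ι ℓ = T := by
    rw [inclX, Matrix.fromCols_mul_fromRows, hA, Matrix.fromCols_mul_fromRows]
    simp
  have h8 : ((((J.addHyperbolic ℓ).ofMatrix _ hg)⁻¹ : (J.addHyperbolic ℓ).U) :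
      GL ((Fin ℓ ⊕ Fin ℓ) ⊕ ι) K).val * Matrix.fromCols A (E * (c⁻¹ * d)) = 1 :=
    congrArg (fun u : (J.addHyperbolic ℓ).U => ((u : GL ((Fin ℓ ⊕ Fin ℓ) ⊕ ι) K)).val)
      (inv_mul_cancel ((J.addHyperbolic ℓ).ofMatrix _ hg))
  rw [← h7]
  exact (Matrix.mul_assoc _ _ _).symm.trans (by rw [h8, Matrix.one_mul])

end Witt

/-! ### Orthogonal complements. -/

section Perp

variable {K ι : Type*} [Field K] [StarRing K] [Fintype ι] [DecidableEq ι]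

namespace HermForm

theorem form_smul_right (J : HermForm K ι) (a : K) (v w : ι → K) :
    J.form v (a • w) = star a * J.form v w := by
  rw [← J.star_form, J.form_smul_left, star_mul', J.star_form]

theorem form_zero_left (J : HermForm K ι) (w : ι → K) : J.form 0 w = 0 := by simp [form]

theorem form_zero_right (J : HermForm K ι) (w : ι → K) : J.form w 0 = 0 := by simp [form]

/-- The orthogonal complement of a subspace. -/
def perp (J : HermForm K ι) (P : Submodule K (ι → K)) : Submodule K (ι → K) where
  carrier := {w | ∀ v ∈ P, J.form v w = 0}
  add_mem' := fun {a b} ha hb v hv => by rw [J.form_add_right, ha v hv, hb v hv, add_zero]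
  zero_mem' := fun v _ => J.form_zero_right v
  smul_mem' := fun c w hw v hv => by rw [J.form_smul_right, hw v hv, mul_zero]

theorem mem_perp {J : HermForm K ι} {P : Submodule K (ι → K)} {w : ι → K} :
    w ∈ J.perp P ↔ ∀ v ∈ P, J.form v w = 0 := Iff.rfl

theorem mem_perp' {J : HermForm K ι} {P : Submodule K (ι → K)} {w : ι → K} :
    w ∈ J.perp P ↔ ∀ v ∈ P, J.form w v = 0 := by
  refine forall₂_congr fun v _ => ?_
  rw [← J.star_form, star_eq_zero]

/-- The complement corresponds to the dual annihilator. The correspondence is conjugate-linear, so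
dimensions are compared by counting elements. -/
theorem finrank_add_finrank_perp [Finite K] (J : HermForm K ι) (P : Submodule K (ι → K)) :
    Module.finrank K P + Module.finrank K (J.perp P) = Fintype.card ι := by
  let D : (ι → K) → Module.Dual K (ι → K) := fun w =>
    { toFun := fun v => J.form v w
      map_add' := fun a b => J.form_add_left a b w
      map_smul' := fun c a => J.form_smul_left c a w }
  have hDbij : Function.Bijective D := by
    constructor
    · intro a b hab
      rw [← sub_eq_zero]
      apply J.eq_zero_of_form
      intro v
      rw [J.form_sub_right, sub_eq_zero]
      exact congrArg (fun φ : Module.Dual K (ι → K) => φ v) hab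
    · intro φ
      obtain ⟨w, hw⟩ := J.exists_form_eq φ
      exact ⟨w, LinearMap.ext hw⟩
  have hmem : ∀ w, w ∈ J.perp P ↔ D w ∈ P.dualAnnihilator := fun w => by
    rw [Submodule.mem_dualAnnihilator]; rfl
  have h1 : Nat.card (J.perp P) = Nat.card P.dualAnnihilator := by
    refine Nat.card_congr (Equiv.ofBijective (fun w => ⟨D w, (hmem w).1 w.2⟩) ⟨?_, ?_⟩)
    · intro a b hab
      exact Subtype.ext (hDbij.1 (congrArg Subtype.val hab))
    · rintro ⟨φ, hφ⟩
      obtain ⟨w, rfl⟩ := hDbij.2 φ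
      exact ⟨⟨w, (hmem w).2 hφ⟩, rfl⟩
  rw [Module.natCard_eq_pow_finrank (K := K) (V := J.perp P),
    Module.natCard_eq_pow_finrank (K := K) (V := P.dualAnnihilator)] at h1
  have h2 : 1 < Nat.card K := Finite.one_lt_card
  rw [Nat.pow_right_injective h2 h1, Subspace.finrank_add_finrank_dualAnnihilator_eq,
    Module.finrank_fintype_fun_eq_card]

theorem perp_perp [Finite K] (J : HermForm K ι) (P : Submodule K (ι → K)) :
    J.perp (J.perp P) = P := by
  symm
  refine Submodule.eq_of_le_of_finrank_eq (fun v hv => mem_perp'.2 fun w hw => hw v hv) ?_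
  have h1 := J.finrank_add_finrank_perp P
  have h2 := J.finrank_add_finrank_perp (J.perp P)
  omega

end HermForm

theorem ctr_mem_skewAdjoint {J : HermForm K ι} (x : Heisenberg J) (h : J.form x.vec x.vec = 0) :
    x.ctr ∈ skewAdjoint K := by
  rw [skewAdjoint.mem_iff]
  linear_combination x.rel + h

end Perp

/-! ### Multiplicity and dimension of the Heisenberg representation. -/

section HeisenbergCharacters

variable {K ι : Type*} [Field K] [Fintype K] [StarRing K] [Fintype ι] [DecidableEq ι]
  {S : Type*} [AddCommGroup S] [Module ℂ S]

/-- A parametrization of the Heisenberg group by pairs. -/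
theorem nonempty_prod_equiv_heisenberg (q : ℕ) [QuadraticStar q K] (J : HermForm K ι) :
    ∃ e : (ι → K) × skewAdjoint K ≃ Heisenberg J, ∀ w z, (e (w, z)).vec = w := by
  choose t ht using fun w => exists_add_star_eq q (J.star_form w w)
  refine ⟨Equiv.mk
    (fun p => ⟨p.1, t p.1 + p.2.1, by
      rw [star_add, skewAdjoint.mem_iff.1 p.2.2, ← ht]; ring⟩)
    (fun h => (h.vec, ⟨h.ctr - t h.vec, by
      rw [skewAdjoint.mem_iff, star_sub]
      linear_combination h.rel - ht h.vec⟩)) ?_ ?_, fun w z => rfl⟩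
  · rintro ⟨w, z⟩
    refine Prod.ext rfl (Subtype.ext ?_)
    change t w + z.1 - t w = z.1
    ring
  · intro h
    ext1
    · rfl
    · change t h.vec + (h.ctr - t h.vec) = h.ctr
      ring

instance finite_heisenberg (J : HermForm K ι) : Finite (Heisenberg J) :=
  Finite.of_injective (fun x : Heisenberg J => (x.vec, x.ctr)) fun x y h => by
    ext1
    · exact congrArg Prod.fst h
    · exact congrArg Prod.snd h

/-- The number of intertwining maps from the Heisenberg representation to a representation with
the same central character. -/
theorem finrank_hom_mul_card (q : ℕ) [QuadraticStar q K] {J : HermForm K ι}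
    {ψ : AddChar (skewAdjoint K) ℂ} (hψ : ψ ≠ 1) [FiniteDimensional ℂ S]
    {ρ : Representation ℂ (Heisenberg J) S} (hρ : IsHeisenbergRep ψ ρ)
    {S' : Type*} [AddCommGroup S'] [Module ℂ S'] [FiniteDimensional ℂ S']
    (σ : Representation ℂ (Heisenberg J) S')
    (hσ : ∀ (z : skewAdjoint K) (s : S'), σ (Heisenberg.center J z) s = ψ z • s) :
    Module.finrank ℂ (ρ.IntertwiningMap σ) * Fintype.card (ι → K) =
      Module.finrank ℂ S * Module.finrank ℂ S' := by
  classical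
  have := Fintype.ofFinite (Heisenberg J)
  obtain ⟨e, he⟩ := nonempty_prod_equiv_heisenberg q J
  have hcard : (Nat.card (Heisenberg J) : ℂ) = Fintype.card (ι → K) * Nat.card (skewAdjoint K) := by
    rw [← Nat.card_congr e, Nat.card_prod, Nat.card_eq_fintype_card (α := ι → K)]
    push_cast
    rfl
  have hc : (Nat.card (Heisenberg J) : ℂ) ≠ 0 := by exact_mod_cast Nat.card_pos.ne'
  have hc' : (Nat.card (skewAdjoint K) : ℂ) ≠ 0 := by exact_mod_cast Nat.card_pos.ne'
  have hinv := invertibleOfNonzero hc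
  have h1 := Representation.card_inv_mul_sum_char_mul_char_eq_finrank ρ σ
  -- The character of `ρ` vanishes off the centre, and on the centre both representations are the
  -- same scalar, so the inner product of characters is a count of central elements.
  have h2 : ∀ x : Heisenberg J, σ.character x * ρ.character x⁻¹ =
      if x.vec = 0 then (Module.finrank ℂ S * Module.finrank ℂ S' : ℂ) else 0 := by
    intro x
    split_ifs with hx
    · have hs := ctr_mem_skewAdjoint x (by rw [hx, J.form_zero_left])
      have hx0 : (x⁻¹).vec = 0 := by rw [Heisenberg.inv_vec, hx, neg_zero]
      have hs' := ctr_mem_skewAdjoint x⁻¹ (by rw [hx0, J.form_zero_left])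
      have e1 : ρ.character x⁻¹ = _ := trace_center hρ x⁻¹ hx0 hs'
      have e2 : σ x = ψ ⟨x.ctr, hs⟩ • (1 : Module.End ℂ S') := by
        ext s
        have h3 : x = Heisenberg.center J ⟨x.ctr, hs⟩ := by
          ext1
          · exact hx
          · rfl
        conv_lhs => rw [h3]
        exact hσ _ s
      have e3 : (⟨(x⁻¹).ctr, hs'⟩ : skewAdjoint K) = -⟨x.ctr, hs⟩ :=
        Subtype.ext (skewAdjoint.mem_iff.1 hs)
      have e4 : ψ ⟨x.ctr, hs⟩ * ψ (-⟨x.ctr, hs⟩) = 1 := by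
        rw [← AddChar.map_add_eq_mul, add_neg_cancel, AddChar.map_zero_eq_one]
      rw [e1, Representation.character, e2, map_smul, LinearMap.trace_one, smul_eq_mul, e3]
      linear_combination (Module.finrank ℂ S' * Module.finrank ℂ S : ℂ) * e4
    · have e1 : ρ.character x⁻¹ = 0 :=
        trace_eq_zero q hψ hρ x⁻¹ (by rw [Heisenberg.inv_vec]; exact neg_ne_zero.2 hx)
      rw [e1, mul_zero]
  simp only [h2] at h1
  rw [← e.sum_comp, Fintype.sum_prod_type] at h1
  simp only [he, Finset.sum_const, Finset.card_univ] at h1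
  rw [← Finset.smul_sum, Finset.sum_ite_eq' Finset.univ (0 : ι → K), if_pos (Finset.mem_univ _),
    nsmul_eq_mul, hcard, ← Nat.card_eq_fintype_card (α := skewAdjoint K)] at h1
  have hW : (Fintype.card (ι → K) : ℂ) ≠ 0 := by exact_mod_cast Fintype.card_ne_zero
  have h3 : (Module.finrank ℂ (ρ.IntertwiningMap σ) * Fintype.card (ι → K) : ℂ) =
      Module.finrank ℂ S * Module.finrank ℂ S' := by
    rw [← h1]
    field_simp
  exact_mod_cast h3

/-- Schur's lemma, combined with the previous count for `σ = ρ`. -/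
theorem IsHeisenbergRep.finrank_sq (q : ℕ) [QuadraticStar q K] {J : HermForm K ι}
    {ψ : AddChar (skewAdjoint K) ℂ} (hψ : ψ ≠ 1) [FiniteDimensional ℂ S]
    {ρ : Representation ℂ (Heisenberg J) S} (hρ : IsHeisenbergRep ψ ρ) :
    Module.finrank ℂ S * Module.finrank ℂ S = Fintype.card (ι → K) := by
  have := hρ.irreducible
  rw [← finrank_hom_mul_card q hψ hρ ρ hρ.central,
    Representation.IsIrreducible.finrank_intertwiningMap_self, one_mul]

end HeisenbergCharacters

theorem finrank_map_add_finrank_inf_ker {K M N : Type*} [Field K] [AddCommGroup M] [Module K M]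
    [FiniteDimensional K M] [AddCommGroup N] [Module K N] (A : M →ₗ[K] N) (P : Submodule K M) :
    Module.finrank K (P.map A) + Module.finrank K (P ⊓ LinearMap.ker A : Submodule K M) =
      Module.finrank K P := by
  have h1 := LinearMap.finrank_range_add_finrank_ker (A.domRestrict P)
  rw [LinearMap.range_domRestrict, LinearMap.ker_domRestrict] at h1
  rw [← h1, ← Submodule.map_comap_subtype]
  congr 1
  exact LinearEquiv.finrank_eq (Submodule.equivMapOfInjective P.subtype Subtype.val_injective
    _).symm

/-! ### Averages over totally isotropic subspaces and their traces against the Weil operators. -/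

section IsotropicAverage

variable {K ι : Type*} [Field K] [StarRing K] [Fintype ι] [DecidableEq ι]

/-- The lift of an isotropic vector to the Heisenberg group. -/
def Heisenberg.ofIsotropic {J : HermForm K ι} (v : ι → K) (hv : J.form v v = 0) : Heisenberg J :=
  ⟨v, 0, by rw [star_zero, add_zero, hv]⟩

/-- An injective map of the finite-dimensional space `Y` into itself is onto. -/
theorem act_inv_mem {J : HermForm K ι} {g : J.U} {Y : Submodule K (ι → K)}
    (hg : ∀ y ∈ Y, HermForm.act g y ∈ Y) : ∀ y ∈ Y, HermForm.act g⁻¹ y ∈ Y := by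
  have hinj : Function.Injective (HermForm.act g) := by
    intro a b hab
    have := congrArg (HermForm.act g⁻¹) hab
    rwa [← HermForm.act_mul, ← HermForm.act_mul, inv_mul_cancel, HermForm.act_one,
      HermForm.act_one] at this
  have h1 : Y.map (HermForm.act g) = Y := by
    refine Submodule.eq_of_le_of_finrank_eq ?_
      (LinearEquiv.finrank_eq (Submodule.equivMapOfInjective _ hinj Y)).symm
    rintro _ ⟨y, hy, rfl⟩
    exact hg y hy
  intro y hy
  rw [← h1] at hy
  obtain ⟨z, hz, rfl⟩ := hy
  rwa [← HermForm.act_mul, inv_mul_cancel, HermForm.act_one]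

theorem act_mem_perp {J : HermForm K ι} {g : J.U} {Y : Submodule K (ι → K)}
    (hg : ∀ y ∈ Y, HermForm.act g y ∈ Y) : ∀ y ∈ J.perp Y, HermForm.act g y ∈ J.perp Y := by
  intro w hw v hv
  have := hw _ (act_inv_mem hg v hv)
  rwa [← HermForm.form_act g, ← HermForm.act_mul, mul_inv_cancel, HermForm.act_one] at this

/-- The vectors that are moved by `g` inside `Y`. -/
def movedInto {J : HermForm K ι} (g : J.U) (Y : Submodule K (ι → K)) : Submodule K (ι → K) :=
  Y.comap (HermForm.act g - LinearMap.id)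

theorem mem_movedInto {J : HermForm K ι} (g : J.U) (Y : Submodule K (ι → K)) (u : ι → K) :
    u ∈ movedInto g Y ↔ HermForm.act g u - u ∈ Y := Iff.rfl

theorem IsHeisenbergRep.nontrivial {S : Type*} [AddCommGroup S] [Module ℂ S] {J : HermForm K ι}
    {ρ : Representation ℂ (Heisenberg J) S} {ψ : AddChar (skewAdjoint K) ℂ}
    (hρ : IsHeisenbergRep ψ ρ) :
    Nontrivial S := by
  have := hρ.irreducible
  by_contra h
  rw [not_nontrivial_iff_subsingleton] at h
  apply bot_ne_top (α := Subrepresentation ρ)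
  ext v
  obtain rfl : v = 0 := Subsingleton.elim _ _
  exact ⟨fun _ => trivial, fun _ => Submodule.zero_mem _⟩

variable [Fintype K]

/-- Isometry gives ⟨gv − v, u⟩ = −⟨gv, gu − u⟩, and gv runs over Y^⊥ when v does. -/
theorem movedInto_eq_perp {J : HermForm K ι} {g : J.U} {Y : Submodule K (ι → K)}
    (hg : ∀ y ∈ Y, HermForm.act g y ∈ Y) :
    movedInto g Y = J.perp ((J.perp Y).map (HermForm.act g - LinearMap.id)) := by
  have key : ∀ u v, J.form (HermForm.act g v - v) u =
      -J.form (HermForm.act g v) (HermForm.act g u - u) := by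
    intro u v
    rw [J.form_sub_left, J.form_sub_right, HermForm.form_act]
    ring
  ext u
  constructor
  · rintro hu _ ⟨v, hv, rfl⟩
    change J.form (HermForm.act g v - v) u = 0
    rw [key, neg_eq_zero]
    exact HermForm.mem_perp'.1 (act_mem_perp hg v hv) _ hu
  · intro hu
    rw [mem_movedInto, ← J.perp_perp Y]
    intro v hv
    have h1 := hu _ ⟨_, act_mem_perp (act_inv_mem hg) v hv, rfl⟩
    have h2 : HermForm.act g (HermForm.act g⁻¹ v) = v := by
      rw [← HermForm.act_mul, mul_inv_cancel, HermForm.act_one]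
    change J.form (HermForm.act g (HermForm.act g⁻¹ v) - HermForm.act g⁻¹ v) u = 0 at h1
    rwa [key, h2, neg_eq_zero] at h1

/-- For isotropic `Y`, `R` is the radical of the skew-hermitian form ⟨u − gu, v⟩ on `movedInto g Y`,
and the left side is the exponent of its Gauss sum. With A = g − 1, both `R` and `movedInto g Y ⊓
Y^⊥` have image Y ∩ A(Y^⊥) under A; comparing the kernels by rank and nullity gives the formula. -/
theorem finrank_movedInto_add {J : HermForm K ι} {g : J.U} {Y : Submodule K (ι → K)}
    (hg : ∀ y ∈ Y, HermForm.act g y ∈ Y) (R : Submodule K (ι → K))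
    (hR : ∀ u, u ∈ R ↔ u ∈ movedInto g Y ∧ ∀ v ∈ movedInto g Y,
      J.form (u - HermForm.act g u) v = 0) :
    Module.finrank K (movedInto g Y) + Module.finrank K R = Module.finrank K Y +
      Module.finrank K (fixed g) +
      Module.finrank K (movedInto g Y ⊓ J.perp Y : Submodule K (ι → K)) := by
  obtain ⟨A, hA⟩ : ∃ A, A = HermForm.act g - LinearMap.id := ⟨_, rfl⟩
  have hAv : ∀ v, A v = HermForm.act g v - v := fun v => by rw [hA]; rfl
  have hfix : fixed g = LinearMap.ker A := by rw [hA]; rfl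
  have hD := movedInto_eq_perp hg
  rw [← hA] at hD
  have hRA : R = (Y ⊓ (J.perp Y).map A).comap A := by
    ext u
    rw [hR, Submodule.mem_comap, Submodule.mem_inf]
    refine and_congr (by rw [mem_movedInto, hAv]) ?_
    rw [← J.perp_perp ((J.perp Y).map A), ← hD, HermForm.mem_perp']
    refine forall₂_congr fun v _ => ?_
    rw [hAv, ← neg_sub, J.form_neg_left, neg_eq_zero]
  have hmapR : R.map A = Y ⊓ (J.perp Y).map A := by
    rw [hRA, Submodule.map_comap_eq, inf_eq_right]
    exact inf_le_right.trans (LinearMap.map_le_range)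
  have hkerD : LinearMap.ker A ≤ movedInto g Y := by
    intro u hu
    rw [mem_movedInto, ← hAv, LinearMap.mem_ker.1 hu]
    exact Y.zero_mem
  have hRker : R ⊓ LinearMap.ker A = LinearMap.ker A := by
    rw [inf_eq_right, hRA]
    intro u hu
    rw [Submodule.mem_comap, LinearMap.mem_ker.1 hu]
    exact Submodule.zero_mem _
  have hmapD : (movedInto g Y ⊓ J.perp Y).map A = Y ⊓ (J.perp Y).map A := by
    ext v
    constructor
    · rintro ⟨u, ⟨hu1, hu2⟩, rfl⟩
      exact ⟨by rw [hAv]; exact hu1, u, hu2, rfl⟩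
    · rintro ⟨hv, u, hu, rfl⟩
      exact ⟨u, ⟨by rw [SetLike.mem_coe, mem_movedInto, ← hAv]; exact hv, hu⟩, rfl⟩
  have hkerD' : (movedInto g Y ⊓ J.perp Y) ⊓ LinearMap.ker A = J.perp Y ⊓ LinearMap.ker A := by
    rw [inf_comm (movedInto g Y), inf_assoc, inf_eq_right.2 hkerD]
  have e1 := finrank_map_add_finrank_inf_ker A (J.perp Y)
  have e2 := finrank_map_add_finrank_inf_ker A R
  have e3 := finrank_map_add_finrank_inf_ker A (movedInto g Y ⊓ J.perp Y)
  have e4 := J.finrank_add_finrank_perp Y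
  have e5 := J.finrank_add_finrank_perp ((J.perp Y).map A)
  rw [← hD] at e5
  rw [hmapR, hRker, ← hfix] at e2
  rw [hmapD, hkerD'] at e3
  omega

variable {S : Type*} [AddCommGroup S] [Module ℂ S]

section

variable {J : HermForm K ι} (ρ : Representation ℂ (Heisenberg J) S) {Y : Submodule K (ι → K)}
  (hY : Y ≤ J.perp Y)

open Classical in
/-- The average of a representation of the Heisenberg group over a totally isotropic subspace. -/
noncomputable def isotropicAvg : Module.End ℂ S :=
  (Nat.card Y : ℂ)⁻¹ • ∑ y : Y, ρ (Heisenberg.ofIsotropic y.1 (hY y.2 y.1 y.2))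

/-- The vectors fixed by a totally isotropic subspace. -/
def isotropicFixed : Submodule ℂ S where
  carrier := {s | ∀ (y : ι → K) (hy : y ∈ Y), ρ (Heisenberg.ofIsotropic y (hY hy y hy)) s = s}
  add_mem' := fun ha hb y hy => by rw [map_add, ha y hy, hb y hy]
  zero_mem' := fun y hy => map_zero _
  smul_mem' := fun c s hs y hy => by rw [map_smul, hs y hy]

theorem apply_mul_isotropicAvg {y : ι → K} (hy : y ∈ Y) :
    ρ (Heisenberg.ofIsotropic y (hY hy y hy)) * isotropicAvg ρ hY = isotropicAvg ρ hY := by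
  classical
  rw [isotropicAvg, mul_smul_comm, Finset.mul_sum]
  congr 1
  refine Fintype.sum_bijective (fun z : Y => (⟨y, hy⟩ : Y) + z) (AddGroup.addLeft_bijective _) _ _
    ?_
  intro z
  rw [← map_mul]
  congr 1
  ext1
  · rfl
  · change 0 + 0 + J.form y z.1 = 0
    rw [hY z.2 y hy]; ring

theorem isotropicAvg_mul_apply {y : ι → K} (hy : y ∈ Y) :
    isotropicAvg ρ hY * ρ (Heisenberg.ofIsotropic y (hY hy y hy)) = isotropicAvg ρ hY := by
  classical
  rw [isotropicAvg, smul_mul_assoc, Finset.sum_mul]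
  congr 1
  refine Fintype.sum_bijective (fun z : Y => z + (⟨y, hy⟩ : Y)) (AddGroup.addRight_bijective _) _ _
    ?_
  intro z
  rw [← map_mul]
  congr 1
  ext1
  · rfl
  · change 0 + 0 + J.form z.1 y = 0
    rw [hY hy z.1 z.2]; ring

theorem isProj_isotropicAvg : LinearMap.IsProj (isotropicFixed ρ hY) (isotropicAvg ρ hY) where
  map_mem s y hy := LinearMap.congr_fun (apply_mul_isotropicAvg ρ hY hy) s
  map_id s hs := by
    classical
    have hc : (Nat.card Y : ℂ) ≠ 0 := by exact_mod_cast Nat.card_pos.ne'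
    rw [isotropicAvg, LinearMap.smul_apply, LinearMap.sum_apply,
      Finset.sum_congr rfl fun y _ => hs y.1 y.2, Finset.sum_const, Finset.card_univ,
      ← Nat.card_eq_fintype_card, ← Nat.cast_smul_eq_nsmul ℂ, smul_smul, inv_mul_cancel₀ hc,
      one_smul]

/-- The average commutes with the centralizer of `Y`. -/
theorem isotropicAvg_mul_comm {x : Heisenberg J} (hx : x.vec ∈ J.perp Y) :
    isotropicAvg ρ hY * ρ x = ρ x * isotropicAvg ρ hY := by
  classical
  rw [isotropicAvg, mul_smul_comm, smul_mul_assoc, Finset.sum_mul, Finset.mul_sum]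
  congr 1
  refine Finset.sum_congr rfl fun y _ => ?_
  rw [← map_mul, ← map_mul]
  congr 1
  ext1
  · exact add_comm _ _
  · change 0 + x.ctr + J.form y.1 x.vec = x.ctr + 0 + J.form x.vec y.1
    rw [hx y.1 y.2, HermForm.mem_perp'.1 hx y.1 y.2]; ring

/-- The average commutes with the operators of the stabilizer of `Y`. -/
theorem isotropicAvg_mul_comm_of_mem {g : J.U} (hg : ∀ y ∈ Y, HermForm.act g y ∈ Y)
    {T : Module.End ℂ S} (hT : ∀ x, T * ρ x = ρ (g • x) * T) :
    T * isotropicAvg ρ hY = isotropicAvg ρ hY * T := by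
  classical
  rw [isotropicAvg, mul_smul_comm, smul_mul_assoc, Finset.mul_sum, Finset.sum_mul]
  congr 1
  refine Fintype.sum_equiv
    { toFun := fun y : Y => (⟨_, hg y.1 y.2⟩ : Y)
      invFun := fun y : Y => (⟨_, act_inv_mem hg y.1 y.2⟩ : Y)
      left_inv := fun y => Subtype.ext ?_
      right_inv := fun y => Subtype.ext ?_ } _ _ fun y => ?_
  · change HermForm.act g⁻¹ (HermForm.act g y.1) = y.1
    rw [← HermForm.act_mul, inv_mul_cancel, HermForm.act_one]
  · change HermForm.act g (HermForm.act g⁻¹ y.1) = y.1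
    rw [← HermForm.act_mul, mul_inv_cancel, HermForm.act_one]
  · rw [hT]
    rfl

variable {ρ}

/-- Only the zero vector contributes, all noncentral elements having trace zero. -/
theorem trace_isotropicAvg [FiniteDimensional ℂ S] (q : ℕ) [QuadraticStar q K]
    {ψ : AddChar (skewAdjoint K) ℂ} (hψ : ψ ≠ 1) (hρ : IsHeisenbergRep ψ ρ) :
      LinearMap.trace ℂ S (isotropicAvg ρ hY) =
    (Nat.card Y : ℂ)⁻¹ * Module.finrank ℂ S := by
  classical
  rw [isotropicAvg, map_smul, map_sum, smul_eq_mul]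
  congr 1
  rw [Finset.sum_eq_single 0]
  · have : Heisenberg.ofIsotropic (0 : Y).1 (hY (0 : Y).2 (0 : Y).1 (0 : Y).2) = 1 := rfl
    rw [this, map_one, LinearMap.trace_one]
  · intro y _ hy
    exact trace_eq_zero q hψ hρ _ fun h => hy (Subtype.ext h)
  · simp

/-- A vector of the Heisenberg representation all of whose translates have average zero is zero. -/
theorem eq_zero_of_isotropicAvg [FiniteDimensional ℂ S] (q : ℕ) [QuadraticStar q K]
    {ψ : AddChar (skewAdjoint K) ℂ} (hψ : ψ ≠ 1) (hρ : IsHeisenbergRep ψ ρ) {s : S}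
    (hs : ∀ x, isotropicAvg ρ hY (ρ x s) = 0) : s = 0 := by
  have := hρ.irreducible
  have := hρ.nontrivial
  -- The vectors all of whose translates have average zero form a subrepresentation. It cannot be
  -- everything, since the average has nonzero trace.
  let M : Subrepresentation ρ :=
    ⟨{ carrier := {s | ∀ x, isotropicAvg ρ hY (ρ x s) = 0}
       add_mem' := fun ha hb x => by rw [map_add, map_add, ha x, hb x, add_zero]
       zero_mem' := fun x => by rw [map_zero, map_zero]
       smul_mem' := fun c s hs x => by rw [map_smul, map_smul, hs x, smul_zero] },
     fun g s hs x => by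
       have := hs (x * g)
       rwa [map_mul] at this⟩
  rcases eq_bot_or_eq_top M with h | h
  · have h1 : s ∈ M := hs
    rw [h] at h1
    exact h1
  · exfalso
    have h0 : isotropicAvg ρ hY = 0 := by
      ext s
      have h1 : s ∈ M := by rw [h]; trivial
      have h2 := h1 1
      rwa [map_one] at h2
    have h1 := trace_isotropicAvg hY q hψ hρ
    rw [h0, map_zero] at h1
    have hc : (Nat.card Y : ℂ) ≠ 0 := by exact_mod_cast Nat.card_pos.ne'
    have hd : (Module.finrank ℂ S : ℂ) ≠ 0 := by
      exact_mod_cast (Module.finrank_pos (R := ℂ) (M := S)).ne'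
    exact mul_ne_zero (inv_ne_zero hc) hd h1.symm

/-- The trace of the product of the average of the Weil representation with the average over a
totally isotropic subspace. -/
theorem trace_avgOp_mul_isotropicAvg [FiniteDimensional ℂ S] (q : ℕ) [QuadraticStar q K]
    {ψ : AddChar (skewAdjoint K) ℂ} (hψ : ψ ≠ 1) (hρ : IsHeisenbergRep ψ ρ) {g : J.U}
    (hg : ∀ y ∈ Y, HermForm.act g y ∈ Y) :
    LinearMap.trace ℂ S (avgOp ρ g * isotropicAvg ρ hY) =
      (Fintype.card (ι → K) : ℂ)⁻¹ * (Nat.card Y : ℂ)⁻¹ *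
      ((-(q : ℂ)) ^ (Module.finrank K Y + Module.finrank K (fixed g) +
        Module.finrank K (movedInto g Y ⊓ J.perp Y : Submodule K (ι → K))) *
        Module.finrank ℂ S) := by
  classical
  -- In the double sum over u and y the trace vanishes unless y = −(gu − u), which requires u to be
  -- moved into `Y`. The surviving terms carry the phase Q(u, u), so the trace is the Gauss sum of
  -- the form `Q`.
  let Q : movedInto g Y → movedInto g Y → K := fun u v => J.form (u.1 - HermForm.act g u.1) v.1
  have hQadd : ∀ x y z, Q (x + y) z = Q x z + Q y z := by
    intro x y z
    simp only [Q, Submodule.coe_add, map_add, J.form_sub_left, J.form_add_left]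
    ring
  have hQsmul : ∀ (a : K) x z, Q (a • x) z = a * Q x z := by
    intro a x z
    simp only [Q, Submodule.coe_smul, map_smul, J.form_sub_left, J.form_smul_left]
    ring
  have hQskew : ∀ x y, star (Q x y) = -Q y x := by
    intro x y
    have h1 := hY y.2 _ x.2
    change J.form (HermForm.act g x.1 - x.1) (HermForm.act g y.1 - y.1) = 0 at h1
    simp only [Q, J.star_form]
    have h2 := congrArg star h1
    simp only [J.form_sub_left, J.form_sub_right, HermForm.form_act, star_sub, J.star_form,
      star_zero] at h2 ⊢
    linear_combination h2
  let R' : Submodule K (movedInto g Y) :=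
    { carrier := {x | ∀ y, Q x y = 0}
      add_mem' := fun {a b} ha hb y => by rw [hQadd, ha y, hb y, add_zero]
      zero_mem' := fun y => by simpa using hQsmul 0 0 y
      smul_mem' := fun c x hx y => by rw [hQsmul, hx y, mul_zero] }
  have hdim := finrank_movedInto_add hg (R'.map (movedInto g Y).subtype) (fun u => by
    constructor
    · rintro ⟨x, hx, rfl⟩
      exact ⟨x.2, fun v hv => hx ⟨v, hv⟩⟩
    · rintro ⟨h1, h2⟩
      exact ⟨⟨u, h1⟩, fun v => h2 v.1 v.2, rfl⟩)
  rw [← LinearEquiv.finrank_eq (Submodule.equivMapOfInjective (movedInto g Y).subtype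
    Subtype.val_injective R')] at hdim
  have hgauss := sum_skew q ψ hψ Q hQadd hQsmul hQskew _ ⊤ R' rfl
    (fun x => ⟨fun h => ⟨trivial, fun y _ => h y⟩, fun h y => h.2 y trivial⟩)
  rw [finrank_top, hdim, finsum_eq_sum_of_fintype] at hgauss
  rw [← hgauss, avgOp, isotropicAvg, smul_mul_assoc, mul_smul_comm, smul_smul, map_smul,
    smul_eq_mul, Finset.sum_mul_sum, map_sum, Finset.sum_mul]
  congr 1
  have h1 : ∀ u : ι → K, LinearMap.trace ℂ S (∑ y : Y, ρ (Heisenberg.comm g u) *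
      ρ (Heisenberg.ofIsotropic y.1 (hY y.2 y.1 y.2))) =
      if h : u ∈ movedInto g Y then
        ψ ⟨Q ⟨u, h⟩ ⟨u, h⟩, skewAdjoint.mem_iff.2 (hQskew _ _)⟩ * Module.finrank ℂ S else 0 := by
    intro u
    rw [map_sum]
    simp only [← map_mul]
    split_ifs with h
    · obtain ⟨y₀, hy₀⟩ : ∃ y₀ : Y, y₀.1 = -(HermForm.act g u - u) := ⟨⟨_, Y.neg_mem h⟩, rfl⟩
      rw [Finset.sum_eq_single y₀]
      · have hctr : (Heisenberg.comm g u * Heisenberg.ofIsotropic y₀.1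
            (hY y₀.2 y₀.1 y₀.2)).ctr = Q ⟨u, h⟩ ⟨u, h⟩ := by
          have h0 : J.form (HermForm.act g u - u) (HermForm.act g u - u) = 0 := hY h _ h
          simp only [Heisenberg.mul_ctr, Heisenberg.comm, Heisenberg.ofIsotropic, Q, hy₀]
          rw [J.form_neg_right, h0, J.form_sub_left]
          ring
        have hvec : (Heisenberg.comm g u * Heisenberg.ofIsotropic y₀.1
            (hY y₀.2 y₀.1 y₀.2)).vec = 0 := by
          simp only [Heisenberg.mul_vec, Heisenberg.comm, Heisenberg.ofIsotropic, hy₀]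
          abel
        rw [trace_center hρ _ hvec (by rw [hctr]; exact skewAdjoint.mem_iff.2 (hQskew _ _))]
        congr 3
      · intro y _ hy
        refine trace_eq_zero q hψ hρ _ fun h0 => hy (Subtype.ext ?_)
        rw [hy₀]
        exact eq_neg_of_add_eq_zero_right h0
      · simp
    · refine Finset.sum_eq_zero fun y _ => trace_eq_zero q hψ hρ _ fun h0 => h ?_
      have h2 : HermForm.act g u - u = -y.1 := eq_neg_of_add_eq_zero_left h0
      rw [mem_movedInto, h2]
      exact Y.neg_mem y.2
  simp only [h1]
  rw [Finset.sum_dite, Finset.sum_const_zero, add_zero]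
  symm
  refine Finset.sum_bij (fun x _ => ⟨x.1.1, by simp⟩) ?_ ?_ ?_ ?_
  · intro x _; simp
  · intro x _ y _ h
    have h' : x.1.1 = y.1.1 := congrArg (fun z => z.1) h
    exact Subtype.ext (Subtype.ext h')
  · rintro ⟨p, hp⟩ _
    simp only [Finset.mem_filter, Finset.mem_univ, true_and] at hp
    exact ⟨⟨⟨p, hp⟩, trivial⟩, Finset.mem_univ _, rfl⟩
  · intro x _
    rfl

end

end IsotropicAverage

/-! ### The Weil representation of Y^⊥ / Y inside that of the whole space. -/

section Restriction

variable {K ι κ : Type*} [Field K] [StarRing K] [Fintype ι] [DecidableEq ι]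
  [Fintype κ] [DecidableEq κ]

/-- The homomorphism of Heisenberg groups induced by an isometric embedding. -/
def Heisenberg.map {J₀ : HermForm K κ} {J₁ : HermForm K ι} (i : (κ → K) →ₗ[K] (ι → K))
    (hi : ∀ v w, J₁.form (i v) (i w) = J₀.form v w) : Heisenberg J₀ →* Heisenberg J₁ where
  toFun x := ⟨i x.vec, x.ctr, by rw [hi, x.rel]⟩
  map_one' := by
    ext1
    · exact map_zero i
    · rfl
  map_mul' x y := by
    ext1
    · exact map_add i _ _
    · exact congrArg (x.ctr + y.ctr + ·) (hi _ _).symm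

/-- The image of `i` is orthogonal to `Y`, so a vector of the image that lies in `Y` is orthogonal
to the whole image; then nondegeneracy of `J₀` applies. -/
theorem isometry_injective {J₀ : HermForm K κ} {J₁ : HermForm K ι} {i : (κ → K) →ₗ[K] (ι → K)}
    (hi : ∀ v w, J₁.form (i v) (i w) = J₀.form v w) {Y : Submodule K (ι → K)}
    (hiY : ∀ v, i v ∈ J₁.perp Y) {v : κ → K} (hv : i v ∈ Y) : v = 0 := by
  refine J₀.eq_zero_of_form fun w => ?_
  rw [← hi]
  exact HermForm.mem_perp'.1 (hiY w) _ hv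

variable [Fintype K]

/-- The dimension of the space of vectors orthogonal to `Y` that are fixed modulo `Y`. -/
theorem finrank_movedInto_inf_perp {J₀ : HermForm K κ} {J₁ : HermForm K ι}
    {i : (κ → K) →ₗ[K] (ι → K)} (hi : ∀ v w, J₁.form (i v) (i w) = J₀.form v w)
    {Y : Submodule K (ι → K)} (hY : Y ≤ J₁.perp Y) (hiY : ∀ v, i v ∈ J₁.perp Y)
    (hdim : Fintype.card ι = Fintype.card κ + 2 * Module.finrank K Y) {g : J₁.U} {g₀ : J₀.U}
    (hg : ∀ y ∈ Y, HermForm.act g y ∈ Y)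
    (hgi : ∀ w, HermForm.act g (i w) - i (HermForm.act g₀ w) ∈ Y) :
    Module.finrank K (movedInto g Y ⊓ J₁.perp Y : Submodule K (ι → K)) =
      Module.finrank K Y + Module.finrank K (fixed g₀) := by
  have hinj : ∀ P : Submodule K (κ → K),
      Function.Injective (Y.subtype.coprod (i ∘ₗ P.subtype)) := by
    intro P
    rw [← LinearMap.ker_eq_bot, LinearMap.ker_eq_bot']
    rintro ⟨⟨y, hy⟩, ⟨w, hw⟩⟩ h
    have h1 : y + i w = 0 := h
    have h2 : w = 0 := isometry_injective hi hiY (by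
      rw [eq_neg_of_add_eq_zero_right h1]
      exact Y.neg_mem hy)
    subst h2
    rw [map_zero, add_zero] at h1
    subst h1
    rfl
  -- The dimension hypothesis makes Y^⊥ the sum of `Y` and the image of `i`.
  have hsum : ∀ u ∈ J₁.perp Y, ∃ y ∈ Y, ∃ w, y + i w = u := by
    have h1 : LinearMap.range (Y.subtype.coprod (i ∘ₗ (⊤ : Submodule K (κ → K)).subtype)) =
        J₁.perp Y := by
      refine Submodule.eq_of_le_of_finrank_eq ?_ ?_
      · rintro _ ⟨⟨⟨y, hy⟩, ⟨w, hw⟩⟩, rfl⟩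
        exact Submodule.add_mem _ (hY hy) (hiY w)
      · rw [LinearMap.finrank_range_of_inj (hinj ⊤), Module.finrank_prod, finrank_top,
          Module.finrank_fintype_fun_eq_card]
        have := J₁.finrank_add_finrank_perp Y
        omega
    intro u hu
    rw [← h1] at hu
    obtain ⟨⟨⟨y, hy⟩, ⟨w, hw⟩⟩, rfl⟩ := hu
    exact ⟨y, hy, w, rfl⟩
  have hrange : LinearMap.range (Y.subtype.coprod (i ∘ₗ (fixed g₀).subtype)) =
      movedInto g Y ⊓ J₁.perp Y := by
    have key : ∀ y w, HermForm.act g (y + i w) - (y + i w) = (HermForm.act g y - y) +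
        (HermForm.act g (i w) - i (HermForm.act g₀ w)) + i (HermForm.act g₀ w - w) := by
      intro y w
      rw [map_add, map_sub]
      abel
    ext u
    constructor
    · rintro ⟨⟨⟨y, hy⟩, ⟨w, hw⟩⟩, rfl⟩
      refine ⟨?_, Submodule.add_mem _ (hY hy) (hiY w)⟩
      change HermForm.act g (y + i w) - (y + i w) ∈ Y
      rw [key, (mem_fixed _ _).1 hw, sub_self, map_zero, add_zero]
      nth_rewrite 2 [← (mem_fixed _ _).1 hw]
      exact Y.add_mem (Y.sub_mem (hg y hy) hy) (hgi w)
    · rintro ⟨h1, h2⟩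
      obtain ⟨y, hy, w, rfl⟩ := hsum u h2
      rw [SetLike.mem_coe, mem_movedInto, key] at h1
      have h3 := (Submodule.add_mem_iff_right Y
        (Y.add_mem (Y.sub_mem (hg y hy) hy) (hgi w))).1 h1
      have h4 := isometry_injective hi hiY h3
      exact ⟨(⟨y, hy⟩, ⟨w, (mem_fixed _ _).2 (sub_eq_zero.1 h4)⟩), rfl⟩
  rw [← hrange, LinearMap.finrank_range_of_inj (hinj _), Module.finrank_prod]

variable {S₀ S₁ : Type*} [AddCommGroup S₀] [Module ℂ S₀] [FiniteDimensional ℂ S₀]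
  [AddCommGroup S₁] [Module ℂ S₁] [FiniteDimensional ℂ S₁]

/-- Cardinalities are written as powers of −q, the base of the Gauss sums, so that trace identities
reduce to identities of exponents. -/
theorem card_fun_eq_neg_pow (q : ℕ) [hK : QuadraticStar q K] :
    (Fintype.card (ι → K) : ℂ) = (-(q : ℂ)) ^ (2 * Fintype.card ι) := by
  rw [Fintype.card_fun, hK.card_eq, pow_mul, neg_sq]; push_cast; rfl

theorem card_submodule_eq_neg_pow {M : Type*} [AddCommGroup M] [Module K M] [Finite M] (q : ℕ)
    [hK : QuadraticStar q K] (Y : Submodule K M) :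
    (Nat.card Y : ℂ) = (-(q : ℂ)) ^ (2 * Module.finrank K Y) := by
  rw [Module.natCard_eq_pow_finrank (K := K) (V := Y), Nat.card_eq_fintype_card, hK.card_eq,
    pow_mul,
    neg_sq]
  push_cast
  rfl

/-- The dimensions of the Heisenberg representations of a hermitian space and of `Y^⊥ / Y`. -/
theorem finrank_eq_mul_card (q : ℕ) [hK : QuadraticStar q K] {ψ : AddChar (skewAdjoint K) ℂ}
    (hψ : ψ ≠ 1) {J₀ : HermForm K κ} {J₁ : HermForm K ι}
    {ρ₀ : Representation ℂ (Heisenberg J₀) S₀} (hρ₀ : IsHeisenbergRep ψ ρ₀)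
    {ρ₁ : Representation ℂ (Heisenberg J₁) S₁} (hρ₁ : IsHeisenbergRep ψ ρ₁)
    (Y : Submodule K (ι → K))
    (hdim : Fintype.card ι = Fintype.card κ + 2 * Module.finrank K Y) :
    Module.finrank ℂ S₁ = Module.finrank ℂ S₀ * Nat.card Y := by
  have h0 := hρ₀.finrank_sq q hψ
  have h1 := hρ₁.finrank_sq q hψ
  apply Nat.pow_left_injective (n := 2) (by norm_num)
  change Module.finrank ℂ S₁ ^ 2 = (Module.finrank ℂ S₀ * Nat.card Y) ^ 2
  rw [mul_pow, sq, h1, sq (Module.finrank ℂ S₀), h0,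
    Module.natCard_eq_pow_finrank (K := K) (V := Y),
    Fintype.card_fun, Fintype.card_fun, hdim, Nat.card_eq_fintype_card]
  ring

/-- The space of vectors fixed by a totally isotropic subspace `Y` is the Heisenberg
representation of `Y^⊥ / Y`. -/
theorem exists_heisenberg_fixed (q : ℕ) [hK : QuadraticStar q K] {ψ : AddChar (skewAdjoint K) ℂ}
    (hψ : ψ ≠ 1) {J₀ : HermForm K κ} {J₁ : HermForm K ι}
    {ρ₀ : Representation ℂ (Heisenberg J₀) S₀} (hρ₀ : IsHeisenbergRep ψ ρ₀)
    {ρ₁ : Representation ℂ (Heisenberg J₁) S₁} (hρ₁ : IsHeisenbergRep ψ ρ₁)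
    {i : (κ → K) →ₗ[K] (ι → K)} (hi : ∀ v w, J₁.form (i v) (i w) = J₀.form v w)
    {Y : Submodule K (ι → K)} (hY : Y ≤ J₁.perp Y) (hiY : ∀ v, i v ∈ J₁.perp Y)
    (hdim : Fintype.card ι = Fintype.card κ + 2 * Module.finrank K Y) :
    ∃ (Ψ : S₀ →ₗ[ℂ] S₁) (pr : S₁ →ₗ[ℂ] S₀), pr ∘ₗ Ψ = LinearMap.id ∧
      Ψ ∘ₗ pr = isotropicAvg ρ₁ hY ∧
      ∀ x, ρ₁ (Heisenberg.map i hi x) ∘ₗ Ψ = Ψ ∘ₗ ρ₀ x := by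
  have hproj := isProj_isotropicAvg ρ₁ hY
  have hirr := hρ₀.irreducible
  have := hρ₀.nontrivial
  have hmem : ∀ x : Heisenberg J₀, ∀ s ∈ isotropicFixed ρ₁ hY,
      ρ₁ (Heisenberg.map i hi x) s ∈ isotropicFixed ρ₁ hY := by
    intro x s hs
    have h1 := isotropicAvg_mul_comm ρ₁ hY (x := Heisenberg.map i hi x) (hiY x.vec)
    have h2 := LinearMap.congr_fun h1 s
    rw [Module.End.mul_apply, Module.End.mul_apply, hproj.map_id s hs] at h2
    rw [← h2]
    exact hproj.map_mem _
  let σ : Representation ℂ (Heisenberg J₀) (isotropicFixed ρ₁ hY) :=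
    { toFun := fun x => (ρ₁ (Heisenberg.map i hi x)).restrict (hmem x)
      map_one' := by
        refine LinearMap.ext fun s => Subtype.ext ?_
        simp
      map_mul' := fun x y => by
        refine LinearMap.ext fun s => Subtype.ext ?_
        simp }
  have hσ : ∀ (z : skewAdjoint K) (s : isotropicFixed ρ₁ hY),
      σ (Heisenberg.center J₀ z) s = ψ z • s := by
    intro z s
    refine Subtype.ext ?_
    have h1 : Heisenberg.map i hi (Heisenberg.center J₀ z) = Heisenberg.center J₁ z := by
      ext1
      · exact map_zero i
      · rfl
    change ρ₁ (Heisenberg.map i hi (Heisenberg.center J₀ z)) s.1 = ψ z • s.1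
    rw [h1, hρ₁.central]
  have hd := finrank_eq_mul_card q hψ hρ₀ hρ₁ Y hdim
  have hfix : Module.finrank ℂ (isotropicFixed ρ₁ hY) = Module.finrank ℂ S₀ := by
    have h1 := trace_isotropicAvg hY q hψ hρ₁
    rw [hproj.trace, hd] at h1
    have hc : (Nat.card Y : ℂ) ≠ 0 := by exact_mod_cast Nat.card_pos.ne'
    have h2 : (Module.finrank ℂ (isotropicFixed ρ₁ hY) : ℂ) = Module.finrank ℂ S₀ := by
      rw [h1]; push_cast; field_simp
    exact_mod_cast h2
  -- The trace of the projection shows that the fixed space has the dimension of `S₀`. It has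
  -- central character ψ, so it receives a nonzero map from `ρ₀`; irreducibility makes the map
  -- injective and the dimensions make it bijective.
  have hhom := finrank_hom_mul_card q hψ hρ₀ σ hσ
  rw [hfix, hρ₀.finrank_sq q hψ] at hhom
  have hhom' : 0 < Module.finrank ℂ (ρ₀.IntertwiningMap σ) := by
    by_contra h
    have h0 : Module.finrank ℂ (ρ₀.IntertwiningMap σ) = 0 := by omega
    rw [h0, zero_mul] at hhom
    exact Fintype.card_ne_zero hhom.symm
  have hnt := Module.nontrivial_of_finrank_pos hhom'
  obtain ⟨f, hf0⟩ := exists_ne (0 : ρ₀.IntertwiningMap σ)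
  have hinj : Function.Injective f :=
    (Representation.IsIrreducible.injective_or_eq_zero f).resolve_right hf0
  let e : S₀ ≃ₗ[ℂ] isotropicFixed ρ₁ hY :=
    LinearEquiv.ofInjectiveOfFinrankEq f.toLinearMap hinj hfix.symm
  have he : ∀ s, e s = f s := fun s => rfl
  refine ⟨(isotropicFixed ρ₁ hY).subtype ∘ₗ e.toLinearMap,
    e.symm.toLinearMap ∘ₗ (isotropicAvg ρ₁ hY).codRestrict _ hproj.map_mem, ?_, ?_, ?_⟩
  · refine LinearMap.ext fun s => ?_
    change e.symm ⟨isotropicAvg ρ₁ hY (e s).1, _⟩ = s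
    rw [LinearEquiv.symm_apply_eq]
    exact Subtype.ext (hproj.map_id _ (e s).2)
  · refine LinearMap.ext fun s => ?_
    change (e (e.symm ⟨isotropicAvg ρ₁ hY s, _⟩)).1 = isotropicAvg ρ₁ hY s
    rw [LinearEquiv.apply_symm_apply]
  · intro x
    refine LinearMap.ext fun s => ?_
    exact congrArg Subtype.val
      (Representation.IntertwiningMap.isIntertwining ρ₀ σ f x s).symm

/-- The Weil representation of the stabilizer of a totally isotropic subspace `Y`, restricted to
the space of vectors fixed by `Y`, is the Weil representation of `Y^⊥ / Y`. -/
theorem weilRep_comp_fixed (q : ℕ) [hK : QuadraticStar q K] {ψ : AddChar (skewAdjoint K) ℂ}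
    (hψ : ψ ≠ 1) {J₀ : HermForm K κ} {J₁ : HermForm K ι}
    {ρ₀ : Representation ℂ (Heisenberg J₀) S₀} (hρ₀ : IsHeisenbergRep ψ ρ₀)
    {ρ₁ : Representation ℂ (Heisenberg J₁) S₁} (hρ₁ : IsHeisenbergRep ψ ρ₁)
    {i : (κ → K) →ₗ[K] (ι → K)} (hi : ∀ v w, J₁.form (i v) (i w) = J₀.form v w)
    {Y : Submodule K (ι → K)} (hY : Y ≤ J₁.perp Y) (hiY : ∀ v, i v ∈ J₁.perp Y)
    (hdim : Fintype.card ι = Fintype.card κ + 2 * Module.finrank K Y)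
    {Ψ : S₀ →ₗ[ℂ] S₁} {pr : S₁ →ₗ[ℂ] S₀} (hprΨ : pr ∘ₗ Ψ = LinearMap.id)
    (hΨpr : Ψ ∘ₗ pr = isotropicAvg ρ₁ hY)
    (hΨ : ∀ x, ρ₁ (Heisenberg.map i hi x) ∘ₗ Ψ = Ψ ∘ₗ ρ₀ x) {g : J₁.U} {g₀ : J₀.U}
    (hg : ∀ y ∈ Y, HermForm.act g y ∈ Y)
    (hgi : ∀ w, HermForm.act g (i w) - i (HermForm.act g₀ w) ∈ Y) :
    weilRep q hψ hρ₁ g ∘ₗ Ψ = Ψ ∘ₗ weilRep q hψ hρ₀ g₀ := by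
  obtain ⟨e, he⟩ : ∃ e, e = isotropicAvg ρ₁ hY := ⟨_, rfl⟩
  rw [← he] at hΨpr
  have heΨ : e ∘ₗ Ψ = Ψ := by
    rw [← hΨpr, LinearMap.comp_assoc, hprΨ, LinearMap.comp_id]
  have hpre : pr ∘ₗ e = pr := by
    rw [← hΨpr, ← LinearMap.comp_assoc, hprΨ, LinearMap.id_comp]
  have hcomm : ∀ g : J₁.U, (∀ y ∈ Y, HermForm.act g y ∈ Y) →
      weilRep q hψ hρ₁ g ∘ₗ e = e ∘ₗ weilRep q hψ hρ₁ g := fun g hg => he ▸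
    isotropicAvg_mul_comm_of_mem ρ₁ hY hg (weilRep_mul_apply q hψ hρ₁ g)
  obtain ⟨ω₁, hω₁⟩ : ∃ ω₁, ω₁ = weilRep q hψ hρ₁ g := ⟨_, rfl⟩
  obtain ⟨ω₀, hω₀⟩ : ∃ ω₀, ω₀ = weilRep q hψ hρ₀ g₀ := ⟨_, rfl⟩
  have hω₁e : ω₁ ∘ₗ e = e ∘ₗ ω₁ := hω₁ ▸ hcomm g hg
  have hω₁Ψ : e ∘ₗ (ω₁ ∘ₗ Ψ) = ω₁ ∘ₗ Ψ := by
    rw [← LinearMap.comp_assoc, ← hω₁e, LinearMap.comp_assoc, heΨ]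
  -- the operator `pr ω₁ Ψ` intertwines the Heisenberg representation with its twist
  have htw : ∀ x : Heisenberg J₀, (pr ∘ₗ ω₁ ∘ₗ Ψ) ∘ₗ ρ₀ x = ρ₀ (g₀ • x) ∘ₗ (pr ∘ₗ ω₁ ∘ₗ Ψ) := by
    intro x
    have h1 : g • Heisenberg.map i hi x = Heisenberg.map i hi (g₀ • x) *
        Heisenberg.ofIsotropic _ (hY (hgi x.vec) _ (hgi x.vec)) := by
      ext1
      · change HermForm.act g (i x.vec) = i (HermForm.act g₀ x.vec) +
          (HermForm.act g (i x.vec) - i (HermForm.act g₀ x.vec))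
        abel
      · have h5 := HermForm.mem_perp'.1 (hiY (HermForm.act g₀ x.vec)) _ (hgi x.vec)
        change x.ctr = x.ctr + 0 + J₁.form (i (HermForm.act g₀ x.vec))
          (HermForm.act g (i x.vec) - i (HermForm.act g₀ x.vec))
        rw [h5]
        ring
    have h2 : ω₁ ∘ₗ ρ₁ (Heisenberg.map i hi x) = ρ₁ (g • Heisenberg.map i hi x) ∘ₗ ω₁ :=
      hω₁ ▸ weilRep_mul_apply q hψ hρ₁ g _
    have h3 : ρ₁ (Heisenberg.ofIsotropic _ (hY (hgi x.vec) _ (hgi x.vec))) ∘ₗ e = e :=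
      he ▸ apply_mul_isotropicAvg ρ₁ hY (hgi x.vec)
    have h4 : pr ∘ₗ ρ₁ (Heisenberg.map i hi (g₀ • x)) ∘ₗ e = ρ₀ (g₀ • x) ∘ₗ pr := by
      rw [← hΨpr, ← LinearMap.comp_assoc _ _ (ρ₁ _), hΨ, ← LinearMap.comp_assoc,
        ← LinearMap.comp_assoc, hprΨ, LinearMap.id_comp]
    calc (pr ∘ₗ ω₁ ∘ₗ Ψ) ∘ₗ ρ₀ x = pr ∘ₗ (ω₁ ∘ₗ ρ₁ (Heisenberg.map i hi x)) ∘ₗ Ψ := by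
          rw [LinearMap.comp_assoc, LinearMap.comp_assoc, ← hΨ, LinearMap.comp_assoc]
      _ = pr ∘ₗ ρ₁ (Heisenberg.map i hi (g₀ • x)) ∘ₗ (ρ₁ (Heisenberg.ofIsotropic _
            (hY (hgi x.vec) _ (hgi x.vec))) ∘ₗ e) ∘ₗ ω₁ ∘ₗ Ψ := by
          rw [h2, h1, map_mul, Module.End.mul_eq_comp, LinearMap.comp_assoc, LinearMap.comp_assoc,
            LinearMap.comp_assoc, hω₁Ψ]
      _ = (pr ∘ₗ ρ₁ (Heisenberg.map i hi (g₀ • x)) ∘ₗ e) ∘ₗ ω₁ ∘ₗ Ψ := by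
          rw [h3]; simp only [LinearMap.comp_assoc]
      _ = _ := by rw [h4]; simp only [LinearMap.comp_assoc]
  have hω₀inv : ω₀ ∘ₗ weilRep q hψ hρ₀ g₀⁻¹ = LinearMap.id := by
    rw [hω₀, ← Module.End.mul_eq_comp, ← map_mul, mul_inv_cancel, map_one]; rfl
  have hω₀inv' : weilRep q hψ hρ₀ g₀⁻¹ ∘ₗ ω₀ = LinearMap.id := by
    rw [hω₀, ← Module.End.mul_eq_comp, ← map_mul, inv_mul_cancel, map_one]; rfl
  have hω₀x : ∀ x : Heisenberg J₀, weilRep q hψ hρ₀ g₀⁻¹ ∘ₗ ρ₀ x =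
      ρ₀ (g₀⁻¹ • x) ∘ₗ weilRep q hψ hρ₀ g₀⁻¹ := weilRep_mul_apply q hψ hρ₀ g₀⁻¹
  -- Both `pr ω₁ Ψ` and `ω₀` intertwine `ρ₀` with its twist by `g₀`; Schur's lemma leaves one
  -- scalar.
  obtain ⟨c, hc⟩ := exists_eq_smul_one hρ₀ ((pr ∘ₗ ω₁ ∘ₗ Ψ) ∘ₗ weilRep q hψ hρ₀ g₀⁻¹) (fun x => by
    rw [Module.End.mul_eq_comp, Module.End.mul_eq_comp, LinearMap.comp_assoc, hω₀x,
      ← LinearMap.comp_assoc, htw, smul_inv_smul, LinearMap.comp_assoc])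
  have hc1 : pr ∘ₗ ω₁ ∘ₗ Ψ = c • ω₀ := by
    have := congrArg (· ∘ₗ ω₀) hc
    simp only [LinearMap.comp_assoc] at this
    rw [hω₀inv', LinearMap.comp_id] at this
    rw [this]
    rfl
  have hc2 : ω₁ ∘ₗ Ψ = c • (Ψ ∘ₗ ω₀) := by
    rw [← LinearMap.comp_smul, ← hc1, ← LinearMap.comp_assoc, hΨpr, hω₁Ψ]
  suffices c = 1 by rw [← hω₁, ← hω₀, hc2, this, one_smul]
  -- the scalar is determined by the traces
  have htr : LinearMap.trace ℂ S₁ (ω₁ * e) = c * LinearMap.trace ℂ S₀ ω₀ := by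
    rw [← smul_eq_mul c, ← map_smul, ← hc1, ← hΨpr, Module.End.mul_eq_comp, ← LinearMap.comp_assoc,
      LinearMap.trace_comp_comm']
  have hd := finrank_eq_mul_card q hψ hρ₀ hρ₁ Y hdim
  rw [hω₁, he, hω₀] at htr
  change LinearMap.trace ℂ S₁ (weilOp q ρ₁ g * isotropicAvg ρ₁ hY) =
    c * LinearMap.trace ℂ S₀ (weilOp q ρ₀ g₀) at htr
  rw [weilOp, weilOp, smul_mul_assoc, map_smul, map_smul,
    trace_avgOp_mul_isotropicAvg hY q hψ hρ₁ hg,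
    finrank_movedInto_inf_perp hi hY hiY hdim hg hgi, smul_eq_mul, smul_eq_mul,
    trace_avgOp q hψ hρ₀, card_fun_eq_neg_pow q, card_fun_eq_neg_pow q, hd, Nat.cast_mul,
    card_submodule_eq_neg_pow q Y, ← neg_sq (q : ℂ)] at htr
  have e1 := finrank_fixed_add g
  have e0 := finrank_fixed_add g₀
  have hq : (-(q : ℂ)) ≠ 0 := by
    rw [neg_ne_zero]; exact_mod_cast (zero_lt_one.trans (one_lt_q q K)).ne'
  have hS : (Module.finrank ℂ S₀ : ℂ) ≠ 0 := by
    have := hρ₀.nontrivial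
    exact_mod_cast (Module.finrank_pos (R := ℂ) (M := S₀)).ne'
  set r := Module.finrank K (LinearMap.range (HermForm.act g - LinearMap.id))
  set r₀ := Module.finrank K (LinearMap.range (HermForm.act g₀ - LinearMap.id))
  set k := Module.finrank K (fixed g)
  set k₀ := Module.finrank K (fixed g₀)
  set y := Module.finrank K Y
  set N := Fintype.card ι
  set N₀ := Fintype.card κ
  set d : ℂ := (Module.finrank ℂ S₀ : ℂ)
  generalize (-(q : ℂ)) = t at *
  have hp : ∀ m, t ^ m ≠ 0 := fun m => pow_ne_zero m hq
  have hp1 := hp (2 * N)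
  have hp2 := hp (2 * N₀)
  have hp3 := hp (2 * y)
  have h2 : t ^ (r + k + y + y + k₀ + 2 * N₀) * d = t ^ (r₀ + 2 * k₀ + 2 * N) * d * c := by
    field_simp at htr
    linear_combination d * htr
  -- The two exponents of −q agree by rank and nullity for g − 1 and g₀ − 1 and by N = N₀ + 2y.
  have e2 : r + k + y + y + k₀ + 2 * N₀ = r₀ + 2 * k₀ + 2 * N := by omega
  rw [e2] at h2
  exact (mul_left_cancel₀ (mul_ne_zero (hp _) hS) ((mul_one _).trans h2)).symm

end Restriction

/-! ### Block extension by the identity on X + X^∨. -/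

section BlockExtension

variable {K κ : Type*} [Field K] [Fintype κ]

/-- The extension of an endomorphism of `V` to `(X + X^∨) ⊕ V` by the identity. -/
def extMat (ℓ : ℕ) (D : Matrix κ κ K) :
    Matrix ((Fin ℓ ⊕ Fin ℓ) ⊕ κ) ((Fin ℓ ⊕ Fin ℓ) ⊕ κ) K :=
  Matrix.fromBlocks 1 0 0 D

theorem extMat_mul_extMat (ℓ : ℕ) (D D' : Matrix κ κ K) :
    extMat ℓ D * extMat ℓ D' = extMat ℓ (D * D') := by
  simp [extMat, Matrix.fromBlocks_multiply]

theorem extMat_mul_inclX (ℓ : ℕ) (D : Matrix κ κ K) :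
    extMat ℓ D * inclX K κ ℓ = inclX K κ ℓ := by
  rw [extMat, inclX, Matrix.fromBlocks_mul_fromRows]; simp

theorem extMat_mul_inclV [DecidableEq κ] (ℓ : ℕ) (D : Matrix κ κ K) :
    extMat ℓ D * inclV K κ ℓ = inclV K κ ℓ * D := by
  rw [extMat, inclV, Matrix.fromBlocks_mul_fromRows, Matrix.fromRows_mul]; simp

end BlockExtension

/-! ### Replacing the dual of τ^σ by τ in parabolic induction. -/

section ContragredientInduction

open Representation

variable {K κ : Type*} [Field K] [StarRing K] [Fintype κ] [DecidableEq κ]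

/-- The automorphism of `GL` given by the star operation on the entries. -/
def conjGL (K : Type*) [Field K] [StarRing K] (κ : Type*) [Fintype κ] [DecidableEq κ] :
    GL κ K →* GL κ K :=
  Matrix.GeneralLinearGroup.map (starRingEnd K)

theorem coe_conjGL (a : GL κ K) :
    ((conjGL K κ a : GL κ K) : Matrix κ κ K) = (a : Matrix κ κ K).map star := rfl

theorem conjGL_conjGL (a : GL κ K) : conjGL K κ (conjGL K κ a) = a := by
  ext i j
  exact star_star _

theorem map_star_mul {α β γ : Type*} [Fintype β] (A : Matrix α β K) (B : Matrix β γ K) :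
    (A * B).map star = A.map star * B.map star := by
  ext i j
  simp [Matrix.mul_apply]

theorem map_star_add {α β : Type*} (A B : Matrix α β K) :
    (A + B).map star = A.map star + B.map star := by
  ext i j
  simp

theorem map_star_inclX (K κ : Type*) [Field K] [StarRing K] (ℓ : ℕ) : (inclX K κ ℓ).map star =
    inclX K κ ℓ := by
  ext ((i | i) | i) j <;> simp [inclX, Matrix.one_apply, apply_ite star]

theorem map_star_inclV (K κ : Type*) [Field K] [StarRing K] [DecidableEq κ] (ℓ : ℕ) :
    (inclV K κ ℓ).map star = inclV K κ ℓ := by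
  ext (i | i) j <;> simp [inclV, Matrix.one_apply, apply_ite star]

/-- The extension of an automorphism of `V` to `(X + X^∨) ⊕ V` by the identity. -/
def hyperbolicExt (ℓ : ℕ) (D : GL κ K) : GL ((Fin ℓ ⊕ Fin ℓ) ⊕ κ) K where
  val := extMat ℓ D.val
  inv := extMat ℓ D⁻¹.val
  val_inv := by
    rw [extMat_mul_extMat, Units.mul_inv, extMat, Matrix.fromBlocks_one]
  inv_val := by
    rw [extMat_mul_extMat, Units.inv_mul, extMat, Matrix.fromBlocks_one]

/-- The hyperbolic Gram matrix has entries 0 and 1, fixed by star, so the identity already works on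
X + X^∨. This choice lets the resulting automorphism preserve the parabolic subgroup. -/
theorem hyperbolicExt_isometry (ℓ : ℕ) (J : HermForm K κ) (D : GL κ K)
    (hD : (D : Matrix κ κ K)ᴴ * J.gram * (D : Matrix κ κ K) = J.gram.map star) :
    ((hyperbolicExt ℓ D : GL _ K) : Matrix _ _ K)ᴴ * (J.addHyperbolic ℓ).gram *
      ((hyperbolicExt ℓ D : GL _ K) : Matrix _ _ K) = (J.addHyperbolic ℓ).gram.map star := by
  have h1 : (Matrix.fromBlocks 0 1 1 0 : Matrix (Fin ℓ ⊕ Fin ℓ) (Fin ℓ ⊕ Fin ℓ) K).map star =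
      Matrix.fromBlocks 0 1 1 0 := by
    ext (i | i) (j | j) <;> simp [Matrix.one_apply, apply_ite star]
  rw [J.gram_addHyperbolic]
  change (extMat ℓ D.val)ᴴ * _ * extMat ℓ D.val = _
  rw [extMat, Matrix.fromBlocks_conjTranspose, Matrix.fromBlocks_multiply,
    Matrix.fromBlocks_multiply,
    Matrix.fromBlocks_map, h1, ← hD]
  simp [Matrix.map_zero]

/-- The automorphism of the parabolic subgroup given by a conjugate-linear isometry. -/
theorem conjHom_mem_parabolic {ℓ : ℕ} {J : HermForm K κ} {D : GL κ K}
    (hD : (D : Matrix κ κ K)ᴴ * J.gram * (D : Matrix κ κ K) = J.gram.map star)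
    {x : (J.addHyperbolic ℓ).U × (GL (Fin ℓ) K × J.U)} (hx : x ∈ parabolic ℓ J) :
    ((J.addHyperbolic ℓ).conjHom _ (hyperbolicExt_isometry ℓ J D hD) x.1,
      (conjGL K (Fin ℓ) x.2.1, J.conjHom D hD x.2.2)) ∈ parabolic ℓ J := by
  obtain ⟨p, a, b⟩ := x
  obtain ⟨h1, y, h2⟩ := hx
  dsimp only at h1 h2
  obtain ⟨A, hA⟩ : ∃ A, A = (p : GL ((Fin ℓ ⊕ Fin ℓ) ⊕ κ) K).val := ⟨_, rfl⟩
  rw [← hA] at h1 h2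
  have h1' := congrArg (fun M => Matrix.map M star) h1
  have h2' := congrArg (fun M => Matrix.map M star) h2
  simp only [map_star_mul, map_star_add, map_star_inclX, map_star_inclV] at h1' h2'
  refine ⟨?_, y.map star * D⁻¹.val, ?_⟩
  · change extMat ℓ D.val * (p : GL ((Fin ℓ ⊕ Fin ℓ) ⊕ κ) K).val.map star *
      extMat ℓ D⁻¹.val * inclX K κ ℓ = inclX K κ ℓ * a.val.map star
    rw [← hA, Matrix.mul_assoc _ _ (inclX K κ ℓ), extMat_mul_inclX, Matrix.mul_assoc, h1',
      ← Matrix.mul_assoc, extMat_mul_inclX]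
  · change extMat ℓ D.val * (p : GL ((Fin ℓ ⊕ Fin ℓ) ⊕ κ) K).val.map star *
      extMat ℓ D⁻¹.val * inclV K κ ℓ =
      inclV K κ ℓ * (D.val * (b : GL κ K).val.map star * D⁻¹.val) +
        inclX K κ ℓ * (y.map star * D⁻¹.val)
    rw [← hA, Matrix.mul_assoc _ _ (inclV K κ ℓ), extMat_mul_inclV, Matrix.mul_assoc,
      ← Matrix.mul_assoc (A.map star), h2', Matrix.add_mul, Matrix.mul_add]
    simp only [← Matrix.mul_assoc]
    rw [extMat_mul_inclX, extMat_mul_inclV]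

theorem conjGL_injective : Function.Injective (conjGL K κ) := fun a b h => by
  rw [← conjGL_conjGL a, h, conjGL_conjGL]

variable {ℓ : ℕ} {J : HermForm K κ}
  {T X : Type*} [AddCommGroup T] [Module ℂ T] [AddCommGroup X] [Module ℂ X]

/-- The representation `Hom(τ^σ, Θ)` of the parabolic subgroup, where `τ^σ` is the composition of
`τ` with the star operation. -/
noncomputable def conjHomRep (J : HermForm K κ) (τ : Representation ℂ (GL (Fin ℓ) K) T)
    (Θ : Representation ℂ J.U X) : Representation ℂ (parabolic ℓ J) (T →ₗ[ℂ] X) :=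
  linHom (τ.comp ((conjGL K (Fin ℓ)).comp
      ((MonoidHom.fst _ _).comp ((MonoidHom.snd _ _).comp (parabolic ℓ J).subtype))))
    (Θ.comp ((MonoidHom.snd _ _).comp ((MonoidHom.snd _ _).comp (parabolic ℓ J).subtype)))

theorem conjHomRep_apply (τ : Representation ℂ (GL (Fin ℓ) K) T) (Θ : Representation ℂ J.U X)
    (x : parabolic ℓ J) (f : T →ₗ[ℂ] X) (t : T) : conjHomRep J τ Θ x f t =
      Θ x.1.2.2 (f (τ (conjGL K (Fin ℓ) x.1.2.1)⁻¹ t)) := by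
  rw [← map_inv]
  rfl

variable [Fintype K]

/-- Parabolic induction of `τ ⊗ Θ` and of `Hom(τ^σ, Θ)` agree. -/
theorem nonempty_coind_conjHomRep_equiv (q : ℕ) [QuadraticStar q K] (hq : Odd q)
    [FiniteDimensional ℂ T] [FiniteDimensional ℂ X]
    (τ : Representation ℂ (GL (Fin ℓ) K) T) (Θ : Representation ℂ J.U X) :
    Nonempty ((coind ((MonoidHom.fst _ _).comp (parabolic ℓ J).subtype)
      (conjHomRep J τ Θ)).Equiv (parabolicInd τ Θ)) := by
  have := Fintype.ofFinite (parabolic ℓ J)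
  obtain ⟨D, hD⟩ := J.exists_conj_isometry q hq
  have hD1 := hyperbolicExt_isometry ℓ J D hD
  refine nonempty_equiv_of_finrank_eq _ _ fun m ρ => ?_
  have h1 := finrank_hom_coind ((MonoidHom.fst _ _).comp (parabolic ℓ J).subtype)
      (conjHomRep J τ Θ) ρ
  have h2 := finrank_hom_coind ((MonoidHom.fst _ _).comp (parabolic ℓ J).subtype)
      (Representation.tprod
        (τ.comp ((MonoidHom.fst _ _).comp ((MonoidHom.snd _ _).comp (parabolic ℓ J).subtype)))
        (Θ.comp ((MonoidHom.snd _ _).comp ((MonoidHom.snd _ _).comp (parabolic ℓ J).subtype)))) ρ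
  suffices h : (Module.finrank ℂ (ρ.IntertwiningMap
      (coind ((MonoidHom.fst _ _).comp (parabolic ℓ J).subtype) (conjHomRep J τ Θ))) : ℂ) =
      Module.finrank ℂ (ρ.IntertwiningMap (parabolicInd τ Θ)) by exact_mod_cast h
  rw [h1]
  refine Eq.trans ?_ h2.symm
  congr 1
  symm
  -- The substitution x ↦ δ(x)⁻¹ in the character sum. On GL it is a ↦ (star a)⁻¹, which turns the
  -- character of the dual of τ^σ into that of τ; on the two unitary components it moves each
  -- element to a conjugate of itself, so the other characters are unchanged.
  let F : parabolic ℓ J → parabolic ℓ J := fun x => (⟨_, conjHom_mem_parabolic hD x.2⟩)⁻¹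
  have hF : Function.Bijective F := by
    rw [← Finite.injective_iff_bijective]
    intro x y h
    have h3 := congrArg Subtype.val (inv_injective h)
    refine Subtype.ext (Prod.ext ?_ (Prod.ext ?_ ?_))
    · exact (J.addHyperbolic ℓ).conjHom_injective _ hD1 (congrArg Prod.fst h3)
    · exact conjGL_injective (congrArg (fun z => z.2.1) h3)
    · exact J.conjHom_injective _ hD (congrArg (fun z => z.2.2) h3)
  refine Fintype.sum_bijective F hF _ _ fun x => ?_
  obtain ⟨⟨p, a, b⟩, hx⟩ := x
  rw [char_tensor, conjHomRep, char_linHom, Pi.mul_apply]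
  change τ.character a * Θ.character b * ρ.character p⁻¹ =
    τ.character (conjGL K (Fin ℓ) (conjGL K (Fin ℓ) a)⁻¹⁻¹) *
      Θ.character (J.conjHom D hD b)⁻¹ *
      ρ.character ((J.addHyperbolic ℓ).conjHom _ hD1 p)⁻¹⁻¹
  rw [inv_inv, inv_inv, conjGL_conjGL]
  obtain ⟨k, hk⟩ := exists_conj_eq_conjHom_inv q hq J D hD b
  obtain ⟨k', hk'⟩ := exists_conj_eq_conjHom_inv q hq (J.addHyperbolic ℓ) _ hD1 p⁻¹
  rw [← hk, char_conj]
  rw [map_inv, inv_inv] at hk'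
  rw [← hk', char_conj]

end ContragredientInduction

/-! ### Tensor products of column spaces as spaces of matrices. -/

section TensorSpace

set_option linter.unusedSectionVars false

variable {K : Type*} [Field K]

/-- Matrices as vectors of a tensor product of column spaces. -/
def tvec {α β : Type*} : Matrix α β K →ₗ[K] (α × β → K) where
  toFun M p := M p.1 p.2
  map_add' _ _ := rfl
  map_smul' _ _ := rfl

theorem tvec_injective {α β : Type*} : Function.Injective (tvec : Matrix α β K →ₗ[K] (α × β → K)) :=
  fun A B h => by
    ext i j
    exact congrFun h (i, j)

variable [StarRing K] {α β : Type*} [Fintype α] [DecidableEq α] [Fintype β] [DecidableEq β]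

theorem kronecker_mulVec_tvec (g : Matrix α α K) (g' : Matrix β β K) (M : Matrix α β K) :
    (g ⊗ₖ g') *ᵥ tvec M = tvec (g * M * g'ᵀ) := by
  ext ⟨i, j⟩
  change ∑ p : α × β, g i p.1 * g' j p.2 * M p.1 p.2 = ∑ l, (∑ k, g i k * M k l) * g' j l
  rw [Fintype.sum_prod_type, Finset.sum_comm]
  refine Finset.sum_congr rfl fun l _ => ?_
  rw [Finset.sum_mul]
  exact Finset.sum_congr rfl fun k _ => by ring

theorem star_tvec_dotProduct (A B : Matrix α β K) :
    star (tvec A) ⬝ᵥ tvec B = Matrix.trace (Aᴴ * B) := by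
  change ∑ p : α × β, star (A p.1 p.2) * B p.1 p.2 = ∑ j, ∑ i, star (A i j) * B i j
  rw [Fintype.sum_prod_type, Finset.sum_comm]

theorem act_tensorHom_tvec {J : HermForm K α} {J' : HermForm K β} (x : J.U × J'.U)
    (M : Matrix α β K) : HermForm.act (tensorHom J J' x) (tvec M) =
      tvec ((x.1 : GL α K).val * M * (x.2 : GL β K).valᵀ) :=
  kronecker_mulVec_tvec _ _ _

theorem form_tvec {J : HermForm K α} {J' : HermForm K β} (A B : Matrix α β K) :
    (J.tensor J').form (tvec A) (tvec B) = Matrix.trace (Bᴴ * (J.gram * A * J'.gramᵀ)) := by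
  rw [← star_tvec_dotProduct, ← kronecker_mulVec_tvec]
  rfl

/-- Orthogonality in the tensor product is thereby read off from the Gram matrices between frames of
the two factors. -/
theorem form_tvec_mul {γ γ' δ δ' : Type*} [Fintype γ] [Fintype γ'] [Fintype δ] [Fintype δ']
    {J : HermForm K α} {J' : HermForm K β}
    (P : Matrix α γ K) (A : Matrix γ γ' K) (P' : Matrix β γ' K)
    (Q : Matrix α δ K) (B : Matrix δ δ' K) (Q' : Matrix β δ' K) :
    (J.tensor J').form (tvec (P * A * P'ᵀ)) (tvec (Q * B * Q'ᵀ)) =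
      Matrix.trace (Bᴴ * (Qᴴ * J.gram * P) * A * (Q'ᴴ * J'.gram * P')ᵀ) := by
  have h1 : (Q'ᴴ * J'.gram * P')ᵀ = P'ᵀ * J'.gramᵀ * Q'ᵀᴴ := by
    rw [Matrix.transpose_mul, Matrix.transpose_mul, Matrix.mul_assoc]
    rfl
  rw [form_tvec, h1]
  calc _ = Matrix.trace (Q'ᵀᴴ * (Bᴴ * (Qᴴ * J.gram * P) * A * (P'ᵀ * J'.gramᵀ))) := by
        simp only [Matrix.conjTranspose_mul, Matrix.mul_assoc]
    _ = _ := by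
        rw [Matrix.trace_mul_comm]
        simp only [Matrix.mul_assoc]

theorem form_tvec_mul_left {γ δ : Type*} [Fintype γ] [Fintype δ]
    {J : HermForm K α} {J' : HermForm K β}
    (P : Matrix α γ K) (A : Matrix γ β K) (Q : Matrix α δ K) (B : Matrix δ β K) :
    (J.tensor J').form (tvec (P * A)) (tvec (Q * B)) =
      Matrix.trace (Bᴴ * (Qᴴ * J.gram * P) * A * J'.gramᵀ) := by
  have h := form_tvec_mul (J := J) (J' := J') P A 1 Q B 1
  simpa using h

end TensorSpace

/-! ### Gram matrices of the frame X, X^∨, V. -/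

section HyperbolicFrame

set_option linter.unusedSectionVars false

variable {K κ : Type*} [Field K] [StarRing K] [Fintype κ] [DecidableEq κ]

/-- The inclusion of `X^∨` into `(X + X^∨) ⊕ V`. -/
def inclXd (K κ : Type*) [Field K] (ℓ : ℕ) : Matrix ((Fin ℓ ⊕ Fin ℓ) ⊕ κ) (Fin ℓ) K :=
  Matrix.fromRows (Matrix.fromRows 0 1) 0

variable (ℓ : ℕ) (J : HermForm K κ)

theorem gram_mul_inclX : (J.addHyperbolic ℓ).gram * inclX K κ ℓ = inclXd K κ ℓ := by
  rw [J.gram_addHyperbolic, inclX, inclXd, Matrix.fromBlocks_mul_fromRows,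
    Matrix.fromBlocks_mul_fromRows]
  simp

theorem gram_mul_inclXd : (J.addHyperbolic ℓ).gram * inclXd K κ ℓ = inclX K κ ℓ := by
  rw [J.gram_addHyperbolic, inclX, inclXd, Matrix.fromBlocks_mul_fromRows,
    Matrix.fromBlocks_mul_fromRows]
  simp

theorem gram_mul_inclV : (J.addHyperbolic ℓ).gram * inclV K κ ℓ = inclV K κ ℓ * J.gram := by
  rw [J.gram_addHyperbolic, inclV, Matrix.fromBlocks_mul_fromRows, Matrix.fromRows_mul]
  simp

theorem inclX_mul_inclX : (inclX K κ ℓ)ᴴ * inclX K κ ℓ = 1 := by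
  rw [inclX, Matrix.conjTranspose_fromRows_eq_fromCols_conjTranspose,
    Matrix.conjTranspose_fromRows_eq_fromCols_conjTranspose, Matrix.fromCols_mul_fromRows,
    Matrix.fromCols_mul_fromRows]
  simp

theorem inclX_mul_inclXd : (inclX K κ ℓ)ᴴ * inclXd K κ ℓ = 0 := by
  rw [inclX, inclXd, Matrix.conjTranspose_fromRows_eq_fromCols_conjTranspose,
    Matrix.conjTranspose_fromRows_eq_fromCols_conjTranspose, Matrix.fromCols_mul_fromRows,
    Matrix.fromCols_mul_fromRows]
  simp

theorem inclX_mul_inclV : (inclX K κ ℓ)ᴴ * inclV K κ ℓ = 0 := by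
  rw [inclX, inclV, Matrix.conjTranspose_fromRows_eq_fromCols_conjTranspose,
    Matrix.conjTranspose_fromRows_eq_fromCols_conjTranspose, Matrix.fromCols_mul_fromRows]
  simp

theorem inclXd_mul_inclV : (inclXd K κ ℓ)ᴴ * inclV K κ ℓ = 0 := by
  rw [inclXd, inclV, Matrix.conjTranspose_fromRows_eq_fromCols_conjTranspose,
    Matrix.conjTranspose_fromRows_eq_fromCols_conjTranspose, Matrix.fromCols_mul_fromRows]
  simp

theorem inclV_mul_inclV : (inclV K κ ℓ)ᴴ * inclV K κ ℓ = 1 := by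
  rw [inclV, Matrix.conjTranspose_fromRows_eq_fromCols_conjTranspose, Matrix.fromCols_mul_fromRows]
  simp

theorem inclXd_mul_inclX : (inclXd K κ ℓ)ᴴ * inclX K κ ℓ = 0 := by
  have := congrArg Matrix.conjTranspose (inclX_mul_inclXd (K := K) (κ := κ) ℓ)
  simpa [Matrix.conjTranspose_mul] using this

theorem inclV_mul_inclXd : (inclV K κ ℓ)ᴴ * inclXd K κ ℓ = 0 := by
  have := congrArg Matrix.conjTranspose (inclXd_mul_inclV (K := K) (κ := κ) ℓ)
  simpa [Matrix.conjTranspose_mul] using this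

theorem gram_inclX_inclX : (inclX K κ ℓ)ᴴ * (J.addHyperbolic ℓ).gram * inclX K κ ℓ = 0 := by
  rw [Matrix.mul_assoc, gram_mul_inclX, inclX_mul_inclXd]

theorem gram_inclX_inclXd : (inclX K κ ℓ)ᴴ * (J.addHyperbolic ℓ).gram * inclXd K κ ℓ = 1 := by
  rw [Matrix.mul_assoc, gram_mul_inclXd, inclX_mul_inclX]

theorem gram_inclX_inclV : (inclX K κ ℓ)ᴴ * (J.addHyperbolic ℓ).gram * inclV K κ ℓ = 0 := by
  rw [Matrix.mul_assoc, gram_mul_inclV, ← Matrix.mul_assoc, inclX_mul_inclV, Matrix.zero_mul]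

theorem gram_inclXd_inclXd : (inclXd K κ ℓ)ᴴ * (J.addHyperbolic ℓ).gram * inclXd K κ ℓ = 0 := by
  rw [Matrix.mul_assoc, gram_mul_inclXd, inclXd_mul_inclX]

theorem gram_inclXd_inclV : (inclXd K κ ℓ)ᴴ * (J.addHyperbolic ℓ).gram * inclV K κ ℓ = 0 := by
  rw [Matrix.mul_assoc, gram_mul_inclV, ← Matrix.mul_assoc, inclXd_mul_inclV, Matrix.zero_mul]

theorem gram_inclV_inclX : (inclV K κ ℓ)ᴴ * (J.addHyperbolic ℓ).gram * inclX K κ ℓ = 0 := by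
  rw [Matrix.mul_assoc, gram_mul_inclX, inclV_mul_inclXd]

theorem gram_inclV_inclV : (inclV K κ ℓ)ᴴ * (J.addHyperbolic ℓ).gram * inclV K κ ℓ = J.gram := by
  rw [Matrix.mul_assoc, gram_mul_inclV, ← Matrix.mul_assoc, inclV_mul_inclV, Matrix.one_mul]

theorem exists_frame_decomposition {β : Type*} (M : Matrix ((Fin ℓ ⊕ Fin ℓ) ⊕ κ) β K) :
    ∃ (A B : Matrix (Fin ℓ) β K) (C : Matrix κ β K), M = inclX K κ ℓ * A + inclXd K κ ℓ * B +
      inclV K κ ℓ * C := by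
  refine ⟨M.toRows₁.toRows₁, M.toRows₁.toRows₂, M.toRows₂, ?_⟩
  ext ((i | i) | i) j <;>
    simp [inclX, inclXd, inclV]

variable {ℓ J}

/-- The action of an element of the parabolic subgroup on `X^∨`. -/
theorem exists_parabolic_mul_inclXd
    {x : (J.addHyperbolic ℓ).U × (GL (Fin ℓ) K × J.U)} (hx : x ∈ parabolic ℓ J) :
    ∃ (A : Matrix (Fin ℓ) (Fin ℓ) K) (C : Matrix κ (Fin ℓ) K),
      (x.1 : GL ((Fin ℓ ⊕ Fin ℓ) ⊕ κ) K).val * inclXd K κ ℓ =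
      inclXd K κ ℓ * (x.2.1⁻¹).valᴴ + inclX K κ ℓ * A + inclV K κ ℓ * C := by
  obtain ⟨A, B, C, h⟩ := exists_frame_decomposition ℓ
    ((x.1 : GL ((Fin ℓ ⊕ Fin ℓ) ⊕ κ) K).val * inclXd K κ ℓ)
  refine ⟨A, C, ?_⟩
  have h1 := HermForm.U_conjTranspose_mul x.1
  -- The component along X^∨ is determined by pairing with X, on which the element acts by its
  -- GL-component.
  have h2 : x.2.1.valᴴ * B = 1 := by
    have h3 := gram_inclX_inclXd (K := K) ℓ J
    have h4 := gram_inclX_inclX (K := K) ℓ J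
    have h5 := gram_inclX_inclV (K := K) ℓ J
    have h8 : (inclX K κ ℓ)ᴴ * (J.addHyperbolic ℓ).gram *
        (inclX K κ ℓ * A + inclXd K κ ℓ * B + inclV K κ ℓ * C) = B := by
      rw [Matrix.mul_add, Matrix.mul_add, ← Matrix.mul_assoc _ _ A, ← Matrix.mul_assoc _ _ B,
        ← Matrix.mul_assoc _ _ C, h3, h4, h5]
      simp
    calc x.2.1.valᴴ * B = x.2.1.valᴴ * ((inclX K κ ℓ)ᴴ * (J.addHyperbolic ℓ).gram *
          (inclX K κ ℓ * A + inclXd K κ ℓ * B + inclV K κ ℓ * C)) := by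
          rw [h8]
      _ = ((x.1 : GL ((Fin ℓ ⊕ Fin ℓ) ⊕ κ) K).val * inclX K κ ℓ)ᴴ * (J.addHyperbolic ℓ).gram *
          ((x.1 : GL ((Fin ℓ ⊕ Fin ℓ) ⊕ κ) K).val * inclXd K κ ℓ) := by
          rw [← h, hx.1]
          simp only [Matrix.conjTranspose_mul, Matrix.mul_assoc]
      _ = (inclX K κ ℓ)ᴴ * ((x.1 : GL ((Fin ℓ ⊕ Fin ℓ) ⊕ κ) K).valᴴ *
          (J.addHyperbolic ℓ).gram * (x.1 : GL ((Fin ℓ ⊕ Fin ℓ) ⊕ κ) K).val) * inclXd K κ ℓ := by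
          simp only [Matrix.conjTranspose_mul, Matrix.mul_assoc]
      _ = 1 := by rw [h1, h3]
  have h6 : (x.2.1⁻¹).valᴴ * x.2.1.valᴴ = 1 := by
    rw [← Matrix.conjTranspose_mul, Units.mul_inv, Matrix.conjTranspose_one]
  have h7 : B = (x.2.1⁻¹).valᴴ := by
    rw [← Matrix.mul_one (x.2.1⁻¹).valᴴ, ← h2, ← Matrix.mul_assoc, h6, Matrix.one_mul]
  rw [h, h7]
  abel

end HyperbolicFrame

/-! ### The isotropic subspaces X ⊗ V₁' and X ⊗ V₁' + V ⊗ X'. -/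

section TensorSubspaces

set_option linter.unusedSectionVars false

variable {K : Type*} [Field K]

/-- Vectors of a tensor product of column spaces as matrices. -/
def tmat {α β : Type*} : (α × β → K) →ₗ[K] Matrix α β K where
  toFun v i j := v (i, j)
  map_add' _ _ := rfl
  map_smul' _ _ := rfl

theorem tvec_tmat {α β : Type*} (v : α × β → K) : tvec (tmat v) = v := rfl

theorem tmat_tvec {α β : Type*} (M : Matrix α β K) : tmat (tvec M) = M := rfl

/-- The map `A ↦ P A` with values in the tensor product space. -/
def tvecMul {α γ : Type*} (β : Type*) [Fintype γ] (P : Matrix α γ K) :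
    Matrix γ β K →ₗ[K] (α × β → K) where
  toFun A := tvec (P * A)
  map_add' A B := by rw [Matrix.mul_add, map_add]
  map_smul' c A := by rw [Matrix.mul_smul, map_smul, RingHom.id_apply]

/-- The subspace `X ⊗ V'`. -/
def tensorX (K κ : Type*) [Field K] (ℓ : ℕ) (β : Type*) :
    Submodule K (((Fin ℓ ⊕ Fin ℓ) ⊕ κ) × β → K) :=
  LinearMap.range (tvecMul β (inclX K κ ℓ))

theorem mem_tensorX {κ β : Type*} {ℓ : ℕ} {v : ((Fin ℓ ⊕ Fin ℓ) ⊕ κ) × β → K} :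
    v ∈ tensorX K κ ℓ β ↔ ∃ A : Matrix (Fin ℓ) β K, tvec (inclX K κ ℓ * A) = v := Iff.rfl

/-- The map `(A, C) ↦ inclX A + inclV C inclXᵀ`, with image `X ⊗ V' + V ⊗ X'`. -/
def tensorXXMap (K κ κ' : Type*) [Field K] [Fintype κ] [DecidableEq κ] (ℓ : ℕ) :
    (Matrix (Fin ℓ) ((Fin ℓ ⊕ Fin ℓ) ⊕ κ') K × Matrix κ (Fin ℓ) K) →ₗ[K]
      (((Fin ℓ ⊕ Fin ℓ) ⊕ κ) × ((Fin ℓ ⊕ Fin ℓ) ⊕ κ') → K) where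
  toFun x := tvec (inclX K κ ℓ * x.1 + inclV K κ ℓ * x.2 * (inclX K κ' ℓ)ᵀ)
  map_add' x y := by
    rw [← map_add]
    congr 1
    simp only [Prod.fst_add, Prod.snd_add, Matrix.mul_add, Matrix.add_mul]
    abel
  map_smul' c x := by
    rw [RingHom.id_apply, ← map_smul]
    congr 1
    simp

/-- The subspace `X ⊗ V' + V ⊗ X'`. -/
def tensorXX (K κ κ' : Type*) [Field K] [Fintype κ] [DecidableEq κ] (ℓ : ℕ) :
    Submodule K (((Fin ℓ ⊕ Fin ℓ) ⊕ κ) × ((Fin ℓ ⊕ Fin ℓ) ⊕ κ') → K) :=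
  LinearMap.range (tensorXXMap K κ κ' ℓ)

theorem mem_tensorXX {κ κ' : Type*} [Fintype κ] [DecidableEq κ] {ℓ : ℕ}
    {v : ((Fin ℓ ⊕ Fin ℓ) ⊕ κ) × ((Fin ℓ ⊕ Fin ℓ) ⊕ κ') → K} :
    v ∈ tensorXX K κ κ' ℓ ↔ ∃ (A : Matrix (Fin ℓ) ((Fin ℓ ⊕ Fin ℓ) ⊕ κ') K)
      (C : Matrix κ (Fin ℓ) K),
      tvec (inclX K κ ℓ * A + inclV K κ ℓ * C * (inclX K κ' ℓ)ᵀ) = v :=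
  ⟨fun ⟨x, hx⟩ => ⟨x.1, x.2, hx⟩, fun ⟨A, C, h⟩ => ⟨(A, C), h⟩⟩

theorem tensorX_le_tensorXX {κ κ' : Type*} [Fintype κ] [DecidableEq κ] (ℓ : ℕ) :
    tensorX K κ ℓ ((Fin ℓ ⊕ Fin ℓ) ⊕ κ') ≤ tensorXX K κ κ' ℓ := by
  rintro v ⟨A, rfl⟩
  refine mem_tensorXX.2 ⟨A, 0, ?_⟩
  rw [Matrix.mul_zero, Matrix.zero_mul, add_zero]
  rfl

/-- The embedding of `V ⊗ V'₁`. -/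
def tensorEmb (K κ : Type*) [Field K] [Fintype κ] [DecidableEq κ] (ℓ : ℕ) (β : Type*) :
    (κ × β → K) →ₗ[K] (((Fin ℓ ⊕ Fin ℓ) ⊕ κ) × β → K) :=
  tvecMul β (inclV K κ ℓ) ∘ₗ tmat

/-- The embedding of `V ⊗ V'`. -/
def tensorEmb₂ (K κ κ' : Type*) [Field K] [Fintype κ] [DecidableEq κ] [Fintype κ'] [DecidableEq κ']
    (ℓ : ℕ) : (κ × κ' → K) →ₗ[K] (((Fin ℓ ⊕ Fin ℓ) ⊕ κ) × ((Fin ℓ ⊕ Fin ℓ) ⊕ κ') → K) where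
  toFun v := tvec (inclV K κ ℓ * tmat v * (inclV K κ' ℓ)ᵀ)
  map_add' v w := by rw [map_add, Matrix.mul_add, Matrix.add_mul, map_add]
  map_smul' c v := by
    rw [map_smul, Matrix.mul_smul, Matrix.smul_mul, map_smul, RingHom.id_apply]

variable [StarRing K]

section Left

variable {κ β : Type*} [Fintype κ] [DecidableEq κ] [Fintype β] [DecidableEq β] {ℓ : ℕ}

theorem inclX_mul_injective {γ : Type*} {A B : Matrix (Fin ℓ) γ K}
    (h : inclX K κ ℓ * A = inclX K κ ℓ * B) : A = B := by
  have := congrArg ((inclX K κ ℓ)ᴴ * ·) h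
  simpa only [← Matrix.mul_assoc, inclX_mul_inclX, Matrix.one_mul] using this

theorem finrank_tensorX : Module.finrank K (tensorX K κ ℓ β) = ℓ * Fintype.card β := by
  have hinj : Function.Injective (tvecMul β (inclX K κ ℓ)) := fun A B h =>
    inclX_mul_injective (tvec_injective h)
  rw [tensorX, LinearMap.finrank_range_of_inj hinj, Module.finrank_matrix, Module.finrank_self,
    Fintype.card_fin, mul_one]

variable (J : HermForm K κ) (J' : HermForm K β)

theorem form_inclX_inclX (A B : Matrix (Fin ℓ) β K) :
    ((J.addHyperbolic ℓ).tensor J').form (tvec (inclX K κ ℓ * A)) (tvec (inclX K κ ℓ * B)) = 0 := by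
  rw [form_tvec_mul_left, gram_inclX_inclX]
  simp

theorem form_inclXd_inclXd (A B : Matrix (Fin ℓ) β K) :
    ((J.addHyperbolic ℓ).tensor J').form (tvec (inclXd K κ ℓ * A)) (tvec (inclXd K κ ℓ * B)) =
      0 := by
  rw [form_tvec_mul_left, gram_inclXd_inclXd]
  simp

theorem form_inclV_inclX (A : Matrix κ β K) (B : Matrix (Fin ℓ) β K) :
    ((J.addHyperbolic ℓ).tensor J').form (tvec (inclV K κ ℓ * A)) (tvec (inclX K κ ℓ * B)) = 0 := by
  rw [form_tvec_mul_left, gram_inclX_inclV]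
  simp

theorem form_inclV_inclXd (A : Matrix κ β K) (B : Matrix (Fin ℓ) β K) :
    ((J.addHyperbolic ℓ).tensor J').form (tvec (inclV K κ ℓ * A)) (tvec (inclXd K κ ℓ * B)) =
      0 := by
  rw [form_tvec_mul_left, gram_inclXd_inclV]
  simp

theorem form_inclV_inclV (A B : Matrix κ β K) :
    ((J.addHyperbolic ℓ).tensor J').form (tvec (inclV K κ ℓ * A)) (tvec (inclV K κ ℓ * B)) =
      Matrix.trace (Bᴴ * J.gram * A * J'.gramᵀ) := by
  rw [form_tvec_mul_left, gram_inclV_inclV]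

theorem form_inclXd_inclX (A B : Matrix (Fin ℓ) β K) :
    ((J.addHyperbolic ℓ).tensor J').form (tvec (inclXd K κ ℓ * A)) (tvec (inclX K κ ℓ * B)) =
      Matrix.trace (Bᴴ * A * J'.gramᵀ) := by
  rw [form_tvec_mul_left, gram_inclX_inclXd, Matrix.mul_one]

theorem tensorX_le_perp : tensorX K κ ℓ β ≤ ((J.addHyperbolic ℓ).tensor J').perp
    (tensorX K κ ℓ β) := by
  rintro _ ⟨A, rfl⟩ _ ⟨B, rfl⟩
  exact form_inclX_inclX J J' B A

theorem tvec_inclV_mem_perp (C : Matrix κ β K) :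
    tvec (inclV K κ ℓ * C) ∈ ((J.addHyperbolic ℓ).tensor J').perp (tensorX K κ ℓ β) := by
  rw [HermForm.mem_perp']
  rintro _ ⟨B, rfl⟩
  exact form_inclV_inclX J J' C B

/-- X^∨ ⊗ V' pairs perfectly with X ⊗ V'; testing against elementary matrices gives B J'ᵀ = 0. -/
theorem eq_zero_of_inclXd_mem_perp {B : Matrix (Fin ℓ) β K}
    (h : tvec (inclXd K κ ℓ * B) ∈ ((J.addHyperbolic ℓ).tensor J').perp (tensorX K κ ℓ β)) :
    B = 0 := by
  rw [HermForm.mem_perp'] at h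
  have h1 : B * J'.gramᵀ = 0 := by
    ext i j
    have h3 := h _ ⟨Matrix.single i j (1 : K), rfl⟩
    change ((J.addHyperbolic ℓ).tensor J').form (tvec (inclXd K κ ℓ * B))
      (tvec (inclX K κ ℓ * Matrix.single i j (1 : K))) = 0 at h3
    rw [form_inclXd_inclX, Matrix.mul_assoc, Matrix.conjTranspose_single, star_one,
      Matrix.trace_single_mul, one_smul] at h3
    exact h3
  have h2 : J'.gramᵀ * J'.gramᵀ⁻¹ = 1 :=
    Matrix.mul_nonsing_inv _ (by rw [Matrix.det_transpose]; exact J'.isUnit_det)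
  rw [← Matrix.mul_one B, ← h2, ← Matrix.mul_assoc, h1, Matrix.zero_mul]

theorem form_tensorEmb (v w : κ × β → K) : ((J.addHyperbolic ℓ).tensor J').form
    (tensorEmb K κ ℓ β v) (tensorEmb K κ ℓ β w) = (J.tensor J').form v w := by
  change ((J.addHyperbolic ℓ).tensor J').form (tvec (inclV K κ ℓ * tmat v))
    (tvec (inclV K κ ℓ * tmat w)) = (J.tensor J').form (tvec (tmat v)) (tvec (tmat w))
  rw [form_inclV_inclV, form_tvec]
  simp only [Matrix.mul_assoc]

variable {J J'}

theorem act_mem_tensorX {x : (J.addHyperbolic ℓ).U × (GL (Fin ℓ) K × J.U)}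
    (hx : x ∈ parabolic ℓ J) (g' : J'.U) : ∀ y ∈ tensorX K κ ℓ β,
      HermForm.act (tensorHom _ _ (x.1, g')) y ∈ tensorX K κ ℓ β := by
  rintro _ ⟨A, rfl⟩
  refine mem_tensorX.2 ⟨x.2.1.val * A * (g' : GL β K).valᵀ, ?_⟩
  change _ = HermForm.act (tensorHom _ _ (x.1, g')) (tvec (inclX K κ ℓ * A))
  rw [act_tensorHom_tvec, ← Matrix.mul_assoc _ _ A, hx.1]
  simp only [Matrix.mul_assoc]

/-- An element that is trivial on X^⊥ / X = V acts trivially on the subquotient V ⊗ V' of the tensor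
space. The identity is written as an action so as to fit `weilRep_comp_fixed` with `g₀ = 1`. -/
theorem act_tensorEmb_sub_mem {x : (J.addHyperbolic ℓ).U × (GL (Fin ℓ) K × J.U)}
    (hx : x ∈ parabolic ℓ J) (hb : x.2.2 = 1) (w : κ × β → K) :
    HermForm.act (tensorHom _ J' (x.1, 1)) (tensorEmb K κ ℓ β w) -
      tensorEmb K κ ℓ β (HermForm.act (1 : (J.tensor J').U) w) ∈ tensorX K κ ℓ β := by
  obtain ⟨y, hy⟩ := hx.2
  refine mem_tensorX.2 ⟨y * tmat w, ?_⟩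
  rw [HermForm.act_one]
  change _ = HermForm.act (tensorHom _ J' (x.1, 1)) (tvec (inclV K κ ℓ * tmat w)) -
    tvec (inclV K κ ℓ * tmat w)
  rw [act_tensorHom_tvec]
  dsimp only
  rw [← Matrix.mul_assoc _ (inclV K κ ℓ) (tmat w), hy, hb, ← map_sub]
  congr 1
  simp [Matrix.add_mul, Matrix.mul_assoc]

end Left

section Both

variable {κ κ' : Type*} [Fintype κ] [DecidableEq κ] [Fintype κ'] [DecidableEq κ'] {ℓ : ℕ}

theorem transpose_inclX_mul : (inclX K κ' ℓ)ᵀ * inclX K κ' ℓ = 1 := by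
  have h := inclX_mul_inclX (K := K) (κ := κ') ℓ
  rwa [Matrix.conjTranspose, Matrix.transpose_map, map_star_inclX] at h

/-- The dimension is such that Y^⊥ / Y has the dimension of V ⊗ V'. -/
theorem finrank_tensorXX : Module.finrank K (tensorXX K κ κ' ℓ) =
    ℓ * (ℓ + ℓ + Fintype.card κ') + Fintype.card κ * ℓ := by
  have hinj : Function.Injective (tensorXXMap K κ κ' ℓ) := by
    rw [← LinearMap.ker_eq_bot, LinearMap.ker_eq_bot']
    rintro ⟨A, C⟩ h
    have h1 : inclX K κ ℓ * A + inclV K κ ℓ * C * (inclX K κ' ℓ)ᵀ = 0 := tvec_injective h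
    have h2 : A = 0 := by
      have := congrArg ((inclX K κ ℓ)ᴴ * ·) h1
      simpa only [Matrix.mul_add, ← Matrix.mul_assoc, inclX_mul_inclX, inclX_mul_inclV,
        Matrix.one_mul, Matrix.zero_mul, add_zero, Matrix.mul_zero] using this
    rw [h2, Matrix.mul_zero, zero_add] at h1
    have h3 : C = 0 := by
      have := congrArg (fun M => (inclV K κ ℓ)ᴴ * M * inclX K κ' ℓ) h1
      simpa only [← Matrix.mul_assoc, inclV_mul_inclV, Matrix.one_mul, Matrix.mul_assoc C,
        transpose_inclX_mul, Matrix.mul_one, Matrix.mul_zero, Matrix.zero_mul] using this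
    rw [h2, h3]
    rfl
  rw [tensorXX, LinearMap.finrank_range_of_inj hinj, Module.finrank_prod, Module.finrank_matrix,
    Module.finrank_matrix, Module.finrank_self, Fintype.card_sum, Fintype.card_sum,
    Fintype.card_fin, mul_one, mul_one]

variable (J : HermForm K κ) (J' : HermForm K κ')

/-- Vectors of `V₁ ⊗ X'` are orthogonal to each other. -/
theorem form_mul_transpose_inclX (A B : Matrix ((Fin ℓ ⊕ Fin ℓ) ⊕ κ) (Fin ℓ) K) :
    ((J.addHyperbolic ℓ).tensor (J'.addHyperbolic ℓ)).form (tvec (A * (inclX K κ' ℓ)ᵀ))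
      (tvec (B * (inclX K κ' ℓ)ᵀ)) = 0 := by
  have h := form_tvec_mul (J := J.addHyperbolic ℓ) (J' := J'.addHyperbolic ℓ) 1 A
    (inclX K κ' ℓ) 1 B (inclX K κ' ℓ)
  rw [gram_inclX_inclX] at h
  simpa using h

theorem form_inclV_mul_transpose (A : Matrix κ κ' K) (B : Matrix κ (Fin ℓ) K) :
    ((J.addHyperbolic ℓ).tensor (J'.addHyperbolic ℓ)).form
      (tvec (inclV K κ ℓ * A * (inclV K κ' ℓ)ᵀ)) (tvec (inclV K κ ℓ * B * (inclX K κ' ℓ)ᵀ)) =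
        0 := by
  rw [form_tvec_mul, gram_inclX_inclV]
  simp

theorem tensorXX_le_perp : tensorXX K κ κ' ℓ ≤
    ((J.addHyperbolic ℓ).tensor (J'.addHyperbolic ℓ)).perp (tensorXX K κ κ' ℓ) := by
  intro v hv w hw
  obtain ⟨A, C, rfl⟩ := mem_tensorXX.1 hv
  obtain ⟨B, D, rfl⟩ := mem_tensorXX.1 hw
  rw [map_add, map_add, HermForm.form_add_left, HermForm.form_add_right, HermForm.form_add_right,
    form_inclX_inclX, form_mul_transpose_inclX, Matrix.mul_assoc _ D, form_inclV_inclX,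
    ← HermForm.star_form, Matrix.mul_assoc _ C, form_inclV_inclX]
  simp

theorem form_tensorEmb₂ (v w : κ × κ' → K) : ((J.addHyperbolic ℓ).tensor (J'.addHyperbolic ℓ)).form
    (tensorEmb₂ K κ κ' ℓ v) (tensorEmb₂ K κ κ' ℓ w) = (J.tensor J').form v w := by
  change ((J.addHyperbolic ℓ).tensor (J'.addHyperbolic ℓ)).form
    (tvec (inclV K κ ℓ * tmat v * (inclV K κ' ℓ)ᵀ))
      (tvec (inclV K κ ℓ * tmat w * (inclV K κ' ℓ)ᵀ)) =
    (J.tensor J').form (tvec (tmat v)) (tvec (tmat w))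
  rw [form_tvec_mul, gram_inclV_inclV, gram_inclV_inclV, form_tvec]
  simp only [Matrix.mul_assoc]

theorem tensorEmb₂_mem_perp (v : κ × κ' → K) : tensorEmb₂ K κ κ' ℓ v ∈
    ((J.addHyperbolic ℓ).tensor (J'.addHyperbolic ℓ)).perp (tensorXX K κ κ' ℓ) := by
  rw [HermForm.mem_perp']
  intro w hw
  obtain ⟨A, C, rfl⟩ := mem_tensorXX.1 hw
  change ((J.addHyperbolic ℓ).tensor (J'.addHyperbolic ℓ)).form
    (tvec (inclV K κ ℓ * tmat v * (inclV K κ' ℓ)ᵀ)) _ = 0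
  rw [map_add, HermForm.form_add_right, form_inclV_mul_transpose, Matrix.mul_assoc (inclV K κ ℓ),
    form_inclV_inclX, add_zero]

variable {J J'}

theorem act_mem_tensorXX {x : (J.addHyperbolic ℓ).U × (GL (Fin ℓ) K × J.U)}
    (hx : x ∈ parabolic ℓ J) {x' : (J'.addHyperbolic ℓ).U × (GL (Fin ℓ) K × J'.U)}
    (hx' : x' ∈ parabolic ℓ J') : ∀ y ∈ tensorXX K κ κ' ℓ,
      HermForm.act (tensorHom _ _ (x.1, x'.1)) y ∈ tensorXX K κ κ' ℓ := by
  intro v hv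
  obtain ⟨A, C, rfl⟩ := mem_tensorXX.1 hv
  rw [map_add, map_add]
  refine Submodule.add_mem _ (tensorX_le_tensorXX ℓ (act_mem_tensorX hx x'.1 _ ⟨A, rfl⟩)) ?_
  obtain ⟨y, hy⟩ := hx.2
  refine mem_tensorXX.2 ⟨y * C * x'.2.1.valᵀ * (inclX K κ' ℓ)ᵀ, (x.2.2 : GL κ K).val * C *
    x'.2.1.valᵀ, ?_⟩
  rw [act_tensorHom_tvec]
  dsimp only
  rw [Matrix.mul_assoc (inclV K κ ℓ) C, ← Matrix.mul_assoc _ (inclV K κ ℓ), hy]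
  congr 1
  have h1 : (inclX K κ' ℓ)ᵀ * (x'.1 : GL ((Fin ℓ ⊕ Fin ℓ) ⊕ κ') K).valᵀ =
      x'.2.1.valᵀ * (inclX K κ' ℓ)ᵀ := by
    rw [← Matrix.transpose_mul, hx'.1, Matrix.transpose_mul]
  rw [Matrix.mul_assoc _ (C * (inclX K κ' ℓ)ᵀ), Matrix.mul_assoc C, h1]
  simp only [Matrix.add_mul, Matrix.mul_assoc]
  abel

/-- Modulo Y the unipotent parts disappear, so Y^⊥ / Y is V ⊗ V' with the action of the unitary
components. -/
theorem act_tensorEmb₂_sub_mem {x : (J.addHyperbolic ℓ).U × (GL (Fin ℓ) K × J.U)}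
    (hx : x ∈ parabolic ℓ J) {x' : (J'.addHyperbolic ℓ).U × (GL (Fin ℓ) K × J'.U)}
    (hx' : x' ∈ parabolic ℓ J') (w : κ × κ' → K) :
    HermForm.act (tensorHom _ _ (x.1, x'.1)) (tensorEmb₂ K κ κ' ℓ w) -
      tensorEmb₂ K κ κ' ℓ (HermForm.act (tensorHom J J' (x.2.2, x'.2.2)) w) ∈
      tensorXX K κ κ' ℓ := by
  obtain ⟨y, hy⟩ := hx.2
  obtain ⟨y', hy'⟩ := hx'.2
  have h1 : (inclV K κ' ℓ)ᵀ * (x'.1 : GL ((Fin ℓ ⊕ Fin ℓ) ⊕ κ') K).valᵀ =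
      (x'.2.2 : GL κ' K).valᵀ * (inclV K κ' ℓ)ᵀ + y'ᵀ * (inclX K κ' ℓ)ᵀ := by
    rw [← Matrix.transpose_mul, hy', Matrix.transpose_add, Matrix.transpose_mul,
      Matrix.transpose_mul]
  refine mem_tensorXX.2 ⟨y * tmat w * ((x'.2.2 : GL κ' K).valᵀ * (inclV K κ' ℓ)ᵀ +
    y'ᵀ * (inclX K κ' ℓ)ᵀ), (x.2.2 : GL κ K).val * tmat w * y'ᵀ, ?_⟩
  change _ = HermForm.act (tensorHom _ _ (x.1, x'.1))
    (tvec (inclV K κ ℓ * tmat w * (inclV K κ' ℓ)ᵀ)) -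
    tvec (inclV K κ ℓ * tmat (HermForm.act (tensorHom J J' (x.2.2, x'.2.2)) (tvec (tmat w))) *
      (inclV K κ' ℓ)ᵀ)
  rw [act_tensorHom_tvec, act_tensorHom_tvec, tmat_tvec]
  dsimp only
  rw [Matrix.mul_assoc (inclV K κ ℓ) (tmat w),
    ← Matrix.mul_assoc _ (inclV K κ ℓ), hy, ← map_sub,
    Matrix.mul_assoc _ (tmat w * (inclV K κ' ℓ)ᵀ), Matrix.mul_assoc (tmat w), h1]
  congr 1
  simp only [Matrix.add_mul, Matrix.mul_add, Matrix.mul_assoc]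
  abel

/-- The stabilizer of the vector `t₀` of `X^∨ ⊗ X'` modulo `X ⊗ V' + V ⊗ X'`. -/
theorem act_inclXd_mul_transpose {x : (J.addHyperbolic ℓ).U × (GL (Fin ℓ) K × J.U)}
    (hx : x ∈ parabolic ℓ J) {x' : (J'.addHyperbolic ℓ).U × (GL (Fin ℓ) K × J'.U)}
    (hx' : x' ∈ parabolic ℓ J') (hxx : x'.2.1 = conjGL K (Fin ℓ) x.2.1) :
    ∃ y ∈ tensorXX K κ κ' ℓ,
      HermForm.act (tensorHom _ _ (x.1, x'.1)) (tvec (inclXd K κ ℓ * (inclX K κ' ℓ)ᵀ)) =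
        tvec (inclXd K κ ℓ * (inclX K κ' ℓ)ᵀ) + y ∧
      ((J.addHyperbolic ℓ).tensor (J'.addHyperbolic ℓ)).form
        (tvec (inclXd K κ ℓ * (inclX K κ' ℓ)ᵀ)) y = 0 := by
  obtain ⟨A, C, h⟩ := exists_parabolic_mul_inclXd hx
  have h1 : (inclX K κ' ℓ)ᵀ * (x'.1 : GL ((Fin ℓ ⊕ Fin ℓ) ⊕ κ') K).valᵀ =
      x'.2.1.valᵀ * (inclX K κ' ℓ)ᵀ := by
    rw [← Matrix.transpose_mul, hx'.1, Matrix.transpose_mul]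
  -- The correspondence of the GL-components under star is what makes the actions on X^∨ and on X'
  -- cancel.
  have h2 : (x.2.1⁻¹).valᴴ * x'.2.1.valᵀ = 1 := by
    have h3 : x'.2.1.valᵀ = x.2.1.valᴴ := by
      rw [hxx, coe_conjGL]; rfl
    rw [h3, ← Matrix.conjTranspose_mul, Units.mul_inv, Matrix.conjTranspose_one]
  refine ⟨tvec ((inclX K κ ℓ * A * x'.2.1.valᵀ + inclV K κ ℓ * C * x'.2.1.valᵀ) *
    (inclX K κ' ℓ)ᵀ), mem_tensorXX.2 ⟨A * x'.2.1.valᵀ * (inclX K κ' ℓ)ᵀ, C * x'.2.1.valᵀ, ?_⟩, ?_,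
    form_mul_transpose_inclX J J' _ _⟩
  · simp only [Matrix.add_mul, Matrix.mul_assoc]
  · rw [act_tensorHom_tvec]
    dsimp only
    rw [← map_add, ← Matrix.mul_assoc, h, Matrix.mul_assoc _ (inclX K κ' ℓ)ᵀ, h1]
    congr 1
    have h4 : inclXd K κ ℓ * (x.2.1⁻¹).valᴴ * (x'.2.1.valᵀ * (inclX K κ' ℓ)ᵀ) =
        inclXd K κ ℓ * (inclX K κ' ℓ)ᵀ := by
      rw [← Matrix.mul_assoc, Matrix.mul_assoc (inclXd K κ ℓ), h2, Matrix.mul_one]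
    rw [Matrix.add_mul, Matrix.add_mul, h4]
    simp only [Matrix.add_mul, Matrix.mul_assoc]
    abel

end Both

end TensorSubspaces

/-! ### Isotropic vectors in the Heisenberg group. -/

section Isotropic

variable {K ι : Type*} [Field K] [StarRing K] [Fintype ι] [DecidableEq ι]

theorem Heisenberg.ofIsotropic_mul {J : HermForm K ι} {v w : ι → K} (hv : J.form v v = 0)
    (hw : J.form w w = 0) (hvw : J.form v w = 0) (h : J.form (v + w) (v + w) = 0) :
    ofIsotropic v hv * ofIsotropic w hw = ofIsotropic (v + w) h := by
  ext1
  · rfl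
  · change 0 + 0 + J.form v w = 0
    rw [hvw, add_zero, add_zero]

theorem Heisenberg.smul_ofIsotropic {J : HermForm K ι} (g : J.U) {v : ι → K}
    (hv : J.form v v = 0) : g • ofIsotropic v hv =
      ofIsotropic (HermForm.act g v) (by rw [HermForm.form_act, hv]) := rfl

variable [Fintype K] {S : Type*} [AddCommGroup S] [Module ℂ S] {J : HermForm K ι}
  (ρ : Representation ℂ (Heisenberg J) S) {Y : Submodule K (ι → K)} (hY : Y ≤ J.perp Y)

theorem isotropicAvg_mul_isotropicAvg_of_le {L : Submodule K (ι → K)} (hL : L ≤ J.perp L)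
    (h : L ≤ Y) : isotropicAvg ρ hY * isotropicAvg ρ hL = isotropicAvg ρ hY := by
  classical
  have hc : (Nat.card L : ℂ) ≠ 0 := by exact_mod_cast Nat.card_pos.ne'
  rw [isotropicAvg.eq_def ρ hL, mul_smul_comm, Finset.mul_sum,
    Finset.sum_congr rfl fun y _ => isotropicAvg_mul_apply ρ hY (h y.2), Finset.sum_const,
    Finset.card_univ, ← Nat.card_eq_fintype_card, ← Nat.cast_smul_eq_nsmul ℂ, smul_smul,
    inv_mul_cancel₀ hc, one_smul]

end Isotropic

/-! ### Projection of the large Weil representation onto the small one. -/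

section DualPairRestriction

variable {K : Type*} [Field K] [StarRing K] {κ β : Type*} [Fintype κ] [DecidableEq κ]
  [Fintype β] [DecidableEq β] {ℓ : ℕ}

/-- The element of the Heisenberg group given by a vector of `X^∨ ⊗ V'`. -/
def Heisenberg.dual (J : HermForm K κ) (J' : HermForm K β) (B : Matrix (Fin ℓ) β K) :
    Heisenberg ((J.addHyperbolic ℓ).tensor J') :=
  ofIsotropic (tvec (inclXd K κ ℓ * B)) (form_inclXd_inclXd J J' B B)

variable [Fintype K] (q : ℕ) [hK : QuadraticStar q K] {ψ : AddChar (skewAdjoint K) ℂ} (hψ : ψ ≠ 1)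

/-- The dual pair intertwines the Heisenberg representation with its twist. -/
theorem dualPairRep_mul_apply {J : HermForm K κ} {J' : HermForm K β} {S : Type*} [AddCommGroup S]
    [Module ℂ S] [FiniteDimensional ℂ S]
    {η : Representation ℂ (Heisenberg (J.tensor J')) S} (hη : IsHeisenbergRep ψ η)
    (x : J.U × J'.U) (h : Heisenberg (J.tensor J')) :
    dualPairRep q hψ hη x * η h = η (tensorHom J J' x • h) * dualPairRep q hψ hη x :=
  weilRep_mul_apply q hψ hη _ h

/-- The elements of the parabolic subgroup that act trivially on `V` fix the vectors fixed by
`X ⊗ V'`. -/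
theorem dualPairRep_mul_isotropicAvg {J : HermForm K κ} {J' : HermForm K β} {S : Type*}
    [AddCommGroup S] [Module ℂ S] [FiniteDimensional ℂ S]
    {η : Representation ℂ (Heisenberg ((J.addHyperbolic ℓ).tensor J')) S}
    (hη : IsHeisenbergRep ψ η) {x : (J.addHyperbolic ℓ).U × (GL (Fin ℓ) K × J.U)}
    (hx : x ∈ parabolic ℓ J) (hb : x.2.2 = 1) :
    dualPairRep q hψ hη (x.1, 1) * isotropicAvg η (tensorX_le_perp J J') =
      isotropicAvg η (tensorX_le_perp J J') := by
  -- An auxiliary Heisenberg representation of V ⊗ V', needed to apply the restriction theorem with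
  -- trivial action on Y^⊥ / Y.
  obtain ⟨n, ρ, hρ⟩ := exists_isHeisenbergRep (J.tensor J') ψ
  have hdim : Fintype.card (((Fin ℓ ⊕ Fin ℓ) ⊕ κ) × β) = Fintype.card (κ × β) +
      2 * Module.finrank K (tensorX K κ ℓ β) := by
    rw [finrank_tensorX]
    simp only [Fintype.card_prod, Fintype.card_sum, Fintype.card_fin]
    ring
  have hi := form_tensorEmb (ℓ := ℓ) J J'
  have hiY : ∀ v, tensorEmb K κ ℓ β v ∈ ((J.addHyperbolic ℓ).tensor J').perp (tensorX K κ ℓ β) :=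
    fun v => tvec_inclV_mem_perp J J' (tmat v)
  obtain ⟨Ψ, pr, h1, h2, h3⟩ := exists_heisenberg_fixed q hψ hρ hη hi (tensorX_le_perp J J') hiY
    hdim
  have h4 := weilRep_comp_fixed q hψ hρ hη hi (tensorX_le_perp J J') hiY hdim h1 h2 h3
    (g := tensorHom _ J' (x.1, 1)) (g₀ := 1) (act_mem_tensorX hx 1) (act_tensorEmb_sub_mem hx hb)
  rw [map_one] at h4
  rw [← h2]
  change (weilRep q hψ hη _ ∘ₗ Ψ) ∘ₗ pr = _
  rw [h4]
  rfl

variable {κ' : Type*} [Fintype κ'] [DecidableEq κ'] {J : HermForm K κ} {J' : HermForm K κ'}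
  {S₀ S₁ : Type*} [AddCommGroup S₀] [Module ℂ S₀] [FiniteDimensional ℂ S₀]
  [AddCommGroup S₁] [Module ℂ S₁] [FiniteDimensional ℂ S₁]
  {η₀ : Representation ℂ (Heisenberg (J.tensor J')) S₀} (hη₀ : IsHeisenbergRep ψ η₀)
  {η₁ : Representation ℂ (Heisenberg ((J.addHyperbolic ℓ).tensor (J'.addHyperbolic ℓ))) S₁}
  (hη₁ : IsHeisenbergRep ψ η₁)

/-- The projection of the Weil representation of the large dual pair onto a copy of the Weil
representation of the small one. -/
theorem exists_dualPairRep_projection : ∃ (lam : S₁ →ₗ[ℂ] S₀) (mu : S₀ →ₗ[ℂ] S₁),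
    lam ∘ₗ mu = LinearMap.id ∧
    mu ∘ₗ lam = η₁ (Heisenberg.dual J _ (inclX K κ' ℓ)ᵀ) * isotropicAvg η₁ (tensorXX_le_perp J J') *
      η₁ (Heisenberg.dual J _ (inclX K κ' ℓ)ᵀ)⁻¹ ∧
    ∀ (x : (J.addHyperbolic ℓ).U × (GL (Fin ℓ) K × J.U))
      (x' : (J'.addHyperbolic ℓ).U × (GL (Fin ℓ) K × J'.U)), x ∈ parabolic ℓ J →
      x' ∈ parabolic ℓ J' → x'.2.1 = conjGL K (Fin ℓ) x.2.1 →
      dualPairRep q hψ hη₁ (x.1, x'.1) ∘ₗ mu = mu ∘ₗ dualPairRep q hψ hη₀ (x.2.2, x'.2.2) ∧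
      lam ∘ₗ dualPairRep q hψ hη₁ (x.1, x'.1) = dualPairRep q hψ hη₀ (x.2.2, x'.2.2) ∘ₗ lam := by
  have hdim : Fintype.card (((Fin ℓ ⊕ Fin ℓ) ⊕ κ) × ((Fin ℓ ⊕ Fin ℓ) ⊕ κ')) =
      Fintype.card (κ × κ') + 2 * Module.finrank K (tensorXX K κ κ' ℓ) := by
    rw [finrank_tensorXX]
    simp only [Fintype.card_prod, Fintype.card_sum, Fintype.card_fin]
    ring
  have hi := form_tensorEmb₂ (ℓ := ℓ) J J'
  have hiY := tensorEmb₂_mem_perp (ℓ := ℓ) J J'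
  have hY := tensorXX_le_perp (ℓ := ℓ) J J'
  obtain ⟨Ψ, pr, h1, h2, h3⟩ := exists_heisenberg_fixed q hψ hη₀ hη₁ hi hY hiY hdim
  obtain ⟨t, ht⟩ : ∃ t, t = Heisenberg.dual J (J'.addHyperbolic ℓ) (inclX K κ' ℓ)ᵀ := ⟨_, rfl⟩
  rw [← ht]
  have ht1 : η₁ t⁻¹ ∘ₗ η₁ t = LinearMap.id := by
    change η₁ t⁻¹ * η₁ t = 1
    rw [← map_mul, inv_mul_cancel, map_one]
  have hPsi : isotropicAvg η₁ hY ∘ₗ Ψ = Ψ := by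
    rw [← h2, LinearMap.comp_assoc, h1, LinearMap.comp_id]
  have hlm : (pr ∘ₗ η₁ t⁻¹) ∘ₗ (η₁ t ∘ₗ Ψ) = LinearMap.id := by
    rw [LinearMap.comp_assoc, ← LinearMap.comp_assoc _ _ (η₁ t⁻¹), ht1, LinearMap.id_comp, h1]
  have hml : (η₁ t ∘ₗ Ψ) ∘ₗ (pr ∘ₗ η₁ t⁻¹) = η₁ t * isotropicAvg η₁ hY * η₁ t⁻¹ := by
    rw [← h2]
    rfl
  -- The projection evaluates at the point t of X^∨ ⊗ X', and the section places a vector there.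
  refine ⟨pr ∘ₗ η₁ t⁻¹, η₁ t ∘ₗ Ψ, hlm, hml, fun x x' hx hx' hxx => ?_⟩
  obtain ⟨W, hW⟩ : ∃ W, W = dualPairRep q hψ hη₁ (x.1, x'.1) := ⟨_, rfl⟩
  have hY' := act_mem_tensorXX hx hx'
  have hΨ' : W ∘ₗ Ψ = Ψ ∘ₗ dualPairRep q hψ hη₀ (x.2.2, x'.2.2) := hW ▸
    weilRep_comp_fixed q hψ hη₀ hη₁ hi hY hiY hdim h1 h2 h3 hY' (act_tensorEmb₂_sub_mem hx hx')
  have hWe : W * isotropicAvg η₁ hY = isotropicAvg η₁ hY * W := hW ▸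
    isotropicAvg_mul_comm_of_mem η₁ hY hY' (dualPairRep_mul_apply q hψ hη₁ _)
  -- The pair moves t only by an element of Y orthogonal to t, and the average over Y absorbs that
  -- element.
  obtain ⟨y, hy, hty, hform⟩ := act_inclXd_mul_transpose hx hx' hxx
  obtain ⟨z, hz⟩ : ∃ z, z = Heisenberg.ofIsotropic y (hY hy y hy) := ⟨_, rfl⟩
  have hsmul : tensorHom _ _ (x.1, x'.1) • t = t * z := by
    rw [ht, hz, Heisenberg.dual, Heisenberg.smul_ofIsotropic,
      Heisenberg.ofIsotropic_mul _ _ hform (by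
        rw [HermForm.form_add_left, HermForm.form_add_right, HermForm.form_add_right, hform,
          ← HermForm.star_form _ _ y, hform, form_inclXd_inclXd, hY hy y hy]
        simp)]
    ext1
    · exact hty
    · rfl
  have hWt : W * η₁ t = η₁ t * η₁ z * W := by
    rw [hW, dualPairRep_mul_apply, hsmul, map_mul]
  have hze : η₁ z * isotropicAvg η₁ hY = isotropicAvg η₁ hY := hz ▸ apply_mul_isotropicAvg η₁ hY hy
  have hez : isotropicAvg η₁ hY * η₁ z = isotropicAvg η₁ hY := hz ▸ isotropicAvg_mul_apply η₁ hY hy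
  have hWmu : W ∘ₗ η₁ t ∘ₗ Ψ = (η₁ t ∘ₗ Ψ) ∘ₗ dualPairRep q hψ hη₀ (x.2.2, x'.2.2) := by
    calc W ∘ₗ η₁ t ∘ₗ Ψ = (W * η₁ t) ∘ₗ Ψ := rfl
      _ = η₁ t ∘ₗ η₁ z ∘ₗ (W ∘ₗ Ψ) := by rw [hWt]; rfl
      _ = η₁ t ∘ₗ (η₁ z * isotropicAvg η₁ hY) ∘ₗ Ψ ∘ₗ dualPairRep q hψ hη₀ (x.2.2, x'.2.2) := by
        rw [hΨ']
        conv_lhs => rw [← hPsi]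
        rfl
      _ = η₁ t ∘ₗ (isotropicAvg η₁ hY ∘ₗ Ψ) ∘ₗ dualPairRep q hψ hη₀ (x.2.2, x'.2.2) := by
        rw [hze]; rfl
      _ = _ := by rw [hPsi]; rfl
  have hWE : W * (η₁ t * isotropicAvg η₁ hY * η₁ t⁻¹) =
      (η₁ t * isotropicAvg η₁ hY * η₁ t⁻¹) * W := by
    have ht2 : η₁ t * η₁ t⁻¹ = 1 := by rw [← map_mul, mul_inv_cancel, map_one]
    have ht3 : η₁ t⁻¹ * η₁ t = 1 := ht1
    calc W * (η₁ t * isotropicAvg η₁ hY * η₁ t⁻¹) = (W * η₁ t) * isotropicAvg η₁ hY * η₁ t⁻¹ := by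
          simp only [mul_assoc]
      _ = η₁ t * η₁ z * (W * isotropicAvg η₁ hY) * η₁ t⁻¹ := by rw [hWt]; simp only [mul_assoc]
      _ = η₁ t * (η₁ z * isotropicAvg η₁ hY) * W * η₁ t⁻¹ := by rw [hWe]; simp only [mul_assoc]
      _ = η₁ t * isotropicAvg η₁ hY * W * η₁ t⁻¹ := by rw [hze]
      _ = η₁ t * (isotropicAvg η₁ hY * η₁ z) * (W * η₁ t⁻¹) := by rw [hez]; simp only [mul_assoc]
      _ = η₁ t * isotropicAvg η₁ hY * η₁ t⁻¹ * (η₁ t * η₁ z * W) * η₁ t⁻¹ := by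
          rw [mul_assoc (η₁ t) (η₁ z) W, mul_assoc _ (η₁ t⁻¹), ← mul_assoc (η₁ t⁻¹) (η₁ t), ht3]
          simp only [mul_assoc, one_mul]
      _ = _ := by rw [← hWt]; simp only [mul_assoc, ht2, mul_one]
  rw [← hW]
  refine ⟨hWmu, ?_⟩
  calc (pr ∘ₗ η₁ t⁻¹) ∘ₗ W = ((pr ∘ₗ η₁ t⁻¹) ∘ₗ (η₁ t ∘ₗ Ψ)) ∘ₗ (pr ∘ₗ η₁ t⁻¹) ∘ₗ W := by
        rw [hlm, LinearMap.id_comp]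
    _ = (pr ∘ₗ η₁ t⁻¹) ∘ₗ ((η₁ t * isotropicAvg η₁ hY * η₁ t⁻¹) * W) := by rw [← hml]; rfl
    _ = (pr ∘ₗ η₁ t⁻¹) ∘ₗ (W ∘ₗ η₁ t ∘ₗ Ψ) ∘ₗ (pr ∘ₗ η₁ t⁻¹) := by rw [← hWE, ← hml]; rfl
    _ = ((pr ∘ₗ η₁ t⁻¹) ∘ₗ (η₁ t ∘ₗ Ψ)) ∘ₗ dualPairRep q hψ hη₀ (x.2.2, x'.2.2) ∘ₗ
        (pr ∘ₗ η₁ t⁻¹) := by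
        rw [hWmu]; rfl
    _ = _ := by rw [hlm, LinearMap.id_comp]

end DualPairRestriction

/-! ### Vanishing from nontrivial commutators. -/

section CommutatorVanishing

variable {K ι : Type*} [Field K] [Fintype K] [StarRing K] [Fintype ι] [DecidableEq ι]
  {S : Type*} [AddCommGroup S] [Module ℂ S]

/-- Elements of the Heisenberg group that do not centralize `Y` move the vectors fixed by `Y` to
vectors with average zero. -/
theorem IsHeisenbergRep.isotropicAvg_mul_mul (q : ℕ) [QuadraticStar q K] {J : HermForm K ι}
    {ψ : AddChar (skewAdjoint K) ℂ} (hψ : ψ ≠ 1) {ρ : Representation ℂ (Heisenberg J) S}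
    (hρ : IsHeisenbergRep ψ ρ) {Y : Submodule K (ι → K)} (hY : Y ≤ J.perp Y) {h : Heisenberg J}
    (hh : h.vec ∉ J.perp Y) : isotropicAvg ρ hY * ρ h * isotropicAvg ρ hY = 0 := by
  obtain ⟨z, hz⟩ := AddChar.ne_one_iff.1 hψ
  obtain ⟨a, ha⟩ := exists_sub_star_eq q (skewAdjoint.mem_iff.1 z.2)
  obtain ⟨v, hv, hvh⟩ : ∃ v ∈ Y, J.form v h.vec ≠ 0 := by
    by_contra! h1
    exact hh (HermForm.mem_perp.2 h1)
  -- Scaled so that the commutator of y and h is the central element z, on which ψ is not 1. The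
  -- averages absorb y, so the product equals ψ(z) times itself.
  obtain ⟨y, hy, hyh⟩ : ∃ y ∈ Y, J.form y h.vec = a :=
    ⟨(a / J.form v h.vec) • v, Y.smul_mem _ hv, by rw [J.form_smul_left, div_mul_cancel₀ _ hvh]⟩
  obtain ⟨e, he⟩ : ∃ e, e = isotropicAvg ρ hY := ⟨_, rfl⟩
  have h1 := apply_mul_isotropicAvg ρ hY hy
  have h2 := isotropicAvg_mul_apply ρ hY hy
  obtain ⟨u, hu⟩ : ∃ u, u = Heisenberg.ofIsotropic y (hY hy y hy) := ⟨_, rfl⟩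
  rw [← hu, ← he] at h1 h2
  rw [← he]
  have h3 : u * h = Heisenberg.center J z * (h * u) := by
    rw [hu]
    ext1
    · simp [Heisenberg.mul_vec, Heisenberg.center, Heisenberg.ofIsotropic, add_comm]
    · simp only [Heisenberg.mul_ctr, Heisenberg.center, Heisenberg.ofIsotropic, hyh,
        J.form_zero_left, ← ha]
      rw [← J.star_form, hyh]
      ring
  have h4 : ρ u * ρ h = ψ z • (ρ h * ρ u) := by
    rw [← map_mul, h3, map_mul, map_mul]
    ext s
    exact hρ.central z _
  have h5 : e * ρ h * e = ψ z • (e * ρ h * e) := by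
    calc e * ρ h * e = e * ρ u * ρ h * e := by rw [h2]
      _ = e * (ρ u * ρ h) * e := by simp only [mul_assoc]
      _ = ψ z • (e * ρ h * (ρ u * e)) := by
        rw [h4, mul_smul_comm, smul_mul_assoc]
        simp only [mul_assoc]
      _ = _ := by rw [h1]
  have h6 : (1 - ψ z) • (e * ρ h * e) = 0 := by
    rw [sub_smul, one_smul, ← h5, sub_self]
  exact (smul_eq_zero.1 h6).resolve_left (sub_ne_zero.2 (Ne.symm hz))

theorem isotropicAvg_mul_isotropicAvg_of_ge {J : HermForm K ι}
    (ρ : Representation ℂ (Heisenberg J) S) {Y L : Submodule K (ι → K)} (hY : Y ≤ J.perp Y)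
    (hL : L ≤ J.perp L) (h : L ≤ Y) :
    isotropicAvg ρ hL * isotropicAvg ρ hY = isotropicAvg ρ hY :=
  LinearMap.ext fun s => (isProj_isotropicAvg ρ hL).map_id _ fun y hy =>
    (isProj_isotropicAvg ρ hY).map_mem s y (h hy)

end CommutatorVanishing

/-! ### Elements of the parabolic subgroup. -/

section ParabolicElements

variable {K κ : Type*} [Field K] [StarRing K] [Fintype κ] [DecidableEq κ] {ℓ : ℕ}

theorem exists_levi_mem_parabolic (J : HermForm K κ) (a : GL (Fin ℓ) K) (b : J.U) :
    ∃ p : (J.addHyperbolic ℓ).U, (p, (a, b)) ∈ parabolic ℓ J ∧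
      (p : GL ((Fin ℓ ⊕ Fin ℓ) ⊕ κ) K).val * inclXd K κ ℓ = inclXd K κ ℓ * (a⁻¹).valᴴ := by
  have hb := HermForm.U_conjTranspose_mul b
  have ha : a⁻¹.val * a.val = 1 := Units.inv_mul a
  have ha' : a.valᴴ * (a⁻¹).valᴴ = 1 := by
    rw [← Matrix.conjTranspose_mul, ha, Matrix.conjTranspose_one]
  refine ⟨(J.addHyperbolic ℓ).ofMatrix
    (Matrix.fromBlocks (Matrix.fromBlocks a.val 0 0 (a⁻¹).valᴴ) 0 0 (b : GL κ K).val) ?_,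
    ⟨?_, 0, ?_⟩, ?_⟩
  · obtain ⟨a', ha''⟩ : ∃ a', a' = a⁻¹.val := ⟨_, rfl⟩
    rw [← ha''] at ha ha' ⊢
    rw [J.gram_addHyperbolic]
    simp [Matrix.fromBlocks_conjTranspose, Matrix.fromBlocks_multiply, hb, ha, ha']
  · rw [HermForm.coe_ofMatrix, inclX, Matrix.fromBlocks_mul_fromRows,
      Matrix.fromBlocks_mul_fromRows,
      Matrix.fromRows_mul, Matrix.fromRows_mul]
    simp
  · rw [HermForm.coe_ofMatrix, inclV, Matrix.fromBlocks_mul_fromRows, Matrix.fromRows_mul]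
    simp
  · rw [HermForm.coe_ofMatrix, inclXd, Matrix.fromBlocks_mul_fromRows,
      Matrix.fromBlocks_mul_fromRows, Matrix.fromRows_mul, Matrix.fromRows_mul]
    simp

/-- The condition on y and z says that the image of X^∨ remains isotropic; the entry mapping V to X
is then forced by orthogonality. -/
theorem exists_unipotent_mem_parabolic (J : HermForm K κ) (y : Matrix κ (Fin ℓ) K)
    (z : Matrix (Fin ℓ) (Fin ℓ) K) (h : z + zᴴ + yᴴ * J.gram * y = 0) :
    ∃ p : (J.addHyperbolic ℓ).U, (p, (1, 1)) ∈ parabolic ℓ J ∧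
      (p : GL ((Fin ℓ ⊕ Fin ℓ) ⊕ κ) K).val * inclXd K κ ℓ =
        inclXd K κ ℓ + inclV K κ ℓ * y + inclX K κ ℓ * z := by
  have hJ := J.isHermitian.eq
  refine ⟨(J.addHyperbolic ℓ).ofMatrix
    (Matrix.fromBlocks (Matrix.fromBlocks 1 z 0 1) (Matrix.fromRows (-(yᴴ * J.gram)) 0)
      (Matrix.fromCols 0 y) 1) ?_, ⟨?_, -(yᴴ * J.gram), ?_⟩, ?_⟩
  · rw [J.gram_addHyperbolic]
    simp only [Matrix.fromBlocks_conjTranspose, Matrix.fromBlocks_multiply,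
      Matrix.conjTranspose_fromRows_eq_fromCols_conjTranspose,
      Matrix.conjTranspose_fromCols_eq_fromRows_conjTranspose, Matrix.mul_zero, Matrix.zero_mul,
      add_zero, zero_add, Matrix.fromBlocks_mul_fromRows, Matrix.fromCols_mul_fromBlocks,
      Matrix.fromCols_mul_fromRows, Matrix.mul_fromCols, Matrix.fromRows_mul,
      Matrix.conjTranspose_one, Matrix.conjTranspose_zero, Matrix.mul_one, Matrix.one_mul,
      Matrix.conjTranspose_neg, Matrix.conjTranspose_mul, Matrix.conjTranspose_conjTranspose, hJ]
    rw [Matrix.fromBlocks_inj]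
    refine ⟨?_, ?_, ?_, rfl⟩
    · ext (i | i) (j | j)
      · simp
      · simp
      · simp
      · exact (congrFun (congrFun h i) j)
    · ext (i | i) j <;> simp
    · ext i (j | j) <;> simp
  · rw [HermForm.coe_ofMatrix, inclX, Matrix.fromBlocks_mul_fromRows,
      Matrix.fromBlocks_mul_fromRows,
      Matrix.fromCols_mul_fromRows]
    simp
  · rw [HermForm.coe_ofMatrix, inclV, inclX, Matrix.fromBlocks_mul_fromRows]
    ext ((i | i) | i) j <;> simp
  · rw [HermForm.coe_ofMatrix, inclXd, inclV, inclX, Matrix.fromBlocks_mul_fromRows,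
      Matrix.fromBlocks_mul_fromRows, Matrix.fromCols_mul_fromRows]
    ext ((i | i) | i) j <;> simp

/-- The stabilizer of a subspace `X` with prescribed action lies in the parabolic subgroup. -/
theorem exists_mem_parabolic_of_mul_inclX {J : HermForm K κ} {p : (J.addHyperbolic ℓ).U}
    {a : GL (Fin ℓ) K}
    (h : (p : GL ((Fin ℓ ⊕ Fin ℓ) ⊕ κ) K).val * inclX K κ ℓ = inclX K κ ℓ * a.val) :
    ∃ b, (p, (a, b)) ∈ parabolic ℓ J := by
  obtain ⟨y, B, C, hV⟩ := exists_frame_decomposition ℓ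
    ((p : GL ((Fin ℓ ⊕ Fin ℓ) ⊕ κ) K).val * inclV K κ ℓ)
  obtain ⟨P, hP⟩ : ∃ P, P = (p : GL ((Fin ℓ ⊕ Fin ℓ) ⊕ κ) K).val := ⟨_, rfl⟩
  have hp := HermForm.U_conjTranspose_mul p
  rw [← hP] at h hV hp
  -- The image of V stays orthogonal to the image of X, which is X, so it has no component along
  -- X^∨.
  have hB : B = 0 := by
    have h1 : a.valᴴ * B = 0 := by
      calc a.valᴴ * B = a.valᴴ * ((inclX K κ ℓ)ᴴ * (J.addHyperbolic ℓ).gram *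
            (inclX K κ ℓ * y + inclXd K κ ℓ * B + inclV K κ ℓ * C)) := by
            rw [Matrix.mul_add ((inclX K κ ℓ)ᴴ * _), Matrix.mul_add ((inclX K κ ℓ)ᴴ * _),
              ← Matrix.mul_assoc _ _ y, ← Matrix.mul_assoc _ _ B, ← Matrix.mul_assoc _ _ C,
                gram_inclX_inclX, gram_inclX_inclXd, gram_inclX_inclV]
            simp
        _ = (inclX K κ ℓ * a.val)ᴴ * (J.addHyperbolic ℓ).gram * (P * inclV K κ ℓ) := by
            rw [hV]
            simp only [Matrix.conjTranspose_mul, Matrix.mul_assoc]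
        _ = (inclX K κ ℓ)ᴴ * (Pᴴ * (J.addHyperbolic ℓ).gram * P) * inclV K κ ℓ := by
            rw [← h]
            simp only [Matrix.conjTranspose_mul, Matrix.mul_assoc]
        _ = 0 := by rw [hp, gram_inclX_inclV]
    have h2 : (a⁻¹).valᴴ * a.valᴴ = 1 := by
      rw [← Matrix.conjTranspose_mul, Units.mul_inv, Matrix.conjTranspose_one]
    rw [← Matrix.one_mul B, ← h2, Matrix.mul_assoc, h1, Matrix.mul_zero]
  rw [hB, Matrix.mul_zero, add_zero] at hV
  have hC : Cᴴ * J.gram * C = J.gram := by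
    have h1 : (inclX K κ ℓ * y + inclV K κ ℓ * C)ᴴ * (J.addHyperbolic ℓ).gram *
        (inclX K κ ℓ * y + inclV K κ ℓ * C) = J.gram := by
      rw [← hV, ← gram_inclV_inclV ℓ J]
      conv_rhs => rw [← hp]
      simp only [Matrix.conjTranspose_mul, Matrix.mul_assoc]
    have h2 : (inclX K κ ℓ * y + inclV K κ ℓ * C)ᴴ * (J.addHyperbolic ℓ).gram *
        (inclX K κ ℓ * y + inclV K κ ℓ * C) =
        yᴴ * ((inclX K κ ℓ)ᴴ * (J.addHyperbolic ℓ).gram * inclX K κ ℓ) * y +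
        yᴴ * ((inclX K κ ℓ)ᴴ * (J.addHyperbolic ℓ).gram * inclV K κ ℓ) * C +
        Cᴴ * ((inclV K κ ℓ)ᴴ * (J.addHyperbolic ℓ).gram * inclX K κ ℓ) * y +
        Cᴴ * ((inclV K κ ℓ)ᴴ * (J.addHyperbolic ℓ).gram * inclV K κ ℓ) * C := by
      simp only [Matrix.conjTranspose_add, Matrix.conjTranspose_mul, Matrix.add_mul, Matrix.mul_add,
        Matrix.mul_assoc]
      abel
    rw [h1, gram_inclX_inclX, gram_inclX_inclV, gram_inclV_inclX, gram_inclV_inclV] at h2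
    simpa using h2.symm
  refine ⟨J.ofMatrix C hC, hP ▸ h, y, ?_⟩
  rw [HermForm.coe_ofMatrix]
  dsimp only
  rw [← hP, hV, add_comm]

end ParabolicElements

/-! ### Cuspidal representations and stabilizers of degenerate matrices. -/

section Cuspidal

variable {K : Type*} [Field K] {ℓ : ℕ}

/-- Replace a column of the identity by z at a position where z does not vanish, then swap columns;
the determinant is that entry up to sign. -/
theorem exists_GL_mulVec_single {n : ℕ} {z : Fin n → K} (hz : z ≠ 0) (i₀ : Fin n) :
    ∃ c : GL (Fin n) K, ∀ i, c.val i i₀ = z i := by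
  obtain ⟨i, hi⟩ := Function.ne_iff.1 hz
  have hdet : (((1 : Matrix (Fin n) (Fin n) K).updateCol i z).submatrix id
      (Equiv.swap i₀ i)).det ≠ 0 := by
    rw [Matrix.det_permute', ← Matrix.cramer_apply, Matrix.cramer_one]
    refine mul_ne_zero ?_ hi
    rcases Int.units_eq_one_or (Equiv.Perm.sign (Equiv.swap i₀ i)) with h | h <;> simp [h]
  refine ⟨Matrix.GeneralLinearGroup.mkOfDetNeZero _ hdet, fun j => ?_⟩
  change ((1 : Matrix (Fin n) (Fin n) K).updateCol i z) j (Equiv.swap i₀ i i₀) = z j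
  rw [Equiv.swap_apply_left, Matrix.updateCol_self]

variable {T : Type*} [AddCommGroup T] [Module ℂ T] {τ : Representation ℂ (GL (Fin ℓ) K) T}

/-- A nontrivial cuspidal representation has no nonzero vector fixed by the stabilizer of a
degenerate matrix. -/
theorem IsCuspidal.eq_zero_of_fixed [Fintype K] [StarRing K] (hτ : IsCuspidal τ)
    (hτ_nontrivial : ℓ = 1 → ∃ g, τ g ≠ 1) {β : Type*} {M : Matrix β (Fin ℓ) K}
    {z : Fin ℓ → K} (hz : z ≠ 0) (hMz : M *ᵥ z = 0) {t : T}
    (ht : ∀ a : GL (Fin ℓ) K, M * a.val = M → τ a t = t) : t = 0 := by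
  have hirr := hτ.irreducible
  rcases Nat.lt_trichotomy ℓ 1 with hℓ | rfl | hℓ
  · exact absurd (funext fun i => absurd i.2 (by omega)) hz
  · have hM : M = 0 := by
      ext i j
      have h1 := congrFun hMz i
      have hz0 : z 0 ≠ 0 := fun h => hz (funext fun k => by rw [Subsingleton.elim k 0, h]; rfl)
      simp only [Matrix.mulVec, dotProduct, Fin.sum_univ_one, Pi.zero_apply] at h1
      rw [Subsingleton.elim j 0]
      exact (mul_eq_zero.1 h1).resolve_right hz0
    have ht' : ∀ a, τ a t = t := fun a => ht a (by rw [hM, Matrix.zero_mul])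
    -- For ℓ = 1 the cuspidality condition is empty. The fixed vectors form a subrepresentation of
    -- the irreducible `τ`, and it is zero because `τ` is nontrivial.
    let N : Subrepresentation τ :=
      ⟨{ carrier := {t | ∀ a, τ a t = t}
         add_mem' := fun ha hb x => by rw [map_add, ha x, hb x]
         zero_mem' := fun x => map_zero _
         smul_mem' := fun c s hs x => by rw [map_smul, hs x] },
       fun g s hs x => by
         have h1 : τ g s = s := hs g
         rw [h1]
         exact hs x⟩
    rcases eq_bot_or_eq_top N with h | h
    · have : t ∈ N := ht'
      rw [h] at this
      exact (Submodule.mem_bot ℂ).1 this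
    · obtain ⟨g, hg⟩ := hτ_nontrivial rfl
      refine absurd (LinearMap.ext fun s => ?_) hg
      have : s ∈ N := h ▸ trivial
      exact this g
  -- With z as first column of c, the first column of M c vanishes. So the stabilizer, conjugated by
  -- c, contains the unipotent radical of the parabolic subgroup of type (1, ℓ − 1).
  · obtain ⟨c, hc⟩ := exists_GL_mulVec_single hz ⟨0, by omega⟩
    have h1 : τ c⁻¹ t = 0 := by
      refine hτ.cuspidal 1 one_pos hℓ _ fun u hu => ?_
      have h2 : τ (c * u * c⁻¹) t = t := by
        refine ht _ ?_
        have h3 : M * c.val * u.val = M * c.val := by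
          conv_rhs => rw [← Matrix.mul_one (M * c.val)]
          ext i j
          rw [Matrix.mul_apply, Matrix.mul_apply]
          refine Finset.sum_congr rfl fun k _ => ?_
          by_cases hk : k.val < 1
          · have h4 : (M * c.val) i k = 0 := by
              have hk0 : k = ⟨0, by omega⟩ := Fin.ext (by simpa using hk)
              have h5 := congrFun hMz i
              rw [Matrix.mul_apply, hk0]
              simpa only [Matrix.mulVec, dotProduct, hc, Pi.zero_apply] using h5
            rw [h4, zero_mul, zero_mul]
          · rw [hu k j fun h => hk h.1]
        rw [Units.val_mul, Units.val_mul, ← Matrix.mul_assoc, ← Matrix.mul_assoc, h3,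
          Matrix.mul_assoc, Units.mul_inv, Matrix.mul_one]
      rw [← Module.End.mul_apply, ← map_mul]
      have h6 : u * c⁻¹ = c⁻¹ * (c * u * c⁻¹) := by group
      rw [h6, map_mul, Module.End.mul_apply, h2]
    have h7 := congrArg (τ c) h1
    rwa [← Module.End.mul_apply, ← map_mul, mul_inv_cancel, map_one, map_zero] at h7

/-- A linear map on a nontrivial cuspidal representation that is invariant under the stabilizer of
a degenerate matrix vanishes. -/
theorem IsCuspidal.eq_zero_of_invariant [Fintype K] [StarRing K] (hτ : IsCuspidal τ)
    (hτ_nontrivial : ℓ = 1 → ∃ g, τ g ≠ 1) {β : Type*} {M : Matrix β (Fin ℓ) K}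
    {z : Fin ℓ → K} (hz : z ≠ 0) (hMz : M *ᵥ z = 0) {E : Type*} [AddCommGroup E] [Module ℂ E]
    (f : T →ₗ[ℂ] E) (hf : ∀ a : GL (Fin ℓ) K, M * a.val = M → ∀ t, f (τ a t) = f t) : f = 0 := by
  classical
  let H : Subgroup (GL (Fin ℓ) K) :=
    { carrier := {a | M * a.val = M}
      one_mem' := Matrix.mul_one M
      mul_mem' := fun {a b} ha hb => by
        change M * (a.val * b.val) = M
        rw [← Matrix.mul_assoc, show M * a.val = M from ha, show M * b.val = M from hb]
      inv_mem' := fun {a} ha => by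
        change M * a⁻¹.val = M
        conv_lhs => rw [← show M * a.val = M from ha]
        rw [Matrix.mul_assoc, Units.mul_inv, Matrix.mul_one] }
  have := Fintype.ofFinite H
  refine LinearMap.ext fun t => ?_
  -- The sum over the stabilizer is a fixed vector, hence zero, while `f` sends it to a nonzero
  -- multiple of `f t`.
  have h1 : ∑ a : H, τ a.1 t = 0 := by
    refine hτ.eq_zero_of_fixed hτ_nontrivial hz hMz fun a ha => ?_
    rw [map_sum]
    refine Fintype.sum_bijective (fun b : H => (⟨a, ha⟩ : H) * b) (Group.mulLeft_bijective _) _ _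
      fun b => ?_
    rw [Subgroup.coe_mul, map_mul, Module.End.mul_apply]
  have h2 := congrArg f h1
  rw [map_sum, map_zero, Finset.sum_congr rfl fun a _ => hf a.1 a.2 t, Finset.sum_const,
    Finset.card_univ, ← Nat.cast_smul_eq_nsmul ℂ] at h2
  exact (smul_eq_zero.1 h2).resolve_left (by exact_mod_cast Fintype.card_ne_zero)

end Cuspidal

/-! ### Full rank or degenerate. -/

section RankDichotomy

variable {K : Type*} [Field K] [StarRing K] {m β : Type*} [Fintype m] [DecidableEq m] [Fintype β]
  [DecidableEq β]

/-- A left inverse of an injective Bᴴ has as adjoint a right inverse of B. The first case is later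
handled by Witt's theorem, the second by cuspidality. -/
theorem exists_mul_eq_one_or_exists_mulVec_eq_zero (B : Matrix m β K) :
    (∃ R : Matrix β m K, B * R = 1) ∨ ∃ z : m → K, z ≠ 0 ∧ Bᴴ *ᵥ z = 0 := by
  by_cases h : LinearMap.ker (Matrix.toLin' Bᴴ) = ⊥
  · left
    obtain ⟨g, hg⟩ := LinearMap.exists_leftInverse_of_injective _ h
    refine ⟨(LinearMap.toMatrix' g)ᴴ, ?_⟩
    have h1 := congrArg LinearMap.toMatrix' hg
    rw [LinearMap.toMatrix'_comp, LinearMap.toMatrix'_toLin', LinearMap.toMatrix'_id] at h1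
    have h2 := congrArg Matrix.conjTranspose h1
    rwa [Matrix.conjTranspose_mul, Matrix.conjTranspose_conjTranspose, Matrix.conjTranspose_one]
      at h2
  · right
    obtain ⟨z, hz, hz0⟩ := (Submodule.ne_bot_iff _).1 h
    exact ⟨z, hz0, by simpa using hz⟩

end RankDichotomy

/-! ### Support of vectors invariant under the unipotent radical. -/

section UnipotentInvariants

set_option linter.unusedSectionVars false

variable {K : Type*} [Field K] [StarRing K] {κ β : Type*} [Fintype κ] [DecidableEq κ]
  [Fintype β] [DecidableEq β] {ℓ : ℕ}

/-- G = B J'ᵀ Bᴴ is hermitian and nonzero, so tr(D G) = a has a solution D, and z = Dᴴ − D works.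
This gives elements of the unipotent radical that act at B by a prescribed phase. -/
theorem exists_skew_trace_eq {J' : HermForm K β} {B : Matrix (Fin ℓ) β K}
    (hB : B * J'.gramᵀ * Bᴴ ≠ 0) (a : K) : ∃ z : Matrix (Fin ℓ) (Fin ℓ) K, z + zᴴ = 0 ∧
      Matrix.trace ((z * B)ᴴ * B * J'.gramᵀ) = a - star a := by
  obtain ⟨G, hG⟩ : ∃ G, G = B * J'.gramᵀ * Bᴴ := ⟨_, rfl⟩
  have hJ : J'.gramᵀᴴ = J'.gramᵀ := J'.isHermitian.transpose.eq
  have hGh : Gᴴ = G := by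
    rw [hG, Matrix.conjTranspose_mul, Matrix.conjTranspose_mul, Matrix.conjTranspose_conjTranspose,
      hJ, Matrix.mul_assoc]
  rw [← hG] at hB
  obtain ⟨i, j, hij⟩ : ∃ i j, G i j ≠ 0 := by
    by_contra! h
    exact hB (Matrix.ext h)
  obtain ⟨D, hD⟩ : ∃ D : Matrix (Fin ℓ) (Fin ℓ) K, Matrix.trace (D * G) = a :=
    ⟨Matrix.single j i (a / G i j), by
      rw [Matrix.trace_single_mul, smul_eq_mul, div_mul_cancel₀ _ hij]⟩
  refine ⟨Dᴴ - D, by simp, ?_⟩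
  calc Matrix.trace (((Dᴴ - D) * B)ᴴ * B * J'.gramᵀ) =
        Matrix.trace (Bᴴ * ((D - Dᴴ) * (B * J'.gramᵀ))) := by
        rw [Matrix.conjTranspose_mul, Matrix.conjTranspose_sub, Matrix.conjTranspose_conjTranspose]
        simp only [Matrix.mul_assoc]
    _ = Matrix.trace (D * G) - Matrix.trace (Gᴴ * D)ᴴ := by
        rw [Matrix.trace_mul_comm, Matrix.mul_assoc, ← hG, Matrix.conjTranspose_mul,
          Matrix.conjTranspose_conjTranspose, Matrix.sub_mul, Matrix.trace_sub]
    _ = a - star a := by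
        rw [Matrix.trace_conjTranspose, hGh, Matrix.trace_mul_comm G D, hD]

theorem form_inclV_mul_eq_zero (J : HermForm K κ) {J' : HermForm K β} {B : Matrix (Fin ℓ) β K}
    (hB : B * J'.gramᵀ * Bᴴ = 0) (y : Matrix κ (Fin ℓ) K) :
    ((J.addHyperbolic ℓ).tensor J').form (tvec (inclV K κ ℓ * (y * B)))
      (tvec (inclV K κ ℓ * (y * B))) = 0 := by
  rw [form_inclV_inclV]
  calc Matrix.trace ((y * B)ᴴ * J.gram * (y * B) * J'.gramᵀ) =
        Matrix.trace (Bᴴ * (yᴴ * J.gram * y * (B * J'.gramᵀ))) := by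
        rw [Matrix.conjTranspose_mul]
        simp only [Matrix.mul_assoc]
    _ = 0 := by
        rw [Matrix.trace_mul_comm, Matrix.mul_assoc, hB, Matrix.mul_zero, Matrix.trace_zero]

theorem act_tensorHom_one_tvec {J : HermForm K κ} {J' : HermForm K β} (p : J.U)
    (M : Matrix κ β K) : HermForm.act (tensorHom J J' (p, 1)) (tvec M) =
      tvec ((p : GL κ K).val * M) := by
  rw [act_tensorHom_tvec]
  congr 1
  simp

variable [Fintype K] (q : ℕ) [hK : QuadraticStar q K] {ψ : AddChar (skewAdjoint K) ℂ} (hψ : ψ ≠ 1)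
  {J : HermForm K κ} {J' : HermForm K β} {S : Type*} [AddCommGroup S] [Module ℂ S]
  [FiniteDimensional ℂ S] {η : Representation ℂ (Heisenberg ((J.addHyperbolic ℓ).tensor J')) S}
  (hη : IsHeisenbergRep ψ η)

/-- The averages of the translates of a vector are compatible with the action of the elements of
the parabolic subgroup that act trivially on `V`. -/
theorem isotropicAvg_apply_inv {x : (J.addHyperbolic ℓ).U × (GL (Fin ℓ) K × J.U)}
    (hx : x ∈ parabolic ℓ J) (hb : x.2.2 = 1) (h : Heisenberg ((J.addHyperbolic ℓ).tensor J'))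
    (s : S) : isotropicAvg η (tensorX_le_perp J J') (η h⁻¹ s) =
      isotropicAvg η (tensorX_le_perp J J') (η (tensorHom _ J' (x.1, 1) • h)⁻¹
        (dualPairRep q hψ hη (x.1, 1) s)) := by
  have h1 := dualPairRep_mul_isotropicAvg q hψ hη hx hb
  have h2 := isotropicAvg_mul_comm_of_mem η (tensorX_le_perp J J') (act_mem_tensorX hx 1)
    (dualPairRep_mul_apply q hψ hη (x.1, 1))
  have h3 := dualPairRep_mul_apply q hψ hη (x.1, 1) h⁻¹
  rw [smul_inv'] at h3
  conv_lhs => rw [← h1, h2]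
  rw [Module.End.mul_apply, ← Module.End.mul_apply (dualPairRep q hψ hη (x.1, 1)), h3]
  rfl

theorem isotropicAvg_apply_ofIsotropic_inv {y : ((Fin ℓ ⊕ Fin ℓ) ⊕ κ) × β → K}
    (hy : y ∈ tensorX K κ ℓ β) (hyy : ((J.addHyperbolic ℓ).tensor J').form y y = 0) (s : S) :
    isotropicAvg η (tensorX_le_perp J J') (η (Heisenberg.ofIsotropic y hyy)⁻¹ s) =
      isotropicAvg η (tensorX_le_perp J J') s := by
  have h1 := isotropicAvg_mul_apply η (tensorX_le_perp J J') hy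
  conv_lhs => rw [← h1]
  rw [Module.End.mul_apply, ← Module.End.mul_apply (η _) (η _), ← map_mul, mul_inv_cancel, map_one,
    Module.End.one_apply]

/-- The support of a vector invariant under the unipotent radical consists of isotropic maps. -/
theorem mul_gram_mul_eq_zero_of_isotropicAvg_ne_zero {s : S}
    (hs : ∀ p : (J.addHyperbolic ℓ).U, (p, (1, 1)) ∈ parabolic ℓ J →
      dualPairRep q hψ hη (p, 1) s = s) {B : Matrix (Fin ℓ) β K}
    (hB : isotropicAvg η (tensorX_le_perp J J') (η (Heisenberg.dual J J' B)⁻¹ s) ≠ 0) :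
    B * J'.gramᵀ * Bᴴ = 0 := by
  by_contra hG
  obtain ⟨c, hc⟩ := AddChar.ne_one_iff.1 hψ
  obtain ⟨a, ha⟩ := exists_sub_star_eq q (skewAdjoint.mem_iff.1 (-c).2)
  obtain ⟨z, hz, hza⟩ := exists_skew_trace_eq hG a
  -- This p fixes s and moves the point B by a vector of X ⊗ V' together with the central element c.
  -- So the value at B equals ψ(c)⁻¹ times itself, with ψ(c) ≠ 1.
  obtain ⟨p, hp, hpz⟩ := exists_unipotent_mem_parabolic J 0 z (by
    rw [hz, Matrix.mul_zero, add_zero])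
  rw [ha] at hza
  have hl : tvec (inclX K κ ℓ * (z * B)) ∈ tensorX K κ ℓ β := ⟨z * B, rfl⟩
  have h1 : tensorHom _ J' (p, 1) • Heisenberg.dual J J' B = Heisenberg.center _ c *
      (Heisenberg.dual J J' B * Heisenberg.ofIsotropic (tvec (inclX K κ ℓ * (z * B)))
        (form_inclX_inclX J J' _ _)) := by
    ext1
    · rw [Heisenberg.smul_vec, Heisenberg.mul_vec, Heisenberg.mul_vec]
      change HermForm.act _ (tvec (inclXd K κ ℓ * B)) =
        0 + (tvec (inclXd K κ ℓ * B) + tvec (inclX K κ ℓ * (z * B)))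
      rw [act_tensorHom_one_tvec, ← Matrix.mul_assoc, hpz, zero_add, ← map_add]
      simp only [Matrix.mul_zero, add_zero, Matrix.add_mul, Matrix.mul_assoc]
    · rw [Heisenberg.smul_ctr, Heisenberg.mul_ctr, Heisenberg.mul_ctr]
      change 0 = c.1 + (0 + 0 + HermForm.form _ (tvec (inclXd K κ ℓ * B))
        (tvec (inclX K κ ℓ * (z * B)))) + HermForm.form _ 0 _
      rw [form_inclXd_inclX, hza, HermForm.form_zero_left]
      simp
  have h2 : ∀ r : S, η (Heisenberg.center _ c)⁻¹ r = (ψ c)⁻¹ • r := by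
    intro r
    have hc0 : ψ c ≠ 0 := by
      have := ψ.map_add_eq_mul c (-c)
      rw [add_neg_cancel, AddChar.map_zero_eq_one] at this
      exact left_ne_zero_of_mul (this ▸ one_ne_zero)
    have h3 : ψ c • η (Heisenberg.center _ c)⁻¹ r = r := by
      rw [← hη.central, ← Module.End.mul_apply, ← map_mul, mul_inv_cancel, map_one,
        Module.End.one_apply]
    conv_rhs => rw [← h3]
    rw [smul_smul, inv_mul_cancel₀ hc0, one_smul]
  have h4 := isotropicAvg_apply_inv q hψ hη hp rfl (Heisenberg.dual J J' B) s
  dsimp only at h4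
  rw [hs p hp, h1, mul_inv_rev, mul_inv_rev, map_mul, map_mul, Module.End.mul_apply,
    Module.End.mul_apply, isotropicAvg_apply_ofIsotropic_inv hl, h2, map_smul, map_smul] at h4
  have h5 : (1 - (ψ c)⁻¹) • isotropicAvg η (tensorX_le_perp J J')
      (η (Heisenberg.dual J J' B)⁻¹ s) = 0 := by
    rw [sub_smul, one_smul, ← h4, sub_self]
  refine hB ((smul_eq_zero.1 h5).resolve_left (sub_ne_zero.2 fun h => hc ?_))
  rw [← inv_inv (ψ c), ← h, inv_one]

/-- The unipotent element with parameter y fixes s and moves the point B by V-component y B, up to a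
vector of X ⊗ V' which the average absorbs. Isotropy of B removes all phases, so the value at B is
fixed by translation by y B. -/
theorem apply_isotropicAvg_of_isotropic (hq : Odd q) {s : S}
    (hs : ∀ p : (J.addHyperbolic ℓ).U, (p, (1, 1)) ∈ parabolic ℓ J →
      dualPairRep q hψ hη (p, 1) s = s) {B : Matrix (Fin ℓ) β K}
    (hB : B * J'.gramᵀ * Bᴴ = 0) (y : Matrix κ (Fin ℓ) K) :
    η (Heisenberg.ofIsotropic (tvec (inclV K κ ℓ * (y * B))) (form_inclV_mul_eq_zero J hB y))
      (isotropicAvg η (tensorX_le_perp J J') (η (Heisenberg.dual J J' B)⁻¹ s)) =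
      isotropicAvg η (tensorX_le_perp J J') (η (Heisenberg.dual J J' B)⁻¹ s) := by
  have h2 : (2 : K) ≠ 0 := two_ne_zero_of_odd q hq
  -- z = −½ yᴴ J y, available since q is odd.
  obtain ⟨z, hz⟩ : ∃ z : Matrix (Fin ℓ) (Fin ℓ) K, z + zᴴ + yᴴ * J.gram * y = 0 := by
    have h3 : (yᴴ * J.gram * y)ᴴ = yᴴ * J.gram * y := by
      rw [Matrix.conjTranspose_mul, Matrix.conjTranspose_mul, Matrix.conjTranspose_conjTranspose,
        J.isHermitian.eq, Matrix.mul_assoc]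
    have h4 : star (2⁻¹ : K) = 2⁻¹ := by
      rw [star_inv₀]
      simp
    refine ⟨-((2⁻¹ : K) • (yᴴ * J.gram * y)), ?_⟩
    rw [Matrix.conjTranspose_neg, Matrix.conjTranspose_smul, h3, h4, ← neg_add, ← add_smul,
      ← two_mul, mul_inv_cancel₀ h2, one_smul, neg_add_cancel]
  obtain ⟨p, hp, hpz⟩ := exists_unipotent_mem_parabolic J y z hz
  have hl : tvec (inclX K κ ℓ * (z * B)) ∈ tensorX K κ ℓ β := ⟨z * B, rfl⟩
  have hvl : ((J.addHyperbolic ℓ).tensor J').form (tvec (inclXd K κ ℓ * B))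
      (tvec (inclX K κ ℓ * (z * B))) = 0 := by
    rw [form_inclXd_inclX, Matrix.conjTranspose_mul, Matrix.mul_assoc, Matrix.mul_assoc,
      Matrix.trace_mul_comm, Matrix.mul_assoc, hB, Matrix.mul_zero, Matrix.trace_zero]
  obtain ⟨u, hu⟩ : ∃ u, u = Heisenberg.ofIsotropic (tvec (inclV K κ ℓ * (y * B)))
    (form_inclV_mul_eq_zero J hB y) := ⟨_, rfl⟩
  have h1 : tensorHom _ J' (p, 1) • Heisenberg.dual J J' B =
      Heisenberg.dual J J' B * u * Heisenberg.ofIsotropic (tvec (inclX K κ ℓ * (z * B)))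
        (form_inclX_inclX J J' _ _) := by
    rw [hu]
    ext1
    · rw [Heisenberg.smul_vec, Heisenberg.mul_vec, Heisenberg.mul_vec]
      change HermForm.act _ (tvec (inclXd K κ ℓ * B)) =
        tvec (inclXd K κ ℓ * B) + tvec (inclV K κ ℓ * (y * B)) + tvec (inclX K κ ℓ * (z * B))
      rw [act_tensorHom_one_tvec, ← Matrix.mul_assoc, hpz, ← map_add, ← map_add]
      simp only [Matrix.add_mul, Matrix.mul_assoc]
    · rw [Heisenberg.smul_ctr, Heisenberg.mul_ctr, Heisenberg.mul_ctr, Heisenberg.mul_vec,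
        HermForm.form_add_left]
      change 0 = 0 + 0 + HermForm.form _ (tvec (inclXd K κ ℓ * B)) (tvec (inclV K κ ℓ * (y * B))) +
        0 + (HermForm.form _ (tvec (inclXd K κ ℓ * B)) (tvec (inclX K κ ℓ * (z * B))) +
          HermForm.form _ (tvec (inclV K κ ℓ * (y * B))) (tvec (inclX K κ ℓ * (z * B))))
      rw [hvl, form_inclV_inclX, ← HermForm.star_form, form_inclV_inclXd]
      simp
  have h4 := isotropicAvg_apply_inv q hψ hη hp rfl (Heisenberg.dual J J' B) s
  dsimp only at h4
  have h5 := isotropicAvg_mul_comm η (tensorX_le_perp J J') (x := u⁻¹) (by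
    rw [Heisenberg.inv_vec, hu]
    exact Submodule.neg_mem _ (tvec_inclV_mem_perp J J' _))
  rw [hs p hp, h1, mul_inv_rev, mul_inv_rev, map_mul, map_mul, Module.End.mul_apply,
    Module.End.mul_apply, isotropicAvg_apply_ofIsotropic_inv hl, ← Module.End.mul_apply _ (η u⁻¹),
    h5, Module.End.mul_apply] at h4
  rw [← hu]
  conv_lhs => rw [h4]
  rw [← Module.End.mul_apply (η u), ← map_mul, mul_inv_cancel, map_one, Module.End.one_apply]

end UnipotentInvariants

/-! ### Injectivity of the projection and vanishing on translates of the section. -/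

section Injectivity

variable {K : Type*} [Field K] [StarRing K] {κ κ' : Type*} [Fintype κ] [DecidableEq κ]
  [Fintype κ'] [DecidableEq κ'] {ℓ : ℕ}
  [Fintype K] (q : ℕ) [hK : QuadraticStar q K] {ψ : AddChar (skewAdjoint K) ℂ} (hψ : ψ ≠ 1)
  {J : HermForm K κ} {J' : HermForm K κ'} {S₀ S₁ : Type*} [AddCommGroup S₀] [Module ℂ S₀]
  [AddCommGroup S₁] [Module ℂ S₁] [FiniteDimensional ℂ S₁]
  {η₁ : Representation ℂ (Heisenberg ((J.addHyperbolic ℓ).tensor (J'.addHyperbolic ℓ))) S₁}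
  (hη₁ : IsHeisenbergRep ψ η₁) {lam : S₁ →ₗ[ℂ] S₀} {mu : S₀ →ₗ[ℂ] S₁}

/-- If the value at B were nonzero, B would be isotropic, and Witt's theorem would give g' moving B
to the standard frame of X'. The translate by g' of the value is then the value at t of the
translate of s; it is fixed by all of Y, so it is what the projection `lam` sees, and `lam` vanishes
on all translates. -/
theorem isotropicAvg_dual_eq_zero_of_mul_eq_one (hq : Odd q)
    (hE : mu ∘ₗ lam = η₁ (Heisenberg.dual J _ (inclX K κ' ℓ)ᵀ) *
      isotropicAvg η₁ (tensorXX_le_perp J J') * η₁ (Heisenberg.dual J _ (inclX K κ' ℓ)ᵀ)⁻¹) {s : S₁}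
    (hs : ∀ p : (J.addHyperbolic ℓ).U, (p, (1, 1)) ∈ parabolic ℓ J →
      dualPairRep q hψ hη₁ (p, 1) s = s)
    (hlam : ∀ g', lam (dualPairRep q hψ hη₁ (1, g') s) = 0)
    {B : Matrix (Fin ℓ) ((Fin ℓ ⊕ Fin ℓ) ⊕ κ') K} {R : Matrix ((Fin ℓ ⊕ Fin ℓ) ⊕ κ') (Fin ℓ) K}
    (hR : B * R = 1) :
    isotropicAvg η₁ (tensorX_le_perp J (J'.addHyperbolic ℓ)) (η₁ (Heisenberg.dual J _ B)⁻¹ s) =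
      0 := by
  by_contra hne
  have hB := mul_gram_mul_eq_zero_of_isotropicAvg_ne_zero q hψ hη₁ hs hne
  have hfix := apply_isotropicAvg_of_isotropic q hψ hη₁ hq hs hB
  -- The frame is Bᵀ: in the matrix model U(V₁') acts from the right through transposes.
  obtain ⟨g', hg'⟩ := exists_unitary_mul_eq_inclX q hq J' Bᵀ (by
    have h1 := congrArg Matrix.transpose hB
    rw [Matrix.transpose_mul, Matrix.transpose_mul, Matrix.transpose_transpose,
      Matrix.transpose_zero, ← Matrix.mul_assoc] at h1
    exact h1) Rᵀ (by rw [← Matrix.transpose_mul, hR, Matrix.transpose_one])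
  have hg'' : B * (g' : GL ((Fin ℓ ⊕ Fin ℓ) ⊕ κ') K).valᵀ = (inclX K κ' ℓ)ᵀ := by
    rw [← hg', Matrix.transpose_mul, Matrix.transpose_transpose]
  have hL := tensorX_le_perp (ℓ := ℓ) J (J'.addHyperbolic ℓ)
  have hY := tensorXX_le_perp (ℓ := ℓ) J J'
  obtain ⟨t, ht⟩ : ∃ t, t = Heisenberg.dual J (J'.addHyperbolic ℓ) (inclX K κ' ℓ)ᵀ := ⟨_, rfl⟩
  obtain ⟨W, hW⟩ : ∃ W, W = dualPairRep q hψ hη₁ (1, g') := ⟨_, rfl⟩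
  have hWη : ∀ h, W * η₁ h = η₁ (tensorHom (J.addHyperbolic ℓ) (J'.addHyperbolic ℓ) (1, g') • h) *
    W :=
    hW ▸ dualPairRep_mul_apply q hψ hη₁ _
  have hact : ∀ (P : Matrix ((Fin ℓ ⊕ Fin ℓ) ⊕ κ) (Fin ℓ) K),
      HermForm.act (tensorHom (J.addHyperbolic ℓ) (J'.addHyperbolic ℓ) (1, g')) (tvec (P * B)) =
        tvec (P * (inclX K κ' ℓ)ᵀ) := by
    intro P
    rw [act_tensorHom_tvec]
    dsimp only
    rw [OneMemClass.coe_one, Units.val_one, Matrix.one_mul, Matrix.mul_assoc, hg'']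
  obtain ⟨r, hr⟩ : ∃ r, r = W (isotropicAvg η₁ hL (η₁ (Heisenberg.dual J _ B)⁻¹ s)) := ⟨_, rfl⟩
  have hr1 : r = isotropicAvg η₁ hL (η₁ t⁻¹ (W s)) := by
    have h1 := isotropicAvg_mul_comm_of_mem η₁ hL
      (act_mem_tensorX (one_mem (parabolic ℓ J)) g') hWη
    have h2 : tensorHom (J.addHyperbolic ℓ) (J'.addHyperbolic ℓ) (1, g') •
        Heisenberg.dual J _ B = t := by
      rw [ht]
      ext1
      · exact hact _
      · rfl
    have h3 := hWη (Heisenberg.dual J _ B)⁻¹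
    rw [smul_inv', h2] at h3
    rw [hr, ← Module.End.mul_apply W, h1, Module.End.mul_apply, ← Module.End.mul_apply W, h3,
      Module.End.mul_apply]
  have hrL : ∀ (y : _) (hy : y ∈ tensorX K κ ℓ ((Fin ℓ ⊕ Fin ℓ) ⊕ κ')),
      η₁ (Heisenberg.ofIsotropic y (hL hy y hy)) r = r := by
    rw [hr1]
    exact (isProj_isotropicAvg η₁ hL).map_mem _
  have hrV : ∀ C : Matrix κ (Fin ℓ) K,
      η₁ (Heisenberg.ofIsotropic (tvec (inclV K κ ℓ * C * (inclX K κ' ℓ)ᵀ))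
        (form_mul_transpose_inclX J J' _ _)) r = r := by
    intro C
    have h1 := hWη (Heisenberg.ofIsotropic _ (form_inclV_mul_eq_zero J hB C))
    have h2 : tensorHom (J.addHyperbolic ℓ) (J'.addHyperbolic ℓ) (1, g') •
        Heisenberg.ofIsotropic _ (form_inclV_mul_eq_zero J hB C) =
        Heisenberg.ofIsotropic (tvec (inclV K κ ℓ * C * (inclX K κ' ℓ)ᵀ))
        (form_mul_transpose_inclX J J' _ _) := by
      ext1
      · have h3 := hact (inclV K κ ℓ * C)
        rw [Matrix.mul_assoc _ C B] at h3
        exact h3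
      · rfl
    rw [h2] at h1
    rw [hr, ← Module.End.mul_apply (η₁ _) W, ← h1, Module.End.mul_apply, hfix]
  -- Y is spanned by X ⊗ V₁', absorbed by the average, and V ⊗ X', the image under g' of the
  -- translations fixing the value at B.
  have hrY : r ∈ isotropicFixed η₁ hY := by
    intro y hy
    obtain ⟨A, C, rfl⟩ := mem_tensorXX.1 hy
    have h1 : Heisenberg.ofIsotropic _ (hY hy _ hy) =
        Heisenberg.ofIsotropic (tvec (inclX K κ ℓ * A)) (form_inclX_inclX J _ _ _) *
        Heisenberg.ofIsotropic (tvec (inclV K κ ℓ * C * (inclX K κ' ℓ)ᵀ))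
          (form_mul_transpose_inclX J J' _ _) := by
      ext1
      · exact map_add _ _ _
      · change 0 = 0 + 0 + HermForm.form _ (tvec (inclX K κ ℓ * A))
          (tvec (inclV K κ ℓ * C * (inclX K κ' ℓ)ᵀ))
        rw [Matrix.mul_assoc, ← HermForm.star_form, form_inclV_inclX]
        simp
    rw [h1, map_mul, Module.End.mul_apply, hrV]
    exact hrL _ ⟨A, rfl⟩
  have h1 : isotropicAvg η₁ hY r = r := (isProj_isotropicAvg η₁ hY).map_id r hrY
  have h2 : isotropicAvg η₁ hY r = isotropicAvg η₁ hY (η₁ t⁻¹ (W s)) := by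
    rw [hr1, ← Module.End.mul_apply, isotropicAvg_mul_isotropicAvg_of_le η₁ hY hL
      (tensorX_le_tensorXX ℓ)]
  have h3 : η₁ t (isotropicAvg η₁ hY (η₁ t⁻¹ (W s))) = 0 := by
    have h4 := LinearMap.congr_fun hE (W s)
    rw [LinearMap.comp_apply, hW, hlam, map_zero, ← ht, ← hW] at h4
    exact h4.symm
  rw [← h2, h1] at h3
  have h5 : r = 0 := by
    have h6 := congrArg (η₁ t⁻¹) h3
    rwa [← Module.End.mul_apply, ← map_mul, inv_mul_cancel, map_one, map_zero] at h6
  apply hne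
  have h7 := congrArg (dualPairRep q hψ hη₁ (1, g')⁻¹) (hr.symm.trans h5)
  rwa [hW, ← Module.End.mul_apply, ← map_mul, inv_mul_cancel, map_one, map_zero] at h7

/-- The projection of the theta correspondence is injective on maps that are equivariant under the
elements of the parabolic subgroup that act trivially on `V`. -/
theorem eq_zero_of_projection_eq_zero (hq : Odd q) {T : Type*} [AddCommGroup T] [Module ℂ T]
    {τ : Representation ℂ (GL (Fin ℓ) K) T} (hτ : IsCuspidal τ)
    (hτ_nontrivial : ℓ = 1 → ∃ g, τ g ≠ 1)
    (hE : mu ∘ₗ lam = η₁ (Heisenberg.dual J _ (inclX K κ' ℓ)ᵀ) *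
      isotropicAvg η₁ (tensorXX_le_perp J J') * η₁ (Heisenberg.dual J _ (inclX K κ' ℓ)ᵀ)⁻¹)
    {s : T →ₗ[ℂ] S₁}
    (hs : ∀ (p : (J.addHyperbolic ℓ).U) (a : GL (Fin ℓ) K), (p, (a, 1)) ∈ parabolic ℓ J →
      ∀ t, dualPairRep q hψ hη₁ (p, 1) (s t) = s (τ a t))
    (hlam : ∀ g' t, lam (dualPairRep q hψ hη₁ (1, g') (s t)) = 0) : s = 0 := by
  have hL := tensorX_le_perp (ℓ := ℓ) J (J'.addHyperbolic ℓ)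
  have hzero : ∀ (B : Matrix (Fin ℓ) ((Fin ℓ ⊕ Fin ℓ) ⊕ κ') K) (t : T),
      isotropicAvg η₁ hL (η₁ (Heisenberg.dual J _ B)⁻¹ (s t)) = 0 := by
    intro B t
    rcases exists_mul_eq_one_or_exists_mulVec_eq_zero B with ⟨R, hR⟩ | ⟨z, hz, hBz⟩
    · refine isotropicAvg_dual_eq_zero_of_mul_eq_one q hψ hη₁ hq hE (fun p hp => ?_)
        (fun g' => hlam g' t) hR
      rw [hs p 1 hp, map_one, Module.End.one_apply]
    -- The Levi element of a acts on X^∨ by (a⁻¹)ᴴ, so it fixes the point B exactly when a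
    -- stabilizes Bᴴ; the value at B is then invariant under that stabilizer.
    · refine LinearMap.congr_fun (hτ.eq_zero_of_invariant hτ_nontrivial hz hBz
        (isotropicAvg η₁ hL ∘ₗ η₁ (Heisenberg.dual J _ B)⁻¹ ∘ₗ s) fun a ha t => ?_) t
      obtain ⟨p, hp, hpd⟩ := exists_levi_mem_parabolic J a 1
      have h1 := isotropicAvg_apply_inv q hψ hη₁ hp rfl (Heisenberg.dual J _ B) (s t)
      dsimp only at h1
      have h2 : tensorHom (J.addHyperbolic ℓ) (J'.addHyperbolic ℓ) (p, 1) •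
        Heisenberg.dual J (J'.addHyperbolic ℓ) B =
          Heisenberg.dual J (J'.addHyperbolic ℓ) B := by
        have h3 : (a⁻¹).valᴴ * B = B := by
          have h4 : Bᴴ * a⁻¹.val = Bᴴ := by
            conv_lhs => rw [← ha]
            rw [Matrix.mul_assoc, Units.mul_inv, Matrix.mul_one]
          have h5 := congrArg Matrix.conjTranspose h4
          rwa [Matrix.conjTranspose_mul, Matrix.conjTranspose_conjTranspose] at h5
        ext1
        · change HermForm.act _ (tvec (inclXd K κ ℓ * B)) = tvec (inclXd K κ ℓ * B)
          rw [act_tensorHom_one_tvec, ← Matrix.mul_assoc, hpd, Matrix.mul_assoc, h3]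
        · rfl
      rw [h2, hs p a hp] at h1
      exact h1.symm
  refine LinearMap.ext fun t => eq_zero_of_isotropicAvg hL q hψ hη₁ fun x => ?_
  -- Every element of the Heisenberg group is an element orthogonal to X ⊗ V₁', which commutes with
  -- the average, times the inverse of a point of X^∨ ⊗ V₁'.
  obtain ⟨A, B, C, hABC⟩ := exists_frame_decomposition ℓ (tmat x.vec)
  have hx : x = (x * Heisenberg.dual J _ (-B)) * (Heisenberg.dual J _ (-B))⁻¹ := by
    rw [mul_inv_cancel_right]
  have hmem : (x * Heisenberg.dual J (J'.addHyperbolic ℓ) (-B)).vec ∈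
      ((J.addHyperbolic ℓ).tensor (J'.addHyperbolic ℓ)).perp (tensorX K κ ℓ _) := by
    rw [Heisenberg.mul_vec]
    change x.vec + tvec (inclXd K κ ℓ * -B) ∈ _
    rw [← tvec_tmat x.vec, hABC, ← map_add, Matrix.mul_neg]
    have h1 : inclX K κ ℓ * A + inclXd K κ ℓ * B + inclV K κ ℓ * C + -(inclXd K κ ℓ * B) =
        inclX K κ ℓ * A + inclV K κ ℓ * C := by abel
    rw [h1, map_add]
    exact Submodule.add_mem _ (hL ⟨A, rfl⟩) (tvec_inclV_mem_perp J _ C)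
  rw [hx, map_mul, Module.End.mul_apply, ← Module.End.mul_apply (isotropicAvg η₁ hL),
    isotropicAvg_mul_comm η₁ hL hmem, Module.End.mul_apply, hzero, map_zero]

/-- The projection kills the translates of its section by the elements that move `X'`. -/
theorem projection_section_eq_zero (hlm : lam ∘ₗ mu = LinearMap.id)
    (hE : mu ∘ₗ lam = η₁ (Heisenberg.dual J _ (inclX K κ' ℓ)ᵀ) *
      isotropicAvg η₁ (tensorXX_le_perp J J') * η₁ (Heisenberg.dual J _ (inclX K κ' ℓ)ᵀ)⁻¹)
    {g' : (J'.addHyperbolic ℓ).U}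
    (hg' : (g' : GL ((Fin ℓ ⊕ Fin ℓ) ⊕ κ') K).val * inclX K κ' ℓ ≠ inclX K κ' ℓ) (s : S₀) :
    lam (dualPairRep q hψ hη₁ (1, g') (mu s)) = 0 := by
  have hL := tensorX_le_perp (ℓ := ℓ) J (J'.addHyperbolic ℓ)
  have hY := tensorXX_le_perp (ℓ := ℓ) J J'
  obtain ⟨W, hW⟩ : ∃ W, W = dualPairRep q hψ hη₁ (1, g') := ⟨_, rfl⟩
  have hWη : ∀ h, W * η₁ h = η₁ (tensorHom (J.addHyperbolic ℓ) (J'.addHyperbolic ℓ) (1, g') • h) *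
    W :=
    hW ▸ dualPairRep_mul_apply q hψ hη₁ _
  obtain ⟨t, ht⟩ : ∃ t, t = Heisenberg.dual J (J'.addHyperbolic ℓ) (inclX K κ' ℓ)ᵀ := ⟨_, rfl⟩
  obtain ⟨h, hh⟩ : ∃ h, h = t⁻¹ * tensorHom (J.addHyperbolic ℓ) (J'.addHyperbolic ℓ) (1, g') • t :=
    ⟨_, rfl⟩
  -- The discrepancy h between t and its image under g' lies in X^∨ ⊗ V₁' up to the centre and is
  -- nonzero when g' moves the frame of X'; so it fails to commute with X ⊗ V₁', and the averages on
  -- both sides of it annihilate the product.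
  have hvec : h.vec ∉ ((J.addHyperbolic ℓ).tensor (J'.addHyperbolic ℓ)).perp (tensorX K κ ℓ _) := by
    intro hmem
    have h1 : h.vec = tvec (inclXd K κ ℓ * ((inclX K κ' ℓ)ᵀ *
        (g' : GL ((Fin ℓ ⊕ Fin ℓ) ⊕ κ') K).valᵀ - (inclX K κ' ℓ)ᵀ)) := by
      rw [hh, ht, Heisenberg.mul_vec, Heisenberg.inv_vec, Heisenberg.smul_vec]
      change -tvec (inclXd K κ ℓ * (inclX K κ' ℓ)ᵀ) +
        HermForm.act _ (tvec (inclXd K κ ℓ * (inclX K κ' ℓ)ᵀ)) = _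
      rw [act_tensorHom_tvec]
      dsimp only
      rw [OneMemClass.coe_one, Units.val_one, Matrix.one_mul, Matrix.mul_sub, map_sub,
        Matrix.mul_assoc]
      abel
    rw [h1] at hmem
    have h2 := sub_eq_zero.1 (eq_zero_of_inclXd_mem_perp J (J'.addHyperbolic ℓ) hmem)
    rw [← Matrix.transpose_mul] at h2
    exact hg' (Matrix.transpose_injective h2)
  have h1 := hη₁.isotropicAvg_mul_mul q hψ hL hvec
  have h2 := isotropicAvg_mul_comm_of_mem η₁ hL (act_mem_tensorX (one_mem (parabolic ℓ J)) g') hWη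
  have h3 := isotropicAvg_mul_isotropicAvg_of_le η₁ hY hL (tensorX_le_tensorXX ℓ)
  have h4 := isotropicAvg_mul_isotropicAvg_of_ge η₁ hY hL (tensorX_le_tensorXX ℓ)
  have h5 : isotropicAvg η₁ hY * η₁ h * W * isotropicAvg η₁ hY = 0 := by
    calc _ = isotropicAvg η₁ hY * isotropicAvg η₁ hL * η₁ h * (W * isotropicAvg η₁ hL) *
          isotropicAvg η₁ hY := by
          rw [h3]
          simp only [mul_assoc, h4]
      _ = isotropicAvg η₁ hY * (isotropicAvg η₁ hL * η₁ h * isotropicAvg η₁ hL) * W *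
          isotropicAvg η₁ hY := by
          rw [h2]
          simp only [mul_assoc]
      _ = 0 := by rw [h1]; simp
  have h6 : (mu ∘ₗ lam) * W * (mu ∘ₗ lam) = 0 := by
    rw [hE, ← ht]
    calc _ = η₁ t * isotropicAvg η₁ hY * η₁ t⁻¹ * (W * η₁ t) * isotropicAvg η₁ hY * η₁ t⁻¹ := by
          simp only [mul_assoc]
      _ = η₁ t * (isotropicAvg η₁ hY * η₁ h * W * isotropicAvg η₁ hY) * η₁ t⁻¹ := by
          rw [hWη, hh, map_mul]
          simp only [mul_assoc]
      _ = 0 := by rw [h5]; simp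
  have h7 : ∀ s, lam (mu s) = s := LinearMap.congr_fun hlm
  have h8 := congrArg lam (LinearMap.congr_fun h6 (mu s))
  rw [Module.End.mul_apply, Module.End.mul_apply, LinearMap.comp_apply, LinearMap.comp_apply, h7,
    h7, LinearMap.zero_apply, map_zero] at h8
  rw [← hW, h8]

end Injectivity

/-! ### From parabolic equivariant maps to induction from P'. -/

section ThetaInduction

open Representation TensorProduct

variable {K : Type*} [Field K] [StarRing K] {κ κ' : Type*} [Fintype κ] [DecidableEq κ]
  [Fintype κ'] [DecidableEq κ'] {ℓ : ℕ} {J : HermForm K κ} {J' : HermForm K κ'}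
  {S₀ S₁ T V : Type*} [AddCommGroup S₀] [Module ℂ S₀] [AddCommGroup S₁] [Module ℂ S₁]
  [AddCommGroup T] [Module ℂ T] [AddCommGroup V] [Module ℂ V]

/-- The inflation of `τ ⊗ π` to the parabolic subgroup. -/
noncomputable abbrev inflationRep (τ : Representation ℂ (GL (Fin ℓ) K) T)
    (π : Representation ℂ J.U V) :
    Representation ℂ (parabolic ℓ J) (T ⊗[ℂ] V) :=
  Representation.tprod
    (τ.comp ((MonoidHom.fst _ _).comp ((MonoidHom.snd _ _).comp (parabolic ℓ J).subtype)))
    (π.comp ((MonoidHom.snd _ _).comp ((MonoidHom.snd _ _).comp (parabolic ℓ J).subtype)))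

/-- The inclusion of the parabolic subgroup into the unitary group. -/
abbrev parabolicHom (ℓ : ℕ) (J : HermForm K κ) : parabolic ℓ J →* (J.addHyperbolic ℓ).U :=
  (MonoidHom.fst _ _).comp (parabolic ℓ J).subtype

variable {ω₁ : Representation ℂ ((J.addHyperbolic ℓ).U × (J'.addHyperbolic ℓ).U) S₁}
  {ω₀ : Representation ℂ (J.U × J'.U) S₀} {τ : Representation ℂ (GL (Fin ℓ) K) T}
  {π : Representation ℂ J.U V}

/-- Parabolic equivariant maps from `τ ⊗ π` to the restriction of `ω₁`. -/
abbrev ParabolicHoms (ω₁ : Representation ℂ ((J.addHyperbolic ℓ).U × (J'.addHyperbolic ℓ).U) S₁)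
    (τ : Representation ℂ (GL (Fin ℓ) K) T) (π : Representation ℂ J.U V) : Type _ :=
  (inflationRep τ π).IntertwiningMap
    ((ω₁.comp (MonoidHom.inl _ _) : Representation ℂ (J.addHyperbolic ℓ).U S₁).comp
      (parabolicHom ℓ J) : Representation ℂ (parabolic ℓ J) S₁)

theorem parabolicHoms_apply (f : ParabolicHoms ω₁ τ π)
    {x : (J.addHyperbolic ℓ).U × (GL (Fin ℓ) K × J.U)} (hx : x ∈ parabolic ℓ J) (t : T) (v : V) :
    f (τ x.2.1 t ⊗ₜ π x.2.2 v) = ω₁ (x.1, 1) (f (t ⊗ₜ v)) :=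
  IntertwiningMap.isIntertwining _ _ f ⟨x, hx⟩ (t ⊗ₜ v)

/-- A linear map that intertwines the action of the pairs of elements of the parabolic subgroups
whose actions on `X` and `X'` are conjugate. -/
def IsParabolicProjection (ω₁ :
    Representation ℂ ((J.addHyperbolic ℓ).U × (J'.addHyperbolic ℓ).U) S₁)
    (ω₀ : Representation ℂ (J.U × J'.U) S₀) (lam : S₁ →ₗ[ℂ] S₀) : Prop :=
  ∀ (x : (J.addHyperbolic ℓ).U × (GL (Fin ℓ) K × J.U))
    (x' : (J'.addHyperbolic ℓ).U × (GL (Fin ℓ) K × J'.U)), x ∈ parabolic ℓ J →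
    x' ∈ parabolic ℓ J' → x'.2.1 = conjGL K (Fin ℓ) x.2.1 →
    lam ∘ₗ ω₁ (x.1, x'.1) = ω₀ (x.2.2, x'.2.2) ∘ₗ lam

variable {lam : S₁ →ₗ[ℂ] S₀}

section ProductGroup

variable {G G' S : Type*} [Group G] [Group G'] [AddCommGroup S] [Module ℂ S]
  (ω : Representation ℂ (G × G') S)

theorem apply_inr_apply_inl (g : G) (g' : G') (s : S) : ω (1, g') (ω (g, 1) s) =
    ω (g, 1) (ω (1, g') s) := by
  rw [← Module.End.mul_apply, ← Module.End.mul_apply, ← map_mul, ← map_mul, Prod.mk_mul_mk,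
    Prod.mk_mul_mk, one_mul, mul_one, mul_one, one_mul]

theorem apply_inr_apply_inr (g g' : G') (s : S) : ω (1, g) (ω (1, g') s) = ω (1, g * g') s := by
  rw [← Module.End.mul_apply, ← map_mul, Prod.mk_mul_mk, one_mul]

theorem apply_inr_mul (g : G) (g' k : G') (s : S) :
    ω (1, g' * k) (ω (g, 1) s) = ω (g, g') (ω (1, k) s) := by
  rw [← Module.End.mul_apply, ← Module.End.mul_apply, ← map_mul, ← map_mul, Prod.mk_mul_mk,
    Prod.mk_mul_mk, one_mul, mul_one, mul_one]

theorem apply_inl_apply_inr_inv (g : G) (g' k : G') (s : S) :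
    ω (g, 1) (ω (1, k⁻¹) s) = ω (1, (g' * k)⁻¹) (ω (g, g') s) := by
  rw [← Module.End.mul_apply, ← Module.End.mul_apply, ← map_mul, ← map_mul, Prod.mk_mul_mk,
    Prod.mk_mul_mk, one_mul, mul_one, one_mul, mul_inv_rev, inv_mul_cancel_right]

end ProductGroup

/-- The map `t ↦ (v ↦ λ (ω₁ (1, g') (f (t ⊗ v))))`. -/
noncomputable def projectionHom (hlam : IsParabolicProjection ω₁ ω₀ lam) (f : ParabolicHoms ω₁ τ π)
    (g' : (J'.addHyperbolic ℓ).U) :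
    T →ₗ[ℂ] π.IntertwiningMap (ω₀.comp (MonoidHom.inl J.U J'.U)) where
  toFun t :=
    { toLinearMap := lam ∘ₗ ω₁ (1, g') ∘ₗ f.toLinearMap ∘ₗ TensorProduct.mk ℂ T V t
      isIntertwining' := fun b => by
        ext v
        obtain ⟨p, hp, -⟩ := exists_levi_mem_parabolic (ℓ := ℓ) J 1 b
        change lam (ω₁ (1, g') (f (t ⊗ₜ π b v))) = ω₀ (b, 1) (lam (ω₁ (1, g') (f (t ⊗ₜ v))))
        have h1 := parabolicHoms_apply f hp t v
        rw [map_one, Module.End.one_apply] at h1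
        have h2 := LinearMap.congr_fun (hlam _ _ hp (one_mem (parabolic ℓ J')) (map_one _).symm)
          (ω₁ (1, g') (f (t ⊗ₜ v)))
        refine Eq.trans ?_ h2
        rw [h1, apply_inr_apply_inl]
        rfl }
  map_add' t t' := by
    ext v
    change lam (ω₁ (1, g') (f ((t + t') ⊗ₜ v))) =
      lam (ω₁ (1, g') (f (t ⊗ₜ v))) + lam (ω₁ (1, g') (f (t' ⊗ₜ v)))
    rw [TensorProduct.add_tmul, map_add, map_add, map_add]
  map_smul' c t := by
    ext v
    change lam (ω₁ (1, g') (f ((c • t) ⊗ₜ v))) = c • lam (ω₁ (1, g') (f (t ⊗ₜ v)))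
    rw [← TensorProduct.smul_tmul', map_smul, map_smul, map_smul]

/-- The map from parabolic equivariant maps to the induced representation. -/
noncomputable def projectionMap (hlam : IsParabolicProjection ω₁ ω₀ lam) :
    ParabolicHoms ω₁ τ π →ₗ[ℂ]
      coindV (parabolicHom ℓ J') (conjHomRep J' τ (theta ω₀ π)) where
  toFun f := ⟨projectionHom hlam f, fun x' g' => by
    refine LinearMap.ext fun t => ?_
    rw [conjHomRep_apply]
    ext v
    -- `x'` is paired with the Levi element of P whose GL-component is its star, so that `lam` is
    -- equivariant for the pair. Equivariance of `f` moves this component to t, which is where τ^σ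
    -- comes from.
    obtain ⟨p, hp, -⟩ := exists_levi_mem_parabolic (ℓ := ℓ) J (conjGL K (Fin ℓ) x'.1.2.1) 1
    change lam (ω₁ (1, x'.1.1 * g') (f (t ⊗ₜ v))) =
      ω₀ (1, x'.1.2.2) (lam (ω₁ (1, g') (f (τ (conjGL K (Fin ℓ) x'.1.2.1)⁻¹ t ⊗ₜ v))))
    have h1 := parabolicHoms_apply f hp (τ (conjGL K (Fin ℓ) x'.1.2.1)⁻¹ t) v
    dsimp only at h1
    rw [map_one, Module.End.one_apply, self_inv_apply] at h1
    have h2 := LinearMap.congr_fun (hlam _ _ hp x'.2 (conjGL_conjGL _).symm)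
      (ω₁ (1, g') (f (τ (conjGL K (Fin ℓ) x'.1.2.1)⁻¹ t ⊗ₜ v)))
    refine Eq.trans ?_ h2
    rw [h1, apply_inr_mul]
    rfl⟩
  map_add' f f' := by
    refine Subtype.ext (funext fun g' => LinearMap.ext fun t => ?_)
    ext v
    change lam (ω₁ (1, g') (f (t ⊗ₜ v) + f' (t ⊗ₜ v))) =
      lam (ω₁ (1, g') (f (t ⊗ₜ v))) + lam (ω₁ (1, g') (f' (t ⊗ₜ v)))
    rw [map_add, map_add]
  map_smul' c f := by
    refine Subtype.ext (funext fun g' => LinearMap.ext fun t => ?_)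
    ext v
    change lam (ω₁ (1, g') (c • f (t ⊗ₜ v))) = c • lam (ω₁ (1, g') (f (t ⊗ₜ v)))
    rw [map_smul, map_smul]

theorem projectionMap_apply (hlam : IsParabolicProjection ω₁ ω₀ lam) (f : ParabolicHoms ω₁ τ π)
    (g' : (J'.addHyperbolic ℓ).U) (t : T)
    (v : V) : (projectionMap hlam f).1 g' t v = lam (ω₁ (1, g') (f (t ⊗ₜ v))) := rfl

/-- For fixed v, the map t ↦ f(t ⊗ v) satisfies the hypotheses of `hinj`, since elements trivial on
V do not move v. -/
theorem projectionMap_injective (hlam : IsParabolicProjection ω₁ ω₀ lam)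
    (hinj : ∀ s : T →ₗ[ℂ] S₁, (∀ (p : (J.addHyperbolic ℓ).U) (a : GL (Fin ℓ) K),
      (p, (a, 1)) ∈ parabolic ℓ J → ∀ t, ω₁ (p, 1) (s t) = s (τ a t)) →
      (∀ g' t, lam (ω₁ (1, g') (s t)) = 0) → s = 0) :
    Function.Injective (projectionMap hlam (τ := τ) (π := π)) := by
  refine (injective_iff_map_eq_zero _).2 fun f hf => ?_
  ext t v
  change f (t ⊗ₜ v) = 0
  refine LinearMap.congr_fun (hinj (f.toLinearMap ∘ₗ (TensorProduct.mk ℂ T V).flip v)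
    (fun p a hp t => ?_) fun g' t => ?_) t
  · have h1 := parabolicHoms_apply f hp t v
    rw [map_one, Module.End.one_apply] at h1
    exact h1.symm
  · have h1 := projectionMap_apply hlam f g' t v
    rw [hf] at h1
    exact h1.symm

theorem coind_conjHomRep_apply_mul
    (F : coindV (parabolicHom ℓ J') (conjHomRep J' τ (theta ω₀ π)))
    {x' : (J'.addHyperbolic ℓ).U × (GL (Fin ℓ) K × J'.U)} (hx' : x' ∈ parabolic ℓ J')
    (g' : (J'.addHyperbolic ℓ).U) (t : T) (v : V) : F.1 (x'.1 * g') t v =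
      ω₀ (1, x'.2.2) (F.1 g' (τ (conjGL K (Fin ℓ) x'.2.1)⁻¹ t) v) := by
  have h1 := coindV_apply_mul (parabolicHom ℓ J') _ F ⟨x', hx'⟩ g'
  have h2 := LinearMap.congr_fun h1 t
  rw [conjHomRep_apply] at h2
  exact DFunLike.congr_fun h2 v

/-- Sections that intertwine the action of the pairs of elements of the parabolic subgroups whose
actions on `X` and `X'` are conjugate. -/
def IsParabolicSection (ω₁ : Representation ℂ ((J.addHyperbolic ℓ).U × (J'.addHyperbolic ℓ).U) S₁)
    (ω₀ : Representation ℂ (J.U × J'.U) S₀) (mu : S₀ →ₗ[ℂ] S₁) : Prop :=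
  ∀ (x : (J.addHyperbolic ℓ).U × (GL (Fin ℓ) K × J.U))
    (x' : (J'.addHyperbolic ℓ).U × (GL (Fin ℓ) K × J'.U)), x ∈ parabolic ℓ J →
    x' ∈ parabolic ℓ J' → x'.2.1 = conjGL K (Fin ℓ) x.2.1 →
    ω₁ (x.1, x'.1) ∘ₗ mu = mu ∘ₗ ω₀ (x.2.2, x'.2.2)

section Surjectivity

variable [Fintype (J'.addHyperbolic ℓ).U] {mu : S₀ →ₗ[ℂ] S₁}

/-- The bilinear map `(t, v) ↦ ∑ ω₁ (1, g'⁻¹) (μ (F g' t v))`. -/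
noncomputable def sectionBilin
    (ω₁ : Representation ℂ ((J.addHyperbolic ℓ).U × (J'.addHyperbolic ℓ).U) S₁)
    (mu : S₀ →ₗ[ℂ] S₁) (F : coindV (parabolicHom ℓ J') (conjHomRep J' τ (theta ω₀ π))) :
    T →ₗ[ℂ] V →ₗ[ℂ] S₁ :=
  LinearMap.mk₂ ℂ
    (fun t v => ∑ g' : (J'.addHyperbolic ℓ).U, ω₁ (1, g'⁻¹) (mu (F.1 g' t v)))
    (fun t t' v => by
      rw [← Finset.sum_add_distrib]
      refine Finset.sum_congr rfl fun g' _ => ?_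
      have h : F.1 g' (t + t') v = F.1 g' t v + F.1 g' t' v := by
        rw [map_add]
        rfl
      rw [h, map_add, map_add])
    (fun c t v => by
      rw [Finset.smul_sum]
      refine Finset.sum_congr rfl fun g' _ => ?_
      have h : F.1 g' (c • t) v = c • F.1 g' t v := by
        rw [map_smul]
        rfl
      rw [h, map_smul, map_smul])
    (fun t v v' => by
      rw [← Finset.sum_add_distrib]
      refine Finset.sum_congr rfl fun g' _ => ?_
      rw [map_add, map_add, map_add])
    (fun c t v => by
      rw [Finset.smul_sum]
      refine Finset.sum_congr rfl fun g' _ => ?_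
      rw [map_smul, map_smul, map_smul])

/-- The sum is reindexed by g' ↦ p' g', where p' is a Levi element of P' matching x; equivariance of
F and of `mu` under the pair makes the terms correspond. -/
theorem sectionBilin_equivariant (hmu : IsParabolicSection ω₁ ω₀ mu)
    (F : coindV (parabolicHom ℓ J') (conjHomRep J' τ (theta ω₀ π)))
    {x : (J.addHyperbolic ℓ).U × (GL (Fin ℓ) K × J.U)} (hx : x ∈ parabolic ℓ J) (t : T) (v : V) :
    sectionBilin ω₁ mu F (τ x.2.1 t) (π x.2.2 v) = ω₁ (x.1, 1) (sectionBilin ω₁ mu F t v) := by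
  obtain ⟨p', hp', -⟩ := exists_levi_mem_parabolic (ℓ := ℓ) J' (conjGL K (Fin ℓ) x.2.1) 1
  have h : ∀ g', F.1 (p' * g') (τ x.2.1 t) (π x.2.2 v) = ω₀ (x.2.2, 1) (F.1 g' t v) := by
    intro g'
    have h1 := coind_conjHomRep_apply_mul F hp' g' (τ x.2.1 t) (π x.2.2 v)
    have h2 : τ (conjGL K (Fin ℓ) (conjGL K (Fin ℓ) x.2.1))⁻¹ (τ x.2.1 t) = t := by
      rw [conjGL_conjGL, inv_self_apply]
    have h3 : ∀ s, ω₀ (1, 1) s = s := LinearMap.congr_fun (map_one ω₀)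
    exact h1.trans ((h3 _).trans ((congrArg (fun t => F.1 g' t (π x.2.2 v)) h2).trans
      (IntertwiningMap.isIntertwining _ _ (F.1 g' t) x.2.2 v)))
  have h' : ∀ g', ω₁ (x.1, 1) (ω₁ (1, g'⁻¹) (mu (F.1 g' t v))) =
      ω₁ (1, (p' * g')⁻¹) (mu (F.1 (p' * g') (τ x.2.1 t) (π x.2.2 v))) := fun g' =>
    (apply_inl_apply_inr_inv ω₁ x.1 p' g' _).trans (congrArg _
      ((LinearMap.congr_fun (hmu x _ hx hp' rfl) (F.1 g' t v)).trans (congrArg mu (h g').symm)))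
  refine Eq.symm ((map_sum _ _ _).trans ?_)
  exact Fintype.sum_bijective (fun g' => p' * g') (Group.mulLeft_bijective p') _ _ h'

/-- The parabolic equivariant map attached to an element of the induced representation. -/
noncomputable def sectionHom (hmu : IsParabolicSection ω₁ ω₀ mu)
    (F : coindV (parabolicHom ℓ J') (conjHomRep J' τ (theta ω₀ π))) : ParabolicHoms ω₁ τ π where
  toLinearMap := TensorProduct.lift (sectionBilin ω₁ mu F)
  isIntertwining' x := TensorProduct.ext' fun t v => sectionBilin_equivariant hmu F x.2 t v

theorem sectionHom_tmul (hmu : IsParabolicSection ω₁ ω₀ mu)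
    (F : coindV (parabolicHom ℓ J') (conjHomRep J' τ (theta ω₀ π))) (t : T) (v : V) :
    sectionHom hmu F (t ⊗ₜ v) =
      ∑ g' : (J'.addHyperbolic ℓ).U, ω₁ (1, g'⁻¹) (mu (F.1 g' t v)) := rfl

open Classical in
-- In the value at x only the terms g' for which x g'⁻¹ fixes X' pointwise survive, by `hvan`. Such
-- an x g'⁻¹ lies in P' with trivial GL-component, so its term is F(x); the scalar counts these
-- elements.
theorem projectionMap_sectionHom (hlam : IsParabolicProjection ω₁ ω₀ lam)
    (hlm : lam ∘ₗ mu = LinearMap.id)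
    (hmu : IsParabolicSection ω₁ ω₀ mu)
    (hvan : ∀ g' : (J'.addHyperbolic ℓ).U,
      (g' : GL ((Fin ℓ ⊕ Fin ℓ) ⊕ κ') K).val * inclX K κ' ℓ ≠ inclX K κ' ℓ →
        ∀ s, lam (ω₁ (1, g') (mu s)) = 0)
    (F : coindV (parabolicHom ℓ J') (conjHomRep J' τ (theta ω₀ π))) :
    projectionMap hlam (sectionHom hmu F) = (∑ y : (J'.addHyperbolic ℓ).U,
      if (y : GL ((Fin ℓ ⊕ Fin ℓ) ⊕ κ') K).val * inclX K κ' ℓ = inclX K κ' ℓ then (1 : ℂ) else 0) •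
        F := by
  obtain ⟨N, hN⟩ : ∃ N : ℂ, N = ∑ y : (J'.addHyperbolic ℓ).U,
      if (y : GL ((Fin ℓ ⊕ Fin ℓ) ⊕ κ') K).val * inclX K κ' ℓ = inclX K κ' ℓ then (1 : ℂ) else 0 :=
    ⟨_, rfl⟩
  rw [← hN]
  have key : ∀ x t v, lam (ω₁ (1, x) (sectionHom hmu F (t ⊗ₜ v))) = N • F.1 x t v := by
    intro x t v
    rw [sectionHom_tmul, hN, Finset.sum_smul]
    refine (congrArg lam (map_sum _ _ _)).trans ((map_sum lam _ _).trans ?_)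
    refine Fintype.sum_bijective (fun g' => x * g'⁻¹)
      ((Group.mulLeft_bijective x).comp (Equiv.inv _).bijective) _ _ fun g' => ?_
    rw [apply_inr_apply_inr]
    split_ifs with h
    · obtain ⟨b, hb⟩ := exists_mem_parabolic_of_mul_inclX (J := J') (p := x * g'⁻¹) (a := 1) (by
        rw [h, Units.val_one, Matrix.mul_one])
      have h1 := coind_conjHomRep_apply_mul F hb g' t v
      have h2 := LinearMap.congr_fun (hmu 1 _ (one_mem _) hb (map_one _).symm) (F.1 g' t v)
      have h3 := LinearMap.congr_fun hlm (ω₀ (1, b) (F.1 g' t v))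
      have h4 : τ (conjGL K (Fin ℓ) 1)⁻¹ t = t := by
        rw [map_one, inv_one, map_one, Module.End.one_apply]
      have h5 : F.1 x t v = ω₀ (1, b) (F.1 g' t v) :=
        (congrArg (fun y => F.1 y t v) (inv_mul_cancel_right x g').symm).trans
          (h1.trans (congrArg (fun t => ω₀ (1, b) (F.1 g' t v)) h4))
      rw [one_smul, h5]
      exact (congrArg lam h2).trans h3
    · rw [hvan _ h, zero_smul]
  refine Subtype.ext (funext fun x => LinearMap.ext fun t => ?_)
  ext v
  exact key x t v

/-- The scalar of `projectionMap_sectionHom` is nonzero because the identity is counted. -/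
theorem projectionMap_surjective (hlam : IsParabolicProjection ω₁ ω₀ lam)
    (hlm : lam ∘ₗ mu = LinearMap.id)
    (hmu : IsParabolicSection ω₁ ω₀ mu)
    (hvan : ∀ g' : (J'.addHyperbolic ℓ).U,
      (g' : GL ((Fin ℓ ⊕ Fin ℓ) ⊕ κ') K).val * inclX K κ' ℓ ≠ inclX K κ' ℓ →
        ∀ s, lam (ω₁ (1, g') (mu s)) = 0) :
    Function.Surjective (projectionMap hlam (τ := τ) (π := π)) := by
  classical
  intro F
  have h1 := projectionMap_sectionHom hlam hlm hmu hvan F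
  obtain ⟨N, hN⟩ : ∃ N : ℂ, N = ∑ y : (J'.addHyperbolic ℓ).U,
      if (y : GL ((Fin ℓ ⊕ Fin ℓ) ⊕ κ') K).val * inclX K κ' ℓ = inclX K κ' ℓ then (1 : ℂ) else 0 :=
    ⟨_, rfl⟩
  have hN0 : N ≠ 0 := by
    rw [hN, Finset.sum_boole, Nat.cast_ne_zero, ← Nat.pos_iff_ne_zero, Finset.card_pos]
    refine ⟨1, Finset.mem_filter.2 ⟨Finset.mem_univ _, ?_⟩⟩
    rw [OneMemClass.coe_one, Units.val_one, Matrix.one_mul]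
  rw [← hN] at h1
  refine ⟨N⁻¹ • sectionHom hmu F, ?_⟩
  rw [map_smul, h1, smul_smul, inv_mul_cancel₀ hN0, one_smul]

end Surjectivity

/-- The theta lift of a parabolically induced representation, in terms of a projection and a
section. -/
theorem nonempty_theta_parabolicInd_equiv [Finite K] (hlam : IsParabolicProjection ω₁ ω₀ lam)
    (hinj : ∀ s : T →ₗ[ℂ] S₁, (∀ (p : (J.addHyperbolic ℓ).U) (a : GL (Fin ℓ) K),
      (p, (a, 1)) ∈ parabolic ℓ J → ∀ t, ω₁ (p, 1) (s t) = s (τ a t)) →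
      (∀ g' t, lam (ω₁ (1, g') (s t)) = 0) → s = 0)
    {mu : S₀ →ₗ[ℂ] S₁} (hlm : lam ∘ₗ mu = LinearMap.id) (hmu : IsParabolicSection ω₁ ω₀ mu)
    (hvan : ∀ g' : (J'.addHyperbolic ℓ).U,
      (g' : GL ((Fin ℓ ⊕ Fin ℓ) ⊕ κ') K).val * inclX K κ' ℓ ≠ inclX K κ' ℓ →
        ∀ s, lam (ω₁ (1, g') (mu s)) = 0) :
    Nonempty ((theta ω₁ (parabolicInd τ π)).Equiv
      (coind (parabolicHom ℓ J') (conjHomRep J' τ (theta ω₀ π)))) := by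
  have := Fintype.ofFinite (J.addHyperbolic ℓ).U
  have := Fintype.ofFinite (J'.addHyperbolic ℓ).U
  have := Fintype.ofFinite (parabolic ℓ J)
  have h1 : Function.Bijective (projectionMap hlam (τ := τ) (π := π)) :=
    ⟨projectionMap_injective hlam hinj, projectionMap_surjective hlam hlm hmu hvan⟩
  let E := coindHomEquiv (parabolicHom ℓ J) (inflationRep τ π)
    (ω₁.comp (MonoidHom.inl _ _) : Representation ℂ (J.addHyperbolic ℓ).U S₁)
  refine ⟨Representation.Equiv.mk (E.trans (LinearEquiv.ofBijective _ h1)) fun g' => ?_⟩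
  refine LinearMap.ext fun f => Subtype.ext (funext fun x => LinearMap.ext fun t => ?_)
  ext v
  change lam (ω₁ (1, x) (ω₁ (1, g') (E f (t ⊗ₜ v)))) = lam (ω₁ (1, x * g') (E f (t ⊗ₜ v)))
  rw [apply_inr_apply_inr]

end ThetaInduction

/-! ### Functoriality of the theta lift. -/

section ThetaPullback

open Representation

variable {G G' S V W : Type*} [Group G] [Group G'] [AddCommGroup S] [Module ℂ S] [AddCommGroup V]
  [Module ℂ V] [AddCommGroup W] [Module ℂ W]

/-- The theta lift of a subrepresentation of `σ` is a subrepresentation of the theta lift of `σ`. -/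
theorem Occurs.theta [Finite G] (ω : Representation ℂ (G × G') S) {ρ : Representation ℂ G V}
    {σ : Representation ℂ G W} (h : Occurs ρ σ) : Occurs (theta ω ρ) (theta ω σ) := by
  obtain ⟨i, hi⟩ := h
  obtain ⟨r, hr⟩ := exists_retraction i hi
  -- Hom is contravariant, so the embedding of theta lifts is composition with an equivariant
  -- retraction, which exists by semisimplicity.
  refine ⟨⟨{ toFun := fun f => f.comp r, map_add' := ?_, map_smul' := ?_ }, fun g' => ?_⟩, ?_⟩
  · intro f f'
    ext w
    rfl
  · intro c f
    ext w
    rfl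
  · refine LinearMap.ext fun f => ?_
    ext w
    rfl
  · intro f f' hff
    ext v
    have h1 := DFunLike.congr_fun (show f.comp r = f'.comp r from hff) (i v)
    rw [IntertwiningMap.comp_apply, IntertwiningMap.comp_apply, hr] at h1
    exact h1

theorem Occurs.trans {U : Type*} [AddCommGroup U] [Module ℂ U] {κ : Representation ℂ G U}
    {ρ : Representation ℂ G V} {σ : Representation ℂ G W} (h : Occurs κ ρ) (h' : Occurs ρ σ) :
    Occurs κ σ := by
  obtain ⟨f, hf⟩ := h
  obtain ⟨f', hf'⟩ := h'
  exact ⟨f'.comp f, hf'.comp hf⟩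

theorem occurs_of_equiv {ρ : Representation ℂ G V} {σ : Representation ℂ G W} (e : ρ.Equiv σ) :
    Occurs ρ σ :=
  ⟨e.toIntertwiningMap, e.toLinearEquiv.injective⟩

end ThetaPullback

set_option maxHeartbeats 4000000 in
/-- The theta correspondence is compatible with parabolic induction from nontrivial cuspidal
representations of the general linear group. -/
theorem nonempty_theta_parabolicInd_equiv_parabolicInd {K : Type*} [Field K] [Fintype K]
    [StarRing K] (q : ℕ) [QuadraticStar q K] (hq : Odd q)
    {ψ : AddChar (skewAdjoint K) ℂ} (hψ : ψ ≠ 1) {κ κ' : Type*} [Fintype κ] [DecidableEq κ]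
    [Fintype κ'] [DecidableEq κ'] {ℓ : ℕ} (J : HermForm K κ) (J' : HermForm K κ')
    {S₀ : Type*} [AddCommGroup S₀] [Module ℂ S₀] [FiniteDimensional ℂ S₀]
    {η₀ : Representation ℂ (Heisenberg (J.tensor J')) S₀} (hη₀ : IsHeisenbergRep ψ η₀)
    {S₁ : Type*} [AddCommGroup S₁] [Module ℂ S₁] [FiniteDimensional ℂ S₁]
    {η₁ : Representation ℂ (Heisenberg ((J.addHyperbolic ℓ).tensor (J'.addHyperbolic ℓ))) S₁}
    (hη₁ : IsHeisenbergRep ψ η₁)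
    {T : Type*} [AddCommGroup T] [Module ℂ T] [FiniteDimensional ℂ T]
    (τ : Representation ℂ (GL (Fin ℓ) K) T) (hτ : IsCuspidal τ)
    (hτ_nontrivial : ℓ = 1 → ∃ g, τ g ≠ 1)
    {V : Type*} [AddCommGroup V] [Module ℂ V] [FiniteDimensional ℂ V]
    (π : Representation ℂ J.U V) :
    Nonempty ((theta (dualPairRep q hψ hη₁) (parabolicInd τ π)).Equiv
      (parabolicInd τ (theta (dualPairRep q hψ hη₀) π))) := by
  obtain ⟨lam, mu, hlm, hE, hpar⟩ := exists_dualPairRep_projection (ℓ := ℓ) q hψ hη₀ hη₁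
  obtain ⟨e₁⟩ := nonempty_theta_parabolicInd_equiv (τ := τ) (π := π)
    (ω₁ := dualPairRep q hψ hη₁) (ω₀ := dualPairRep q hψ hη₀)
    (fun x x' hx hx' h => (hpar x x' hx hx' h).2)
    (fun s hs h => eq_zero_of_projection_eq_zero q hψ hη₁ hq hτ hτ_nontrivial hE hs h) hlm
    (fun x x' hx hx' h => (hpar x x' hx hx' h).1)
    (fun g' hg' s => projection_section_eq_zero q hψ hη₁ hlm hE hg' s)
  -- Finite dimension of the small theta lift, needed for the character computation in
  -- `nonempty_coind_conjHomRep_equiv`.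
  have : FiniteDimensional ℂ (π.IntertwiningMap ((dualPairRep q hψ hη₀).comp
      (MonoidHom.inl J.U J'.U))) :=
    Module.Finite.of_injective
      ({ toFun := fun f => f.toLinearMap, map_add' := fun _ _ => rfl, map_smul' :=
        fun _ _ => rfl } :
        π.IntertwiningMap ((dualPairRep q hψ hη₀).comp (MonoidHom.inl J.U J'.U)) →ₗ[ℂ] V →ₗ[ℂ] S₀)
      fun f f' h => Representation.IntertwiningMap.ext h
  obtain ⟨e₂⟩ := nonempty_coind_conjHomRep_equiv q hq τ (theta (dualPairRep q hψ hη₀) π)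
  exact ⟨e₁.trans e₂⟩

end FiniteUnitary

open FiniteUnitary in
theorem proposition7p2 {K : Type*} [Field K] [Fintype K] [StarRing K]
    (q : ℕ) [QuadraticStar q K] (hq : Odd q)
    {ψ : AddChar (skewAdjoint K) ℂ} (hψ : ψ ≠ 1) {n n' ℓ : ℕ}
    (J : HermForm K (Fin n)) (J' : HermForm K (Fin n'))
    {S₀ : Type*} [AddCommGroup S₀] [Module ℂ S₀] [FiniteDimensional ℂ S₀]
    {η₀ : Representation ℂ (Heisenberg (J.tensor J')) S₀} (hη₀ : IsHeisenbergRep ψ η₀)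
    {S₁ : Type*} [AddCommGroup S₁] [Module ℂ S₁] [FiniteDimensional ℂ S₁]
    {η₁ : Representation ℂ (Heisenberg ((J.addHyperbolic ℓ).tensor (J'.addHyperbolic ℓ))) S₁}
    (hη₁ : IsHeisenbergRep ψ η₁)
    {T : Type*} [AddCommGroup T] [Module ℂ T] [FiniteDimensional ℂ T]
    (τ : Representation ℂ (GL (Fin ℓ) K) T) (hτ : IsCuspidal τ)
    (hτ_nontrivial : ℓ = 1 → ∃ g, τ g ≠ 1)
    {V : Type*} [AddCommGroup V] [Module ℂ V] [FiniteDimensional ℂ V]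
    (π : Representation ℂ J.U V) (hπ : π.IsIrreducible) :
    (∀ {A : Type*} [AddCommGroup A] [Module ℂ A] [FiniteDimensional ℂ A]
        {B : Type*} [AddCommGroup B] [Module ℂ B] [FiniteDimensional ℂ B]
        (ρ : Representation ℂ (J.addHyperbolic ℓ).U A)
        (ρ' : Representation ℂ (J'.addHyperbolic ℓ).U B),
        ρ.IsIrreducible → Occurs ρ (parabolicInd τ π) →
        ρ'.IsIrreducible → Occurs ρ' (theta (dualPairRep q hψ hη₁) ρ) →
        Occurs ρ' (parabolicInd τ (theta (dualPairRep q hψ hη₀) π))) ∧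
    ((parabolicInd τ π).IsIrreducible →
      Nonempty ((theta (dualPairRep q hψ hη₁) (parabolicInd τ π)).Equiv
        (parabolicInd τ (theta (dualPairRep q hψ hη₀) π)))) := by
  have e := nonempty_theta_parabolicInd_equiv_parabolicInd q hq hψ J J' hη₀ hη₁ τ hτ
    hτ_nontrivial π
  refine ⟨fun ρ ρ' _ hρ _ hρ' => ?_, fun _ => e⟩
  obtain ⟨e⟩ := e
  -- ρ' occurs in Θ(ρ), which embeds into Θ(R(τ ⊗ π)) ≅ R(τ ⊗ π').
  exact (hρ'.trans (hρ.theta _)).trans (occurs_of_equiv e)
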